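/- **Proposition 7.2.** Let $M$ be a smooth Riemannian manifold of dimension $m$ (without boundary, possibly incomplete), with distance $d$, Levi-Civita connection $\nabla$ and curvature tensor $R(A,B)C=(\nabla_A\nabla_B-\nabla_B\nabla_A-\nabla_{[A,B]})C$. Let $\|R_p\|$ and $\|\nabla R_p\|$ be the suprema of $\|R_p(v_1,v_2)v_3\|$ and of $\|(\nabla_{v_1}R_p)(v_2,v_3)v_4\|$ over unit vectors $v_i\in T_pM$. Let $\varphi_t(v)=\dot\gamma_v(t)$ be the geodesic flow, where $\gamma_v$ is the maximal geodesic with $\dot\gamma_v(0)=v$; $\varphi_t(v)$ is defined if $t$ lies in the domain of $\gamma_v$. The *Sasaki metric* on the tangent bundle $TN$ of a Riemannian manifold $N$ is $\langle \xi,\eta\rangle=\langle D\pi\,\xi,D\pi\,\eta\rangle+\langle\kappa\xi,\kappa\eta\rangle$, where $\pi:TN\to N$ is the projection and $\kappa:TTN\to TN$ is the connector of the Levi-Civita connection of $N$ (if $\xi$ is the initial velocity of a curve $V(t)$ in $TN$ over a curve $c(t)$ in $N$, then $\kappa\xi=\frac{D}{dt}V(0)$ is the covariant derivative along $c$). The unit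 tangent bundle $T^1M\subset TM$ carries the restriction of the Sasaki metric of $TM$, and $d_{Sas}$ is its Riemannian distance on $T^1M$. Applying the construction to $N=T^1M$ with this metric gives a Sasaki metric on $TT^1M$; $\mathbf d_{Sas}$ is its Riemannian distance on $TT^1M$. Here $T^1_vT^1M$ denotes the set of unit vectors in $T_vT^1M$, and $\|D_v\varphi_t\|$ is the operator norm of $D_v\varphi_t:T_vT^1M\to T_{\varphi_t(v)}T^1M$ in the Sasaki metric. Let $0<t_0\le 1$ and let $\gamma:[-t_0,t_0]\to M$ be a unit-speed geodesic segment. Suppose that there are constants $C_1,C_2,C_3>1$ and $\epsilon_0>0$ such that for all $t\in(-t_0,t_0)$: 1. if $v\in T^1M$ satisfies $d_{Sas}(v,\dot\gamma(0))<\epsilon_0$ and $\varphi_t(v)$ is defined, then $\max\{\|D_v\varphi_t\|,\|D_{\varphi_t(v)}\varphi_{-t}\|\}\le C_1$; 2. if $p\in M$ satisfies $d(p,\gamma(t))<\epsilon_0$, then $\|R_p\|\le C_2$ and $\|\nabla R_p\|\le C_3$. Then there exists $\epsilon_1>0$ such that for every $t\in(-t_0,t_0)$: * $\varphi_t$ is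 defined and differentiable at every $v\in T^1M$ with $d_{Sas}(v,\dot\gamma(0))<\epsilon_1$; and * for all $v_0,v_1\in T^1M$ with $d_{Sas}(v_i,\dot\gamma(0))<\epsilon_1$ $(i=0,1)$, and all $\xi_i\in T^1_{v_i}T^1M$ $(i=0,1)$ with $\mathbf d_{Sas}(\xi_0,\xi_1)<\epsilon_1$, $$\mathbf d_{Sas}\bigl(D\varphi_t(\xi_0),D\varphi_t(\xi_1)\bigr)\le\bigl(8m\,C_1^4\,C_2^2\,C_3\bigr)\,\mathbf d_{Sas}(\xi_0,\xi_1).$$ -/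

import Mathlib

open Bundle Set MeasureTheory
open scoped Manifold ContDiff ENNReal Topology

noncomputable section

namespace Sasaki

section General

/-! Riemannian geometry of a metric tensor `g` on a manifold `N` without boundary, modelled on a
finite-dimensional space `E`. In Mathlib the tangent space `TangentSpace I x` is `E`, identified
through the preferred chart at `x`; likewise a vector tangent to `TN` at `V` is a pair
`(a, b) : E × E`, in the bundle chart of `TN` induced by the preferred chart at the foot point
of `V`. -/

variable {E : Type*} [NormedAddCommGroup E] [NormedSpace ℝ E]
  {H : Type*} [TopologicalSpace H] {I : ModelWithCorners ℝ E H}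
  {N : Type*} [TopologicalSpace N] [ChartedSpace H N]

/-- The coefficients of `g` at the point with coordinate `y` in the preferred chart at `x`. -/
def metricInChart (g : (p : N) → TangentSpace I p → TangentSpace I p → ℝ)
    (x : N) (y : E) (a b : E) : ℝ :=
  g ((extChartAt I x).symm y)
    (mfderiv 𝓘(ℝ, E) I (extChartAt I x).symm y a)
    (mfderiv 𝓘(ℝ, E) I (extChartAt I x).symm y b)

/-- `w` is the Christoffel vector `Γ(a, b)` of the Levi-Civita connection of `g` at `x`, in the
preferred chart at `x`: one has `g(w, c) = (∂_a g(b, c) + ∂_b g(a, c) - ∂_c g(a, b)) / 2` for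
all `c`. It exists and is unique if `g` is a Riemannian metric. -/
def IsChristoffel (g : (p : N) → TangentSpace I p → TangentSpace I p → ℝ)
    (x : N) (a b w : E) : Prop :=
  ∀ c : E, metricInChart g x (extChartAt I x x) w c =
    (fderiv ℝ (fun y => metricInChart g x y b c) (extChartAt I x x) a
      + fderiv ℝ (fun y => metricInChart g x y a c) (extChartAt I x x) b
      - fderiv ℝ (fun y => metricInChart g x y a b) (extChartAt I x x) c) / 2

/-- The Christoffel vector `Γ(a, b)` at `x`. -/
def christoffel (g : (p : N) → TangentSpace I p → TangentSpace I p → ℝ)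
    (x : N) (a b : E) : E :=
  Classical.epsilon (IsChristoffel g x a b)

variable [IsManifold I 1 N]

/-- The derivative at `V` of the projection `TN → N`. -/
def horiz (V : TangentBundle I N) (ξ : TangentSpace I.tangent V) : TangentSpace I V.proj :=
  mfderiv I.tangent I (TotalSpace.proj : TangentBundle I N → N) V ξ

/-- The vertical coordinate of a vector tangent to `TN`, in the preferred chart. -/
def vertCoord (V : TangentBundle I N) (ξ : TangentSpace I.tangent V) : E :=
  Prod.snd (α := E) (β := E) ξ

/-- The connector `κ : T_V TN → T_{π V} N` of the Levi-Civita connection of `g`. If `ξ` is the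
velocity of a curve `V(t)` in `TN` over `c(t)`, then `κ ξ = V̇ + Γ(ċ, V)` in coordinates, which
is the covariant derivative of `V` along `c`. -/
def connector (g : (p : N) → TangentSpace I p → TangentSpace I p → ℝ)
    (V : TangentBundle I N) (ξ : TangentSpace I.tangent V) : TangentSpace I V.proj :=
  vertCoord V ξ + christoffel g V.proj (horiz V ξ) V.snd

/-- The Sasaki metric on `TN`: `⟨(u₁, w₁), (u₂, w₂)⟩ = ⟨u₁, u₂⟩ + ⟨w₁, w₂⟩`, where a vector `ξ`
tangent to `TN` corresponds to the pair `(Dπ ξ, κ ξ)`. -/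
def sasakiMetric (g : (p : N) → TangentSpace I p → TangentSpace I p → ℝ)
    (V : TangentBundle I N) (ξ η : TangentSpace I.tangent V) : ℝ :=
  g V.proj (horiz V ξ) (horiz V η) + g V.proj (connector g V ξ) (connector g V η)

/-- The covariant derivative `∇_X Y` of vector fields, `κ (DY (X))`. -/
def nabla (g : (p : N) → TangentSpace I p → TangentSpace I p → ℝ)
    (X Y : (p : N) → TangentSpace I p) (p : N) : TangentSpace I p :=
  connector g (⟨p, Y p⟩ : TangentBundle I N)
    (mfderiv I I.tangent (fun q => (⟨q, Y q⟩ : TangentBundle I N)) p (X p))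

/-- The curvature tensor `R(A, B)C = (∇_A ∇_B - ∇_B ∇_A - ∇_[A,B]) C`. -/
def curvature (g : (p : N) → TangentSpace I p → TangentSpace I p → ℝ)
    (A B C : (p : N) → TangentSpace I p) (p : N) : TangentSpace I p :=
  nabla g A (nabla g B C) p - nabla g B (nabla g A C) p
    - nabla g (VectorField.mlieBracket I A B) C p

/-- The covariant derivative `(∇_W R)(X, Y)Z` of the curvature tensor, by the product rule. -/
def nablaCurvature (g : (p : N) → TangentSpace I p → TangentSpace I p → ℝ)
    (W X Y Z : (p : N) → TangentSpace I p) (p : N) : TangentSpace I p :=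
  nabla g W (curvature g X Y Z) p - curvature g (nabla g W X) Y Z p
    - curvature g X (nabla g W Y) Z p - curvature g X Y (nabla g W Z) p

/-- The velocity `ċ(t)` of a curve in `N`, as a point of `TN`. -/
def velocity (I : ModelWithCorners ℝ E H) [IsManifold I 1 N] (c : ℝ → N) (t : ℝ) :
    TangentBundle I N :=
  ⟨c t, mfderiv 𝓘(ℝ, ℝ) I c t (1 : ℝ)⟩

/-- The covariant derivative, along its curve of foot points, of a curve `V` in `TN`. -/
def covDeriv (g : (p : N) → TangentSpace I p → TangentSpace I p → ℝ)
    (V : ℝ → TangentBundle I N) (t : ℝ) : TangentSpace I (V t).proj :=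
  connector g (V t) (mfderiv 𝓘(ℝ, ℝ) I.tangent V t (1 : ℝ))

/-- `c` restricts to a geodesic of `g` on the open interval `(a, b)`. -/
def IsGeodesicOn (g : (p : N) → TangentSpace I p → TangentSpace I p → ℝ)
    (c : ℝ → N) (a b : ℝ) : Prop :=
  ContMDiffOn 𝓘(ℝ, ℝ) I 2 c (Ioo a b) ∧ ∀ t ∈ Ioo a b, covDeriv g (velocity I c) t = 0

/-- `w = φ_t(v)`: some geodesic, defined on an open interval that contains `0` and `t`, has
velocity `v` at time `0` and `w` at time `t`. -/
def FlowsTo (g : (p : N) → TangentSpace I p → TangentSpace I p → ℝ)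
    (t : ℝ) (v w : TangentBundle I N) : Prop :=
  ∃ (c : ℝ → N) (a b : ℝ), IsGeodesicOn g c a b ∧ (0 : ℝ) ∈ Ioo a b ∧ t ∈ Ioo a b ∧
    velocity I c 0 = v ∧ velocity I c t = w

/-- The set of vectors `v` such that `φ_t(v)` is defined. -/
def flowDomain (g : (p : N) → TangentSpace I p → TangentSpace I p → ℝ) (t : ℝ) :
    Set (TangentBundle I N) :=
  {v | ∃ w, FlowsTo g t v w}

open Classical in
/-- The time-`t` map `φ_t` of the geodesic flow (the identity outside its domain). -/
def geodesicFlow (g : (p : N) → TangentSpace I p → TangentSpace I p → ℝ) (t : ℝ)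
    (v : TangentBundle I N) : TangentBundle I N :=
  if h : ∃ w, FlowsTo g t v w then h.choose else v

end General

section Manifold

variable {m : ℕ} {M : Type*} [EMetricSpace M] [ChartedSpace (EuclideanSpace ℝ (Fin m)) M]
  [IsManifold (𝓡 m) ∞ M] [RiemannianBundle (fun x : M => TangentSpace (𝓡 m) x)]

/-- The metric tensor of `M`. -/
def metric (p : M) (u w : TangentSpace (𝓡 m) p) : ℝ := inner ℝ u w

/-- The unit tangent bundle `T¹M`, a hypersurface in `TM`. -/
def unitTangent (m : ℕ) (M : Type*) [EMetricSpace M]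
    [ChartedSpace (EuclideanSpace ℝ (Fin m)) M] [IsManifold (𝓡 m) ∞ M]
    [RiemannianBundle (fun x : M => TangentSpace (𝓡 m) x)] : Set (TangentBundle (𝓡 m) M) :=
  {v | ‖v.snd‖ = 1}

/-- The Sasaki norm of a vector tangent to `TM`. -/
def sasakiNorm (v : TangentBundle (𝓡 m) M) (ξ : TangentSpace (𝓡 m).tangent v) : ℝ :=
  √(sasakiMetric metric v ξ ξ)

/-- The Sasaki distance on `T¹M`: the infimum of the Sasaki lengths of the `C¹` curves in
`T¹M`. -/
def sasakiEDist (v₀ v₁ : TangentBundle (𝓡 m) M) : ℝ≥0∞ :=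
  ⨅ (σ : ℝ → TangentBundle (𝓡 m) M)
    (_ : ContMDiffOn 𝓘(ℝ, ℝ) (𝓡 m).tangent 1 σ (Icc 0 1) ∧ σ 0 = v₀ ∧ σ 1 = v₁ ∧
      ∀ s ∈ Icc (0 : ℝ) 1, σ s ∈ unitTangent m M),
    ∫⁻ s in Icc (0 : ℝ) 1, ENNReal.ofReal
      (sasakiNorm (σ s) (mfderivWithin 𝓘(ℝ, ℝ) (𝓡 m).tangent σ (Icc 0 1) s (1 : ℝ)))

/-- The tangent bundle `TT¹M` inside `TTM`. The tangent space of `T¹M` at `v` is the set of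
all `ξ` with `κ ξ` orthogonal to `v`. -/
def tangentUnitTangent (m : ℕ) (M : Type*) [EMetricSpace M]
    [ChartedSpace (EuclideanSpace ℝ (Fin m)) M] [IsManifold (𝓡 m) ∞ M]
    [RiemannianBundle (fun x : M => TangentSpace (𝓡 m) x)] :
    Set (TangentBundle (𝓡 m).tangent (TangentBundle (𝓡 m) M)) :=
  {ξ | ξ.proj ∈ unitTangent m M ∧
    inner ℝ (connector metric ξ.proj ξ.snd) ξ.proj.snd = 0}

/-- The Sasaki norm of the component of `ξ ∈ T_v TM`, `v ∈ T¹M`, that is tangent to `T¹M`: the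
unit normal of `T¹M` at `v` is the vertical vector `ν` with `κ ν = v`, so that the normal
component of `ξ` has length `|⟨κ ξ, v⟩|`. -/
def tangentialNorm (v : TangentBundle (𝓡 m) M) (ξ : TangentSpace (𝓡 m).tangent v) : ℝ :=
  √(sasakiMetric metric v ξ ξ - (inner ℝ (connector metric v ξ) v.snd) ^ 2)

/-- The norm of a vector `Z`, tangent to `TT¹M` at `ξ`, in the Sasaki metric that the
Riemannian manifold `T¹M` (with its own Sasaki metric) induces on `TT¹M`. The Levi-Civita
connection of the hypersurface `T¹M` is the tangential part of that of `TM`, hence so is its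
connector. -/
def sasakiNorm₂ (ξ : TangentBundle (𝓡 m).tangent (TangentBundle (𝓡 m) M))
    (Z : TangentSpace (𝓡 m).tangent.tangent ξ) : ℝ :=
  √(sasakiNorm ξ.proj (horiz ξ Z) ^ 2
    + tangentialNorm ξ.proj (connector (sasakiMetric metric) ξ Z) ^ 2)

/-- The Sasaki distance on `TT¹M`: the infimum of the lengths of the `C¹` curves in `TT¹M`. -/
def sasakiEDist₂ (ξ₀ ξ₁ : TangentBundle (𝓡 m).tangent (TangentBundle (𝓡 m) M)) : ℝ≥0∞ :=
  ⨅ (σ : ℝ → TangentBundle (𝓡 m).tangent (TangentBundle (𝓡 m) M))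
    (_ : ContMDiffOn 𝓘(ℝ, ℝ) (𝓡 m).tangent.tangent 1 σ (Icc 0 1) ∧ σ 0 = ξ₀ ∧ σ 1 = ξ₁ ∧
      ∀ s ∈ Icc (0 : ℝ) 1, σ s ∈ tangentUnitTangent m M),
    ∫⁻ s in Icc (0 : ℝ) 1, ENNReal.ofReal
      (sasakiNorm₂ (σ s)
        (mfderivWithin 𝓘(ℝ, ℝ) (𝓡 m).tangent.tangent σ (Icc 0 1) s (1 : ℝ)))

/-- The unit vectors `T¹T¹M` in `TT¹M`. -/
def unitTangentUnitTangent (m : ℕ) (M : Type*) [EMetricSpace M]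
    [ChartedSpace (EuclideanSpace ℝ (Fin m)) M] [IsManifold (𝓡 m) ∞ M]
    [RiemannianBundle (fun x : M => TangentSpace (𝓡 m) x)] :
    Set (TangentBundle (𝓡 m).tangent (TangentBundle (𝓡 m) M)) :=
  {ξ | ξ ∈ tangentUnitTangent m M ∧ sasakiNorm ξ.proj ξ.snd = 1}

/-- The derivative `Dφ_t` of the time-`t` map of the geodesic flow, as a map of `TTM`. -/
def flowDeriv (t : ℝ) (ξ : TangentBundle (𝓡 m).tangent (TangentBundle (𝓡 m) M)) :
    TangentBundle (𝓡 m).tangent (TangentBundle (𝓡 m) M) :=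
  tangentMap (𝓡 m).tangent (𝓡 m).tangent (geodesicFlow metric t) ξ

/-- The operator norm `‖D_v φ_t‖` of the derivative of `φ_t` on `T¹M`. -/
def flowDerivNorm (t : ℝ) (v : TangentBundle (𝓡 m) M) : ℝ≥0∞ :=
  ⨆ (ξ : TangentBundle (𝓡 m).tangent (TangentBundle (𝓡 m) M))
    (_ : ξ ∈ unitTangentUnitTangent m M ∧ ξ.proj = v),
    ENNReal.ofReal (sasakiNorm (flowDeriv t ξ).proj (flowDeriv t ξ).snd)

/-- Smooth vector fields on `M`. -/
def IsSmoothField (X : (p : M) → TangentSpace (𝓡 m) p) : Prop :=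
  ContMDiff (𝓡 m) (𝓡 m).tangent ∞ (fun p => (⟨p, X p⟩ : TangentBundle (𝓡 m) M))

/-- The norm `‖R_p‖`: the supremum of `‖R_p(v₁, v₂)v₃‖` over unit vectors `vᵢ` at `p`, each of
them extended to a smooth vector field (the value does not depend on the extension). -/
def curvatureNorm (m : ℕ) {M : Type*} [EMetricSpace M]
    [ChartedSpace (EuclideanSpace ℝ (Fin m)) M] [IsManifold (𝓡 m) ∞ M]
    [RiemannianBundle (fun x : M => TangentSpace (𝓡 m) x)] (p : M) : ℝ≥0∞ :=
  ⨆ (X : Fin 3 → (q : M) → TangentSpace (𝓡 m) q)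
    (_ : ∀ i, IsSmoothField (X i) ∧ ‖X i p‖ = 1),
    ENNReal.ofReal ‖curvature metric (X 0) (X 1) (X 2) p‖

/-- The norm `‖∇R_p‖`: the supremum of `‖(∇_{v₁} R_p)(v₂, v₃)v₄‖` over unit vectors `vᵢ` at
`p`. -/
def nablaCurvatureNorm (m : ℕ) {M : Type*} [EMetricSpace M]
    [ChartedSpace (EuclideanSpace ℝ (Fin m)) M] [IsManifold (𝓡 m) ∞ M]
    [RiemannianBundle (fun x : M => TangentSpace (𝓡 m) x)] (p : M) : ℝ≥0∞ :=
  ⨆ (X : Fin 4 → (q : M) → TangentSpace (𝓡 m) q)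
    (_ : ∀ i, IsSmoothField (X i) ∧ ‖X i p‖ = 1),
    ENNReal.ofReal ‖nablaCurvature metric (X 0) (X 1) (X 2) (X 3) p‖

end Manifold

end Sasaki

end

/-! The velocity `Z` of a curve of vectors `ξ` in `TT¹M` has two components: the horizontal part `η
= Dπ Z`, and the part `X` of the Sasaki connector of `Z` that is tangent to `T¹M`. The length on
`TT¹M` integrates `√(|η|² + |X|²)`, so it suffices that `Dφ_t` multiplies the speed of every short
curve by at most `8 C₁⁴ C₂² C₃`. The factor `m` costs nothing, since unit vectors exist only if `m ≥
1`.

The horizontal part of the image curve is `Dφ_t η`, of length at most `C₁ |η|`. Let `X_t` be the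
other component at time `t`. Its pull-back `Y_t = Dφ_{-t} X_t` moves in one fixed vector space, and
`Y_t' = Dφ_{-t} S_t`, where `S_t` measures how far the flow is from preserving the connection. To
find `S_t`, write `Dφ_t ξ = (J, K)` and `Dφ_t η = (I, I₂)` as Jacobi fields with their covariant
derivatives, and commute covariant derivatives in the two-parameter family of geodesics that the
curve generates. All second-order quantities cancel: `S_t` is bilinear in `(J, K)` and `(I, I₂)`,
with coefficients built from `R`, `R` applied twice and `∇R`, together with a term `⟨K, I₂⟩ T` (`T`
the velocity of the geodesic) that comes from keeping the vectors tangent to `T¹M`. Counting terms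
gives `|S_t| ≤ 5 C₂² C₃ |Dφ_t ξ| |Dφ_t η|`, and integration gives Duhamel's estimate `|X_t| ≤ C₁
(|X_0| + 5 C₁³ C₂² C₃ |ξ| |η| |t|)`.

This core consists of `jacobi_evolution` (the evolution equations), `hasDerivAt_sasaki_cov` with
`source_bound` (the error term and its size), `hasDerivAt_transport` (the same in terms of the flow
in coordinates), `sasN_flow_le` (Duhamel) and `sasakiNorm₂_flow_le` (the growth of the speed).

Two facts make it apply to short curves from a unit vector `ξ₀`. A cut-off function on `TM`, with
derivative bounded in the Sasaki norm, shows that the foot points stay where the hypotheses hold.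
And `log (1 + |ξ|²)` changes no faster than arc length, so that `|ξ| ≤ 7/5` along the curve; then `5
· 7/5 = 7`, and `n² + (k + 7 n)² ≤ 64 (n² + k²)` produces the `8`.

The rest is groundwork. The connector, the curvature and the Sasaki metric are defined through
preferred charts, which change with the point, so each is first computed in an arbitrary
parametrization. The smoothness of the geodesic flow comes from the implicit function theorem in a
space of paths. -/

set_option synthInstance.maxHeartbeats 400000

noncomputable section

namespace Sasaki

set_option synthInstance.maxHeartbeats 400000

section Instances

/-! Shortcut instances for spaces of multilinear forms. -/

variable {E : Type*} [NormedAddCommGroup E] [NormedSpace ℝ E]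

instance instNormedAddCommGroupBilin : NormedAddCommGroup (E →L[ℝ] E →L[ℝ] ℝ) :=
  ContinuousLinearMap.toNormedAddCommGroup

@[reducible] instance instAddCommGroupBilin : AddCommGroup (E →L[ℝ] E →L[ℝ] ℝ) :=
  instNormedAddCommGroupBilin.toAddCommGroup

@[reducible] instance instNormedSpaceBilin : NormedSpace ℝ (E →L[ℝ] E →L[ℝ] ℝ) :=
  ContinuousLinearMap.toNormedSpace

@[reducible] instance instModuleBilin : Module ℝ (E →L[ℝ] E →L[ℝ] ℝ) :=
  instNormedSpaceBilin.toModule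

instance instNormedAddCommGroupTrilin : NormedAddCommGroup (E →L[ℝ] E →L[ℝ] E →L[ℝ] ℝ) :=
  ContinuousLinearMap.toNormedAddCommGroup

@[reducible] instance instAddCommGroupTrilin : AddCommGroup (E →L[ℝ] E →L[ℝ] E →L[ℝ] ℝ) :=
  instNormedAddCommGroupTrilin.toAddCommGroup

@[reducible] instance instNormedSpaceTrilin : NormedSpace ℝ (E →L[ℝ] E →L[ℝ] E →L[ℝ] ℝ) :=
  ContinuousLinearMap.toNormedSpace

@[reducible] instance instModuleTrilin : Module ℝ (E →L[ℝ] E →L[ℝ] E →L[ℝ] ℝ) :=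
  instNormedSpaceTrilin.toModule

variable {E' E'' F : Type*} [NormedAddCommGroup E'] [NormedSpace ℝ E'] [NormedAddCommGroup E'']
  [NormedSpace ℝ E''] [NormedAddCommGroup F] [NormedSpace ℝ F]

instance instNormedAddCommGroupClm₂ : NormedAddCommGroup (E →L[ℝ] E' →L[ℝ] F) :=
  ContinuousLinearMap.toNormedAddCommGroup

@[reducible] instance instAddCommGroupClm₂ : AddCommGroup (E →L[ℝ] E' →L[ℝ] F) :=
  instNormedAddCommGroupClm₂.toAddCommGroup

@[reducible] instance instNormedSpaceClm₂ : NormedSpace ℝ (E →L[ℝ] E' →L[ℝ] F) :=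
  ContinuousLinearMap.toNormedSpace

@[reducible] instance instModuleClm₂ : Module ℝ (E →L[ℝ] E' →L[ℝ] F) :=
  instNormedSpaceClm₂.toModule

instance instNormedAddCommGroupClm₃ : NormedAddCommGroup (E →L[ℝ] E' →L[ℝ] E'' →L[ℝ] F) :=
  ContinuousLinearMap.toNormedAddCommGroup

@[reducible] instance instAddCommGroupClm₃ : AddCommGroup (E →L[ℝ] E' →L[ℝ] E'' →L[ℝ] F) :=
  instNormedAddCommGroupClm₃.toAddCommGroup

@[reducible] instance instNormedSpaceClm₃ : NormedSpace ℝ (E →L[ℝ] E' →L[ℝ] E'' →L[ℝ] F) :=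
  ContinuousLinearMap.toNormedSpace

@[reducible] instance instModuleClm₃ : Module ℝ (E →L[ℝ] E' →L[ℝ] E'' →L[ℝ] F) :=
  instNormedSpaceClm₃.toModule

end Instances

/-! ### Derivatives as maps of model spaces, and parametrizations of open sets -/

section Param

variable {E : Type*} [NormedAddCommGroup E] [NormedSpace ℝ E]
  {H : Type*} [TopologicalSpace H] {I : ModelWithCorners ℝ E H}
  {N : Type*} [TopologicalSpace N] [ChartedSpace H N]
  {E' : Type*} [NormedAddCommGroup E'] [NormedSpace ℝ E']
  {H' : Type*} [TopologicalSpace H'] {I' : ModelWithCorners ℝ E' H'}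
  {N' : Type*} [TopologicalSpace N'] [ChartedSpace H' N']
  {E'' : Type*} [NormedAddCommGroup E''] [NormedSpace ℝ E'']
  {H'' : Type*} [TopologicalSpace H''] {I'' : ModelWithCorners ℝ E'' H''}
  {N'' : Type*} [TopologicalSpace N''] [ChartedSpace H'' N'']

/-- The derivative of a map of manifolds, as a map of the model vector spaces. -/
def mD (I : ModelWithCorners ℝ E H) (I' : ModelWithCorners ℝ E' H') (f : N → N') (x : N) :
    E →L[ℝ] E' :=
  mfderiv I I' f x

theorem mD_comp {f : N → N'} {g : N' → N''} {x : N} (hg : MDifferentiableAt I' I'' g (f x))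
    (hf : MDifferentiableAt I I' f x) :
    mD I I'' (fun y => g (f y)) x = (mD I' I'' g (f x)).comp (mD I I' f x) :=
  mfderiv_comp x hg hf

theorem mD_comp_apply {f : N → N'} {g : N' → N''} {x : N} (hg : MDifferentiableAt I' I'' g (f x))
    (hf : MDifferentiableAt I I' f x) (v : E) :
    mD I I'' (fun y => g (f y)) x v = mD I' I'' g (f x) (mD I I' f x v) := by
  rw [mD_comp hg hf]; rfl

theorem mD_congr {f g : N → N'} {x : N} (h : f =ᶠ[𝓝 x] g) : mD I I' f x = mD I I' g x := by
  unfold mD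
  have := h.mfderiv_eq (I := I) (I' := I')
  exact this

theorem mD_eq_fderiv (f : E → E') (x : E) : mD 𝓘(ℝ, E) 𝓘(ℝ, E') f x = fderiv ℝ f x :=
  mfderiv_eq_fderiv

theorem mD_id (x : N) : mD I I (fun y => y) x = ContinuousLinearMap.id ℝ E :=
  mfderiv_id

/-- `P` parametrizes an open subset of `N` by the open subset `Ω` of the model vector space, with
inverse `Q`. -/
structure IsParam (I : ModelWithCorners ℝ E H) (P : E → N) (Q : N → E) (Ω : Set E) : Prop where
  isOpen : IsOpen Ω
  isOpen_image : IsOpen (P '' Ω)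
  smooth : ContMDiffOn 𝓘(ℝ, E) I ∞ P Ω
  smooth_inv : ContMDiffOn I 𝓘(ℝ, E) ∞ Q (P '' Ω)
  left_inv : ∀ y ∈ Ω, Q (P y) = y

theorem isParam_extChartAt [I.Boundaryless] [IsManifold I ∞ N] (x : N) :
    IsParam I (extChartAt I x).symm (extChartAt I x) (extChartAt I x).target := by
  have h : (extChartAt I x).symm '' (extChartAt I x).target = (extChartAt I x).source :=
    (extChartAt I x).symm_image_target_eq_source
  refine ⟨isOpen_extChartAt_target x, ?_, contMDiffOn_extChartAt_symm x, ?_,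
    fun y hy => (extChartAt I x).right_inv hy⟩
  · rw [h]; exact isOpen_extChartAt_source x
  · rw [h]; exact contMDiffOn_extChartAt.mono (by rw [extChartAt_source])

namespace IsParam

variable {P : E → N} {Q : N → E} {Ω : Set E} (hP : IsParam I P Q Ω)
include hP

theorem right_inv {p : N} (hp : p ∈ P '' Ω) : P (Q p) = p := by
  obtain ⟨y, hy, rfl⟩ := hp; rw [hP.left_inv y hy]

theorem inv_mem {p : N} (hp : p ∈ P '' Ω) : Q p ∈ Ω := by
  obtain ⟨y, hy, rfl⟩ := hp; rwa [hP.left_inv y hy]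

theorem mem_nhds {y : E} (hy : y ∈ Ω) : Ω ∈ 𝓝 y := hP.isOpen.mem_nhds hy

theorem image_mem_nhds {y : E} (hy : y ∈ Ω) : P '' Ω ∈ 𝓝 (P y) :=
  hP.isOpen_image.mem_nhds (mem_image_of_mem P hy)

theorem contMDiffAt {y : E} (hy : y ∈ Ω) : ContMDiffAt 𝓘(ℝ, E) I ∞ P y :=
  hP.smooth.contMDiffAt (hP.mem_nhds hy)

theorem contMDiffAt_inv {y : E} (hy : y ∈ Ω) : ContMDiffAt I 𝓘(ℝ, E) ∞ Q (P y) :=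
  hP.smooth_inv.contMDiffAt (hP.image_mem_nhds hy)

theorem mdifferentiableAt {y : E} (hy : y ∈ Ω) : MDifferentiableAt 𝓘(ℝ, E) I P y :=
  (hP.contMDiffAt hy).mdifferentiableAt (by simp)

theorem mdifferentiableAt_inv {y : E} (hy : y ∈ Ω) : MDifferentiableAt I 𝓘(ℝ, E) Q (P y) :=
  (hP.contMDiffAt_inv hy).mdifferentiableAt (by simp)

theorem mD_inv_mD {y : E} (hy : y ∈ Ω) (a : E) :
    mD I 𝓘(ℝ, E) Q (P y) (mD 𝓘(ℝ, E) I P y a) = a := by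
  rw [← mD_comp_apply (hP.mdifferentiableAt_inv hy) (hP.mdifferentiableAt hy),
    mD_congr (g := fun z => z) (by filter_upwards [hP.mem_nhds hy] with z hz using hP.left_inv z hz),
    mD_id]
  rfl

theorem mD_mD_inv {y : E} (hy : y ∈ Ω) (a : E) :
    mD 𝓘(ℝ, E) I P y (mD I 𝓘(ℝ, E) Q (P y) a) = a := by
  have h1 := hP.mdifferentiableAt hy
  have h2 := mD_comp_apply (f := Q) (g := P) (x := P y) (by rwa [hP.left_inv y hy])
    (hP.mdifferentiableAt_inv hy) a
  rw [hP.left_inv y hy] at h2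
  rw [← h2, mD_congr (g := fun z => z)
    (by filter_upwards [hP.image_mem_nhds hy] with z hz using hP.right_inv hz), mD_id]
  rfl

end IsParam

/-! ### Coordinates on the tangent bundle -/

section Tangent

variable [IsManifold I 1 N]

/-- The tangent vector at `p` with coordinates `u`. -/
def mkT (I : ModelWithCorners ℝ E H) [IsManifold I 1 N] (p : N) (u : E) : TangentBundle I N :=
  ⟨p, u⟩

/-- The coordinates of a tangent vector. -/
def vec (V : TangentBundle I N) : E := V.snd

theorem mkT_proj (p : N) (u : E) : (mkT I p u).proj = p := rfl

theorem vec_mkT (p : N) (u : E) : vec (mkT I p u) = u := rfl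

theorem mkT_vec (V : TangentBundle I N) : mkT I V.proj (vec V) = V := rfl

/-- The parametrization of the tangent bundle induced by a parametrization of the base. -/
def tangentParam (I : ModelWithCorners ℝ E H) [IsManifold I 1 N] (P : E → N) (z : E × E) :
    TangentBundle I N :=
  mkT I (P z.1) (mD 𝓘(ℝ, E) I P z.1 z.2)

/-- The inverse of `tangentParam`. -/
def tangentParamInv (Q : N → E) (V : TangentBundle I N) : E × E :=
  (Q V.proj, mD I 𝓘(ℝ, E) Q V.proj (vec V))

theorem contMDiff_prod_tangentBundle : ContMDiff 𝓘(ℝ, E × E) (𝓘(ℝ, E)).tangent ∞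
    (fun z : E × E => (⟨z.1, z.2⟩ : TangentBundle 𝓘(ℝ, E) E)) := by
  intro z
  rw [Bundle.contMDiffAt_totalSpace]
  constructor
  · exact contDiff_fst.contMDiff.contMDiffAt
  · simp
    exact contDiff_snd.contMDiff.contMDiffAt

theorem contMDiff_tangentBundle_prod : ContMDiff (𝓘(ℝ, E)).tangent 𝓘(ℝ, E × E) ∞
    (fun z : TangentBundle 𝓘(ℝ, E) E => ((z.proj, z.snd) : E × E)) := by
  rw [contMDiff_prod_module_iff]
  constructor
  · exact Bundle.contMDiff_proj _
  · exact contMDiff_snd_tangentBundle_modelSpace E 𝓘(ℝ,E)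

theorem ContMDiffOn.tangentMap_of_isOpen [IsManifold I ∞ N] [IsManifold I' ∞ N'] {f : N → N'}
    {s : Set N} (hs : IsOpen s) {n k : WithTop ℕ∞} (hf : ContMDiffOn I I' n f s) (hk : k + 1 ≤ n)
    (hn : n ≤ (∞ : WithTop ℕ∞)) :
    ContMDiffOn I.tangent I'.tangent k (tangentMap I I' f) (TotalSpace.proj ⁻¹' s) := by
  have : IsManifold I n N := .of_le hn
  have : IsManifold I' n N' := .of_le hn
  refine (hf.contMDiffOn_tangentMapWithin hk hs.uniqueMDiffOn).congr fun V hV => ?_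
  simp only [tangentMap, tangentMapWithin]
  rw [mfderivWithin_of_isOpen hs hV]

/-- The result is again a parametrization, now of an open subset of `TN`; so the construction can be
iterated, and one parametrization of `N` gives coordinates on `TTN` and `TTTN`. -/
theorem IsParam.tangent [IsManifold I ∞ N] {P : E → N} {Q : N → E} {Ω : Set E}
    (hP : IsParam I P Q Ω) :
    IsParam I.tangent (tangentParam I P) (tangentParamInv Q) (Ω ×ˢ univ) := by
  have him : tangentParam I P '' (Ω ×ˢ univ) = TotalSpace.proj ⁻¹' (P '' Ω) := by
    ext V
    constructor
    · rintro ⟨z, hz, rfl⟩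
      exact ⟨z.1, hz.1, rfl⟩
    · rintro ⟨y, hy, hyV⟩
      rw [← mkT_vec V, ← hyV]
      refine ⟨(y, mD I 𝓘(ℝ, E) Q (P y) (vec V)), ⟨hy, mem_univ _⟩, ?_⟩
      simp only [tangentParam]
      rw [hP.mD_mD_inv hy]
  refine ⟨hP.isOpen.prod isOpen_univ, ?_, ?_, ?_, ?_⟩
  · rw [him]
    exact hP.isOpen_image.preimage (FiberBundle.continuous_proj E (TangentSpace I))
  · have h1 := ContMDiffOn.tangentMap_of_isOpen hP.isOpen hP.smooth (k := ∞) (by simp) le_rfl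
    exact h1.comp contMDiff_prod_tangentBundle.contMDiffOn fun z hz => hz.1
  · rw [him]
    have h1 := ContMDiffOn.tangentMap_of_isOpen hP.isOpen_image hP.smooth_inv (k := ∞) (by simp)
      le_rfl
    exact contMDiff_tangentBundle_prod.comp_contMDiffOn h1
  · rintro ⟨y, u⟩ ⟨hy, -⟩
    simp only [tangentParam, tangentParamInv, mkT_proj, vec_mkT]
    rw [hP.left_inv y hy, hP.mD_inv_mD hy]

/-- The preferred chart of `TN` at `V` depends only on the foot point of `V`, and is the chart of
`N` together with its derivative. This is what ties the coordinates of `T_V TN` to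
`tangentParamInv`. -/
theorem extChartAt_tangent (V W : TangentBundle I N)
    (h : W.proj ∈ (extChartAt I V.proj).source) :
    extChartAt I.tangent V W =
      (extChartAt I V.proj W.proj, mD I 𝓘(ℝ, E) (extChartAt I V.proj) W.proj (vec W)) := by
  have h1 := TangentBundle.continuousLinearMapAt_trivializationAt (I := I) (x₀ := V.proj)
    (x := W.proj) (by simpa using h)
  have h2 : mD I 𝓘(ℝ, E) (extChartAt I V.proj) W.proj (vec W) =
    (trivializationAt E (TangentSpace I) V.proj).continuousLinearMapAt ℝ W.proj W.snd :=
    (DFunLike.congr_fun h1 W.snd).symm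
  have h3 : (trivializationAt E (TangentSpace I) V.proj).continuousLinearMapAt ℝ W.proj W.snd =
      (trivializationAt E (TangentSpace I) V.proj W).2 := by
    rw [Trivialization.continuousLinearMapAt_apply, Trivialization.linearMapAt_apply,
      if_pos (by simpa using h)]
  rw [h2.trans h3]
  rfl

theorem extChartAt_tangent_source (V : TangentBundle I N) :
    (extChartAt I.tangent V).source = TotalSpace.proj ⁻¹' (extChartAt I V.proj).source := by
  ext z
  simp

theorem extChartAt_tangent_symm [IsManifold I ∞ N] [I.Boundaryless] (V : TangentBundle I N)
    {z : E × E} (hz : z.1 ∈ (extChartAt I V.proj).target) :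
    (extChartAt I.tangent V).symm z = tangentParam I (extChartAt I V.proj).symm z := by
  have hP := isParam_extChartAt (I := I) V.proj
  have h1 : tangentParam I (extChartAt I V.proj).symm z ∈ (extChartAt I.tangent V).source := by
    rw [extChartAt_tangent_source]
    exact (extChartAt I V.proj).map_target hz
  have h2 : extChartAt I.tangent V (tangentParam I (extChartAt I V.proj).symm z) = z := by
    rw [extChartAt_tangent V _ ((extChartAt I V.proj).map_target hz)]
    exact hP.tangent.left_inv z ⟨hz, mem_univ _⟩
  rw [← (extChartAt I.tangent V).left_inv h1, h2]

theorem mD_extChartAt_self (x : N) :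
    mD I 𝓘(ℝ, E) (extChartAt I x) x = ContinuousLinearMap.id ℝ E :=
  mfderiv_extChartAt_self

theorem mD_extChartAt_symm_self [IsManifold I ∞ N] [I.Boundaryless] (x : N) :
    mD 𝓘(ℝ, E) I (extChartAt I x).symm (extChartAt I x x) = ContinuousLinearMap.id ℝ E := by
  have hP := isParam_extChartAt (I := I) x
  ext a
  have := hP.mD_inv_mD (mem_extChartAt_target x) a
  rw [extChartAt_to_inv, mD_extChartAt_self] at this
  exact this

omit [IsManifold I 1 N] in
-- At its own centre the preferred chart has the identity as derivative, so precomposing with the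
-- inverse chart does not change the derivative there.
theorem mD_eq_of_chart [IsManifold I' ∞ N'] [I'.Boundaryless] [IsManifold I' 1 N']
    (f : N' → N) (x : N') (hf : MDifferentiableAt I' I f x) :
    mD I' I f x = mD 𝓘(ℝ, E') I (fun z => f ((extChartAt I' x).symm z)) (extChartAt I' x x) := by
  have hP := isParam_extChartAt (I := I') x
  rw [mD_comp (by rwa [extChartAt_to_inv]) (hP.mdifferentiableAt (mem_extChartAt_target x)),
    mD_extChartAt_symm_self, extChartAt_to_inv]
  rfl

theorem mdifferentiable_proj : MDifferentiable I.tangent I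
    (TotalSpace.proj : TangentBundle I N → N) :=
  (Bundle.contMDiff_proj (n := 1) (TangentSpace I)).mdifferentiable (by simp)

theorem mD_proj [IsManifold I ∞ N] [I.Boundaryless] (V : TangentBundle I N) (ξ : E × E) :
    mD I.tangent I (TotalSpace.proj : TangentBundle I N → N) V ξ = ξ.1 := by
  have hP := isParam_extChartAt (I := I) V.proj
  rw [mD_eq_of_chart _ _ (mdifferentiable_proj V)]
  have hc : (extChartAt I.tangent V V).1 = extChartAt I V.proj V.proj := by
    rw [extChartAt_tangent _ _ (mem_extChartAt_source _)]
  have ht : (extChartAt I.tangent V V).1 ∈ (extChartAt I V.proj).target := by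
    rw [hc]; exact mem_extChartAt_target _
  rw [mD_congr (g := fun z : E × E => (extChartAt I V.proj).symm z.1)]
  · rw [mD_comp_apply (I' := 𝓘(ℝ, E)) (f := Prod.fst) (g := (extChartAt I V.proj).symm)
      (hP.mdifferentiableAt ht) differentiableAt_fst.mdifferentiableAt]
    rw [hc, mD_extChartAt_symm_self]
    have : mD 𝓘(ℝ, E × E) 𝓘(ℝ, E) (Prod.fst : E × E → E) (extChartAt I.tangent V V) ξ = ξ.1 := by
      rw [mD_eq_fderiv, fderiv_fst]; rfl
    exact this
  · have : Prod.fst ⁻¹' (extChartAt I V.proj).target ∈ 𝓝 (extChartAt I.tangent V V) :=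
      continuous_fst.continuousAt.preimage_mem_nhds ((isOpen_extChartAt_target _).mem_nhds ht)
    filter_upwards [this] with z hz
    rw [extChartAt_tangent_symm V hz]
    rfl

/-- In the preferred chart the map is `(z, u) ↦ (σ z, Dσ_z u)` with `σ` the transition map.
Differentiating the second entry produces `D²σ`, the non-tensorial term that the Christoffel vectors
have to absorb. -/
theorem mD_tangentParamInv [IsManifold I ∞ N] [I.Boundaryless] {P : E → N} {Q : N → E} {Ω : Set E}
    (hP : IsParam I P Q Ω) (V : TangentBundle I N) (hV : V.proj ∈ P '' Ω) (ξ : E × E) :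
    mD I.tangent 𝓘(ℝ, E × E) (tangentParamInv Q) V ξ =
      (mD I 𝓘(ℝ, E) Q V.proj ξ.1,
        mD I 𝓘(ℝ, E) Q V.proj ξ.2 +
        fderiv ℝ (fderiv ℝ (fun z => Q ((extChartAt I V.proj).symm z))) (extChartAt I V.proj V.proj)
          ξ.1 (vec V)) := by
  have hψ := isParam_extChartAt (I := I) V.proj
  have hz0 : (extChartAt I V.proj V.proj) ∈ (extChartAt I V.proj).target := mem_extChartAt_target _
  have hc : extChartAt I.tangent V V = (extChartAt I V.proj V.proj, vec V) := by
    rw [extChartAt_tangent _ _ (mem_extChartAt_source _), mD_extChartAt_self]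
    rfl
  obtain ⟨y, hy, hyV⟩ := hV
  have hQ : ∀ p ∈ P '' Ω, MDifferentiableAt I 𝓘(ℝ, E) Q p := by
    rintro _ ⟨y, hy, rfl⟩; exact hP.mdifferentiableAt_inv hy
  have hev : ∀ᶠ z in 𝓝 (extChartAt I V.proj V.proj), z ∈ (extChartAt I V.proj).target ∧
      (extChartAt I V.proj).symm z ∈ P '' Ω := by
    refine Filter.Eventually.and (hψ.mem_nhds hz0) ?_
    refine (continuousAt_extChartAt_symm V.proj).eventually_mem ?_
    rw [extChartAt_to_inv, ← hyV]
    exact hP.image_mem_nhds hy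
  have hσ : ContDiffAt ℝ ∞ (fun z => Q ((extChartAt I V.proj).symm z))
      (extChartAt I V.proj V.proj) := by
    rw [← contMDiffAt_iff_contDiffAt]
    refine ContMDiffAt.comp _ ?_ (hψ.contMDiffAt hz0)
    rw [extChartAt_to_inv, ← hyV]
    exact hP.contMDiffAt_inv hy
  have hσ' : fderiv ℝ (fun z => Q ((extChartAt I V.proj).symm z)) (extChartAt I V.proj V.proj) =
      mD I 𝓘(ℝ, E) Q V.proj := by
    rw [← mD_eq_fderiv, mD_eq_of_chart (I' := I) Q V.proj (hQ _ ⟨y, hy, hyV⟩)]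
  rw [← hσ']
  set σ : E → E := fun z => Q ((extChartAt I V.proj).symm z) with hσdef
  rw [mD_eq_of_chart (I' := I.tangent) _ _
    (by
      have := hP.tangent.mdifferentiableAt_inv (y := tangentParamInv Q V)
        ⟨hP.inv_mem ⟨y, hy, hyV⟩, mem_univ _⟩
      rwa [hP.tangent.right_inv] at this
      refine ⟨(y, mD I 𝓘(ℝ, E) Q (P y) (vec V)), ⟨hy, mem_univ _⟩, ?_⟩
      rw [tangentParam, hP.mD_mD_inv hy, hyV, mkT_vec]), hc]
  rw [mD_congr (g := fun z : E × E => (σ z.1, fderiv ℝ σ z.1 z.2))]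
  · rw [mD_eq_fderiv]
    have h1 : HasFDerivAt σ (fderiv ℝ σ (extChartAt I V.proj V.proj)) (extChartAt I V.proj V.proj) :=
      (hσ.differentiableAt (by simp)).hasFDerivAt
    have h2 : HasFDerivAt (fderiv ℝ σ) (fderiv ℝ (fderiv ℝ σ) (extChartAt I V.proj V.proj))
        (extChartAt I V.proj V.proj) :=
      ((hσ.fderiv_right (m := 1) (by norm_cast)).differentiableAt (by simp)).hasFDerivAt
    have h3 : HasFDerivAt (fun z : E × E => z.1) (ContinuousLinearMap.fst ℝ E E)
      ((extChartAt I V.proj V.proj), vec V) := hasFDerivAt_fst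
    have h4 : HasFDerivAt (fun z : E × E => z.2) (ContinuousLinearMap.snd ℝ E E)
      ((extChartAt I V.proj V.proj), vec V) := hasFDerivAt_snd
    have h5 := (HasFDerivAt.comp (f := fun z : E × E => z.1) _ h1 h3).prodMk
      ((HasFDerivAt.comp (f := fun z : E × E => z.1) _ h2 h3).clm_apply h4)
    refine (DFunLike.congr_fun h5.fderiv ξ).trans ?_
    simp
  · have : ∀ᶠ z : E × E in 𝓝 (extChartAt I V.proj V.proj, vec V),
        z.1 ∈ (extChartAt I V.proj).target ∧ (extChartAt I V.proj).symm z.1 ∈ P '' Ω :=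
      (continuous_fst.tendsto (extChartAt I V.proj V.proj, vec V)).eventually hev
    filter_upwards [this] with z hz
    rw [extChartAt_tangent_symm V hz.1]
    simp only [tangentParamInv, tangentParam, mkT_proj, vec_mkT]
    rw [← mD_eq_fderiv, hσdef, mD_comp_apply (hQ _ hz.2) (hψ.mdifferentiableAt hz.1)]

end Tangent

end Param

/-! ### Christoffel vectors and the connector in an arbitrary parametrization -/

section Christoffel

variable {E : Type*} [NormedAddCommGroup E] [NormedSpace ℝ E]

/-- `w` is the Christoffel vector `Γ(a, b)` at `y` of the metric with coefficients `B`. -/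
def IsKoszul (B : E → E →L[ℝ] E →L[ℝ] ℝ) (y a b w : E) : Prop :=
  ∀ c, B y w c = (fderiv ℝ B y a b c + fderiv ℝ B y b a c - fderiv ℝ B y c a b) / 2

theorem fderiv_pullback {B : E → E →L[ℝ] E →L[ℝ] ℝ} {σ : E → E} {τ : E → E →L[ℝ] E} {z : E}
    {B' : E →L[ℝ] E →L[ℝ] E →L[ℝ] ℝ} {σ' : E →L[ℝ] E} {τ' : E →L[ℝ] E →L[ℝ] E}
    (hB : HasFDerivAt B B' (σ z)) (hσ : HasFDerivAt σ σ' z) (hτ : HasFDerivAt τ τ' z)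
    (a b c : E) :
    fderiv ℝ (fun z => B (σ z) (τ z b) (τ z c)) z a =
      B' (σ' a) (τ z b) (τ z c) + B (σ z) (τ' a b) (τ z c) + B (σ z) (τ z b) (τ' a c) := by
  have h1 : HasFDerivAt (fun z => B (σ z)) (B'.comp σ') z := hB.comp z hσ
  have h2 := (h1.clm_apply (hτ.clm_apply (hasFDerivAt_const b z))).clm_apply
      (hτ.clm_apply (hasFDerivAt_const c z))
  refine (DFunLike.congr_fun h2.fderiv a).trans ?_
  simp
  ring

variable {H : Type*} [TopologicalSpace H] {I : ModelWithCorners ℝ E H}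
  {N : Type*} [TopologicalSpace N] [ChartedSpace H N]

/-- `g` is a field of inner products. -/
structure IsMetricTensor (I : ModelWithCorners ℝ E H)
    (g : (p : N) → TangentSpace I p → TangentSpace I p → ℝ) : Prop where
  add : ∀ (p : N) (a b c : E), g p (a + b : E) c = g p a c + g p b c
  smul : ∀ (p : N) (r : ℝ) (a c : E), g p (r • a : E) c = r * g p a c
  symm : ∀ (p : N) (a b : E), g p a b = g p b a
  pos : ∀ (p : N) (a : E), a ≠ 0 → 0 < g p a a

namespace IsMetricTensor

variable {g : (p : N) → TangentSpace I p → TangentSpace I p → ℝ} (hg : IsMetricTensor I g)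
include hg

theorem sub (p : N) (a b c : E) : g p (a - b : E) c = g p a c - g p b c := by
  have h1 := hg.add p a ((-1 : ℝ) • b) c
  have h2 := hg.smul p (-1) b c
  rw [h2] at h1
  rw [sub_eq_add_neg, ← neg_one_smul ℝ b]
  rw [h1]; ring

theorem ext_left (p : N) {a b : E} (h : ∀ c : E, g p a c = g p b c) : a = b := by
  by_contra hne
  have h1 := hg.pos p (a - b) (sub_ne_zero.2 hne)
  rw [hg.sub, h, sub_self] at h1
  exact lt_irrefl _ h1

end IsMetricTensor

/-- `B` gives the coefficients of `g` in the parametrization `P` near `y`. -/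
structure IsCoeff (g : (p : N) → TangentSpace I p → TangentSpace I p → ℝ) (P : E → N)
    (B : E → E →L[ℝ] E →L[ℝ] ℝ) (y : E) : Prop where
  eventually_eq : ∀ᶠ z in 𝓝 y, ∀ a b : E,
    g (P z) (mD 𝓘(ℝ, E) I P z a) (mD 𝓘(ℝ, E) I P z b) = B z a b
  differentiableAt : DifferentiableAt ℝ B y

theorem IsCoeff.symm {g : (p : N) → TangentSpace I p → TangentSpace I p → ℝ}
    (hg : IsMetricTensor I g) {P : E → N} {B : E → E →L[ℝ] E →L[ℝ] ℝ} {y : E}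
    (hB : IsCoeff g P B y) (a b : E) : B y a b = B y b a := by
  rw [← hB.eventually_eq.self_of_nhds, ← hB.eventually_eq.self_of_nhds, hg.symm]

/-- `christoffel` is a choice among the solutions of the Koszul equation; the metric is
nondegenerate, so there is at most one. -/
theorem christoffel_eq_of_isChristoffel {g : (p : N) → TangentSpace I p → TangentSpace I p → ℝ}
    (hg : IsMetricTensor I g) [IsManifold I ∞ N] [I.Boundaryless] {p : N} {a b w : E}
    (h : IsChristoffel g p a b w) : christoffel g p a b = w := by
  have h1 : IsChristoffel g p a b (christoffel g p a b) := Classical.epsilon_spec ⟨w, h⟩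
  have h2 : ∀ a b : E, metricInChart g p (extChartAt I p p) a b = g p a b := by
    intro a b
    have h3 : metricInChart g p (extChartAt I p p) a b =
      g ((extChartAt I p).symm (extChartAt I p p))
        (mD 𝓘(ℝ, E) I (extChartAt I p).symm (extChartAt I p p) a)
        (mD 𝓘(ℝ, E) I (extChartAt I p).symm (extChartAt I p p) b) := rfl
    rw [h3, mD_extChartAt_symm_self, extChartAt_to_inv]
    rfl
  refine hg.ext_left p fun c => ?_
  rw [← h2, ← h2, h1 c, h c]

variable [IsManifold I ∞ N] [I.Boundaryless]
  {g : (p : N) → TangentSpace I p → TangentSpace I p → ℝ} (hg : IsMetricTensor I g)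
  {P : E → N} {Q : N → E} {Ω : Set E} (hP : IsParam I P Q Ω)

include hP in
theorem IsParam.contDiffAt_transition {p : N} (hp : p ∈ P '' Ω) :
    ContDiffAt ℝ ∞ (fun z => Q ((extChartAt I p).symm z)) (extChartAt I p p) ∧
    fderiv ℝ (fun z => Q ((extChartAt I p).symm z)) (extChartAt I p p) = mD I 𝓘(ℝ, E) Q p ∧
    ∀ᶠ z in 𝓝 (extChartAt I p p), (extChartAt I p).symm z ∈ P '' Ω := by
  have hψ := isParam_extChartAt (I := I) p
  have hz0 := mem_extChartAt_target (I := I) p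
  obtain ⟨y, hy, rfl⟩ := hp
  refine ⟨?_, ?_, ?_⟩
  · rw [← contMDiffAt_iff_contDiffAt]
    refine ContMDiffAt.comp _ ?_ (hψ.contMDiffAt hz0)
    rw [extChartAt_to_inv]
    exact hP.contMDiffAt_inv hy
  · rw [← mD_eq_fderiv, mD_eq_of_chart (I' := I) Q _ (hP.mdifferentiableAt_inv hy)]
  · refine (continuousAt_extChartAt_symm _).eventually_mem ?_
    rw [extChartAt_to_inv]
    exact hP.image_mem_nhds hy

include hg hP in
/-- The transformation law of the Christoffel vectors. -/
theorem mD_christoffel {B : E → E →L[ℝ] E →L[ℝ] ℝ} {y : E} (hy : y ∈ Ω) (hB : IsCoeff g P B y)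
    {a b w : E} (hw : IsKoszul B y (mD I 𝓘(ℝ, E) Q (P y) a) (mD I 𝓘(ℝ, E) Q (P y) b) w) :
    mD I 𝓘(ℝ, E) Q (P y) (christoffel g (P y) a b) = w +
      fderiv ℝ (fderiv ℝ (fun z => Q ((extChartAt I (P y)).symm z)))
        (extChartAt I (P y) (P y)) a b := by
  obtain ⟨hσ, hσ', hev⟩ := hP.contDiffAt_transition (mem_image_of_mem P hy)
  have hψ := isParam_extChartAt (I := I) (P y)
  have hz0 := mem_extChartAt_target (I := I) (P y)
  set z₀ := extChartAt I (P y) (P y) with hz₀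
  set σ : E → E := fun z => Q ((extChartAt I (P y)).symm z) with hσdef
  have hσz : σ z₀ = y := by
    simp only [hσdef, hz₀]; rw [extChartAt_to_inv, hP.left_inv y hy]
  rw [← hσ'] at hw
  set A := mD 𝓘(ℝ, E) I P y
  have hA : ∀ v, fderiv ℝ σ z₀ (A v) = v := by
    intro v; rw [hσ']; exact hP.mD_inv_mD hy v
  set W := w + fderiv ℝ (fderiv ℝ σ) z₀ a b
  -- The derivative of `Q` inverts `A`, so it is enough to verify the Koszul equation in the
  -- preferred chart for the vector `A W`.
  suffices h : christoffel g (P y) a b = A W by rw [h]; exact hP.mD_inv_mD hy _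
  -- The coefficients in the preferred chart are the pull-back of `B` under the transition map `σ`.
  have hloc : ∀ b c : E, (fun z => metricInChart g (P y) z b c) =ᶠ[𝓝 z₀]
      fun z => B (σ z) (fderiv ℝ σ z b) (fderiv ℝ σ z c) := by
    intro b c
    have h1 : ∀ᶠ z in 𝓝 z₀, ∀ a b : E,
      g (P (σ z)) (mD 𝓘(ℝ, E) I P (σ z) a) (mD 𝓘(ℝ, E) I P (σ z) b) = B (σ z) a b :=
      hσ.continuousAt.eventually (by rw [hσz]; exact hB.eventually_eq)
    filter_upwards [h1, hψ.mem_nhds hz0, hev] with z hz hz1 hz2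
    rw [← hz]
    have h3 : metricInChart g (P y) z b c =
      g ((extChartAt I (P y)).symm z)
        (mD 𝓘(ℝ, E) I (extChartAt I (P y)).symm z b)
        (mD 𝓘(ℝ, E) I (extChartAt I (P y)).symm z c) := rfl
    have h4 : ∀ v, mD 𝓘(ℝ, E) I P (σ z) (fderiv ℝ σ z v) =
        mD 𝓘(ℝ, E) I (extChartAt I (P y)).symm z v := by
      intro v
      obtain ⟨y', hy', hyz⟩ := hz2
      have hσy : σ z = y' := by simp only [hσdef]; rw [← hyz, hP.left_inv _ hy']
      rw [← mD_eq_fderiv, mD_comp_apply (by rw [← hyz]; exact hP.mdifferentiableAt_inv hy')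
        (hψ.mdifferentiableAt hz1), ← hyz, hσy, hP.mD_mD_inv hy']
    have h5 : P (σ z) = (extChartAt I (P y)).symm z := hP.right_inv hz2
    rw [h3, h4, h4, h5]
  have hBσ : HasFDerivAt B (fderiv ℝ B y) (σ z₀) := by
    rw [hσz]; exact hB.differentiableAt.hasFDerivAt
  have h1 : HasFDerivAt σ (fderiv ℝ σ z₀) z₀ := (hσ.differentiableAt (by simp)).hasFDerivAt
  have h2 : HasFDerivAt (fderiv ℝ σ) (fderiv ℝ (fderiv ℝ σ) z₀) z₀ :=
    ((hσ.fderiv_right (m := 1) (by norm_cast)).differentiableAt (by simp)).hasFDerivAt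
  have hsymm : ∀ a b, fderiv ℝ (fderiv ℝ σ) z₀ a b = fderiv ℝ (fderiv ℝ σ) z₀ b a := by
    intro a b
    exact (hσ.isSymmSndFDerivAt (by simp; norm_cast)) a b
  have hder : ∀ a b c : E, fderiv ℝ (fun z => metricInChart g (P y) z b c) z₀ a =
      fderiv ℝ B y (fderiv ℝ σ z₀ a) (fderiv ℝ σ z₀ b) (fderiv ℝ σ z₀ c)
      + B y (fderiv ℝ (fderiv ℝ σ) z₀ a b) (fderiv ℝ σ z₀ c)
      + B y (fderiv ℝ σ z₀ b) (fderiv ℝ (fderiv ℝ σ) z₀ a c) := by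
    intro a b c
    rw [(hloc b c).fderiv_eq]
    rw [fderiv_pullback hBσ h1 h2, hσz]
  -- In the alternating sum of the Koszul formula the symmetry of `D²σ` cancels every second-order
  -- term except the two equal ones that contain `D²σ(a, b)`.
  apply christoffel_eq_of_isChristoffel hg
  intro c
  have hval := (hloc (A W) c).self_of_nhds
  simp only at hval
  rw [hder, hder, hder, hval, hσz, hA]
  have hw' := hw (fderiv ℝ σ z₀ c)
  have hs := hB.symm hg
  simp only [W, map_add, add_apply]
  rw [hw', hsymm b a, hsymm c a, hsymm c b, hs (fderiv ℝ σ z₀ b), hs (fderiv ℝ σ z₀ a) (fderiv ℝ (fderiv ℝ σ) z₀ b c)]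
  ring

section Connector

variable [IsManifold I 1 N]

include hg hP in
/-- The connector in coordinates. -/
theorem mD_connector {B : E → E →L[ℝ] E →L[ℝ] ℝ} {V : TangentBundle I N} (hV : V.proj ∈ P '' Ω)
    (hB : IsCoeff g P B (Q V.proj)) (ξ : E × E) {w : E}
    (hw : IsKoszul B (Q V.proj) (mD I.tangent 𝓘(ℝ, E × E) (tangentParamInv Q) V ξ).1
      (tangentParamInv Q V).2 w) :
    mD I 𝓘(ℝ, E) Q V.proj (connector g V ξ) =
      (mD I.tangent 𝓘(ℝ, E × E) (tangentParamInv Q) V ξ).2 + w := by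
  rw [mD_tangentParamInv hP V hV] at hw ⊢
  have hc : connector g V ξ = (ξ.2 + christoffel g V.proj (mD I.tangent I TotalSpace.proj V ξ)
    (vec V) : E) := rfl
  rw [hc, mD_proj, map_add]
  -- The same `D²σ` occurs in the vertical coordinate and in the transformed Christoffel vector,
  -- which is why the connector transforms like a vector.
  have h1 := mD_christoffel hg hP (hP.inv_mem hV) hB (a := ξ.1) (b := vec V) (w := w)
  rw [hP.right_inv hV] at h1
  rw [h1 hw]
  simp only
  abel

theorem horiz_eq (V : TangentBundle I N) (ξ : E × E) : horiz V ξ = ξ.1 := mD_proj V ξ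

include hP in
theorem mD_horiz {V : TangentBundle I N} (hV : V.proj ∈ P '' Ω) (ξ : E × E) :
    mD I 𝓘(ℝ, E) Q V.proj (horiz V ξ) = (mD I.tangent 𝓘(ℝ, E × E) (tangentParamInv Q) V ξ).1 := by
  rw [mD_tangentParamInv hP V hV, horiz_eq]

omit [IsManifold I ∞ N] [I.Boundaryless] in
theorem proj_tangentParam (z : E × E) : (tangentParam I P z).proj = P z.1 := rfl

include hP in
theorem horiz_tangentParam {z : E × E} (hz : z.1 ∈ Ω) (ζ : E × E) :
    horiz (tangentParam I P z) (mD 𝓘(ℝ, E × E) I.tangent (tangentParam I P) z ζ) =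
      mD 𝓘(ℝ, E) I P z.1 ζ.1 := by
  have h1 := mD_horiz hP (V := tangentParam I P z) (mem_image_of_mem P hz)
    (mD 𝓘(ℝ, E × E) I.tangent (tangentParam I P) z ζ)
  rw [hP.tangent.mD_inv_mD ⟨hz, mem_univ _⟩] at h1
  rw [← h1]
  exact (hP.mD_mD_inv hz _).symm

include hg hP in
theorem connector_tangentParam {B : E → E →L[ℝ] E →L[ℝ] ℝ} {z : E × E} (hz : z.1 ∈ Ω)
    (hB : IsCoeff g P B z.1) (ζ : E × E) {w : E} (hw : IsKoszul B z.1 ζ.1 z.2 w) :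
    connector g (tangentParam I P z) (mD 𝓘(ℝ, E × E) I.tangent (tangentParam I P) z ζ) =
      mD 𝓘(ℝ, E) I P z.1 (ζ.2 + w) := by
  have hzz : z ∈ Ω ×ˢ (univ : Set E) := ⟨hz, mem_univ _⟩
  have h1 := mD_connector hg hP (B := B) (V := tangentParam I P z) (mem_image_of_mem P hz)
    (by rw [proj_tangentParam, hP.left_inv _ hz]; exact hB)
    (mD 𝓘(ℝ, E × E) I.tangent (tangentParam I P) z ζ) (w := w)
  rw [hP.tangent.mD_inv_mD hzz, hP.tangent.left_inv _ hzz, proj_tangentParam,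
    hP.left_inv _ hz] at h1
  rw [← h1 hw]
  exact (hP.mD_mD_inv hz _).symm

end Connector

end Christoffel

/-! ### Curvature and its symmetries on an open subset of a vector space -/

section LocalGeometry

variable {E : Type*} [NormedAddCommGroup E] [NormedSpace ℝ E]

/-- The curvature tensor of the connection with Christoffel symbols `Γ`. -/
def curv (Γ : E → E →L[ℝ] E →L[ℝ] E) (y a b c : E) : E :=
  fderiv ℝ Γ y a b c - fderiv ℝ Γ y b a c + Γ y a (Γ y b c) - Γ y b (Γ y a c)

/-- The covariant derivative of the curvature tensor. -/
def dcurv (Γ : E → E →L[ℝ] E →L[ℝ] E) (y w a b c : E) : E :=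
  fderiv ℝ (fun y => curv Γ y a b c) y w + Γ y w (curv Γ y a b c) - curv Γ y (Γ y w a) b c
    - curv Γ y a (Γ y w b) c - curv Γ y a b (Γ y w c)

/-- A metric on an open set together with its Levi-Civita connection. -/
structure IsLeviCivita (Ω : Set E) (B : E → E →L[ℝ] E →L[ℝ] ℝ) (Γ : E → E →L[ℝ] E →L[ℝ] E) :
    Prop where
  isOpen : IsOpen Ω
  contDiffOn_metric : ContDiffOn ℝ ∞ B Ω
  contDiffOn : ContDiffOn ℝ ∞ Γ Ω
  metric_symm : ∀ y ∈ Ω, ∀ a b, B y a b = B y b a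
  pos : ∀ y ∈ Ω, ∀ a, a ≠ 0 → 0 < B y a a
  symm : ∀ y ∈ Ω, ∀ a b, Γ y a b = Γ y b a
  compat : ∀ y ∈ Ω, ∀ a b c, fderiv ℝ B y a b c = B y (Γ y a b) c + B y b (Γ y a c)

section Curv

variable (Γ : E → E →L[ℝ] E →L[ℝ] E) (y : E)

theorem curv_add_left (a a' b c : E) : curv Γ y (a + a') b c = curv Γ y a b c + curv Γ y a' b c := by
  simp only [curv, map_add, add_apply]; abel

theorem curv_add_mid (a b b' c : E) : curv Γ y a (b + b') c = curv Γ y a b c + curv Γ y a b' c := by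
  simp only [curv, map_add, add_apply]; abel

theorem curv_add_right (a b c c' : E) : curv Γ y a b (c + c') = curv Γ y a b c + curv Γ y a b c' := by
  simp only [curv, map_add]; abel

theorem curv_smul_left (r : ℝ) (a b c : E) : curv Γ y (r • a) b c = r • curv Γ y a b c := by
  simp only [curv, map_smul, smul_apply, smul_sub, smul_add]

theorem curv_smul_mid (r : ℝ) (a b c : E) : curv Γ y a (r • b) c = r • curv Γ y a b c := by
  simp only [curv, map_smul, smul_apply, smul_sub, smul_add]

theorem curv_smul_right (r : ℝ) (a b c : E) : curv Γ y a b (r • c) = r • curv Γ y a b c := by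
  simp only [curv, map_smul, smul_sub, smul_add]

theorem curv_antisymm (a b c : E) : curv Γ y a b c = - curv Γ y b a c := by
  simp only [curv]; abel

end Curv

section Deriv

variable {Γ : E → E →L[ℝ] E →L[ℝ] E} {x a b c : ℝ → E} {x' a' b' c' : E} {t : ℝ}

theorem hasDerivAt_bilin {F : Type*} [NormedAddCommGroup F] [NormedSpace ℝ F]
    {Γ : E → E →L[ℝ] E →L[ℝ] F} (hΓ : DifferentiableAt ℝ Γ (x t))
    (hx : HasDerivAt x x' t) (ha : HasDerivAt a a' t) (hb : HasDerivAt b b' t) :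
    HasDerivAt (fun s => Γ (x s) (a s) (b s))
      (fderiv ℝ Γ (x t) x' (a t) (b t) + Γ (x t) a' (b t) + Γ (x t) (a t) b') t := by
  have h1 : HasDerivAt (fun s => Γ (x s)) (fderiv ℝ Γ (x t) x') t :=
    hΓ.hasFDerivAt.comp_hasDerivAt t hx
  have h2 := (h1.clm_apply ha).clm_apply hb
  simpa using h2

theorem hasDerivAt_fderiv_bilin (hΓ : ContDiffAt ℝ 2 Γ (x t))
    (hx : HasDerivAt x x' t) (ha : HasDerivAt a a' t) (hb : HasDerivAt b b' t)
    (hc : HasDerivAt c c' t) :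
    HasDerivAt (fun s => fderiv ℝ Γ (x s) (a s) (b s) (c s))
      (fderiv ℝ (fderiv ℝ Γ) (x t) x' (a t) (b t) (c t) + fderiv ℝ Γ (x t) a' (b t) (c t)
        + fderiv ℝ Γ (x t) (a t) b' (c t) + fderiv ℝ Γ (x t) (a t) (b t) c') t := by
  have h0 : DifferentiableAt ℝ (fderiv ℝ Γ) (x t) :=
    (hΓ.fderiv_right (m := 1) (by norm_num)).differentiableAt (by simp)
  have h1 : HasDerivAt (fun s => fderiv ℝ Γ (x s)) (fderiv ℝ (fderiv ℝ Γ) (x t) x') t :=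
    h0.hasFDerivAt.comp_hasDerivAt t hx
  have h2 := ((h1.clm_apply ha).clm_apply hb).clm_apply hc
  simpa [add_assoc] using h2

/-- An auxiliary expression for the derivative of the curvature tensor. -/
theorem hasDerivAt_curv_aux (hΓ : ContDiffAt ℝ 2 Γ (x t))
    (hx : HasDerivAt x x' t) (ha : HasDerivAt a a' t) (hb : HasDerivAt b b' t)
    (hc : HasDerivAt c c' t) :
    HasDerivAt (fun s => curv Γ (x s) (a s) (b s) (c s))
      ((fderiv ℝ (fderiv ℝ Γ) (x t) x' (a t) (b t) (c t)
        - fderiv ℝ (fderiv ℝ Γ) (x t) x' (b t) (a t) (c t)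
        + fderiv ℝ Γ (x t) x' (a t) (Γ (x t) (b t) (c t))
        + Γ (x t) (a t) (fderiv ℝ Γ (x t) x' (b t) (c t))
        - fderiv ℝ Γ (x t) x' (b t) (Γ (x t) (a t) (c t))
        - Γ (x t) (b t) (fderiv ℝ Γ (x t) x' (a t) (c t)))
        + curv Γ (x t) a' (b t) (c t) + curv Γ (x t) (a t) b' (c t)
        + curv Γ (x t) (a t) (b t) c') t := by
  have hd : DifferentiableAt ℝ Γ (x t) := hΓ.differentiableAt (by simp)
  have h1 := hasDerivAt_fderiv_bilin hΓ hx ha hb hc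
  have h2 := hasDerivAt_fderiv_bilin hΓ hx hb ha hc
  have h3 := hasDerivAt_bilin hd hx ha (hasDerivAt_bilin hd hx hb hc)
  have h4 := hasDerivAt_bilin hd hx hb (hasDerivAt_bilin hd hx ha hc)
  refine (((h1.sub h2).add h3).sub h4).congr_deriv ?_
  simp only [curv, map_add]
  abel

theorem fderiv_curv {y : E} (hΓ : ContDiffAt ℝ 2 Γ y) (w a b c : E) :
    fderiv ℝ (fun y => curv Γ y a b c) y w =
      fderiv ℝ (fderiv ℝ Γ) y w a b c - fderiv ℝ (fderiv ℝ Γ) y w b a c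
        + fderiv ℝ Γ y w a (Γ y b c) + Γ y a (fderiv ℝ Γ y w b c)
        - fderiv ℝ Γ y w b (Γ y a c) - Γ y b (fderiv ℝ Γ y w a c) := by
  have hd : DifferentiableAt ℝ Γ y := hΓ.differentiableAt (by simp)
  have h0 : DifferentiableAt ℝ (fderiv ℝ Γ) y :=
    (hΓ.fderiv_right (m := 1) (by norm_num)).differentiableAt (by simp)
  have hda : DifferentiableAt ℝ (fun y => curv Γ y a b c) y := by
    have e1 : ∀ u v w : E, DifferentiableAt ℝ (fun y => fderiv ℝ Γ y u v w) y := fun u v w =>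
      ((h0.clm_apply (differentiableAt_const u)).clm_apply (differentiableAt_const v)).clm_apply
        (differentiableAt_const w)
    have e2 : ∀ u v : E, DifferentiableAt ℝ (fun y => Γ y u v) y := fun u v =>
      (hd.clm_apply (differentiableAt_const u)).clm_apply (differentiableAt_const v)
    have e3 : ∀ u v w : E, DifferentiableAt ℝ (fun y => Γ y u (Γ y v w)) y := fun u v w =>
      (hd.clm_apply (differentiableAt_const u)).clm_apply (e2 v w)
    exact (((e1 a b c).sub (e1 b a c)).add (e3 a b c)).sub (e3 b a c)
  have hline : HasDerivAt (fun s : ℝ => y + s • w) w 0 := by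
    simpa using ((hasDerivAt_id (0 : ℝ)).smul_const w).const_add y
  have h1 := hasDerivAt_curv_aux (Γ := Γ) (x := fun s : ℝ => y + s • w) (t := 0)
    (by simpa using hΓ) hline (hasDerivAt_const 0 a) (hasDerivAt_const 0 b) (hasDerivAt_const 0 c)
  have h2 : HasDerivAt (fun s : ℝ => curv Γ (y + s • w) a b c)
      (fderiv ℝ (fun y => curv Γ y a b c) y w) 0 := by
    have h3 : HasFDerivAt (fun y => curv Γ y a b c) (fderiv ℝ (fun y => curv Γ y a b c) y)
      ((fun s : ℝ => y + s • w) 0) := by simpa using hda.hasFDerivAt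
    exact h3.comp_hasDerivAt 0 hline
  rw [h2.unique h1]
  simp [curv]

theorem hasDerivAt_curv (hΓ : ContDiffAt ℝ 2 Γ (x t))
    (hx : HasDerivAt x x' t) (ha : HasDerivAt a a' t) (hb : HasDerivAt b b' t)
    (hc : HasDerivAt c c' t) :
    HasDerivAt (fun s => curv Γ (x s) (a s) (b s) (c s))
      (fderiv ℝ (fun y => curv Γ y (a t) (b t) (c t)) (x t) x'
        + curv Γ (x t) a' (b t) (c t) + curv Γ (x t) (a t) b' (c t)
        + curv Γ (x t) (a t) (b t) c') t := by
  rw [fderiv_curv hΓ]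
  exact hasDerivAt_curv_aux hΓ hx ha hb hc

/-- The product rule for the covariant derivative of the curvature tensor along a curve. -/
theorem hasDerivAt_curv_cov (hΓ : ContDiffAt ℝ 2 Γ (x t))
    (hx : HasDerivAt x x' t) (ha : HasDerivAt a a' t) (hb : HasDerivAt b b' t)
    (hc : HasDerivAt c c' t) :
    HasDerivAt (fun s => curv Γ (x s) (a s) (b s) (c s))
      (dcurv Γ (x t) x' (a t) (b t) (c t)
        + curv Γ (x t) (a' + Γ (x t) x' (a t)) (b t) (c t)
        + curv Γ (x t) (a t) (b' + Γ (x t) x' (b t)) (c t)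
        + curv Γ (x t) (a t) (b t) (c' + Γ (x t) x' (c t))
        - Γ (x t) x' (curv Γ (x t) (a t) (b t) (c t))) t := by
  refine (hasDerivAt_curv hΓ hx ha hb hc).congr_deriv ?_
  simp only [dcurv, curv_add_left, curv_add_mid, curv_add_right]
  abel

end Deriv

namespace IsLeviCivita

variable {Ω : Set E} {B : E → E →L[ℝ] E →L[ℝ] ℝ} {Γ : E → E →L[ℝ] E →L[ℝ] E}
  (h : IsLeviCivita Ω B Γ) {y : E} (hy : y ∈ Ω)
include h hy

theorem contDiffAt : ContDiffAt ℝ ∞ Γ y := h.contDiffOn.contDiffAt (h.isOpen.mem_nhds hy)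

theorem contDiffAt_two : ContDiffAt ℝ 2 Γ y := (h.contDiffAt hy).of_le (by norm_cast)

theorem contDiffAt_metric : ContDiffAt ℝ ∞ B y :=
  h.contDiffOn_metric.contDiffAt (h.isOpen.mem_nhds hy)

theorem differentiableAt : DifferentiableAt ℝ Γ y := (h.contDiffAt hy).differentiableAt (by simp)

theorem differentiableAt_metric : DifferentiableAt ℝ B y :=
  (h.contDiffAt_metric hy).differentiableAt (by simp)

theorem fderiv_symm (a b c : E) : fderiv ℝ Γ y a b c = fderiv ℝ Γ y a c b := by
  have h1 : ∀ b c : E, HasFDerivAt (fun z => Γ z b c) (((fderiv ℝ Γ y).flip b).flip c) y := by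
    intro b c
    have := ((h.differentiableAt hy).hasFDerivAt.clm_apply (hasFDerivAt_const b y)).clm_apply
      (hasFDerivAt_const c y)
    refine this.congr_fderiv ?_
    ext v
    simp
  have h2 : (fun z => Γ z b c) =ᶠ[𝓝 y] fun z => Γ z c b := by
    filter_upwards [h.isOpen.mem_nhds hy] with z hz using h.symm z hz b c
  have h3 := (h1 b c).unique ((h1 c b).congr_of_eventuallyEq h2)
  simpa using DFunLike.congr_fun h3 a

/-- The first Bianchi identity. -/
theorem bianchi (a b c : E) : curv Γ y a b c + curv Γ y b c a + curv Γ y c a b = 0 := by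
  simp only [curv]
  rw [h.fderiv_symm hy a b c, h.fderiv_symm hy b c a, h.fderiv_symm hy c a b,
    h.symm y hy b c, h.symm y hy a c, h.symm y hy b a]
  abel

theorem hasDerivAt_metric {x a b : ℝ → E} {x' a' b' : E} {t : ℝ} (hxy : x t = y)
    (hx : HasDerivAt x x' t) (ha : HasDerivAt a a' t) (hb : HasDerivAt b b' t) :
    HasDerivAt (fun s => B (x s) (a s) (b s))
      (B y (a' + Γ y x' (a t)) (b t) + B y (a t) (b' + Γ y x' (b t))) t := by
  subst hxy
  refine (hasDerivAt_bilin (h.differentiableAt_metric hy) hx ha hb).congr_deriv ?_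
  rw [h.compat _ hy]
  simp only [map_add, add_apply]
  ring

/-- Differentiate the compatibility of `B` with `Γ` once more. The second derivative of `B` is
symmetric in the directions `a` and `b`, and the difference of the two orders is exactly the sum of
the two curvature terms. -/
theorem metric_curv (a b c d : E) : B y (curv Γ y a b c) d = - B y (curv Γ y a b d) c := by
  have hd2 : DifferentiableAt ℝ (fderiv ℝ B) y :=
    (((h.contDiffAt_metric hy).of_le (m := 2) (by norm_cast)).fderiv_right (m := 1)
      (by norm_num)).differentiableAt (by simp)
  have key : ∀ a b : E, fderiv ℝ (fderiv ℝ B) y a b c d =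
      B y (fderiv ℝ Γ y a b c) d + B y (Γ y a (Γ y b c)) d + B y (Γ y b c) (Γ y a d)
      + B y (Γ y a c) (Γ y b d) + B y c (fderiv ℝ Γ y a b d) + B y c (Γ y a (Γ y b d)) := by
    intro a b
    have hline : HasDerivAt (fun s : ℝ => y + s • a) a 0 := by
      simpa using ((hasDerivAt_id (0 : ℝ)).smul_const a).const_add y
    have hy0 : (fun s : ℝ => y + s • a) 0 = y := by simp
    have hfd : HasDerivAt (fun s : ℝ => fderiv ℝ B (y + s • a)) (fderiv ℝ (fderiv ℝ B) y a) 0 := by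
      have : HasFDerivAt (fderiv ℝ B) (fderiv ℝ (fderiv ℝ B) y) ((fun s : ℝ => y + s • a) 0) := by
        rw [hy0]; exact hd2.hasFDerivAt
      exact this.comp_hasDerivAt 0 hline
    have h1 := ((hfd.clm_apply (hasDerivAt_const 0 b)).clm_apply (hasDerivAt_const 0 c)).clm_apply
      (hasDerivAt_const 0 d)
    have hΓ : ∀ e : E, HasDerivAt (fun s : ℝ => Γ (y + s • a) b e) (fderiv ℝ Γ y a b e) 0 := by
      intro e
      have := hasDerivAt_bilin (Γ := Γ) (x := fun s : ℝ => y + s • a) (t := 0)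
        (by simpa using h.differentiableAt hy) hline (hasDerivAt_const 0 b)
        (hasDerivAt_const 0 e)
      simpa using this
    have h2 := (h.hasDerivAt_metric hy hy0 hline (hΓ c) (hasDerivAt_const 0 d)).add
      (h.hasDerivAt_metric hy hy0 hline (hasDerivAt_const 0 c) (hΓ d))
    have hev : (fun s : ℝ => fderiv ℝ B (y + s • a) b c d) =ᶠ[𝓝 0]
        fun s => B (y + s • a) (Γ (y + s • a) b c) d + B (y + s • a) c (Γ (y + s • a) b d) := by
      have : ∀ᶠ s : ℝ in 𝓝 0, y + s • a ∈ Ω :=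
        hline.continuousAt.eventually_mem (by simpa using h.isOpen.mem_nhds hy)
      filter_upwards [this] with s hs using h.compat _ hs b c d
    have h3 := h1.unique (h2.congr_of_eventuallyEq hev)
    simp only [map_zero, add_zero, zero_add, zero_smul, map_add, add_apply] at h3
    rw [h3]
    ring
  have hsym : fderiv ℝ (fderiv ℝ B) y a b = fderiv ℝ (fderiv ℝ B) y b a :=
    ((h.contDiffAt_metric hy).isSymmSndFDerivAt (by simp; norm_cast)) a b
  have h1 := key a b
  have h2 := key b a
  rw [hsym] at h1
  rw [h1] at h2
  have hs := h.metric_symm y hy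
  rw [hs (curv Γ y a b d) c]
  simp only [curv, map_add, map_sub, add_apply, sub_apply]
  linarith

/-- The classical octahedron argument: the four Bianchi identities for the cyclic shifts of `a, b,
c, d` are combined by means of skew-symmetry in the first two and in the last two slots. -/
theorem curv_pair_symm (a b c d : E) : B y (curv Γ y a b c) d = B y (curv Γ y c d a) b := by
  have b1 := congrArg (fun v => B y v d) (h.bianchi hy a b c)
  have b2 := congrArg (fun v => B y v a) (h.bianchi hy b c d)
  have b3 := congrArg (fun v => B y v b) (h.bianchi hy c d a)
  have b4 := congrArg (fun v => B y v c) (h.bianchi hy d a b)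
  simp only [map_add, add_apply, map_zero, zero_apply] at b1 b2 b3 b4
  have s1 := h.metric_curv hy
  have s2 : ∀ a b c d, B y (curv Γ y a b c) d = - B y (curv Γ y b a c) d := by
    intro a b c d
    rw [curv_antisymm]; simp
  linarith [s1 a b c d, s1 b c a d, s1 c a b d, s1 b c d a, s1 c d b a, s1 d b c a, s1 c d a b,
    s1 d a c b, s1 a c d b, s1 d a b c, s1 a b d c, s1 b d a c, s2 c a b d, s2 d b c a,
    s2 a c d b, s2 b d a c, s2 c a d b, s2 d b a c, s2 a b d c, s2 c d b a]

end IsLeviCivita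

end LocalGeometry

/-! ### The Levi-Civita connection of the Sasaki metric in coordinates -/

section SasakiLocal

variable {E : Type*} [NormedAddCommGroup E] [NormedSpace ℝ E]

theorem contDiffOn_bilinearComp {X E' F : Type*} [NormedAddCommGroup X] [NormedSpace ℝ X]
    [NormedAddCommGroup E'] [NormedSpace ℝ E'] [NormedAddCommGroup F] [NormedSpace ℝ F]
    {n : WithTop ℕ∞} {s : Set X} {B : X → E →L[ℝ] E →L[ℝ] F} {f g : X → E' →L[ℝ] E}
    (hB : ContDiffOn ℝ n B s) (hf : ContDiffOn ℝ n f s) (hg : ContDiffOn ℝ n g s) :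
    ContDiffOn ℝ n (fun z => (B z).bilinearComp (f z) (g z)) s := by
  have h4 : ContDiffOn ℝ n (fun z => ((B z).comp (f z)).flip) s :=
    (ContinuousLinearMap.flipₗᵢ ℝ E' E F).contDiff.comp_contDiffOn (hB.clm_comp hf)
  exact (ContinuousLinearMap.flipₗᵢ ℝ E' E' F).contDiff.comp_contDiffOn (h4.clm_comp hg)

/-- The connector of the connection `Γ` at `z = (x, u)`. -/
def kap (Γ : E → E →L[ℝ] E →L[ℝ] E) (z : E × E) : E × E →L[ℝ] E :=
  ContinuousLinearMap.snd ℝ E E + ((Γ z.1).flip z.2).comp (ContinuousLinearMap.fst ℝ E E)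

theorem kap_apply (Γ : E → E →L[ℝ] E →L[ℝ] E) (z a : E × E) :
    kap Γ z a = a.2 + Γ z.1 a.1 z.2 := by
  simp [kap]

/-- The coefficients of the Sasaki metric. -/
def sasB (B : E → E →L[ℝ] E →L[ℝ] ℝ) (Γ : E → E →L[ℝ] E →L[ℝ] E) (z : E × E) :
    E × E →L[ℝ] E × E →L[ℝ] ℝ :=
  (B z.1).bilinearComp (ContinuousLinearMap.fst ℝ E E) (ContinuousLinearMap.fst ℝ E E) +
    (B z.1).bilinearComp (kap Γ z) (kap Γ z)

theorem sasB_apply (B : E → E →L[ℝ] E →L[ℝ] ℝ) (Γ : E → E →L[ℝ] E →L[ℝ] E) (z a b : E × E) :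
    sasB B Γ z a b = B z.1 a.1 b.1 + B z.1 (kap Γ z a) (kap Γ z b) := by
  simp [sasB]

/-- The horizontal part of the Christoffel vectors of the Sasaki metric. -/
def sasH (Γ : E → E →L[ℝ] E →L[ℝ] E) (z a b : E × E) : E :=
  Γ z.1 a.1 b.1 + (1 / 2 : ℝ) • (curv Γ z.1 z.2 (kap Γ z b) a.1 + curv Γ z.1 z.2 (kap Γ z a) b.1)

/-- The vertical part of the Christoffel vectors of the Sasaki metric. -/
def sasV (Γ : E → E →L[ℝ] E →L[ℝ] E) (z a b : E × E) : E :=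
  fderiv ℝ Γ z.1 a.1 b.1 z.2 + Γ z.1 b.1 a.2 + Γ z.1 a.1 (kap Γ z b)
    - (1 / 2 : ℝ) • curv Γ z.1 a.1 b.1 z.2

/-- The Christoffel vectors of the Sasaki metric. -/
def sasΓ (Γ : E → E →L[ℝ] E →L[ℝ] E) (z a b : E × E) : E × E :=
  (sasH Γ z a b, sasV Γ z a b - Γ z.1 (sasH Γ z a b) z.2)

theorem kap_sasΓ (Γ : E → E →L[ℝ] E →L[ℝ] E) (z a b : E × E) :
    kap Γ z (sasΓ Γ z a b) = sasV Γ z a b := by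
  simp [kap_apply, sasΓ]

/-- The uniqueness half of the fundamental theorem: for a torsion-free connection compatible with
the metric, the alternating sum of three derivatives of the metric leaves only `Γ a b`. -/
theorem isKoszul_of_compat {B : E → E →L[ℝ] E →L[ℝ] ℝ} {y : E} {Γ : E → E → E}
    (hs : ∀ a b, B y a b = B y b a) (hΓ : ∀ a b, Γ a b = Γ b a)
    (h : ∀ a b c, fderiv ℝ B y a b c = B y (Γ a b) c + B y b (Γ a c)) (a b : E) :
    IsKoszul B y a b (Γ a b) := by
  intro c
  rw [h, h, h, hs b, hs a (Γ b c), hΓ b a, hΓ c a, hΓ c b, hs a (Γ b c)]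
  ring

namespace IsLeviCivita

variable {Ω : Set E} {B : E → E →L[ℝ] E →L[ℝ] ℝ} {Γ : E → E →L[ℝ] E →L[ℝ] E}
  (h : IsLeviCivita Ω B Γ)
include h

theorem isKoszul {y : E} (hy : y ∈ Ω) (a b : E) : IsKoszul B y a b (Γ y a b) :=
  isKoszul_of_compat (Γ := fun a b => Γ y a b) (h.metric_symm y hy) (h.symm y hy) (h.compat y hy)
    a b

theorem contDiffOn_kap : ContDiffOn ℝ ∞ (kap Γ) (Ω ×ˢ univ) := by
  have h1 : ContDiffOn ℝ ∞ (fun z : E × E => Γ z.1) (Ω ×ˢ univ) :=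
    h.contDiffOn.comp contDiff_fst.contDiffOn fun z hz => hz.1
  have h2 : ContDiffOn ℝ ∞ (fun z : E × E => (Γ z.1).flip) (Ω ×ˢ univ) :=
    (ContinuousLinearMap.flipₗᵢ ℝ E E E).contDiff.comp_contDiffOn h1
  exact contDiffOn_const.add ((h2.clm_apply contDiff_snd.contDiffOn).clm_comp contDiffOn_const)

theorem contDiffOn_sasB : ContDiffOn ℝ ∞ (sasB B Γ) (Ω ×ˢ univ) := by
  have h1 : ContDiffOn ℝ ∞ (fun z : E × E => B z.1) (Ω ×ˢ univ) :=
    h.contDiffOn_metric.comp contDiff_fst.contDiffOn fun z hz => hz.1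
  exact (contDiffOn_bilinearComp h1 contDiffOn_const contDiffOn_const).add
    (contDiffOn_bilinearComp h1 h.contDiffOn_kap h.contDiffOn_kap)

theorem sasB_symm {z : E × E} (hz : z.1 ∈ Ω) (a b : E × E) :
    sasB B Γ z a b = sasB B Γ z b a := by
  rw [sasB_apply, sasB_apply, h.metric_symm _ hz, h.metric_symm _ hz (kap Γ z a)]

/-- Symmetry is plain for the horizontal part. Without its last term the vertical part has
antisymmetrization `R(a₁, b₁)u`, where `u` is the point of the fibre; subtracting half of that
curvature makes it symmetric. -/
theorem sasΓ_symm {z : E × E} (hz : z.1 ∈ Ω) (a b : E × E) : sasΓ Γ z a b = sasΓ Γ z b a := by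
  have h1 : sasH Γ z a b = sasH Γ z b a := by
    simp only [sasH]
    rw [h.symm _ hz a.1, add_comm (curv Γ z.1 z.2 (kap Γ z b) a.1)]
  have h2 : sasV Γ z a b = sasV Γ z b a := by
    have h3 : curv Γ z.1 a.1 b.1 z.2 = (1 / 2 : ℝ) • curv Γ z.1 a.1 b.1 z.2 -
        (1 / 2 : ℝ) • curv Γ z.1 b.1 a.1 z.2 := by
      rw [curv_antisymm Γ z.1 b.1 a.1]
      module
    have h4 : fderiv ℝ Γ z.1 a.1 b.1 z.2 + Γ z.1 b.1 a.2 + Γ z.1 a.1 (kap Γ z b) -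
        (fderiv ℝ Γ z.1 b.1 a.1 z.2 + Γ z.1 a.1 b.2 + Γ z.1 b.1 (kap Γ z a)) =
        curv Γ z.1 a.1 b.1 z.2 := by
      simp only [kap_apply, map_add, curv]
      abel
    rw [h3] at h4
    simp only [sasV]
    rw [← sub_eq_zero] at h4 ⊢
    rw [← h4]
    abel
  simp only [sasΓ, h1, h2]

/-- `sasΓ` gives the Levi-Civita connection of the Sasaki metric. -/
theorem sasB_compat {z : E × E} (hz : z.1 ∈ Ω) (a b c : E × E) :
    fderiv ℝ (sasB B Γ) z a b c =
      sasB B Γ z (sasΓ Γ z a b) c + sasB B Γ z b (sasΓ Γ z a c) := by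
  have hd : DifferentiableAt ℝ (sasB B Γ) z :=
    (h.contDiffOn_sasB.contDiffAt ((h.isOpen.prod isOpen_univ).mem_nhds ⟨hz, mem_univ _⟩)).differentiableAt
      (by simp)
  have hline : HasDerivAt (fun s : ℝ => z + s • a) a 0 := by
    simpa using ((hasDerivAt_id (0 : ℝ)).smul_const a).const_add z
  have h1 : HasDerivAt (fun s : ℝ => sasB B Γ (z + s • a) b c) (fderiv ℝ (sasB B Γ) z a b c) 0 := by
    have h2 : HasFDerivAt (sasB B Γ) (fderiv ℝ (sasB B Γ) z) ((fun s : ℝ => z + s • a) 0) := by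
      simpa using hd.hasFDerivAt
    have h3 := ((h2.comp_hasDerivAt 0 hline).clm_apply (hasDerivAt_const 0 b)).clm_apply
      (hasDerivAt_const 0 c)
    simpa using h3
  have hx : HasDerivAt (fun s : ℝ => z.1 + s • a.1) a.1 0 := by
    simpa using ((hasDerivAt_id (0 : ℝ)).smul_const a.1).const_add z.1
  have hu : HasDerivAt (fun s : ℝ => z.2 + s • a.2) a.2 0 := by
    simpa using ((hasDerivAt_id (0 : ℝ)).smul_const a.2).const_add z.2
  have hx0 : z.1 + (0 : ℝ) • a.1 = z.1 := by simp
  have hk : ∀ e : E × E, HasDerivAt (fun s : ℝ => e.2 + Γ (z.1 + s • a.1) e.1 (z.2 + s • a.2))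
      (fderiv ℝ Γ z.1 a.1 e.1 z.2 + Γ z.1 e.1 a.2) 0 := by
    intro e
    have := (hasDerivAt_bilin (Γ := Γ) (by simpa using h.differentiableAt hz) hx
      (hasDerivAt_const 0 e.1) hu).const_add e.2
    simpa using this
  have h4 := (h.hasDerivAt_metric hz hx0 hx (hasDerivAt_const 0 b.1) (hasDerivAt_const 0 c.1)).add
    (h.hasDerivAt_metric hz hx0 hx (hk b) (hk c))
  have h5 := h1.unique (h4.congr_of_eventuallyEq (Filter.Eventually.of_forall fun s => by
    simp [sasB_apply, kap_apply]))
  rw [h5]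
  have s1 := h.metric_symm _ hz
  -- The curvature terms of the horizontal part cancel those of the vertical part: pair symmetry
  -- moves the fibre vector `z.2` into the first slot, and skew-symmetry disposes of the rest.
  have e1 := h.curv_pair_symm hz a.1 b.1 z.2 (kap Γ z c)
  have e2 := h.curv_pair_symm hz a.1 c.1 z.2 (kap Γ z b)
  have e3 := h.metric_curv hz z.2 (kap Γ z a) b.1 c.1
  have eb : b.2 + Γ (z.1 + (0 : ℝ) • a.1) b.1 (z.2 + (0 : ℝ) • a.2) = kap Γ z b := by
    simp [kap_apply]
  have ec : c.2 + Γ (z.1 + (0 : ℝ) • a.1) c.1 (z.2 + (0 : ℝ) • a.2) = kap Γ z c := by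
    simp [kap_apply]
  simp only [eb, ec, zero_add]
  rw [sasB_apply, sasB_apply, kap_sasΓ, kap_sasΓ]
  simp only [sasΓ, sasH, sasV, map_add, map_sub, map_smul, add_apply, sub_apply, smul_apply,
    smul_eq_mul]
  rw [s1 b.1 (curv Γ z.1 z.2 (kap Γ z c) a.1), s1 b.1 (curv Γ z.1 z.2 (kap Γ z a) c.1),
    s1 (kap Γ z b) (curv Γ z.1 a.1 c.1 z.2)]
  have e4 := h.metric_curv hz z.2 (kap Γ z c) a.1 b.1
  have e5 := h.metric_curv hz z.2 (kap Γ z b) a.1 c.1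
  linarith

theorem isKoszul_sas {z : E × E} (hz : z.1 ∈ Ω) (a b : E × E) :
    IsKoszul (sasB B Γ) z a b (sasΓ Γ z a b) :=
  isKoszul_of_compat (h.sasB_symm hz) (h.sasΓ_symm hz) (h.sasB_compat hz) a b

end IsLeviCivita

end SasakiLocal

/-! ### Covariant derivatives along geodesics and the evolution of varied Jacobi fields -/

section Evolution

variable {E : Type*} [NormedAddCommGroup E] [NormedSpace ℝ E]

/-- The derivative in `s` of a family of curves, differentiated in `τ`. -/
theorem hasDerivAt_deriv_swap {F : Type*} [NormedAddCommGroup F] [NormedSpace ℝ F]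
    {f : ℝ × ℝ → F} (hf : ContDiffAt ℝ 2 f (0, 0)) {g : ℝ → F} {g' : F}
    (hg : ∀ᶠ s in 𝓝 (0 : ℝ), HasDerivAt (fun τ => f (τ, s)) (g s) 0) (hg' : HasDerivAt g g' 0) :
    HasDerivAt (fun τ => deriv (fun s => f (τ, s)) 0) g' 0 := by
  have hd : ∀ᶠ p in 𝓝 ((0 : ℝ), (0 : ℝ)), DifferentiableAt ℝ f p := by
    have := (hf.eventually (by simp)).mono fun p hp => hp.differentiableAt (by simp)
    exact this
  have h2 : HasFDerivAt (fderiv ℝ f) (fderiv ℝ (fderiv ℝ f) (0, 0)) (0, 0) :=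
    ((hf.fderiv_right (m := 1) (by norm_num)).differentiableAt (by simp)).hasFDerivAt
  have hτ : HasDerivAt (fun τ : ℝ => (τ, (0 : ℝ))) (1, 0) 0 :=
    (hasDerivAt_id 0).prodMk (hasDerivAt_const 0 0)
  have hs : ∀ τ : ℝ, HasDerivAt (fun s : ℝ => (τ, s)) (0, 1) 0 := fun τ =>
    (hasDerivAt_const 0 τ).prodMk (hasDerivAt_id 0)
  have hs' : ∀ s : ℝ, HasDerivAt (fun τ : ℝ => (τ, s)) (1, 0) 0 := fun s =>
    (hasDerivAt_id 0).prodMk (hasDerivAt_const 0 s)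
  have e1 : (fun τ => deriv (fun s => f (τ, s)) 0) =ᶠ[𝓝 0] fun τ => fderiv ℝ f (τ, 0) (0, 1) := by
    filter_upwards [hτ.continuousAt.eventually hd] with τ h
    exact (h.hasFDerivAt.comp_hasDerivAt 0 (hs τ)).deriv
  have e2 : g =ᶠ[𝓝 0] fun s => fderiv ℝ f (0, s) (1, 0) := by
    filter_upwards [hg, (hs 0).continuousAt.eventually hd] with s h h'
    exact h.unique (h'.hasFDerivAt.comp_hasDerivAt 0 (hs' s))
  have h3 : HasDerivAt (fun τ : ℝ => fderiv ℝ f (τ, 0) (0, 1))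
      (fderiv ℝ (fderiv ℝ f) (0, 0) (1, 0) (0, 1)) 0 := by
    simpa using (HasFDerivAt.comp_hasDerivAt (f := fun τ : ℝ => (τ, (0 : ℝ))) 0 h2 hτ).clm_apply
      (hasDerivAt_const 0 ((0 : ℝ), (1 : ℝ)))
  have h4 : HasDerivAt (fun s : ℝ => fderiv ℝ f (0, s) (1, 0))
      (fderiv ℝ (fderiv ℝ f) (0, 0) (0, 1) (1, 0)) 0 := by
    simpa using (HasFDerivAt.comp_hasDerivAt (f := fun s : ℝ => ((0 : ℝ), s)) 0 h2 (hs 0)).clm_apply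
      (hasDerivAt_const 0 ((1 : ℝ), (0 : ℝ)))
  have h5 := hg'.unique (h4.congr_of_eventuallyEq e2)
  have h6 : fderiv ℝ (fderiv ℝ f) (0, 0) (1, 0) (0, 1) =
      fderiv ℝ (fderiv ℝ f) (0, 0) (0, 1) (1, 0) :=
    (hf.isSymmSndFDerivAt (by simp)) (1, 0) (0, 1)
  rw [h5, ← h6]
  exact h3.congr_of_eventuallyEq e1

/-- The field `X` along a curve through `y` with velocity `v` has covariant derivative `X'` at
time `t`. -/
def HasCov (Γ : E → E →L[ℝ] E →L[ℝ] E) (y v : E) (X : ℝ → E) (X' : E) (t : ℝ) : Prop :=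
  HasDerivAt X (X' - Γ y v (X t)) t

namespace HasCov

variable {Γ : E → E →L[ℝ] E →L[ℝ] E} {y v : E} {X Y Z : ℝ → E} {X' Y' Z' : E} {t : ℝ}

theorem of_hasDerivAt (h : HasDerivAt X X' t) : HasCov Γ y v X (X' + Γ y v (X t)) t := by
  simpa [HasCov] using h

theorem hasDerivAt (h : HasCov Γ y v X X' t) : HasDerivAt X (X' - Γ y v (X t)) t := h

theorem congr (h : HasCov Γ y v X X' t) (e : X' = Y') : HasCov Γ y v X Y' t := e ▸ h

theorem add (h : HasCov Γ y v X X' t) (h' : HasCov Γ y v Y Y' t) :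
    HasCov Γ y v (fun s => X s + Y s) (X' + Y') t := by
  refine (HasDerivAt.add (f := X) (g := Y) h h').congr_deriv ?_
  simp only [map_add]; abel

theorem sub (h : HasCov Γ y v X X' t) (h' : HasCov Γ y v Y Y' t) :
    HasCov Γ y v (fun s => X s - Y s) (X' - Y') t := by
  refine (HasDerivAt.sub (f := X) (g := Y) h h').congr_deriv ?_
  simp only [map_sub]; abel

theorem const_smul (r : ℝ) (h : HasCov Γ y v X X' t) :
    HasCov Γ y v (fun s => r • X s) (r • X') t := by
  refine (HasDerivAt.const_smul (f := X) r h).congr_deriv ?_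
  simp only [map_smul, smul_sub]

theorem smul {f : ℝ → ℝ} {f' : ℝ} (hf : HasDerivAt f f' t) (h : HasCov Γ y v X X' t) :
    HasCov Γ y v (fun s => f s • X s) (f' • X t + f t • X') t := by
  refine (HasDerivAt.smul (f := X) hf h).congr_deriv ?_
  simp only [map_smul, smul_sub]; abel

theorem curv {x : ℝ → E} (hΓ : ContDiffAt ℝ 2 Γ y) (hxy : x t = y) (hx : HasDerivAt x v t)
    (hX : HasCov Γ y v X X' t) (hY : HasCov Γ y v Y Y' t) (hZ : HasCov Γ y v Z Z' t) :
    HasCov Γ y v (fun s => curv Γ (x s) (X s) (Y s) (Z s))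
      (dcurv Γ y v (X t) (Y t) (Z t) + Sasaki.curv Γ y X' (Y t) (Z t)
        + Sasaki.curv Γ y (X t) Y' (Z t) + Sasaki.curv Γ y (X t) (Y t) Z') t := by
  subst hxy
  refine (hasDerivAt_curv_cov hΓ hx hX hY hZ).congr_deriv ?_
  simp only [sub_add_cancel]

theorem metric {x : ℝ → E} {Ω : Set E} {B : E → E →L[ℝ] E →L[ℝ] ℝ} (h : IsLeviCivita Ω B Γ)
    (hy : y ∈ Ω) (hxy : x t = y) (hx : HasDerivAt x v t)
    (hX : HasCov Γ y v X X' t) (hY : HasCov Γ y v Y Y' t) :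
    HasDerivAt (fun s => B (x s) (X s) (Y s)) (B y X' (Y t) + B y (X t) Y') t := by
  refine (h.hasDerivAt_metric hy hxy hx hX hY).congr_deriv ?_
  simp only [sub_add_cancel]

end HasCov

variable {Ω : Set E} {B : E → E →L[ℝ] E →L[ℝ] ℝ} {Γ : E → E →L[ℝ] E →L[ℝ] E}

/-- Commutation of the covariant derivatives of a two-parameter family. -/
theorem HasCov.commute {x T X I dT dX : ℝ → E} {y Z dZ : E} {t : ℝ} (hd : DifferentiableAt ℝ Γ y)
    (hxy : x t = y)
    (hx : HasDerivAt x (T t) t) (hI : HasDerivAt I (dT t) t)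
    (hX : HasCov Γ y (T t) X Z t)
    (hdX : HasDerivAt dX (dZ - (fderiv ℝ Γ y (I t) (T t) (X t) + Γ y (dT t) (X t)
      + Γ y (T t) (dX t))) t) :
    HasCov Γ y (T t) (fun s => dX s + Γ (x s) (I s) (X s))
      (dZ + Γ y (I t) Z + Sasaki.curv Γ y (T t) (I t) (X t)) t := by
  subst hxy
  refine (hdX.add (hasDerivAt_bilin hd hx hI hX.hasDerivAt)).congr_deriv ?_
  simp only [Sasaki.curv, map_sub, map_add]
  abel

/-- The geodesic spray in coordinates. -/
def sprayF (Γ : E → E →L[ℝ] E →L[ℝ] E) (z : E × E) : E × E := (z.2, - Γ z.1 z.2 z.2)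

theorem hasFDerivAt_sprayF {z : E × E} (hd : DifferentiableAt ℝ Γ z.1)
    (hs : ∀ a b, Γ z.1 a b = Γ z.1 b a) (a : E × E) :
    DifferentiableAt ℝ (sprayF Γ) z ∧
    fderiv ℝ (sprayF Γ) z a =
      (a.2, - (fderiv ℝ Γ z.1 a.1 z.2 z.2 + (2 : ℝ) • Γ z.1 a.2 z.2)) := by
  have h1 : HasFDerivAt (fun z : E × E => Γ z.1)
      ((fderiv ℝ Γ z.1).comp (ContinuousLinearMap.fst ℝ E E)) z :=
    HasFDerivAt.comp (g := Γ) z hd.hasFDerivAt hasFDerivAt_fst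
  have h2 : HasFDerivAt (fun z : E × E => z.2) (ContinuousLinearMap.snd ℝ E E) z := hasFDerivAt_snd
  have h3 := h2.prodMk ((h1.clm_apply h2).clm_apply h2).neg
  refine ⟨h3.differentiableAt, (DFunLike.congr_fun h3.fderiv a).trans ?_⟩
  simp [hs z.2 a.2, two_smul]
  abel

/-- The Lie derivative along the spray of a vector field with horizontal part `h` and vertical part
`k`. -/
theorem hasDerivAt_lift {x T h k : ℝ → E} {y h' k' : E} {t : ℝ} (hd : DifferentiableAt ℝ Γ y)
    (hs : ∀ a b, Γ y a b = Γ y b a) (hxy : x t = y) (hx : HasDerivAt x (T t) t)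
    (hT : HasCov Γ y (T t) T 0 t) (hh : HasCov Γ y (T t) h h' t) (hk : HasCov Γ y (T t) k k' t) :
    HasDerivAt (fun s => ((h s, k s - Γ (x s) (h s) (T s)) : E × E))
      (fderiv ℝ (sprayF Γ) (y, T t) (h t, k t - Γ y (h t) (T t)) +
        (h' - k t, k' + curv Γ y (h t) (T t) (T t) - Γ y (h' - k t) (T t))) t := by
  subst hxy
  refine (hh.hasDerivAt.prodMk (hk.hasDerivAt.sub (hasDerivAt_bilin hd hx hh.hasDerivAt
    hT.hasDerivAt))).congr_deriv ?_
  rw [(hasFDerivAt_sprayF (z := (x t, T t)) hd hs _).2]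
  simp only [Sasaki.curv, map_sub, sub_apply, zero_sub, map_neg]
  refine Prod.ext ?_ ?_
  · simp only [Prod.fst_add]
    rw [hs (T t) (h t)]; abel
  · simp only [Prod.snd_add]
    rw [hs (T t) (k t), hs (T t) (h t), hs (T t) (Γ (x t) (h t) (T t)), two_smul]
    abel

/-- The geodesic and Jacobi equations for a two-parameter family, linearised in `s`. -/
theorem jacobi_evolution (hL : IsLeviCivita Ω B Γ) {x T J K : ℝ × ℝ → E}
    (hΩ : x (0, 0) ∈ Ω)
    (cx : ContDiffAt ℝ 2 x (0, 0)) (cT : ContDiffAt ℝ 2 T (0, 0)) (cJ : ContDiffAt ℝ 2 J (0, 0))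
    (cK : ContDiffAt ℝ 2 K (0, 0))
    (hx : ∀ᶠ s in 𝓝 (0 : ℝ), HasDerivAt (fun τ => x (τ, s)) (T (0, s)) 0)
    (hT : ∀ᶠ s in 𝓝 (0 : ℝ), HasCov Γ (x (0, s)) (T (0, s)) (fun τ => T (τ, s)) 0 0)
    (hJ : ∀ᶠ s in 𝓝 (0 : ℝ), HasCov Γ (x (0, s)) (T (0, s)) (fun τ => J (τ, s)) (K (0, s)) 0)
    (hK : ∀ᶠ s in 𝓝 (0 : ℝ), HasCov Γ (x (0, s)) (T (0, s)) (fun τ => K (τ, s))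
      (- curv Γ (x (0, s)) (J (0, s)) (T (0, s)) (T (0, s))) 0)
    {I I₂ W U : ℝ → E} (eI : I = fun τ => deriv (fun s => x (τ, s)) 0)
    (eI₂ : I₂ = fun τ => deriv (fun s => T (τ, s)) 0 + Γ (x (τ, 0)) (I τ) (T (τ, 0)))
    (eW : W = fun τ => deriv (fun s => J (τ, s)) 0 + Γ (x (τ, 0)) (I τ) (J (τ, 0)))
    (eU : U = fun τ => deriv (fun s => K (τ, s)) 0 + Γ (x (τ, 0)) (I τ) (K (τ, 0))) :
    HasCov Γ (x (0, 0)) (T (0, 0)) I (I₂ 0) 0 ∧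
    HasCov Γ (x (0, 0)) (T (0, 0)) I₂ (- curv Γ (x (0, 0)) (I 0) (T (0, 0)) (T (0, 0))) 0 ∧
    HasCov Γ (x (0, 0)) (T (0, 0)) W (U 0 + curv Γ (x (0, 0)) (T (0, 0)) (I 0) (J (0, 0))) 0 ∧
    HasCov Γ (x (0, 0)) (T (0, 0)) U
      (-(dcurv Γ (x (0, 0)) (I 0) (J (0, 0)) (T (0, 0)) (T (0, 0))
        + curv Γ (x (0, 0)) (W 0) (T (0, 0)) (T (0, 0))
        + curv Γ (x (0, 0)) (J (0, 0)) (I₂ 0) (T (0, 0))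
        + curv Γ (x (0, 0)) (J (0, 0)) (T (0, 0)) (I₂ 0))
        + curv Γ (x (0, 0)) (T (0, 0)) (I 0) (K (0, 0))) 0 := by
  have hd := hL.differentiableAt hΩ
  have hs0 : HasDerivAt (fun s : ℝ => ((0 : ℝ), s)) (0, 1) 0 :=
    (hasDerivAt_const 0 0).prodMk (hasDerivAt_id 0)
  have dS : ∀ {X : ℝ × ℝ → E}, ContDiffAt ℝ 2 X (0, 0) →
      HasDerivAt (fun s => X (0, s)) (deriv (fun s => X (0, s)) 0) 0 := by
    intro X cX
    exact ((cX.differentiableAt (by simp)).hasFDerivAt.comp_hasDerivAt 0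
      hs0).differentiableAt.hasDerivAt
  have dx := dS cx
  have dT := dS cT
  have dJ := dS cJ
  have dK := dS cK
  have hI : HasDerivAt I (deriv (fun s => T (0, s)) 0) 0 := by
    rw [eI]; exact hasDerivAt_deriv_swap cx hx dT
  have I0 : I 0 = deriv (fun s => x (0, s)) 0 := by rw [eI]
  -- With `Z = D_τ X` this is `D_τ D_s X = D_s Z + R(T, I) X`. The last three claims are its
  -- instances `(X, Z) = (T, 0)`, `(J, K)` and `(K, -R(J, T)T)`; the first is the absence of
  -- torsion.
  have main : ∀ {X : ℝ × ℝ → E} {Z : ℝ → E} {dZ : E}, ContDiffAt ℝ 2 X (0, 0) →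
      (∀ᶠ s in 𝓝 (0 : ℝ), HasCov Γ (x (0, s)) (T (0, s)) (fun τ => X (τ, s)) (Z s) 0) →
      HasDerivAt Z dZ 0 →
      HasCov Γ (x (0, 0)) (T (0, 0))
        (fun τ => deriv (fun s => X (τ, s)) 0 + Γ (x (τ, 0)) (I τ) (X (τ, 0)))
        (dZ + Γ (x (0, 0)) (I 0) (Z 0) + curv Γ (x (0, 0)) (T (0, 0)) (I 0) (X (0, 0))) 0 := by
    intro X Z dZ cX hX hZ
    refine HasCov.commute (x := fun τ => x (τ, 0)) (T := fun τ => T (τ, 0))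
      (X := fun τ => X (τ, 0)) (I := I) (dT := fun τ => deriv (fun s => T (τ, s)) 0)
      (dX := fun τ => deriv (fun s => X (τ, s)) 0) hd rfl hx.self_of_nhds hI hX.self_of_nhds ?_
    rw [I0]
    refine hasDerivAt_deriv_swap cX (g := fun s => Z s - Γ (x (0, s)) (T (0, s)) (X (0, s))) hX ?_
    exact hZ.sub (hasDerivAt_bilin hd dx dT (dS cX))
  refine ⟨?_, ?_, ?_, ?_⟩
  · refine (HasCov.of_hasDerivAt hI).congr ?_
    rw [eI₂, hL.symm _ hΩ]
  · rw [eI₂]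
    refine (main cT hT (hasDerivAt_const 0 0)).congr ?_
    rw [curv_antisymm]; simp
  · rw [eW, eU]
    exact (main cJ hJ dK).congr rfl
  · have h1 := hasDerivAt_curv_cov (hL.contDiffAt_two hΩ) dx dJ dT dT
    rw [eU]
    refine (main cK hK h1.neg).congr ?_
    rw [eW, eI₂, ← I0, hL.symm _ hΩ (I 0) (J (0, 0)), hL.symm _ hΩ (I 0) (T (0, 0))]
    simp only [map_neg, curv_add_left, curv_add_mid, curv_add_right]
    rw [hL.symm _ hΩ (J (0, 0)) (I 0), hL.symm _ hΩ (T (0, 0)) (I 0)]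
    abel

end Evolution

/-! ### Cauchy–Schwarz and norm inequalities for a bilinear form without a fixed norm -/

section InnerForm

/-- A positive semidefinite symmetric bilinear form. -/
structure IsInner {V : Type*} [AddCommGroup V] [Module ℝ V] (b : V → V → ℝ) : Prop where
  add_left : ∀ u v w, b (u + v) w = b u w + b v w
  smul_left : ∀ (r : ℝ) u w, b (r • u) w = r * b u w
  symm : ∀ u w, b u w = b w u
  nonneg : ∀ u, 0 ≤ b u u

/-- The seminorm of a positive semidefinite form. -/
def fnorm {V : Type*} (b : V → V → ℝ) (u : V) : ℝ := √(b u u)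

theorem fnorm_nonneg {V : Type*} {b : V → V → ℝ} (u : V) : 0 ≤ fnorm b u := Real.sqrt_nonneg _

namespace IsInner

variable {V : Type*} [AddCommGroup V] [Module ℝ V] {b : V → V → ℝ} (h : IsInner b)
include h

theorem add_right (u v w : V) : b u (v + w) = b u v + b u w := by
  rw [h.symm, h.add_left, h.symm v, h.symm w]

theorem smul_right (r : ℝ) (u w : V) : b u (r • w) = r * b u w := by
  rw [h.symm, h.smul_left, h.symm w]

theorem neg_left (u w : V) : b (-u) w = - b u w := by
  have := h.smul_left (-1) u w
  simpa using this

theorem sub_left (u v w : V) : b (u - v) w = b u w - b v w := by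
  rw [sub_eq_add_neg, h.add_left, h.neg_left, sub_eq_add_neg]

theorem sub_right (u v w : V) : b u (v - w) = b u v - b u w := by
  rw [h.symm, h.sub_left, h.symm v, h.symm w]

theorem fnorm_sq (u : V) : fnorm b u ^ 2 = b u u := Real.sq_sqrt (h.nonneg u)

theorem sq_le (u w : V) : b u w ^ 2 ≤ b u u * b w w := by
  have key : ∀ r : ℝ, 0 ≤ b w w * (r * r) + (2 * b u w) * r + b u u := by
    intro r
    have := h.nonneg (u + r • w)
    rw [h.add_left, h.add_right, h.add_right, h.smul_left, h.smul_left, h.smul_right,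
      h.smul_right, h.symm w u] at this
    linarith
  have := discrim_le_zero key
  rw [discrim] at this
  linarith

theorem abs_le (u w : V) : |b u w| ≤ fnorm b u * fnorm b w := by
  refine abs_le_of_sq_le_sq ?_ (mul_nonneg (fnorm_nonneg u) (fnorm_nonneg w))
  rw [mul_pow, h.fnorm_sq, h.fnorm_sq]
  exact h.sq_le u w

theorem fnorm_add (u w : V) : fnorm b (u + w) ≤ fnorm b u + fnorm b w := by
  refine Real.sqrt_le_iff.2 ⟨add_nonneg (fnorm_nonneg u) (fnorm_nonneg w), ?_⟩
  have h1 := (_root_.abs_le.1 (h.abs_le u w)).2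
  rw [h.add_left, h.add_right, h.add_right, h.symm w u]
  have h2 := h.fnorm_sq u
  have h3 := h.fnorm_sq w
  nlinarith

theorem fnorm_smul (r : ℝ) (u : V) : fnorm b (r • u) = |r| * fnorm b u := by
  rw [fnorm, h.smul_left, h.smul_right, ← mul_assoc, Real.sqrt_mul (mul_self_nonneg r),
    Real.sqrt_mul_self_eq_abs, fnorm]

theorem fnorm_neg (u : V) : fnorm b (-u) = fnorm b u := by
  have := h.fnorm_smul (-1) u
  simpa using this

theorem fnorm_sub (u w : V) : fnorm b (u - w) ≤ fnorm b u + fnorm b w := by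
  rw [sub_eq_add_neg, ← h.fnorm_neg w]
  exact h.fnorm_add u (-w)

theorem fnorm_sub_proj {t : V} (ht : b t t = 1) (u : V) : fnorm b (u - b u t • t) ≤ fnorm b u := by
  refine Real.sqrt_le_sqrt ?_
  rw [h.sub_left, h.sub_right, h.sub_right, h.smul_left, h.smul_left, h.smul_right, h.smul_right,
    ht, h.symm t u]
  nlinarith [sq_nonneg (b u t)]

end IsInner

end InnerForm

/-! ### The error term of the transport equation and its size -/

section SourceBound

variable {E : Type*} [NormedAddCommGroup E] [NormedSpace ℝ E]
  {Ω : Set E} {B : E → E →L[ℝ] E →L[ℝ] ℝ} {Γ : E → E →L[ℝ] E →L[ℝ] E}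

theorem IsLeviCivita.isInner (hL : IsLeviCivita Ω B Γ) {y : E} (hy : y ∈ Ω) :
    IsInner (fun a b => B y a b) where
  add_left u v w := by simp
  smul_left r u w := by simp
  symm := hL.metric_symm y hy
  nonneg u := by
    rcases eq_or_ne u 0 with rfl | hu
    · simp
    · exact (hL.pos y hy u hu).le

/-- The bounds `C₂` and `C₃` on the curvature and its covariant derivative. -/
structure CurvBound (B : E → E →L[ℝ] E →L[ℝ] ℝ) (Γ : E → E →L[ℝ] E →L[ℝ] E) (y : E)
    (C₂ C₃ : ℝ) : Prop where
  one_le : 1 ≤ C₂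
  one_le' : 1 ≤ C₃
  curv_le : ∀ a b c, fnorm (fun a b => B y a b) (curv Γ y a b c) ≤
    C₂ * (fnorm (fun a b => B y a b) a * fnorm (fun a b => B y a b) b *
      fnorm (fun a b => B y a b) c)
  dcurv_le : ∀ w a b c, fnorm (fun a b => B y a b) (dcurv Γ y w a b c) ≤
    C₃ * (fnorm (fun a b => B y a b) w * fnorm (fun a b => B y a b) a *
      fnorm (fun a b => B y a b) b * fnorm (fun a b => B y a b) c)

/-- The two brackets are bilinear forms in `(j, k)` and `(i, l)`, of operator norm at most `3` and
`4`; the constant is `√(3² + 4²) = 5`. -/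
theorem numeric_bound {j k i l c sh sv : ℝ} (hc : 0 ≤ c) (hsh : 0 ≤ sh) (hsv : 0 ≤ sv)
    (h1 : sh ≤ c * (5 / 2 * (j * i) + 1 / 2 * (k * i) + 1 / 2 * (j * l) + 2 * (k * l)))
    (h2 : sv ≤ c * (3 / 2 * (j * i) + 2 * (k * i) + 3 * (j * l))) :
    √(sh ^ 2 + sv ^ 2) ≤ 5 * c * (√(j ^ 2 + k ^ 2) * √(i ^ 2 + l ^ 2)) := by
  set X := √(j ^ 2 + k ^ 2)
  set Y := √(i ^ 2 + l ^ 2)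
  have hX : X ^ 2 = j ^ 2 + k ^ 2 := Real.sq_sqrt (by positivity)
  have hY : Y ^ 2 = i ^ 2 + l ^ 2 := Real.sq_sqrt (by positivity)
  have hXY : 0 ≤ X * Y := mul_nonneg (Real.sqrt_nonneg _) (Real.sqrt_nonneg _)
  have cs : ∀ a b : ℝ, (a * j + b * k) ^ 2 ≤ (a ^ 2 + b ^ 2) * X ^ 2 := by
    intro a b
    rw [hX]
    nlinarith [sq_nonneg (a * k - b * j)]
  have e1 : 5 / 2 * (j * i) + 1 / 2 * (k * i) + 1 / 2 * (j * l) + 2 * (k * l) ≤ 3 * (X * Y) := by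
    refine abs_le_of_sq_le_sq' ?_ (by positivity) |>.2
    have := cs (5 / 2 * i + 1 / 2 * l) (1 / 2 * i + 2 * l)
    have h3 : (5 / 2 * i + 1 / 2 * l) ^ 2 + (1 / 2 * i + 2 * l) ^ 2 ≤ 9 * Y ^ 2 := by
      rw [hY]; nlinarith [sq_nonneg (i - l), sq_nonneg i, sq_nonneg l]
    calc _ = ((5 / 2 * i + 1 / 2 * l) * j + (1 / 2 * i + 2 * l) * k) ^ 2 := by ring
      _ ≤ _ := this
      _ ≤ 9 * Y ^ 2 * X ^ 2 := by gcongr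
      _ = _ := by ring
  have e2 : 3 / 2 * (j * i) + 2 * (k * i) + 3 * (j * l) ≤ 4 * (X * Y) := by
    refine abs_le_of_sq_le_sq' ?_ (by positivity) |>.2
    have := cs (3 / 2 * i + 3 * l) (2 * i)
    have h3 : (3 / 2 * i + 3 * l) ^ 2 + (2 * i) ^ 2 ≤ 16 * Y ^ 2 := by
      rw [hY]; nlinarith [sq_nonneg (i - l), sq_nonneg i, sq_nonneg l]
    calc _ = ((3 / 2 * i + 3 * l) * j + (2 * i) * k) ^ 2 := by ring
      _ ≤ _ := this
      _ ≤ 16 * Y ^ 2 * X ^ 2 := by gcongr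
      _ = _ := by ring
  have f1 : sh ≤ 3 * (c * (X * Y)) := h1.trans (by nlinarith)
  have f2 : sv ≤ 4 * (c * (X * Y)) := h2.trans (by nlinarith)
  refine Real.sqrt_le_iff.2 ⟨by positivity, ?_⟩
  calc sh ^ 2 + sv ^ 2 ≤ (3 * (c * (X * Y))) ^ 2 + (4 * (c * (X * Y))) ^ 2 := by gcongr
    _ = _ := by ring

/-- Every summand is `R`, `R` applied twice, or `∇R`, evaluated on one of `J, K`, one of `I, I₂`,
and copies of the unit vector `T`, except for `l T`, which is of size `|K| |I₂|`. Adding the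
coefficients gives the two forms of `numeric_bound`. The vertical part enters only through an upper
bound because it is a projection of the displayed expression. -/
theorem source_bound (hL : IsLeviCivita Ω B Γ) {y : E} (hy : y ∈ Ω) {C₂ C₃ : ℝ}
    (hC : CurvBound B Γ y C₂ C₃) {T J K I I₂ : E} {l : ℝ} (hT : B y T T = 1)
    (hl : |l| ≤ fnorm (fun a b => B y a b) K * fnorm (fun a b => B y a b) I₂) {Sh Sv : E}
    (hSh : Sh = curv Γ y T I J + (1 / 2 : ℝ) • curv Γ y I J T
      + (1 / 2 : ℝ) • (dcurv Γ y T T K I - curv Γ y T (curv Γ y J T T) I + curv Γ y T K I₂)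
      + (1 / 2 : ℝ) • (dcurv Γ y T T I₂ J - curv Γ y T (curv Γ y I T T) J + curv Γ y T I₂ K)
      + l • T)
    (hSv : fnorm (fun a b => B y a b) Sv ≤ fnorm (fun a b => B y a b)
      ((1 / 2 : ℝ) • curv Γ y (curv Γ y T K I) T T + (1 / 2 : ℝ) • curv Γ y (curv Γ y T I₂ J) T T
      - dcurv Γ y I J T T - curv Γ y J I₂ T - curv Γ y J T I₂ + curv Γ y T I K
      - (1 / 2 : ℝ) • (dcurv Γ y T I J T + curv Γ y I₂ J T + curv Γ y I K T))) :
    √(B y Sh Sh + B y Sv Sv) ≤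
      5 * (C₂ ^ 2 * C₃) * (√(B y J J + B y K K) * √(B y I I + B y I₂ I₂)) := by
  have hb := hL.isInner hy
  set n := fnorm (fun a b => B y a b) with hn
  have sq : ∀ a, B y a a = n a ^ 2 := fun a => (hb.fnorm_sq a).symm
  have nn : ∀ a, 0 ≤ n a := fun a => fnorm_nonneg a
  have hT' : n T = 1 := by rw [hn, fnorm]; simp [hT]
  have ad : ∀ u w, n (u + w) ≤ n u + n w := hb.fnorm_add
  have sb : ∀ u w, n (u - w) ≤ n u + n w := hb.fnorm_sub
  have sm : ∀ (r : ℝ) u, n (r • u) = |r| * n u := hb.fnorm_smul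
  have half : |(1 / 2 : ℝ)| = 1 / 2 := abs_of_pos (by norm_num)
  have hc1 := hC.one_le
  have hc2 := hC.one_le'
  -- One constant serves all terms: the factors `C₂`, `C₂²`, `C₃` and `1` are all at most `C₂² C₃`,
  -- because `C₂` and `C₃` are at least `1`.
  have cR : ∀ a b c, n (curv Γ y a b c) ≤ C₂ ^ 2 * C₃ * (n a * n b * n c) := by
    intro a b c
    refine (hC.curv_le a b c).trans ?_
    have : C₂ ≤ C₂ ^ 2 * C₃ := by nlinarith
    exact mul_le_mul_of_nonneg_right this
      (mul_nonneg (mul_nonneg (nn a) (nn b)) (nn c))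
  have cRR : ∀ a b c d r, n (curv Γ y (curv Γ y a b c) d r) ≤
      C₂ ^ 2 * C₃ * (n a * n b * n c * n d * n r) := by
    intro a b c d r
    refine (hC.curv_le _ d r).trans ?_
    have h1 := hC.curv_le a b c
    have h0 : 0 ≤ n a * n b * n c * n d * n r :=
      mul_nonneg (mul_nonneg (mul_nonneg (mul_nonneg (nn a) (nn b)) (nn c)) (nn d)) (nn r)
    calc C₂ * (n (curv Γ y a b c) * n d * n r) ≤ C₂ * (C₂ * (n a * n b * n c) * n d * n r) := by
          have := nn d; have := nn r
          gcongr
      _ = C₂ ^ 2 * 1 * (n a * n b * n c * n d * n r) := by ring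
      _ ≤ _ := by gcongr
  have cRR' : ∀ a b c d r, n (curv Γ y d (curv Γ y a b c) r) ≤
      C₂ ^ 2 * C₃ * (n a * n b * n c * n d * n r) := by
    intro a b c d r
    rw [curv_antisymm, hn, hb.fnorm_neg]
    exact cRR a b c d r
  have cD : ∀ w a b c, n (dcurv Γ y w a b c) ≤ C₂ ^ 2 * C₃ * (n w * n a * n b * n c) := by
    intro w a b c
    refine (hC.dcurv_le w a b c).trans ?_
    have : C₃ ≤ C₂ ^ 2 * C₃ := le_mul_of_one_le_left (by linarith) (one_le_pow₀ hc1)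
    exact mul_le_mul_of_nonneg_right this
      (mul_nonneg (mul_nonneg (mul_nonneg (nn w) (nn a)) (nn b)) (nn c))
  have c0 : 1 ≤ C₂ ^ 2 * C₃ := by nlinarith
  set c := C₂ ^ 2 * C₃
  simp only [sq]
  refine numeric_bound (by positivity) (nn _) (nn _) ?_ ?_
  · rw [hSh]
    have hlT : n (l • T) ≤ c * (n K * n I₂) := by
      rw [sm, hT', mul_one]
      refine hl.trans (le_mul_of_one_le_left (mul_nonneg (nn K) (nn I₂)) c0)
    have b1 := cR T I J
    have b2 := cR I J T
    have b3 := cD T T K I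
    have b4 := cRR' J T T T I
    have b5 := cR T K I₂
    have b6 := cD T T I₂ J
    have b7 := cRR' I T T T J
    have b8 := cR T I₂ K
    rw [hT'] at b1 b2 b3 b4 b5 b6 b7 b8
    have a1 := ad (curv Γ y T I J + (1 / 2 : ℝ) • curv Γ y I J T
      + (1 / 2 : ℝ) • (dcurv Γ y T T K I - curv Γ y T (curv Γ y J T T) I + curv Γ y T K I₂)
      + (1 / 2 : ℝ) • (dcurv Γ y T T I₂ J - curv Γ y T (curv Γ y I T T) J + curv Γ y T I₂ K)) (l • T)
    have a2 := ad (curv Γ y T I J + (1 / 2 : ℝ) • curv Γ y I J T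
      + (1 / 2 : ℝ) • (dcurv Γ y T T K I - curv Γ y T (curv Γ y J T T) I + curv Γ y T K I₂))
      ((1 / 2 : ℝ) • (dcurv Γ y T T I₂ J - curv Γ y T (curv Γ y I T T) J + curv Γ y T I₂ K))
    have a3 := ad (curv Γ y T I J + (1 / 2 : ℝ) • curv Γ y I J T)
      ((1 / 2 : ℝ) • (dcurv Γ y T T K I - curv Γ y T (curv Γ y J T T) I + curv Γ y T K I₂))
    have a4 := ad (curv Γ y T I J) ((1 / 2 : ℝ) • curv Γ y I J T)
    have a5 := ad (dcurv Γ y T T K I - curv Γ y T (curv Γ y J T T) I) (curv Γ y T K I₂)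
    have a6 := sb (dcurv Γ y T T K I) (curv Γ y T (curv Γ y J T T) I)
    have a7 := ad (dcurv Γ y T T I₂ J - curv Γ y T (curv Γ y I T T) J) (curv Γ y T I₂ K)
    have a8 := sb (dcurv Γ y T T I₂ J) (curv Γ y T (curv Γ y I T T) J)
    rw [sm, half] at a2 a3 a4
    linarith
  · refine hSv.trans ?_
    have b1 := cRR T K I T T
    have b2 := cRR T I₂ J T T
    have b3 := cD I J T T
    have b4 := cR J I₂ T
    have b5 := cR J T I₂
    have b6 := cR T I K
    have b7 := cD T I J T
    have b8 := cR I₂ J T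
    have b9 := cR I K T
    rw [hT'] at b1 b2 b3 b4 b5 b6 b7 b8 b9
    have a1 := sb ((1 / 2 : ℝ) • curv Γ y (curv Γ y T K I) T T
      + (1 / 2 : ℝ) • curv Γ y (curv Γ y T I₂ J) T T
      - dcurv Γ y I J T T - curv Γ y J I₂ T - curv Γ y J T I₂ + curv Γ y T I K)
      ((1 / 2 : ℝ) • (dcurv Γ y T I J T + curv Γ y I₂ J T + curv Γ y I K T))
    have a2 := ad ((1 / 2 : ℝ) • curv Γ y (curv Γ y T K I) T T
      + (1 / 2 : ℝ) • curv Γ y (curv Γ y T I₂ J) T T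
      - dcurv Γ y I J T T - curv Γ y J I₂ T - curv Γ y J T I₂) (curv Γ y T I K)
    have a3 := sb ((1 / 2 : ℝ) • curv Γ y (curv Γ y T K I) T T
      + (1 / 2 : ℝ) • curv Γ y (curv Γ y T I₂ J) T T
      - dcurv Γ y I J T T - curv Γ y J I₂ T) (curv Γ y J T I₂)
    have a4 := sb ((1 / 2 : ℝ) • curv Γ y (curv Γ y T K I) T T
      + (1 / 2 : ℝ) • curv Γ y (curv Γ y T I₂ J) T T
      - dcurv Γ y I J T T) (curv Γ y J I₂ T)
    have a5 := sb ((1 / 2 : ℝ) • curv Γ y (curv Γ y T K I) T T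
      + (1 / 2 : ℝ) • curv Γ y (curv Γ y T I₂ J) T T) (dcurv Γ y I J T T)
    have a6 := ad ((1 / 2 : ℝ) • curv Γ y (curv Γ y T K I) T T)
      ((1 / 2 : ℝ) • curv Γ y (curv Γ y T I₂ J) T T)
    have a7 := ad (dcurv Γ y T I J T + curv Γ y I₂ J T) (curv Γ y I K T)
    have a8 := ad (dcurv Γ y T I J T) (curv Γ y I₂ J T)
    rw [sm, half] at a1 a6
    rw [sm, half] at a6
    linarith

/-- The Sasaki covariant derivative `(P, Q)` of a Jacobi field along a family of geodesics, made
tangent to the unit tangent bundle, is transported by the flow up to an error `S`. -/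
theorem hasDerivAt_sasaki_cov (hL : IsLeviCivita Ω B Γ) {y : E} (hy : y ∈ Ω) {C₂ C₃ : ℝ}
    (hC : CurvBound B Γ y C₂ C₃) {x T J K I I₂ W U : ℝ → E} (hxy : x 0 = y)
    (hx : HasDerivAt x (T 0) 0) (hT : HasCov Γ y (T 0) T 0 0)
    (hJ : HasCov Γ y (T 0) J (K 0) 0)
    (hK : HasCov Γ y (T 0) K (- Sasaki.curv Γ y (J 0) (T 0) (T 0)) 0)
    (hI : HasCov Γ y (T 0) I (I₂ 0) 0)
    (hI₂ : HasCov Γ y (T 0) I₂ (- Sasaki.curv Γ y (I 0) (T 0) (T 0)) 0)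
    (hW : HasCov Γ y (T 0) W (U 0 + Sasaki.curv Γ y (T 0) (I 0) (J 0)) 0)
    (hU : HasCov Γ y (T 0) U (-(dcurv Γ y (I 0) (J 0) (T 0) (T 0)
        + Sasaki.curv Γ y (W 0) (T 0) (T 0) + Sasaki.curv Γ y (J 0) (I₂ 0) (T 0)
        + Sasaki.curv Γ y (J 0) (T 0) (I₂ 0)) + Sasaki.curv Γ y (T 0) (I 0) (K 0)) 0)
    (hTT : B y (T 0) (T 0) = 1) (hUT : B y (U 0) (T 0) + B y (K 0) (I₂ 0) = 0)
    {P Q N : ℝ → E}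
    (hP : P = fun τ => W τ + (1 / 2 : ℝ) • Sasaki.curv Γ (x τ) (T τ) (K τ) (I τ)
      + (1 / 2 : ℝ) • Sasaki.curv Γ (x τ) (T τ) (I₂ τ) (J τ))
    (hQ : Q = fun τ => U τ - (1 / 2 : ℝ) • Sasaki.curv Γ (x τ) (I τ) (J τ) (T τ))
    (hN : N = fun τ => Q τ - B (x τ) (Q τ) (T τ) • T τ) :
    ∃ Sh Sv : E, HasDerivAt (fun τ => ((P τ, N τ - Γ (x τ) (P τ) (T τ)) : E × E))
      (fderiv ℝ (sprayF Γ) (y, T 0) (P 0, N 0 - Γ y (P 0) (T 0)) + (Sh, Sv - Γ y Sh (T 0))) 0 ∧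
      B y Sv (T 0) = 0 ∧
      √(B y Sh Sh + B y Sv Sv) ≤ 5 * (C₂ ^ 2 * C₃) *
        (√(B y (J 0) (J 0) + B y (K 0) (K 0)) * √(B y (I 0) (I 0) + B y (I₂ 0) (I₂ 0))) := by
  have hΓ := hL.contDiffAt_two hy
  have hb := hL.isInner hy
  have dP := (hW.add ((HasCov.curv hΓ hxy hx hT hK hI).const_smul (1 / 2))).add
    ((HasCov.curv hΓ hxy hx hT hI₂ hJ).const_smul (1 / 2))
  rw [← hP] at dP
  obtain ⟨Q', hQ', dQ⟩ := (⟨_, rfl, hU.sub ((HasCov.curv hΓ hxy hx hI hJ hT).const_smul (1 / 2))⟩ :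
    ∃ Q', Q' = _ ∧ HasCov Γ y (T 0) _ Q' 0)
  rw [← hQ] at dQ
  have dN := dQ.sub (HasCov.smul (HasCov.metric hL hy hxy hx dQ hT) hT)
  rw [← hN] at dN
  have e3 : B y (Sasaki.curv Γ y (P 0) (T 0) (T 0)) (T 0) = 0 := by
    have e1 := hL.metric_curv hy (P 0) (T 0) (T 0) (T 0)
    linarith
  -- The error has horizontal part `P' - N` and vertical part `N' + R(P, T)T`. The field `U` cancels
  -- in the former and `W` in the latter, so that only products of first-order data remain.
  refine ⟨_, _, hasDerivAt_lift (hL.differentiableAt hy) (hL.symm y hy) hxy hx hT dP dN, ?_, ?_⟩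
  · simp only [map_add, map_sub, map_smul, add_apply, sub_apply, smul_apply, smul_eq_mul, map_zero,
      hTT, e3, smul_zero, zero_apply]
    ring
  · have hQ0 : B y (Q 0) (T 0) = - B y (K 0) (I₂ 0) := by
      rw [hQ]
      have e1 := hL.metric_curv hy (I 0) (J 0) (T 0) (T 0)
      have e2 := hL.metric_symm y hy (Sasaki.curv Γ y (I 0) (J 0) (T 0)) (T 0)
      simp only [map_sub, map_smul, sub_apply, smul_apply, smul_eq_mul, hxy]
      linarith
    -- The coefficient of `T` in the horizontal error is `⟨Q, T⟩`. It equals `-⟨K, I₂⟩`, by the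
    -- differentiated constraint `hUT` and because `R(I, J)T` is orthogonal to `T`.
    refine source_bound hL hy hC (T := T 0) (l := B y (Q 0) (T 0)) hTT ?_ ?_ ?_
    · rw [hQ0, abs_neg]; exact hb.abs_le _ _
    · have e0 : Sasaki.curv Γ y 0 (K 0) (I 0) = 0 ∧ Sasaki.curv Γ y 0 (I₂ 0) (J 0) = 0 := by
        simp [Sasaki.curv]
      have en : ∀ a b c, Sasaki.curv Γ y a (-b) c = - Sasaki.curv Γ y a b c := by
        intro a b c
        simpa using Sasaki.curv_smul_mid Γ y (-1) a b c
      rw [hN, e0.1, e0.2, en, en]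
      simp only [hxy]
      rw [hQ]
      simp only [hxy]
      module
    -- The vertical error is the projection orthogonal to `T` of `Q' + R(P, T)T`, since `R(P, T)T`
    -- is itself orthogonal to `T`. A projection does not increase the norm, so it remains to expand
    -- this vector.
    · refine le_trans (le_of_eq ?_) (hb.fnorm_sub_proj hTT _)
      have e0 : Sasaki.curv Γ y (I 0) (J 0) 0 = 0 := by simp [Sasaki.curv]
      congr 1
      have eX : Q' + Sasaki.curv Γ y (P 0) (T 0) (T 0) =
          (1 / 2 : ℝ) • Sasaki.curv Γ y (Sasaki.curv Γ y (T 0) (K 0) (I 0)) (T 0) (T 0)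
          + (1 / 2 : ℝ) • Sasaki.curv Γ y (Sasaki.curv Γ y (T 0) (I₂ 0) (J 0)) (T 0) (T 0)
          - dcurv Γ y (I 0) (J 0) (T 0) (T 0) - Sasaki.curv Γ y (J 0) (I₂ 0) (T 0)
          - Sasaki.curv Γ y (J 0) (T 0) (I₂ 0) + Sasaki.curv Γ y (T 0) (I 0) (K 0)
          - (1 / 2 : ℝ) • (dcurv Γ y (T 0) (I 0) (J 0) (T 0) + Sasaki.curv Γ y (I₂ 0) (J 0) (T 0)
            + Sasaki.curv Γ y (I 0) (K 0) (T 0)) := by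
        rw [hP, hQ', e0]
        simp only [hxy, curv_add_left, curv_smul_left]
        module
      rw [← eX]
      simp only [map_add, add_apply, e3, map_zero]
      module

end SourceBound

/-! ### Existence of the Levi-Civita connection on an open set -/

section LeviCivita

variable {E : Type*} [NormedAddCommGroup E] [NormedSpace ℝ E]

/-- The Koszul form of a metric. -/
def koszulForm (B : E → E →L[ℝ] E →L[ℝ] ℝ) (y : E) : E →L[ℝ] E →L[ℝ] E →L[ℝ] ℝ :=
  (1 / 2 : ℝ) • (fderiv ℝ B y + (fderiv ℝ B y).flip
    - ((ContinuousLinearMap.flipₗᵢ ℝ E E ℝ : (E →L[ℝ] E →L[ℝ] ℝ) →L[ℝ] _).comp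
      (fderiv ℝ B y).flip))

theorem koszulForm_apply (B : E → E →L[ℝ] E →L[ℝ] ℝ) (y a b c : E) :
    koszulForm B y a b c =
      (fderiv ℝ B y a b c + fderiv ℝ B y b a c - fderiv ℝ B y c a b) / 2 := by
  simp [koszulForm]
  ring

/-- The Christoffel symbols of a metric. -/
def leviCivita (B : E → E →L[ℝ] E →L[ℝ] ℝ) (y : E) : E →L[ℝ] E →L[ℝ] E :=
  (ContinuousLinearMap.compL ℝ E (E →L[ℝ] ℝ) E (ContinuousLinearMap.inverse (B y))).comp
    (koszulForm B y)

theorem leviCivita_apply (B : E → E →L[ℝ] E →L[ℝ] ℝ) (y a b : E) :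
    leviCivita B y a b = ContinuousLinearMap.inverse (B y) (koszulForm B y a b) := rfl

variable [FiniteDimensional ℝ E]

theorem exists_equiv_of_pos {b : E →L[ℝ] E →L[ℝ] ℝ} (h : ∀ a, a ≠ 0 → 0 < b a a) :
    ∃ e : E ≃L[ℝ] (E →L[ℝ] ℝ), (e : E →L[ℝ] E →L[ℝ] ℝ) = b := by
  have hinj : Function.Injective (b : E →ₗ[ℝ] (E →L[ℝ] ℝ)) := by
    rw [← LinearMap.ker_eq_bot, LinearMap.ker_eq_bot']
    intro a ha
    by_contra hne
    have h1 := h a hne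
    have h2 : b a = 0 := ha
    rw [h2] at h1
    exact lt_irrefl _ h1
  have hdim : Module.finrank ℝ E = Module.finrank ℝ (E →L[ℝ] ℝ) := by
    rw [← LinearEquiv.finrank_eq (LinearMap.toContinuousLinearMap (𝕜 := ℝ) (E := E) (F' := ℝ))]
    exact Subspace.dual_finrank_eq.symm
  exact ⟨(LinearEquiv.ofInjectiveOfFinrankEq (b : E →ₗ[ℝ] (E →L[ℝ] ℝ)) hinj
    hdim).toContinuousLinearEquiv, by ext a c; rfl⟩

/-- In finite dimension a positive definite form is an isomorphism onto the dual, so the Koszul form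
can be solved for `Γ`; smoothness holds because inversion is smooth at isomorphisms. -/
theorem isLeviCivita_leviCivita {Ω : Set E} {B : E → E →L[ℝ] E →L[ℝ] ℝ} (hΩ : IsOpen Ω)
    (hB : ContDiffOn ℝ ∞ B Ω) (hs : ∀ y ∈ Ω, ∀ a b, B y a b = B y b a)
    (hp : ∀ y ∈ Ω, ∀ a, a ≠ 0 → 0 < B y a a) : IsLeviCivita Ω B (leviCivita B) := by
  have hds : ∀ y ∈ Ω, ∀ a b c, fderiv ℝ B y a b c = fderiv ℝ B y a c b := by
    intro y hy a b c
    have hd : DifferentiableAt ℝ B y :=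
      (hB.contDiffAt (hΩ.mem_nhds hy)).differentiableAt (by simp)
    have e : ∀ b c : E, fderiv ℝ (fun z => B z b c) y a = fderiv ℝ B y a b c := by
      intro b c
      have := (hd.hasFDerivAt.clm_apply (hasFDerivAt_const b y)).clm_apply (hasFDerivAt_const c y)
      refine (DFunLike.congr_fun this.fderiv a).trans (by simp)
    rw [← e, ← e]
    have : (fun z => B z b c) =ᶠ[𝓝 y] fun z => B z c b := by
      filter_upwards [hΩ.mem_nhds hy] with z hz using hs z hz b c
    rw [this.fderiv_eq]
  have key : ∀ y ∈ Ω, ∀ a b c, B y (leviCivita B y a b) c = koszulForm B y a b c := by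
    intro y hy a b c
    obtain ⟨e, he⟩ := exists_equiv_of_pos (hp y hy)
    rw [leviCivita_apply, ← he, ContinuousLinearMap.inverse_equiv]
    simp
  have ext : ∀ y ∈ Ω, ∀ a b, (∀ c, B y a c = B y b c) → a = b := by
    intro y hy a b h
    obtain ⟨e, he⟩ := exists_equiv_of_pos (hp y hy)
    apply e.injective
    ext c
    have := h c
    rwa [← he] at this
  refine ⟨hΩ, hB, ?_, hs, hp, ?_, ?_⟩
  · have hd : ContDiffOn ℝ ∞ (fderiv ℝ B) Ω := hB.fderiv_of_isOpen hΩ (by simp)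
    have hfl : ContDiffOn ℝ ∞ (fun y => (fderiv ℝ B y).flip) Ω :=
      (ContinuousLinearMap.flipₗᵢ ℝ E E (E →L[ℝ] ℝ)).contDiff.comp_contDiffOn hd
    have hk : ContDiffOn ℝ ∞ (koszulForm B) Ω :=
      ((hd.add hfl).sub (contDiffOn_const.clm_comp hfl)).const_smul _
    have hi : ContDiffOn ℝ ∞ (fun y => ContinuousLinearMap.inverse (B y)) Ω := by
      intro y hy
      obtain ⟨e, he⟩ := exists_equiv_of_pos (hp y hy)
      have h1 := contDiffAt_map_inverse (n := ∞) e
      rw [he] at h1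
      exact h1.comp_contDiffWithinAt y (hB y hy)
    exact ((ContinuousLinearMap.compL ℝ E (E →L[ℝ] ℝ) E).contDiff.comp_contDiffOn hi).clm_comp hk
  · intro y hy a b
    refine ext y hy _ _ fun c => ?_
    rw [key y hy, key y hy, koszulForm_apply, koszulForm_apply, hds y hy c a b]
    ring
  · intro y hy a b c
    rw [hs y hy b, key y hy, key y hy, koszulForm_apply, koszulForm_apply, hds y hy c a b,
      hds y hy a c b, hds y hy b a c]
    ring

end LeviCivita

/-! ### Riemannian metrics in coordinates, and the Sasaki metric as a Riemannian metric on `TN` -/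

section ChartData

variable {E : Type*} [NormedAddCommGroup E] [NormedSpace ℝ E]
  {H : Type*} [TopologicalSpace H] {I : ModelWithCorners ℝ E H}
  {N : Type*} [TopologicalSpace N] [ChartedSpace H N]

theorem IsMetricTensor.isInner {g : (p : N) → TangentSpace I p → TangentSpace I p → ℝ}
    (hg : IsMetricTensor I g) (p : N) : IsInner (V := E) (fun a b => g p a b) where
  add_left := hg.add p
  smul_left := hg.smul p
  symm := hg.symm p
  nonneg u := by
    rcases eq_or_ne u 0 with rfl | hu
    · have := hg.smul p 0 0 0
      rw [zero_smul, zero_mul] at this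
      exact this.ge
    · exact (hg.pos p u hu).le

/-- The metric `g` and its connection in a parametrization. -/
structure ChartData (I : ModelWithCorners ℝ E H)
    (g : (p : N) → TangentSpace I p → TangentSpace I p → ℝ) (P : E → N) (Q : N → E) (Ω : Set E)
    (B : E → E →L[ℝ] E →L[ℝ] ℝ) (Γ : E → E →L[ℝ] E →L[ℝ] E) : Prop where
  metricTensor : IsMetricTensor I g
  param : IsParam I P Q Ω
  lc : IsLeviCivita Ω B Γ
  coeff : ∀ y ∈ Ω, ∀ a b : E, g (P y) (mD 𝓘(ℝ, E) I P y a) (mD 𝓘(ℝ, E) I P y b) = B y a b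

/-- A Riemannian metric. -/
def IsRiemannian (I : ModelWithCorners ℝ E H)
    (g : (p : N) → TangentSpace I p → TangentSpace I p → ℝ) : Prop :=
  ∀ x : N, ∃ B Γ, ChartData I g (extChartAt I x).symm (extChartAt I x) (extChartAt I x).target B Γ

theorem sasakiMetric_eq [IsManifold I 1 N] (g : (p : N) → TangentSpace I p → TangentSpace I p → ℝ)
    (V : TangentBundle I N) (ξ η : E × E) :
    sasakiMetric g V ξ η =
      g V.proj (horiz V ξ) (horiz V η) + g V.proj (connector g V ξ) (connector g V η) := rfl

theorem IsParam.exists_tangentParam [IsManifold I 1 N] {P : E → N} {Q : N → E} {Ω : Set E}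
    (hP : IsParam I P Q Ω) {V : TangentBundle I N} (hV : V.proj ∈ P '' Ω) :
    ∃ z : E × E, z.1 ∈ Ω ∧ tangentParam I P z = V := by
  obtain ⟨p, u⟩ := V
  obtain ⟨y, hy, rfl⟩ := hV
  refine ⟨(y, mD I 𝓘(ℝ, E) Q (P y) u), hy, ?_⟩
  exact congrArg (mkT I (P y)) (hP.mD_mD_inv hy u)

namespace ChartData

variable {g : (p : N) → TangentSpace I p → TangentSpace I p → ℝ} {P : E → N} {Q : N → E}
  {Ω : Set E} {B : E → E →L[ℝ] E →L[ℝ] ℝ} {Γ : E → E →L[ℝ] E →L[ℝ] E}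
  (D : ChartData I g P Q Ω B Γ)
include D

theorem isCoeff {y : E} (hy : y ∈ Ω) : IsCoeff g P B y where
  eventually_eq := by
    filter_upwards [D.param.mem_nhds hy] with z hz using D.coeff z hz
  differentiableAt := D.lc.differentiableAt_metric hy

variable [IsManifold I ∞ N] [IsManifold I 1 N] [I.Boundaryless]

theorem horiz {z : E × E} (hz : z.1 ∈ Ω) (ζ : E × E) :
    horiz (tangentParam I P z) (mD 𝓘(ℝ, E × E) I.tangent (tangentParam I P) z ζ) =
      mD 𝓘(ℝ, E) I P z.1 ζ.1 := horiz_tangentParam D.param hz ζ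

theorem connector {z : E × E} (hz : z.1 ∈ Ω) (ζ : E × E) :
    connector g (tangentParam I P z) (mD 𝓘(ℝ, E × E) I.tangent (tangentParam I P) z ζ) =
      mD 𝓘(ℝ, E) I P z.1 (kap Γ z ζ) := by
  rw [connector_tangentParam D.metricTensor D.param hz (D.isCoeff hz) ζ (D.lc.isKoszul hz ζ.1 z.2),
    kap_apply]

theorem sasaki {z : E × E} (hz : z.1 ∈ Ω) (a b : E × E) :
    sasakiMetric g (tangentParam I P z) (mD 𝓘(ℝ, E × E) I.tangent (tangentParam I P) z a)
      (mD 𝓘(ℝ, E × E) I.tangent (tangentParam I P) z b) = sasB B Γ z a b := by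
  refine (sasakiMetric_eq g _ _ _).trans ?_
  rw [D.horiz hz, D.horiz hz, D.connector hz, D.connector hz, sasB_apply]
  exact congrArg₂ _ (D.coeff _ hz _ _) (D.coeff _ hz _ _)

end ChartData

namespace IsRiemannian

variable {g : (p : N) → TangentSpace I p → TangentSpace I p → ℝ} (hg : IsRiemannian I g)
include hg

theorem metricTensor : IsMetricTensor I g where
  add p := by obtain ⟨B, Γ, D⟩ := hg p; exact D.metricTensor.add p
  smul p := by obtain ⟨B, Γ, D⟩ := hg p; exact D.metricTensor.smul p
  symm p := by obtain ⟨B, Γ, D⟩ := hg p; exact D.metricTensor.symm p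
  pos p := by obtain ⟨B, Γ, D⟩ := hg p; exact D.metricTensor.pos p

variable [IsManifold I ∞ N] [IsManifold I 1 N] [I.Boundaryless]

omit [I.Boundaryless] in
/-- Coordinates at a point of the tangent bundle. -/
theorem exists_chart (V : TangentBundle I N) : ∃ (P : E → N) (Q : N → E) (Ω : Set E)
    (B : E → E →L[ℝ] E →L[ℝ] ℝ) (Γ : E → E →L[ℝ] E →L[ℝ] E) (z : E × E),
    ChartData I g P Q Ω B Γ ∧ z.1 ∈ Ω ∧ tangentParam I P z = V ∧
    ∀ ξ : E × E, ∃ ζ : E × E, mD 𝓘(ℝ, E × E) I.tangent (tangentParam I P) z ζ = ξ := by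
  obtain ⟨B, Γ, D⟩ := hg V.proj
  obtain ⟨z, hz, e⟩ := D.param.exists_tangentParam (V := V)
    ⟨_, mem_extChartAt_target V.proj, extChartAt_to_inv V.proj⟩
  exact ⟨_, _, _, B, Γ, z, D, hz, e, fun ξ => ⟨_, D.param.tangent.mD_mD_inv ⟨hz, mem_univ _⟩ ξ⟩⟩

/-- The Christoffel vector is chosen separately for each pair of arguments, so linearity of the
connector is not visible in its definition; in coordinates the connector is the linear map `kap`. -/
theorem connector_add (V : TangentBundle I N) (ξ η : E × E) :
    connector g V (ξ + η : E × E) = (connector g V ξ + connector g V η : E) := by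
  obtain ⟨P, Q, Ω, B, Γ, z, D, hz, rfl, hs⟩ := hg.exists_chart V
  obtain ⟨a, rfl⟩ := hs ξ
  obtain ⟨b, rfl⟩ := hs η
  rw [← map_add, D.connector hz, D.connector hz, D.connector hz, map_add, map_add]
  rfl

theorem connector_smul (V : TangentBundle I N) (r : ℝ) (ξ : E × E) :
    connector g V (r • ξ : E × E) = (r • connector g V ξ : E) := by
  obtain ⟨P, Q, Ω, B, Γ, z, D, hz, rfl, hs⟩ := hg.exists_chart V
  obtain ⟨a, rfl⟩ := hs ξ
  rw [← map_smul, D.connector hz, D.connector hz, map_smul, map_smul]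
  rfl

theorem metricTensor_sasaki : IsMetricTensor I.tangent (sasakiMetric g) where
  add V a b c := by
    obtain ⟨P, Q, Ω, B, Γ, z, D, hz, rfl, hs⟩ := hg.exists_chart V
    obtain ⟨a, rfl⟩ := hs a
    obtain ⟨b, rfl⟩ := hs b
    obtain ⟨c, rfl⟩ := hs c
    rw [← map_add, D.sasaki hz, D.sasaki hz, D.sasaki hz, map_add, add_apply]
  smul V r a c := by
    obtain ⟨P, Q, Ω, B, Γ, z, D, hz, rfl, hs⟩ := hg.exists_chart V
    obtain ⟨a, rfl⟩ := hs a
    obtain ⟨c, rfl⟩ := hs c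
    rw [← map_smul, D.sasaki hz, D.sasaki hz, map_smul, smul_apply, smul_eq_mul]
  symm V a b := by
    obtain ⟨P, Q, Ω, B, Γ, z, D, hz, rfl, hs⟩ := hg.exists_chart V
    obtain ⟨a, rfl⟩ := hs a
    obtain ⟨b, rfl⟩ := hs b
    rw [D.sasaki hz, D.sasaki hz, D.lc.sasB_symm hz]
  pos V a ha := by
    obtain ⟨P, Q, Ω, B, Γ, z, D, hz, rfl, hs⟩ := hg.exists_chart V
    obtain ⟨a, rfl⟩ := hs a
    rw [D.sasaki hz, sasB_apply]
    have hp := D.lc.pos _ hz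
    have hn := (D.lc.isInner hz).nonneg
    -- A vector is determined by its horizontal part and its connector: if the former vanishes, the
    -- latter is the vertical coordinate.
    rcases eq_or_ne a.1 0 with h1 | h1
    · have h2 : kap Γ z a ≠ 0 := by
        intro h0
        rw [kap_apply, h1] at h0
        refine ha ?_
        have : a = 0 := Prod.ext h1 (by simpa using h0)
        rw [this, map_zero]
      exact add_pos_of_nonneg_of_pos (hn _) (hp _ h2)
    · exact add_pos_of_pos_of_nonneg (hp _ h1) (hn _)

end IsRiemannian

namespace ChartData

variable {g : (p : N) → TangentSpace I p → TangentSpace I p → ℝ} {P : E → N} {Q : N → E}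
  {Ω : Set E} {B : E → E →L[ℝ] E →L[ℝ] ℝ} {Γ : E → E →L[ℝ] E →L[ℝ] E}
  (D : ChartData I g P Q Ω B Γ) [IsManifold I ∞ N] [IsManifold I 1 N] [I.Boundaryless]
include D

theorem isCoeff_sasaki {z : E × E} (hz : z.1 ∈ Ω) :
    IsCoeff (sasakiMetric g) (tangentParam I P) (sasB B Γ) z where
  eventually_eq := by
    filter_upwards [D.param.tangent.mem_nhds ⟨hz, mem_univ z.2⟩] with w hw a b
    exact D.sasaki hw.1 a b
  differentiableAt := (D.lc.contDiffOn_sasB.contDiffAt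
    (D.param.tangent.mem_nhds ⟨hz, mem_univ z.2⟩)).differentiableAt (by simp)

/-- The connector of the Sasaki metric in coordinates. -/
theorem connector_sasaki (hg : IsRiemannian I g) {z : E × E} (hz : z.1 ∈ Ω) (u a b : E × E) :
    Sasaki.connector (sasakiMetric g) (tangentParam I.tangent (tangentParam I P) (z, u))
      (mD 𝓘(ℝ, (E × E) × (E × E)) I.tangent.tangent (tangentParam I.tangent (tangentParam I P))
        (z, u) (a, b)) =
      mD 𝓘(ℝ, E × E) I.tangent (tangentParam I P) z (b + sasΓ Γ z a u) :=
  connector_tangentParam hg.metricTensor_sasaki D.param.tangent (z := (z, u))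
    ⟨hz, mem_univ _⟩ (D.isCoeff_sasaki hz) (a, b) (D.lc.isKoszul_sas hz a u)

theorem horiz_sasaki {z : E × E} (hz : z.1 ∈ Ω) (u a b : E × E) :
    Sasaki.horiz (tangentParam I.tangent (tangentParam I P) (z, u))
      (mD 𝓘(ℝ, (E × E) × (E × E)) I.tangent.tangent (tangentParam I.tangent (tangentParam I P))
        (z, u) (a, b)) =
      mD 𝓘(ℝ, E × E) I.tangent (tangentParam I P) z a :=
  horiz_tangentParam D.param.tangent (z := (z, u)) ⟨hz, mem_univ _⟩ (a, b)

end ChartData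

end ChartData

/-! ### The given metric of `M` -/

section MetricM

variable {m : ℕ} {M : Type*} [EMetricSpace M] [ChartedSpace (EuclideanSpace ℝ (Fin m)) M]
  [IsManifold (𝓡 m) ∞ M] [RiemannianBundle (fun x : M => TangentSpace (𝓡 m) x)]

omit [IsManifold (𝓡 m) ∞ M] in
theorem isMetricTensor_metric : IsMetricTensor (𝓡 m) (metric (M := M)) where
  add p a b c := inner_add_left (𝕜 := ℝ) (E := TangentSpace (𝓡 m) p) a b c
  smul p r a c := real_inner_smul_left (F := TangentSpace (𝓡 m) p) a c r
  symm p a b := real_inner_comm (F := TangentSpace (𝓡 m) p) b a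
  pos p _ ha := real_inner_self_pos (F := TangentSpace (𝓡 m) p) |>.2 ha

variable [IsContMDiffRiemannianBundle (𝓡 m) ∞ (EuclideanSpace ℝ (Fin m))
      (fun x : M => TangentSpace (𝓡 m) x)]

/-- The coefficients in a chart are inner products of the coordinate fields, which are smooth
sections of the tangent bundle; the connection is then `leviCivita` of these coefficients. -/
theorem isRiemannian_metric : IsRiemannian (𝓡 m) (metric (M := M)) := by
  intro x
  have hP := isParam_extChartAt (I := 𝓡 m) x
  set P := (extChartAt (𝓡 m) x).symm
  set Ω := (extChartAt (𝓡 m) x).target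
  have hg := isMetricTensor_metric (m := m) (M := M)
  have hex : ∀ y, ∃ b : EuclideanSpace ℝ (Fin m) →L[ℝ] EuclideanSpace ℝ (Fin m) →L[ℝ] ℝ,
      ∀ u v : EuclideanSpace ℝ (Fin m), b u v =
        metric (P y) (mD 𝓘(ℝ, EuclideanSpace ℝ (Fin m)) (𝓡 m) P y u)
        (mD 𝓘(ℝ, EuclideanSpace ℝ (Fin m)) (𝓡 m) P y v) := by
    intro y
    have hi := hg.isInner (P y)
    set b₀ : EuclideanSpace ℝ (Fin m) →ₗ[ℝ] EuclideanSpace ℝ (Fin m) →ₗ[ℝ] ℝ :=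
      LinearMap.mk₂ ℝ (fun u v => metric (P y) u v) hi.add_left hi.smul_left hi.add_right
        hi.smul_right
    refine ⟨(LinearMap.toContinuousLinearMap ((LinearMap.toContinuousLinearMap (𝕜 := ℝ)
      (E := EuclideanSpace ℝ (Fin m)) (F' := ℝ)).toLinearMap.comp b₀)).bilinearComp
      (mD 𝓘(ℝ, EuclideanSpace ℝ (Fin m)) (𝓡 m) P y)
      (mD 𝓘(ℝ, EuclideanSpace ℝ (Fin m)) (𝓡 m) P y), fun u v => rfl⟩
  choose B hB using hex
  have hT := hP.tangent.smooth
  refine ⟨B, leviCivita B, hg, hP, isLeviCivita_leviCivita hP.isOpen ?_ ?_ ?_,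
    fun y _ a b => (hB y a b).symm⟩
  · refine contDiffOn_clm_apply.2 fun u => contDiffOn_clm_apply.2 fun v => ?_
    rw [← contMDiffOn_iff_contDiffOn]
    have hsec : ∀ u, ContMDiffOn 𝓘(ℝ, EuclideanSpace ℝ (Fin m)) (𝓡 m).tangent ∞
        (fun y => tangentParam (𝓡 m) P (y, u)) Ω := fun u =>
      hT.comp ((contDiff_id.prodMk contDiff_const).contMDiff.contMDiffOn) fun y hy =>
        ⟨hy, mem_univ _⟩
    have := ContMDiffOn.inner_bundle (hsec u) (hsec v)
    refine this.congr fun y _ => hB y u v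
  · intro y _ a b
    rw [hB, hB, hg.symm]
  · intro y hy a ha
    rw [hB]
    refine hg.pos _ _ fun h0 => ha ?_
    have := hP.mD_inv_mD hy a
    rw [h0, map_zero] at this
    exact this.symm

end MetricM

/-! ### Smoothness of `u ↦ f ∘ u` on spaces of continuous functions -/

section Superposition

universe u

variable {X : Type*} [TopologicalSpace X] [CompactSpace X]
  {E F : Type u} [NormedAddCommGroup E] [NormedSpace ℝ E] [NormedAddCommGroup F] [NormedSpace ℝ F]

/-- Pointwise application of a continuous family of linear maps. -/
def pointwiseApply (X : Type*) [TopologicalSpace X] [CompactSpace X]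
    (E F : Type*) [NormedAddCommGroup E] [NormedSpace ℝ E] [NormedAddCommGroup F]
    [NormedSpace ℝ F] : C(X, E →L[ℝ] F) →L[ℝ] C(X, E) →L[ℝ] C(X, F) :=
  LinearMap.mkContinuous₂
    (LinearMap.mk₂ ℝ (fun (A : C(X, E →L[ℝ] F)) (h : C(X, E)) =>
      (⟨fun x => A x (h x), by fun_prop⟩ : C(X, F)))
      (fun A A' h => by ext x; simp) (fun c A h => by ext x; simp)
      (fun A h h' => by ext x; simp) (fun c A h => by ext x; simp)) 1
    (fun A h => by
      rw [one_mul]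
      refine (ContinuousMap.norm_le _ (by positivity)).2 fun x => ?_
      exact ((A x).le_opNorm (h x)).trans (by gcongr <;> exact ContinuousMap.norm_coe_le_norm _ x))

/-- Because `f'` is Lipschitz, the mean value inequality bounds the remainder at each point of `X`
by `K ‖v - u‖²`, uniformly over `X`. -/
theorem hasFDerivAt_superposition (f : C(E, F)) (f' : C(E, E →L[ℝ] F))
    (hf : ∀ x, HasFDerivAt f (f' x) x) {K : NNReal} (hK : LipschitzWith K f') (u : C(X, E)) :
    HasFDerivAt (fun v : C(X, E) => f.comp v) (pointwiseApply X E F (f'.comp u)) u := by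
  have key : (fun v : C(X, E) => f.comp v - f.comp u - pointwiseApply X E F (f'.comp u) (v - u))
      =O[𝓝 u] fun v => ‖v - u‖ ^ 2 := by
    refine Asymptotics.IsBigO.of_bound K (Filter.Eventually.of_forall fun v => ?_)
    rw [norm_pow, norm_norm]
    refine (ContinuousMap.norm_le _ (by positivity)).2 fun x => ?_
    have hx : ‖v x - u x‖ ≤ ‖v - u‖ := ContinuousMap.norm_coe_le_norm (v - u) x
    have := (convex_closedBall (u x) ‖v - u‖).norm_image_sub_le_of_norm_hasFDerivWithin_le'
      (f := f) (f' := f') (φ := f' (u x)) (C := K * ‖v - u‖)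
      (fun y _ => (hf y).hasFDerivWithinAt) (fun y hy => by
        refine (hK.norm_sub_le y (u x)).trans ?_
        gcongr
        exact mem_closedBall_iff_norm.1 hy)
      (Metric.mem_closedBall_self (norm_nonneg _)) (mem_closedBall_iff_norm.2 hx)
    refine this.trans ?_
    rw [pow_two, ← mul_assoc]
    gcongr
  have h1 := key.hasFDerivAt (𝕜 := ℝ) (by norm_num)
  have h2 : HasFDerivAt (fun v : C(X, E) => f.comp u + pointwiseApply X E F (f'.comp u) (v - u))
      (pointwiseApply X E F (f'.comp u)) u := by
    simpa using ((pointwiseApply X E F (f'.comp u)).hasFDerivAt.comp u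
      ((hasFDerivAt_id u).sub_const u)).const_add (f.comp u)
  have h3 := h1.add h2
  rw [zero_add] at h3
  refine h3.congr_of_eventuallyEq (Filter.Eventually.of_forall fun v => ?_)
  simp only [Pi.add_apply]
  abel

/-- The derivative is superposition with `fderiv ℝ f` followed by a continuous linear map, so the
degree drops by one at each step. Compact support passes to the derivative and supplies the global
Lipschitz constant. The target `F` varies in the induction, and `E` and `F` share a universe so that
`E →L[ℝ] F` is again admissible. -/
theorem contDiff_superposition (n : ℕ) : ∀ (F : Type u) [NormedAddCommGroup F] [NormedSpace ℝ F]
    (f : C(E, F)), ContDiff ℝ ∞ f → HasCompactSupport f →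
    ContDiff ℝ n (fun v : C(X, E) => f.comp v) := by
  induction n with
  | zero =>
    intro F _ _ f hf hc
    exact contDiff_zero.2 (ContinuousMap.continuous_postcomp f)
  | succ n ih =>
    intro F _ _ f hf hc
    have hd : ContDiff ℝ ∞ (fderiv ℝ f) := hf.fderiv_right (by simp)
    have hcd : HasCompactSupport (fderiv ℝ f) := hc.fderiv ℝ
    obtain ⟨K, hK⟩ := hd.lipschitzWith_of_hasCompactSupport hcd (by simp)
    set f' : C(E, E →L[ℝ] F) := ⟨fderiv ℝ f, hd.continuous⟩
    have hf' : ∀ u : C(X, E), HasFDerivAt (fun v : C(X, E) => f.comp v)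
        (pointwiseApply X E F (f'.comp u)) u := fun u =>
      hasFDerivAt_superposition f f' (fun x => (hf.differentiable (by simp) x).hasFDerivAt) hK u
    push_cast
    rw [contDiff_succ_iff_fderiv]
    refine ⟨fun u => (hf' u).differentiableAt, by simp, ?_⟩
    have e : fderiv ℝ (fun v : C(X, E) => f.comp v) = fun u =>
        pointwiseApply X E F (f'.comp u) := funext fun u => (hf' u).fderiv
    rw [e]
    exact (pointwiseApply X E F).contDiff.comp (ih _ f' hd hcd)

end Superposition

/-! ### Smooth dependence of flows on time and on the initial point -/

section LocalFlow

variable {E : Type*} [NormedAddCommGroup E] [NormedSpace ℝ E]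

/-- The primitive that vanishes at `0`. -/
def primitiveCLM (E : Type*) [NormedAddCommGroup E] [NormedSpace ℝ E] :
    C(Icc (0 : ℝ) 1, E) →L[ℝ] C(Icc (0 : ℝ) 1, E) :=
  LinearMap.mkContinuous
    { toFun := fun u => ⟨fun t => ∫ s in (0 : ℝ)..t, u (projIcc 0 1 zero_le_one s), by
        have h : Continuous fun s : ℝ => u (projIcc 0 1 zero_le_one s) := by fun_prop
        exact (intervalIntegral.continuous_primitive (fun a b => h.intervalIntegrable a b) 0).comp
          continuous_subtype_val⟩
      map_add' := fun u v => by
        ext t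
        have h : ∀ u : C(Icc (0 : ℝ) 1, E), Continuous fun s : ℝ => u (projIcc 0 1 zero_le_one s) :=
          fun u => by fun_prop
        exact intervalIntegral.integral_add ((h u).intervalIntegrable _ _)
          ((h v).intervalIntegrable _ _)
      map_smul' := fun c u => by
        ext t
        exact intervalIntegral.integral_smul c _ } 1
    (fun u => by
      rw [one_mul]
      refine (ContinuousMap.norm_le _ (norm_nonneg _)).2 fun t => ?_
      refine (intervalIntegral.norm_integral_le_of_norm_le_const (C := ‖u‖)
        fun s _ => ContinuousMap.norm_coe_le_norm u _).trans ?_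
      have := t.2
      rw [sub_zero, abs_of_nonneg this.1]
      exact mul_le_of_le_one_right (norm_nonneg _) this.2)

/-- The integral equation is solved for the whole path by the implicit function theorem. Time is
rescaled to `[0, 1]` and its length `p.1` becomes a parameter, so that smoothness in time and in the
initial point come together. At parameter `0` the equation is `u - z = 0`, whose derivative in `u`
is the identity. -/
theorem exists_implicit_flow [CompleteSpace E] {f : E → E} (hf : ContDiff ℝ ∞ f)
    (hc : HasCompactSupport f) (z₀ : E) {n : ℕ} (hn : n ≠ 0) :
    ∃ ψ : ℝ × E → C(Icc (0 : ℝ) 1, E), ContDiffAt ℝ n ψ (0, z₀) ∧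
      ∀ᶠ p in 𝓝 ((0 : ℝ), z₀), ∀ t : Icc (0 : ℝ) 1,
        ψ p t = p.2 + p.1 • ∫ s in (0 : ℝ)..t, f (ψ p (projIcc 0 1 zero_le_one s)) := by
  set fc : C(E, E) := ⟨f, hf.continuous⟩
  set cst : E →L[ℝ] C(Icc (0 : ℝ) 1, E) := ContinuousLinearMap.const ℝ (Icc (0 : ℝ) 1)
  set G : (ℝ × E) × C(Icc (0 : ℝ) 1, E) → C(Icc (0 : ℝ) 1, E) := fun q =>
    q.2 - (cst q.1.2 + q.1.1 • primitiveCLM E (fc.comp q.2)) with hG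
  have hGd : ContDiff ℝ n G := by
    have h1 : ContDiff ℝ n (fun v : C(Icc (0 : ℝ) 1, E) => fc.comp v) :=
      contDiff_superposition n E fc hf hc
    have h2 : ContDiff ℝ n (fun q : (ℝ × E) × C(Icc (0 : ℝ) 1, E) => primitiveCLM E (fc.comp q.2)) :=
      (primitiveCLM E).contDiff.comp (h1.comp contDiff_snd)
    have h3 : ContDiff ℝ n (fun q : (ℝ × E) × C(Icc (0 : ℝ) 1, E) => cst q.1.2) :=
      cst.contDiff.comp (contDiff_snd.comp contDiff_fst)
    exact contDiff_snd.sub (h3.add ((contDiff_fst.comp contDiff_fst).smul h2))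
  set pt : (ℝ × E) × C(Icc (0 : ℝ) 1, E) := ((0, z₀), cst z₀)
  have hn' : (n : WithTop ℕ∞) ≠ 0 := by exact_mod_cast hn
  have hinv : (fderiv ℝ G pt ∘L .inr ℝ (ℝ × E) C(Icc (0 : ℝ) 1, E)).IsInvertible := by
    have h1 : HasFDerivAt G (fderiv ℝ G pt) pt :=
      (hGd.differentiable hn' pt).hasFDerivAt
    have h2 : HasFDerivAt (fun u : C(Icc (0 : ℝ) 1, E) => (((0 : ℝ), z₀), u))
        (.inr ℝ (ℝ × E) C(Icc (0 : ℝ) 1, E)) (cst z₀) :=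
      hasFDerivAt_prodMk_right _ _
    have h3 := h1.comp (cst z₀) h2
    have h4 : HasFDerivAt (G ∘ fun u : C(Icc (0 : ℝ) 1, E) => (((0 : ℝ), z₀), u))
        (ContinuousLinearMap.id ℝ _) (cst z₀) := by
      have : (G ∘ fun u : C(Icc (0 : ℝ) 1, E) => (((0 : ℝ), z₀), u)) = fun u => u - cst z₀ := by
        funext u
        simp [hG]
      rw [this]
      exact (hasFDerivAt_id _).sub_const _
    rw [h3.unique h4]
    exact ⟨ContinuousLinearEquiv.refl ℝ _, rfl⟩
  refine ⟨hGd.contDiffAt.implicitFunction hn' hinv,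
    hGd.contDiffAt.contDiffAt_implicitFunction hn' hinv, ?_⟩
  have h0 : G pt = 0 := by simp [hG, pt]
  filter_upwards [hGd.contDiffAt.eventually_apply_implicitFunction hn' hinv] with p hp t
  rw [h0] at hp
  exact congrArg (fun v : C(Icc (0 : ℝ) 1, E) => v t) (sub_eq_zero.1 hp)

/-- The flow of a compactly supported smooth vector field depends smoothly on time and on the
initial point. -/
theorem exists_flow_of_hasCompactSupport [CompleteSpace E] {f : E → E} (hf : ContDiff ℝ ∞ f)
    (hc : HasCompactSupport f) (z₀ : E) {n : ℕ} (hn : n ≠ 0) :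
    ∃ Φ : ℝ × E → E, ContDiffAt ℝ n Φ (0, z₀) ∧ (∀ᶠ z in 𝓝 z₀, Φ (0, z) = z) ∧
      ∀ᶠ p in 𝓝 ((0 : ℝ), z₀), HasDerivAt (fun s => Φ (s, p.2)) (f (Φ p)) p.1 := by
  obtain ⟨ψ, hψ, hev⟩ := exists_implicit_flow hf hc z₀ hn
  set i1 : Icc (0 : ℝ) 1 := ⟨1, zero_le_one, le_rfl⟩
  set Φ : ℝ × E → E := fun p => ψ p i1 with hΦ
  have hΦd : ContDiffAt ℝ n Φ (0, z₀) :=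
    (ContinuousMap.evalCLM ℝ i1 : C(Icc (0 : ℝ) 1, E) →L[ℝ] E).contDiff.contDiffAt.comp _ hψ
  have hn' : (n : WithTop ℕ∞) ≠ 0 := by exact_mod_cast hn
  have hn1 : (1 : WithTop ℕ∞) ≤ n := by exact_mod_cast Nat.one_le_iff_ne_zero.2 hn
  obtain ⟨K, hK⟩ := hf.lipschitzWith_of_hasCompactSupport hc (by simp)
  have hev2 := hev.and ((hΦd.of_le hn1).eventually (by simp))
  rw [nhds_prod_eq] at hev2
  obtain ⟨δ, hδ, ρ, hρ, H⟩ : ∃ δ > 0, ∃ ρ > 0, ∀ s, |s| < δ → ∀ z ∈ Metric.ball z₀ ρ,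
      (∀ t : Icc (0 : ℝ) 1, ψ (s, z) t = z + s • ∫ r in (0 : ℝ)..t,
        f (ψ (s, z) (projIcc 0 1 zero_le_one r))) ∧ ContDiffAt ℝ 1 Φ (s, z) := by
    obtain ⟨p1, h1, p2, h2, h12⟩ := Filter.eventually_prod_iff.1 hev2
    obtain ⟨δ, hδ, h1'⟩ := Metric.eventually_nhds_iff.1 h1
    obtain ⟨ρ, hρ, h2'⟩ := Metric.eventually_nhds_iff.1 h2
    exact ⟨δ, hδ, ρ, hρ, fun s hs z hz => h12 (h1' (by simpa using hs)) (h2' hz)⟩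
  set U : ℝ → E → ℝ → E := fun s z t => z + s • ∫ r in (0 : ℝ)..t,
    f (ψ (s, z) (projIcc 0 1 zero_le_one r)) with hU
  have hUψ : ∀ s, |s| < δ → ∀ z ∈ Metric.ball z₀ ρ, ∀ t : Icc (0 : ℝ) 1, U s z t = ψ (s, z) t :=
    fun s hs z hz t => ((H s hs z hz).1 t).symm
  have hUd : ∀ s, |s| < δ → ∀ z ∈ Metric.ball z₀ ρ, ∀ t ∈ Icc (0 : ℝ) 1,
      HasDerivAt (U s z) (s • f (U s z t)) t := by
    intro s hs z hz t ht
    have hcont : Continuous fun r : ℝ => f (ψ (s, z) (projIcc 0 1 zero_le_one r)) :=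
      hf.continuous.comp (by fun_prop)
    have h1 := ((hcont.integral_hasStrictDerivAt 0 t).hasDerivAt.const_smul s).const_add z
    have h2 := hUψ s hs z hz ⟨t, ht⟩
    rw [projIcc_of_mem zero_le_one ht, ← h2] at h1
    exact h1
  -- Both `t ↦ U s z (c t)` and `U (c s) z` solve `u' = c s f(u)` with initial value `z`; by
  -- uniqueness, the solution up to time `s` contains those for all smaller times.
  have hscale : ∀ s, |s| < δ → ∀ z ∈ Metric.ball z₀ ρ, ∀ c ∈ Icc (0 : ℝ) 1,
      Φ (c * s, z) = U s z c := by
    intro s hs z hz c hc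
    have hcs : |c * s| < δ := by
      rw [abs_mul, abs_of_nonneg hc.1]
      exact (mul_le_of_le_one_left (abs_nonneg s) hc.2).trans_lt hs
    have hd1 : ∀ t ∈ Icc (0 : ℝ) 1,
        HasDerivAt (fun t => U s z (c * t)) ((c * s) • f (U s z (c * t))) t := by
      intro t ht
      have h1 := hUd s hs z hz (c * t) ⟨mul_nonneg hc.1 ht.1, mul_le_one₀ hc.2 ht.1 ht.2⟩
      have h2 := h1.scomp t ((hasDerivAt_id t).const_mul c)
      rw [mul_one, smul_smul] at h2
      exact h2
    have hlip : ∀ t : ℝ, LipschitzWith (‖c * s‖₊ * K) fun x => (c * s) • f x := fun _ =>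
      (lipschitzWith_smul (c * s)).comp hK
    have heq := ODE_solution_unique (v := fun _ x => (c * s) • f x) (a := 0) (b := 1)
      (f := fun t => U s z (c * t)) (g := U (c * s) z) hlip
      (fun t ht => (hd1 t ht).continuousAt.continuousWithinAt)
      (fun t ht => (hd1 t ⟨ht.1, ht.2.le⟩).hasDerivWithinAt)
      (fun t ht => (hUd _ hcs z hz t ht).continuousAt.continuousWithinAt)
      (fun t ht => (hUd _ hcs z hz t ⟨ht.1, ht.2.le⟩).hasDerivWithinAt)
      (by simp [hU])
    have h1 := heq (right_mem_Icc.2 zero_le_one)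
    have h2 := hUψ (c * s) hcs z hz i1
    simp only [mul_one] at h1
    rw [h1]
    exact h2.symm
  -- Differentiate `c ↦ Φ (c s, z)` at `c = 1`. This yields `s` times the assertion, and the
  -- derivative is only one-sided because `c` is confined to `[0, 1]`.
  have hderiv : ∀ s, |s| < δ → s ≠ 0 → ∀ z ∈ Metric.ball z₀ ρ,
      fderiv ℝ Φ (s, z) (1, 0) = f (Φ (s, z)) := by
    intro s hs hs0 z hz
    have h1 : HasFDerivAt Φ (fderiv ℝ Φ (s, z)) (1 * s, z) := by
      rw [one_mul]
      exact ((H s hs z hz).2.differentiableAt (by simp)).hasFDerivAt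
    have h2 : HasDerivAt (fun c : ℝ => (c * s, z)) (s, 0) 1 := by
      simpa using ((hasDerivAt_id (1 : ℝ)).mul_const s).prodMk (hasDerivAt_const 1 z)
    have h3 := (HasFDerivAt.comp_hasDerivAt (f := fun c : ℝ => (c * s, z)) 1 h1 h2).hasDerivWithinAt
      (s := Icc 0 1)
    have h4 := (hUd s hs z hz 1 (right_mem_Icc.2 zero_le_one)).hasDerivWithinAt (s := Icc 0 1)
    have h5 := h4.congr_of_mem (f₁ := Φ ∘ fun c : ℝ => (c * s, z))
      (fun c hc => hscale s hs z hz c hc) (right_mem_Icc.2 zero_le_one)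
    have h6 := (uniqueDiffOn_Icc (zero_lt_one' ℝ) 1 (right_mem_Icc.2 zero_le_one)).eq_deriv _ h3 h5
    rw [← hscale s hs z hz 1 (right_mem_Icc.2 zero_le_one), one_mul] at h6
    have h7 : ((s, 0) : ℝ × E) = s • ((1 : ℝ), (0 : E)) := by simp
    rw [h7, map_smul] at h6
    exact smul_right_injective E hs0 h6
  -- At `s = 0` the equation follows by continuity of both sides.
  have hderiv' : ∀ s, |s| < δ → ∀ z ∈ Metric.ball z₀ ρ,
      fderiv ℝ Φ (s, z) (1, 0) = f (Φ (s, z)) := by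
    intro s hs z hz
    rcases eq_or_ne s 0 with rfl | hs0
    · have hc0 := (H 0 hs z hz).2
      have hcf : ContinuousAt (fun p => fderiv ℝ Φ p (1, 0)) ((0 : ℝ), z) :=
        ((hc0.fderiv_right (m := 0) (by norm_num)).continuousAt).clm_apply continuousAt_const
      have hpath : Continuous fun s : ℝ => (s, z) := by fun_prop
      have t1 : Filter.Tendsto (fun s : ℝ => fderiv ℝ Φ (s, z) (1, 0)) (𝓝[≠] 0)
          (𝓝 (fderiv ℝ Φ (0, z) (1, 0))) :=
        (ContinuousAt.comp (f := fun s : ℝ => (s, z)) hcf hpath.continuousAt).tendsto.mono_left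
          nhdsWithin_le_nhds
      have t2 : Filter.Tendsto (fun s : ℝ => f (Φ (s, z))) (𝓝[≠] 0) (𝓝 (f (Φ (0, z)))) :=
        (hf.continuous.continuousAt.comp (ContinuousAt.comp (f := fun s : ℝ => (s, z))
          hc0.continuousAt hpath.continuousAt)).tendsto.mono_left nhdsWithin_le_nhds
      refine tendsto_nhds_unique_of_eventuallyEq t1 t2 ?_
      have h1 : ∀ᶠ s in 𝓝[≠] (0 : ℝ), |s| < δ := by
        refine nhdsWithin_le_nhds ?_
        filter_upwards [Metric.ball_mem_nhds (0 : ℝ) hδ] with s hs'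
        simpa using hs'
      filter_upwards [h1, self_mem_nhdsWithin] with s h2 h3 using hderiv s h2 h3 z hz
    · exact hderiv s hs hs0 z hz
  have hδ0 : |(0 : ℝ)| < δ := by simpa using hδ
  refine ⟨Φ, hΦd, ?_, ?_⟩
  · filter_upwards [Metric.ball_mem_nhds z₀ hρ] with z hz
    have := hUψ 0 hδ0 z hz i1
    rw [hΦ]
    simp only
    rw [← this]
    simp [hU]
  · have hm : Metric.ball (0 : ℝ) δ ×ˢ Metric.ball z₀ ρ ∈ 𝓝 ((0 : ℝ), z₀) :=
      prod_mem_nhds (Metric.ball_mem_nhds _ hδ) (Metric.ball_mem_nhds _ hρ)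
    filter_upwards [hm] with p hp
    have hp1 : |p.1| < δ := by simpa using hp.1
    have h1 := ((H p.1 hp1 p.2 hp.2).2.differentiableAt (by simp)).hasFDerivAt
    have h2 : HasDerivAt (fun s : ℝ => (s, p.2)) (1, 0) p.1 :=
      (hasDerivAt_id _).prodMk (hasDerivAt_const _ _)
    have h3 := HasFDerivAt.comp_hasDerivAt (f := fun s : ℝ => (s, p.2)) p.1 h1 h2
    rw [hderiv' p.1 hp1 p.2 hp.2] at h3
    exact h3

/-- The local flow of a smooth vector field. -/
theorem exists_local_flow [FiniteDimensional ℝ E] {f : E → E} {Ω : Set E} (hΩ : IsOpen Ω)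
    (hf : ContDiffOn ℝ ∞ f Ω) {z₀ : E} (hz₀ : z₀ ∈ Ω) {n : ℕ} (hn : n ≠ 0) :
    ∃ Φ : ℝ × E → E, ContDiffAt ℝ n Φ (0, z₀) ∧ (∀ᶠ z in 𝓝 z₀, Φ (0, z) = z) ∧
      ∀ᶠ p in 𝓝 ((0 : ℝ), z₀), Φ p ∈ Ω ∧ HasDerivAt (fun s => Φ (s, p.2)) (f (Φ p)) p.1 := by
  have : CompleteSpace E := FiniteDimensional.complete ℝ E
  obtain ⟨r, hr, hrΩ⟩ := Metric.nhds_basis_closedBall.mem_iff.1 (hΩ.mem_nhds hz₀)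
  -- Multiplication by the bump function makes the field smooth and compactly supported on the whole
  -- space; where the bump equals `1`, which covers short times near `z₀`, the two flows agree.
  set χ : ContDiffBump z₀ := ⟨r / 2, r, half_pos hr, half_lt_self hr⟩
  have hts : tsupport χ ⊆ Ω := by rw [χ.tsupport_eq]; exact hrΩ
  have hg : ContDiff ℝ ∞ (fun z => χ z • f z) := by
    rw [contDiff_iff_contDiffAt]
    intro z
    by_cases hz : z ∈ tsupport χ
    · exact χ.contDiffAt.smul (hf.contDiffAt (hΩ.mem_nhds (hts hz)))
    · refine contDiffAt_const (c := (0 : E)) |>.congr_of_eventuallyEq ?_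
      filter_upwards [(isClosed_tsupport _).isOpen_compl.mem_nhds hz] with w hw
      rw [image_eq_zero_of_notMem_tsupport hw, zero_smul]
  obtain ⟨Φ, h1, h2, h3⟩ := exists_flow_of_hasCompactSupport hg χ.hasCompactSupport.smul_right z₀ hn
  refine ⟨Φ, h1, h2, ?_⟩
  have h0 : Φ (0, z₀) = z₀ := h2.self_of_nhds
  have h4 : ∀ᶠ w in 𝓝 (Φ (0, z₀)), w ∈ Ω ∧ χ w = 1 := by
    rw [h0]
    exact (hΩ.eventually_mem hz₀).and χ.eventuallyEq_one
  filter_upwards [h3, h1.continuousAt.eventually h4] with p h5 h6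
  rw [h6.2, one_smul] at h5
  exact ⟨h6.1, h5⟩

end LocalFlow

/-! ### Velocities of curves in a manifold -/

section Velocity

variable {E : Type*} [NormedAddCommGroup E] [NormedSpace ℝ E]
  {H : Type*} [TopologicalSpace H] {I : ModelWithCorners ℝ E H}
  {N : Type*} [TopologicalSpace N] [ChartedSpace H N]
  {E' : Type*} [NormedAddCommGroup E'] [NormedSpace ℝ E']
  {H' : Type*} [TopologicalSpace H'] {I' : ModelWithCorners ℝ E' H'}
  {N' : Type*} [TopologicalSpace N'] [ChartedSpace H' N']

/-- `HasMFDerivAt`, with the derivative as a map of model spaces. -/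
def HasMD (I : ModelWithCorners ℝ E H) (I' : ModelWithCorners ℝ E' H') (f : N → N') (x : N)
    (L : E →L[ℝ] E') : Prop :=
  HasMFDerivAt I I' f x L

/-- The curve `c` has velocity `ξ` at time `t`. -/
def HasVel (I : ModelWithCorners ℝ E H) (c : ℝ → N) (ξ : E) (t : ℝ) : Prop :=
  HasMD 𝓘(ℝ, ℝ) I c t ((1 : ℝ →L[ℝ] ℝ).smulRight ξ)

theorem HasVel.continuousAt {c : ℝ → N} {ξ : E} {t : ℝ} (h : HasVel I c ξ t) : ContinuousAt c t :=
  HasMFDerivAt.continuousAt h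

theorem HasVel.mD_eq {c : ℝ → N} {ξ : E} {t : ℝ} (h : HasVel I c ξ t) :
    mD 𝓘(ℝ, ℝ) I c t 1 = ξ := by
  have h1 : mD 𝓘(ℝ, ℝ) I c t = (1 : ℝ →L[ℝ] ℝ).smulRight ξ := HasMFDerivAt.mfderiv h
  rw [h1]
  simp

theorem hasVel_of_mdifferentiableAt {c : ℝ → N} {t : ℝ} (h : MDifferentiableAt 𝓘(ℝ, ℝ) I c t) :
    HasVel I c (mD 𝓘(ℝ, ℝ) I c t 1) t := by
  have h1 : mD 𝓘(ℝ, ℝ) I c t = (1 : ℝ →L[ℝ] ℝ).smulRight (mD 𝓘(ℝ, ℝ) I c t 1) := by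
    ext
    simp
  have h2 : HasMD 𝓘(ℝ, ℝ) I c t (mD 𝓘(ℝ, ℝ) I c t) := h.hasMFDerivAt
  unfold HasVel
  rw [← h1]
  exact h2

theorem HasVel.comp {c : ℝ → N} {ξ : E} {t : ℝ} {f : N → N'} (h : HasVel I c ξ t)
    (hf : MDifferentiableAt I I' f (c t)) :
    HasVel I' (fun s => f (c s)) (mD I I' f (c t) ξ) t := by
  have h1 := hasVel_of_mdifferentiableAt (I := I') (c := fun s => f (c s)) (t := t)
    (hf.comp t h.mdifferentiableAt)
  rwa [mD_comp_apply hf h.mdifferentiableAt, h.mD_eq] at h1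

theorem hasVel_iff_hasDerivAt {c : ℝ → E} {ξ : E} {t : ℝ} :
    HasVel 𝓘(ℝ, E) c ξ t ↔ HasDerivAt c ξ t := by
  unfold HasVel
  have : (1 : ℝ →L[ℝ] ℝ).smulRight ξ = ContinuousLinearMap.toSpanSingleton ℝ ξ := by
    ext; simp
  rw [this, hasDerivAt_iff_hasFDerivAt]
  exact hasMFDerivAt_iff_hasFDerivAt

theorem HasVel.congr_of_eventuallyEq {c c' : ℝ → N} {ξ : E} {t : ℝ} (h : HasVel I c ξ t)
    (e : c' =ᶠ[𝓝 t] c) : HasVel I c' ξ t := by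
  have h' : HasMFDerivAt 𝓘(ℝ, ℝ) I c t _ := h
  have := h'.congr_of_eventuallyEq e
  exact this

theorem HasVel.scomp {c : ℝ → N} {ξ : E} {t : ℝ} {f : ℝ → ℝ} {f' : ℝ} (h : HasVel I c ξ (f t))
    (hf : HasDerivAt f f' t) : HasVel I (fun s => c (f s)) (f' • ξ) t := by
  have h1 := (hasVel_iff_hasDerivAt.2 hf).comp (I' := I) (f := c) h.mdifferentiableAt
  have h2 : mD 𝓘(ℝ, ℝ) I c (f t) f' = f' • ξ := by
    rw [← h.mD_eq, ← map_smul, smul_eq_mul, mul_one]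
  rwa [h2] at h1

theorem IsParam.hasVel {P : E → N} {Q : N → E} {Ω : Set E} (hP : IsParam I P Q Ω) {z : ℝ → E}
    {a : E} {t : ℝ} (hz : z t ∈ Ω) (h : HasDerivAt z a t) :
    HasVel I (fun s => P (z s)) (mD 𝓘(ℝ, E) I P (z t) a) t :=
  (hasVel_iff_hasDerivAt.2 h).comp (hP.mdifferentiableAt hz)

theorem IsParam.hasDerivAt {P : E → N} {Q : N → E} {Ω : Set E} (hP : IsParam I P Q Ω) {c : ℝ → N}
    {ξ : E} {t : ℝ} (hc : c t ∈ P '' Ω) (h : HasVel I c ξ t) :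
    HasDerivAt (fun s => Q (c s)) (mD I 𝓘(ℝ, E) Q (c t) ξ) t := by
  obtain ⟨y, hy, e⟩ := hc
  exact hasVel_iff_hasDerivAt.1 (h.comp (e ▸ hP.mdifferentiableAt_inv hy))

theorem isMIntegralCurveOn_iff_hasVel {c : ℝ → N} {X : (p : N) → TangentSpace I p} {s : Set ℝ}
    (hs : IsOpen s) : IsMIntegralCurveOn c X s ↔ ∀ t ∈ s, HasVel I c (X (c t)) t :=
  ⟨fun h t ht => (h t ht).hasMFDerivAt (hs.mem_nhds ht),
    fun h t ht => HasMFDerivAt.hasMFDerivWithinAt (h t ht)⟩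

end Velocity

/-! ### The tangent bundle is Hausdorff -/

section TangentT2

variable {E : Type*} [NormedAddCommGroup E] [NormedSpace ℝ E]
  {H : Type*} [TopologicalSpace H] {I : ModelWithCorners ℝ E H}
  {N : Type*} [TopologicalSpace N] [ChartedSpace H N] [IsManifold I 1 N]

/-- Vectors at different points are separated by the projection, vectors at the same point by a
chart. Uniqueness of integral curves of the spray, a vector field on `TN`, relies on this. -/
instance instT2SpaceTangentBundle [T2Space N] : T2Space (TangentBundle I N) := by
  refine ⟨fun V W hne => ?_⟩
  have hc : Continuous (TotalSpace.proj : TangentBundle I N → N) :=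
    FiberBundle.continuous_proj E (TangentSpace I)
  by_cases h : V.proj = W.proj
  · set S := (extChartAt I.tangent V).source
    have hS : IsOpen S := isOpen_extChartAt_source V
    have hV : V ∈ S := mem_extChartAt_source V
    have hW : W ∈ S := by
      rw [show S = _ from extChartAt_tangent_source V]
      rw [mem_preimage, ← h]
      exact mem_extChartAt_source V.proj
    have hcont : ContinuousOn (extChartAt I.tangent V) S := continuousOn_extChartAt V
    have hne' : extChartAt I.tangent V V ≠ extChartAt I.tangent V W := fun e =>
      hne ((extChartAt I.tangent V).injOn hV hW e)
    obtain ⟨u, w, hu, hw, hVu, hWw, hd⟩ := t2_separation hne'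
    refine ⟨_, _, hcont.isOpen_inter_preimage hS hu, hcont.isOpen_inter_preimage hS hw, ⟨hV, hVu⟩,
      ⟨hW, hWw⟩, ?_⟩
    exact (hd.preimage _).mono inter_subset_right inter_subset_right
  · obtain ⟨u, w, hu, hw, hVu, hWw, hd⟩ := t2_separation h
    exact ⟨_, _, hu.preimage hc, hw.preimage hc, hVu, hWw, hd.preimage _⟩

end TangentT2

/-! ### Geodesics as projections of integral curves of the spray -/

section Spray

variable {E : Type*} [NormedAddCommGroup E] [NormedSpace ℝ E]
  {H : Type*} [TopologicalSpace H] {I : ModelWithCorners ℝ E H}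
  {N : Type*} [TopologicalSpace N] [ChartedSpace H N] [IsManifold I ∞ N] [IsManifold I 1 N]
  [I.Boundaryless]

/-- The geodesic spray. -/
def spray (g : (p : N) → TangentSpace I p → TangentSpace I p → ℝ) (V : TangentBundle I N) :
    TangentSpace I.tangent V :=
  ((vec V, - christoffel g V.proj V.snd V.snd) : E × E)

variable {g : (p : N) → TangentSpace I p → TangentSpace I p → ℝ}

/-- The first condition says that a curve in `TN` is the velocity of its projection, the second that
its covariant derivative vanishes; together they fix both coordinates of its derivative. -/
theorem eq_spray {V : TangentBundle I N} {ξ : E × E} (h1 : horiz V ξ = vec V)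
    (h2 : connector g V ξ = (0 : E)) : ξ = spray g V := by
  have h3 : ξ.2 + christoffel g V.proj (horiz V ξ) V.snd = (0 : E) := h2
  rw [show horiz V ξ = V.snd from h1] at h3
  have h4 : ξ.1 = vec V := (horiz_eq V ξ).symm.trans h1
  exact Prod.ext h4 (eq_neg_of_add_eq_zero_left h3)

theorem horiz_spray (V : TangentBundle I N) : horiz V (spray g V) = vec V :=
  horiz_eq V (spray g V)

theorem connector_spray (V : TangentBundle I N) : connector g V (spray g V) = (0 : E) := by
  have h1 : connector g V (spray g V) = - christoffel g V.proj V.snd V.snd +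
    christoffel g V.proj (horiz V (spray g V)) V.snd := rfl
  rw [h1, show horiz V (spray g V) = V.snd from horiz_spray V]
  exact neg_add_cancel (G := E) _

theorem ChartData.spray_eq {P : E → N} {Q : N → E}
    {Ω : Set E} {B : E → E →L[ℝ] E →L[ℝ] ℝ} {Γ : E → E →L[ℝ] E →L[ℝ] E}
    (D : ChartData I g P Q Ω B Γ) {z : E × E} (hz : z.1 ∈ Ω) :
    mD 𝓘(ℝ, E × E) I.tangent (tangentParam I P) z (sprayF Γ z) =
      spray g (tangentParam I P z) := by
  refine eq_spray ?_ ?_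
  · rw [D.horiz hz]; rfl
  · rw [D.connector hz, kap_apply, sprayF, neg_add_cancel, map_zero]

theorem IsLeviCivita.contDiffOn_sprayF {Ω : Set E} {B : E → E →L[ℝ] E →L[ℝ] ℝ}
    {Γ : E → E →L[ℝ] E →L[ℝ] E} (h : IsLeviCivita Ω B Γ) :
    ContDiffOn ℝ ∞ (sprayF Γ) (Ω ×ˢ univ) := by
  have h1 : ContDiffOn ℝ ∞ (fun z : E × E => Γ z.1) (Ω ×ˢ univ) :=
    h.contDiffOn.comp contDiff_fst.contDiffOn fun z hz => hz.1
  exact contDiff_snd.contDiffOn.prodMk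
    ((h1.clm_apply contDiff_snd.contDiffOn).clm_apply contDiff_snd.contDiffOn).neg

variable (hg : IsRiemannian I g)
include hg

theorem contMDiff_spray : ContMDiff I.tangent I.tangent.tangent ∞
    (fun V => (⟨V, spray g V⟩ : TangentBundle I.tangent (TangentBundle I N))) := by
  intro V
  obtain ⟨P, Q, Ω, B, Γ, z, D, hz, rfl, -⟩ := hg.exists_chart V
  have hT := D.param.tangent
  have hzz : z ∈ Ω ×ˢ (univ : Set E) := ⟨hz, mem_univ _⟩
  have h1 : ContMDiffAt I.tangent 𝓘(ℝ, E × E) ∞ (tangentParamInv Q) (tangentParam I P z) :=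
    hT.contMDiffAt_inv hzz
  have h2 : ContDiffAt ℝ ∞ (fun z => (z, sprayF Γ z)) z :=
    contDiffAt_id.prodMk (D.lc.contDiffOn_sprayF.contDiffAt (hT.mem_nhds hzz))
  have h3 : ContMDiffAt 𝓘(ℝ, (E × E) × (E × E)) I.tangent.tangent ∞
      (tangentParam I.tangent (tangentParam I P)) (z, sprayF Γ z) :=
    hT.tangent.contMDiffAt ⟨hzz, mem_univ _⟩
  have h4 : ContMDiffAt 𝓘(ℝ, E × E) I.tangent.tangent ∞
      (fun z => tangentParam I.tangent (tangentParam I P) (z, sprayF Γ z)) z :=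
    ContMDiffAt.comp z h3 h2.contMDiffAt
  have h5 : ContMDiffAt I.tangent I.tangent.tangent ∞
      (fun V => tangentParam I.tangent (tangentParam I P)
        (tangentParamInv Q V, sprayF Γ (tangentParamInv Q V))) (tangentParam I P z) :=
    ContMDiffAt.comp (tangentParam I P z) (by rwa [hT.left_inv z hzz]) h1
  refine h5.congr_of_eventuallyEq ?_
  filter_upwards [hT.image_mem_nhds hzz] with W hW
  obtain ⟨w, hw, rfl⟩ := hW
  rw [hT.left_inv w hw]
  exact congrArg (mkT I.tangent (tangentParam I P w)) (D.spray_eq hw.1).symm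

omit hg in
theorem hasVel_velocity {c : ℝ → N} {a b : ℝ} (h : IsGeodesicOn g c a b) :
    ∀ t ∈ Ioo a b, HasVel I.tangent (velocity I c) (spray g (velocity I c t)) t := by
  intro t ht
  have h2 : ContMDiffOn 𝓘(ℝ, ℝ).tangent I.tangent 1 (tangentMap 𝓘(ℝ, ℝ) I c)
      (TotalSpace.proj ⁻¹' (Ioo a b)) :=
    ContMDiffOn.tangentMap_of_isOpen isOpen_Ioo h.1 (by norm_num) (by norm_cast)
  have h3 : ContMDiff 𝓘(ℝ, ℝ) 𝓘(ℝ, ℝ).tangent ∞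
      (fun t : ℝ => (⟨t, (1 : ℝ)⟩ : TangentBundle 𝓘(ℝ, ℝ) ℝ)) :=
    contMDiff_prod_tangentBundle.comp (contDiff_id.prodMk contDiff_const).contMDiff
  have h4 : ContMDiffAt 𝓘(ℝ, ℝ) I.tangent 1 (velocity I c) t :=
    (h2.contMDiffAt ((isOpen_Ioo.preimage (FiberBundle.continuous_proj ℝ
      (TangentSpace 𝓘(ℝ, ℝ)))).mem_nhds ht)).comp t ((h3 t).of_le (by norm_cast))
  have h5 : HasVel I.tangent (velocity I c) (mD 𝓘(ℝ, ℝ) I.tangent (velocity I c) t 1) t :=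
    hasVel_of_mdifferentiableAt (h4.mdifferentiableAt (by simp))
  have h6 : mD 𝓘(ℝ, ℝ) I.tangent (velocity I c) t 1 = spray g (velocity I c t) := by
    refine eq_spray ?_ (h.2 t ht)
    exact (h5.comp (mdifferentiable_proj _)).mD_eq.symm
  rwa [← h6]

/-- A geodesic is required to be `C²`, while an integral curve is only assumed differentiable.
Regularity is recovered from the differential equation itself. -/
theorem isGeodesicOn_of_hasVel {V : ℝ → TangentBundle I N} {a b : ℝ}
    (h : ∀ t ∈ Ioo a b, HasVel I.tangent V (spray g (V t)) t) :
    IsGeodesicOn g (fun t => (V t).proj) a b ∧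
    ∀ t ∈ Ioo a b, velocity I (fun t => (V t).proj) t = V t := by
  have hv : ∀ t ∈ Ioo a b, velocity I (fun t => (V t).proj) t = V t := by
    intro t ht
    have h1 : mD 𝓘(ℝ, ℝ) I (fun t => (V t).proj) t 1 = vec (V t) :=
      ((h t ht).comp (mdifferentiable_proj _)).mD_eq.trans (horiz_spray (g := g) (V t))
    have h2 : velocity I (fun t => (V t).proj) t =
      mkT I (V t).proj (mD 𝓘(ℝ, ℝ) I (fun t => (V t).proj) t 1) := rfl
    rw [h2, h1, mkT_vec]
  refine ⟨⟨fun t ht => ContMDiffAt.contMDiffWithinAt ?_, fun t ht => ?_⟩, hv⟩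
  · obtain ⟨P, Q, Ω, B, Γ, z, D, hz, e, -⟩ := hg.exists_chart (V t)
    have hT := D.param.tangent
    have hzz : z ∈ Ω ×ˢ (univ : Set E) := ⟨hz, mem_univ _⟩
    set w : ℝ → E × E := fun s => tangentParamInv Q (V s) with hw
    have hev : ∀ᶠ s in 𝓝 t, s ∈ Ioo a b ∧ V s ∈ tangentParam I P '' (Ω ×ˢ univ) := by
      refine (isOpen_Ioo.eventually_mem ht).and ((h t ht).continuousAt.eventually ?_)
      rw [← e]
      exact hT.image_mem_nhds hzz
    have hwd : ∀ᶠ s in 𝓝 t, w s ∈ Ω ×ˢ (univ : Set E) ∧ HasDerivAt w (sprayF Γ (w s)) s := by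
      filter_upwards [hev] with s hs
      have h1 := hT.hasDerivAt hs.2 (h s hs.1)
      obtain ⟨y, hy, e1⟩ := hs.2
      rw [← e1, ← D.spray_eq hy.1, hT.mD_inv_mD hy] at h1
      have h2 : w s = y := by rw [hw]; simp only; rw [← e1, hT.left_inv y hy]
      rw [← h2] at h1 hy
      exact ⟨hy, h1⟩
    -- Bootstrapping: if `w` is `Cⁿ`, then so is its derivative `sprayF Γ (w s)`, hence `w` is
    -- `Cⁿ⁺¹`.
    have step : ∀ n : ℕ, ContDiffAt ℝ n w t → ContDiffAt ℝ (n + 1 : ℕ) w t := by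
      intro n hn
      have h1 : ContDiffAt ℝ n (fun s => sprayF Γ (w s)) t :=
        ((D.lc.contDiffOn_sprayF.contDiffAt (hT.mem_nhds hwd.self_of_nhds.1)).of_le
          (by norm_cast; exact le_top)).comp t hn
      push_cast
      rw [contDiffAt_succ_iff_hasFDerivAt]
      refine ⟨fun s => ContinuousLinearMap.toSpanSingleton ℝ (sprayF Γ (w s)), ?_, ?_⟩
      · obtain ⟨u, hu, hu'⟩ := hwd.exists_mem
        exact ⟨u, hu, fun s hs => (hu' s hs).2.hasFDerivAt⟩
      · exact (ContinuousLinearMap.toSpanSingletonCLE (𝕜 := ℝ)).contDiff.contDiffAt.comp t h1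
    have h0 : ContDiffAt ℝ (0 : ℕ) w t := by
      refine contDiffAt_zero.2 ?_
      obtain ⟨u, hu, hu'⟩ := hwd.exists_mem
      exact ⟨u, hu, fun s hs => (hu' s hs).2.continuousAt.continuousWithinAt⟩
    have h2 := step _ (step 0 h0)
    have h3 : ContMDiffAt 𝓘(ℝ, ℝ) I 2 (fun s => P (w s).1) t :=
      ((D.param.contMDiffAt hwd.self_of_nhds.1.1).of_le (by norm_cast)).comp t
        ((contDiffAt_fst.comp t h2).contMDiffAt)
    refine h3.congr_of_eventuallyEq ?_
    filter_upwards [hev] with s hs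
    obtain ⟨y, hy, e1⟩ := hs.2
    have h4 : w s = y := by rw [hw]; simp only; rw [← e1, hT.left_inv y hy]
    rw [h4, ← e1]; rfl
  · have h1 : ∀ᶠ s in 𝓝 t, velocity I (fun t => (V t).proj) s = V s := by
      filter_upwards [isOpen_Ioo.mem_nhds ht] with s hs using hv s hs
    have h2 : mD 𝓘(ℝ, ℝ) I.tangent (velocity I (fun t => (V t).proj)) t 1 =
        spray g (velocity I (fun t => (V t).proj) t) := by
      rw [((h t ht).congr_of_eventuallyEq h1).mD_eq, hv t ht]
    have h3 : covDeriv g (velocity I (fun t => (V t).proj)) t =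
      connector g (velocity I (fun t => (V t).proj) t)
        (mD 𝓘(ℝ, ℝ) I.tangent (velocity I (fun t => (V t).proj)) t 1) := rfl
    rw [h3, h2]
    exact connector_spray _

end Spray

/-! ### The geodesic flow: uniqueness, group law, smoothness -/

section GeodesicFlow

variable {E : Type*} [NormedAddCommGroup E] [NormedSpace ℝ E]
  {H : Type*} [TopologicalSpace H] {I : ModelWithCorners ℝ E H}
  {N : Type*} [TopologicalSpace N] [ChartedSpace H N] [IsManifold I ∞ N] [IsManifold I 1 N]
  [I.Boundaryless]

omit [IsManifold I ∞ N] [IsManifold I 1 N] [I.Boundaryless] in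
theorem HasVel.congr_vel {c : ℝ → N} {ξ η : E} {t : ℝ} (h : HasVel I c ξ t) (e : ξ = η) :
    HasVel I c η t := e ▸ h

/-- An integral curve of the geodesic spray. -/
def IsSprayCurve (g : (p : N) → TangentSpace I p → TangentSpace I p → ℝ)
    (V : ℝ → TangentBundle I N) (a b : ℝ) : Prop :=
  ∀ t ∈ Ioo a b, HasVel I.tangent V (spray g (V t)) t

variable {g : (p : N) → TangentSpace I p → TangentSpace I p → ℝ} (hg : IsRiemannian I g)

omit [IsManifold I ∞ N] [I.Boundaryless] in
theorem IsSprayCurve.shift {V : ℝ → TangentBundle I N} {a b : ℝ} (h : IsSprayCurve g V a b)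
    (r : ℝ) : IsSprayCurve g (fun s => V (s + r)) (a - r) (b - r) := by
  intro t ht
  have h1 := h (t + r) ⟨by linarith [ht.1], by linarith [ht.2]⟩
  have h2 := h1.scomp (f := fun s => s + r) ((hasDerivAt_id t).add_const r)
  exact h2.congr_vel (one_smul ℝ (spray g (V (t + r)) : E × E))

omit [IsManifold I ∞ N] [I.Boundaryless] in
theorem IsSprayCurve.mono {V : ℝ → TangentBundle I N} {a b a' b' : ℝ} (h : IsSprayCurve g V a b)
    (h' : Ioo a' b' ⊆ Ioo a b) : IsSprayCurve g V a' b' := fun t ht => h t (h' ht)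

include hg

/-- This replaces geodesics, which satisfy a second-order equation, by integral curves of a smooth
field, for which uniqueness and gluing are available. -/
theorem flowsTo_iff {t : ℝ} {v w : TangentBundle I N} : FlowsTo g t v w ↔
    ∃ V a b, IsSprayCurve g V a b ∧ (0 : ℝ) ∈ Ioo a b ∧ t ∈ Ioo a b ∧ V 0 = v ∧ V t = w := by
  constructor
  · rintro ⟨c, a, b, hc, h0, ht, rfl, rfl⟩
    exact ⟨_, a, b, hasVel_velocity hc, h0, ht, rfl, rfl⟩
  · rintro ⟨V, a, b, hV, h0, ht, rfl, rfl⟩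
    obtain ⟨h1, h2⟩ := isGeodesicOn_of_hasVel hg hV
    exact ⟨_, a, b, h1, h0, ht, h2 0 h0, h2 t ht⟩

theorem FlowsTo.symm {t : ℝ} {v w : TangentBundle I N} (h : FlowsTo g t v w) :
    FlowsTo g (-t) w v := by
  rw [flowsTo_iff hg] at h ⊢
  obtain ⟨V, a, b, hV, h0, ht, rfl, rfl⟩ := h
  refine ⟨_, _, _, hV.shift t, ⟨by linarith [ht.1], by linarith [ht.2]⟩,
    ⟨by linarith [h0.1], by linarith [h0.2]⟩, by simp, by simp⟩

variable [T2Space N]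

theorem IsSprayCurve.eqOn {V W : ℝ → TangentBundle I N} {a b t₀ : ℝ} (hV : IsSprayCurve g V a b)
    (hW : IsSprayCurve g W a b) (ht : t₀ ∈ Ioo a b) (h : V t₀ = W t₀) : EqOn V W (Ioo a b) :=
  isMIntegralCurveOn_Ioo_eqOn_of_contMDiff_boundaryless ht
    ((contMDiff_spray hg).of_le (by norm_cast))
    ((isMIntegralCurveOn_iff_hasVel isOpen_Ioo).2 hV)
    ((isMIntegralCurveOn_iff_hasVel isOpen_Ioo).2 hW) h

theorem FlowsTo.unique {t : ℝ} {v w w' : TangentBundle I N} (h : FlowsTo g t v w)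
    (h' : FlowsTo g t v w') : w = w' := by
  rw [flowsTo_iff hg] at h h'
  obtain ⟨V, a, b, hV, h0, ht, rfl, rfl⟩ := h
  obtain ⟨W, a', b', hW, h0', ht', e, rfl⟩ := h'
  refine IsSprayCurve.eqOn hg (hV.mono (Ioo_subset_Ioo (le_max_left a a') (min_le_left b b')))
    (hW.mono (Ioo_subset_Ioo (le_max_right a a') (min_le_right b b'))) (t₀ := 0)
    ⟨max_lt h0.1 h0'.1, lt_min h0.2 h0'.2⟩ e.symm ⟨max_lt ht.1 ht'.1, lt_min ht.2 ht'.2⟩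

theorem FlowsTo.eq_geodesicFlow {t : ℝ} {v w : TangentBundle I N} (h : FlowsTo g t v w) :
    geodesicFlow g t v = w := by
  have hex : ∃ w, FlowsTo g t v w := ⟨w, h⟩
  rw [geodesicFlow, dif_pos hex]
  exact FlowsTo.unique hg hex.choose_spec h

theorem flowsTo_geodesicFlow {t : ℝ} {v : TangentBundle I N} (h : v ∈ flowDomain g t) :
    FlowsTo g t v (geodesicFlow g t v) := by
  obtain ⟨w, hw⟩ := h
  rwa [hw.eq_geodesicFlow hg]

/-- The second integral curve, shifted by `t`, agrees with the first at time `t`; hence the two glue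
to an integral curve on the union of two overlapping intervals, which is again an interval. -/
theorem FlowsTo.trans {t s : ℝ} {v w u : TangentBundle I N} (h : FlowsTo g t v w)
    (h' : FlowsTo g s w u) : FlowsTo g (t + s) v u := by
  classical
  rw [flowsTo_iff hg] at h h' ⊢
  obtain ⟨V, a, b, hV, h0, ht, rfl, rfl⟩ := h
  obtain ⟨W, a', b', hW, h0', hs, e, rfl⟩ := h'
  have hW' := hW.shift (-t)
  simp only [sub_neg_eq_add] at hW'
  have htt : t ∈ Ioo (a' + t) (b' + t) := ⟨by linarith [h0'.1], by linarith [h0'.2]⟩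
  have hpw := isMIntegralCurveOn_piecewise (t₀ := t)
    ((contMDiff_spray hg).of_le (by norm_cast))
    ((isMIntegralCurveOn_iff_hasVel isOpen_Ioo).2 hV)
    ((isMIntegralCurveOn_iff_hasVel isOpen_Ioo).2 hW') ⟨ht, htt⟩ (by simp [e])
  have heq := eqOn_piecewise_of_isMIntegralCurveOn_Ioo (t₀ := t)
    ((contMDiff_spray hg).of_le (by norm_cast))
    ((isMIntegralCurveOn_iff_hasVel isOpen_Ioo).2 hV)
    ((isMIntegralCurveOn_iff_hasVel isOpen_Ioo).2 hW') ⟨ht, htt⟩ (by simp [e])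
  rw [isMIntegralCurveOn_iff_hasVel (isOpen_Ioo.union isOpen_Ioo)] at hpw
  have hsub : Ioo (min a (a' + t)) (max b (b' + t)) ⊆ Ioo a b ∪ Ioo (a' + t) (b' + t) := by
    rintro r ⟨h1, h2⟩
    rcases min_lt_iff.1 h1 with h1 | h1 <;> rcases lt_max_iff.1 h2 with h2 | h2
    · exact Or.inl ⟨h1, h2⟩
    · rcases lt_or_ge r b with h3 | h3
      · exact Or.inl ⟨h1, h3⟩
      · exact Or.inr ⟨by linarith [htt.1, ht.2], h2⟩
    · rcases lt_or_ge a r with h3 | h3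
      · exact Or.inl ⟨h3, h2⟩
      · exact Or.inr ⟨h1, by linarith [htt.2, ht.1]⟩
    · exact Or.inr ⟨h1, h2⟩
  refine ⟨_, _, _, fun r hr => hpw r (hsub hr), ⟨min_lt_of_left_lt h0.1, lt_max_of_lt_left h0.2⟩,
    ⟨min_lt_of_right_lt (by linarith [hs.1]), lt_max_of_lt_right (by linarith [hs.2])⟩,
    piecewise_eq_of_mem _ _ _ h0, ?_⟩
  rw [heq ⟨by linarith [hs.1], by linarith [hs.2]⟩]
  simp

theorem geodesicFlow_add {t s : ℝ} {v : TangentBundle I N} (h : v ∈ flowDomain g t)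
    (h' : geodesicFlow g t v ∈ flowDomain g s) :
    v ∈ flowDomain g (t + s) ∧
      geodesicFlow g (t + s) v = geodesicFlow g s (geodesicFlow g t v) := by
  have h1 := (flowsTo_geodesicFlow hg h).trans hg (flowsTo_geodesicFlow hg h')
  exact ⟨⟨_, h1⟩, h1.eq_geodesicFlow hg⟩

theorem geodesicFlow_neg {t : ℝ} {v : TangentBundle I N} (h : v ∈ flowDomain g t) :
    geodesicFlow g t v ∈ flowDomain g (-t) ∧ geodesicFlow g (-t) (geodesicFlow g t v) = v := by
  have h1 := (flowsTo_geodesicFlow hg h).symm hg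
  exact ⟨⟨_, h1⟩, h1.eq_geodesicFlow hg⟩

theorem IsSprayCurve.geodesicFlow_eq {V : ℝ → TangentBundle I N} {a b t : ℝ}
    (hV : IsSprayCurve g V a b) (h0 : (0 : ℝ) ∈ Ioo a b) (ht : t ∈ Ioo a b) :
    V 0 ∈ flowDomain g t ∧ geodesicFlow g t (V 0) = V t := by
  have h1 : FlowsTo g t (V 0) (V t) := (flowsTo_iff hg).2 ⟨V, a, b, hV, h0, ht, rfl, rfl⟩
  exact ⟨⟨_, h1⟩, h1.eq_geodesicFlow hg⟩

variable [FiniteDimensional ℝ E]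

/-- The geodesic flow in coordinates, for short times. -/
theorem exists_local_geodesicFlow (V₀ : TangentBundle I N) {n : ℕ} (hn : n ≠ 0) :
    ∃ δ > 0, ∃ U : Set (TangentBundle I N), IsOpen U ∧ V₀ ∈ U ∧ ∀ s, |s| < δ → ∀ v ∈ U,
      v ∈ flowDomain g s ∧ ContMDiffAt (𝓘(ℝ, ℝ).prod I.tangent) I.tangent n
        (fun p : ℝ × TangentBundle I N => geodesicFlow g p.1 p.2) (s, v) := by
  obtain ⟨P, Q, Ω, B, Γ, z₀, D, hz, rfl, -⟩ := hg.exists_chart V₀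
  have hT := D.param.tangent
  have hzz : z₀ ∈ Ω ×ˢ (univ : Set E) := ⟨hz, mem_univ _⟩
  obtain ⟨Φ, h1, h2, h3⟩ := exists_local_flow hT.isOpen D.lc.contDiffOn_sprayF hzz hn
  have hev := (h1.eventually (by simp)).and h3
  rw [nhds_prod_eq] at hev
  obtain ⟨δ, hδ, ρ, hρ, K⟩ : ∃ δ > 0, ∃ ρ > 0, ∀ s, |s| < δ → ∀ z ∈ Metric.ball z₀ ρ,
      (ContDiffAt ℝ n Φ (s, z) ∧ Φ (s, z) ∈ Ω ×ˢ (univ : Set E) ∧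
        HasDerivAt (fun s => Φ (s, z)) (sprayF Γ (Φ (s, z))) s) ∧ Φ (0, z) = z := by
    obtain ⟨p1, h1, p2, h2', h12⟩ := Filter.eventually_prod_iff.1 hev
    obtain ⟨δ, hδ, h1'⟩ := Metric.eventually_nhds_iff.1 h1
    obtain ⟨ρ, hρ, h2''⟩ := Metric.eventually_nhds_iff.1 (h2'.and h2)
    exact ⟨δ, hδ, ρ, hρ, fun s hs z hz => ⟨h12 (h1' (by simpa using hs)) (h2'' hz).1, (h2'' hz).2⟩⟩
  have hU : IsOpen (tangentParam I P '' (Ω ×ˢ univ) ∩ tangentParamInv Q ⁻¹' Metric.ball z₀ ρ) :=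
    hT.smooth_inv.continuousOn.isOpen_inter_preimage hT.isOpen_image Metric.isOpen_ball
  have hδ0 : (0 : ℝ) ∈ Ioo (-δ) δ := ⟨by linarith, hδ⟩
  have key : ∀ s, |s| < δ → ∀ v ∈ tangentParam I P '' (Ω ×ˢ univ) ∩
      tangentParamInv Q ⁻¹' Metric.ball z₀ ρ, v ∈ flowDomain g s ∧
        geodesicFlow g s v = tangentParam I P (Φ (s, tangentParamInv Q v)) := by
    rintro s hs v ⟨hv, hv'⟩
    have hc : IsSprayCurve g (fun r => tangentParam I P (Φ (r, tangentParamInv Q v))) (-δ) δ := by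
      intro r hr
      obtain ⟨⟨-, k1, k2⟩, -⟩ := K r (abs_lt.2 hr) _ hv'
      have := hT.hasVel (z := fun r => Φ (r, tangentParamInv Q v)) k1 k2
      rwa [D.spray_eq k1.1] at this
    have := hc.geodesicFlow_eq hg hδ0 (abs_lt.1 hs)
    simp only [(K 0 (by simpa using hδ) _ hv').2, hT.right_inv hv] at this
    exact this
  refine ⟨δ, hδ, _, hU, ⟨mem_image_of_mem _ hzz, ?_⟩, fun s hs v hv => ⟨(key s hs v hv).1, ?_⟩⟩
  · rw [mem_preimage, hT.left_inv _ hzz]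
    exact Metric.mem_ball_self hρ
  · have hle : (n : WithTop ℕ∞) ≤ (∞ : WithTop ℕ∞) := by exact_mod_cast le_top
    obtain ⟨⟨k1, k2, -⟩, -⟩ := K s hs _ hv.2
    obtain ⟨y, hy, rfl⟩ := hv.1
    have c1 : ContMDiffAt (𝓘(ℝ, ℝ).prod I.tangent) 𝓘(ℝ, ℝ × (E × E)) n
        (fun p : ℝ × TangentBundle I N => (p.1, tangentParamInv Q p.2)) (s, tangentParam I P y) := by
      refine contMDiffAt_fst.prodMk_space ?_
      exact ContMDiffAt.comp (g := tangentParamInv Q) (s, tangentParam I P y)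
        ((hT.contMDiffAt_inv hy).of_le hle) contMDiffAt_snd
    have c2 : ContMDiffAt (𝓘(ℝ, ℝ).prod I.tangent) I.tangent n
        (fun p : ℝ × TangentBundle I N => tangentParam I P (Φ (p.1, tangentParamInv Q p.2)))
        (s, tangentParam I P y) := by
      have c3 : ContMDiffAt 𝓘(ℝ, ℝ × (E × E)) I.tangent n (fun q => tangentParam I P (Φ q))
          (s, tangentParamInv Q (tangentParam I P y)) :=
        ContMDiffAt.comp _ ((hT.contMDiffAt k2).of_le hle) k1.contMDiffAt
      exact ContMDiffAt.comp (s, tangentParam I P y) c3 c1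
    refine c2.congr_of_eventuallyEq ?_
    have ho : IsOpen (Ioo (-δ) δ) := isOpen_Ioo
    filter_upwards [(ho.prod hU).mem_nhds ⟨abs_lt.1 hs, hv⟩] with p hp
    exact (key p.1 (abs_lt.2 hp.1) p.2 hp.2).2

/-- The domain of the geodesic flow is open, and the flow is smooth. -/
theorem contMDiffAt_geodesicFlow {t : ℝ} {v : TangentBundle I N} (hv : v ∈ flowDomain g t) {n : ℕ}
    (hn : n ≠ 0) :
    ContMDiffAt (𝓘(ℝ, ℝ).prod I.tangent) I.tangent n
      (fun p : ℝ × TangentBundle I N => geodesicFlow g p.1 p.2) (t, v) ∧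
    ∀ᶠ p in 𝓝 (t, v), p.2 ∈ flowDomain g p.1 := by
  obtain ⟨w, hw⟩ := hv
  obtain ⟨V, a, b, hV, h0, ht, rfl, rfl⟩ := (flowsTo_iff hg).1 hw
  set G : Set ℝ := {t | ContMDiffAt (𝓘(ℝ, ℝ).prod I.tangent) I.tangent n
      (fun p : ℝ × TangentBundle I N => geodesicFlow g p.1 p.2) (t, V 0) ∧
    ∀ᶠ p in 𝓝 (t, V 0), p.2 ∈ flowDomain g p.1} with hG
  have hpath : ∀ v : TangentBundle I N, Continuous fun s : ℝ => (s, v) := fun v => by fun_prop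
  have hopen : IsOpen G := by
    rw [isOpen_iff_mem_nhds]
    rintro s ⟨h1, h2⟩
    have h3 := ((contMDiffAt_iff_contMDiffAt_nhds (by simp)).1 h1).and h2.eventually_nhds
    exact (hpath (V 0)).continuousAt.eventually h3
  have hlocal : ∀ s v, (∃ δ > 0, ∃ U : Set (TangentBundle I N), IsOpen U ∧ v ∈ U ∧
      ∀ s, |s| < δ → ∀ v ∈ U, v ∈ flowDomain g s ∧
        ContMDiffAt (𝓘(ℝ, ℝ).prod I.tangent) I.tangent n
        (fun p : ℝ × TangentBundle I N => geodesicFlow g p.1 p.2) (s, v)) → s = (0 : ℝ) →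
      ∀ᶠ p in 𝓝 (s, v), p.2 ∈ flowDomain g p.1 := by
    rintro s v ⟨δ, hδ, U, hU, hvU, h⟩ rfl
    have ho : IsOpen (Ioo (-δ) δ) := isOpen_Ioo
    filter_upwards [(ho.prod hU).mem_nhds (x := (0, v)) ⟨⟨by linarith, hδ⟩, hvU⟩] with p hp
    exact (h p.1 (abs_lt.2 hp.1) p.2 hp.2).1
  have hsub : Ioo a b ⊆ G := by
    -- The good times form an open set containing `0`, and they are closed in `(a, b)`: near a limit
    -- time `r` the short-time flow exists for a uniform time `δ` around `V r`, and it can be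
    -- composed with `φ_s` for a good time `s` within `δ` of `r`. Connectedness finishes the
    -- argument.
    refine isPreconnected_Ioo.subset_of_closure_inter_subset hopen ⟨0, h0, ?_⟩ ?_
    · have hl := exists_local_geodesicFlow hg (V 0) hn
      refine ⟨?_, hlocal 0 _ hl rfl⟩
      obtain ⟨δ, hδ, U, hU, hvU, h⟩ := hl
      exact (h 0 (by simpa using hδ) _ hvU).2
    · rintro r ⟨hr, hrab⟩
      obtain ⟨δ, hδ, U, hU, hvU, h⟩ := exists_local_geodesicFlow hg (V r) hn
      have hnb : Ioo (r - δ) (r + δ) ∩ (Ioo a b ∩ V ⁻¹' U) ∈ 𝓝 r := by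
        refine Filter.inter_mem (Ioo_mem_nhds (by linarith) (by linarith))
          (Filter.inter_mem (isOpen_Ioo.mem_nhds hrab) ?_)
        exact (hV r hrab).continuousAt.preimage_mem_nhds (hU.mem_nhds hvU)
      obtain ⟨s, ⟨hs1, hs2, hs3⟩, hsG⟩ := mem_closure_iff_nhds.1 hr _ hnb
      have hes := (hV.geodesicFlow_eq hg h0 hs2).2
      have hslice : Continuous fun v : TangentBundle I N => (s, v) := by fun_prop
      have hφs : ContMDiffAt I.tangent I.tangent n (geodesicFlow g s) (V 0) :=
        ContMDiffAt.comp (V 0) (f := fun v : TangentBundle I N => (s, v)) hsG.1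
          (contMDiffAt_const.prodMk contMDiffAt_id)
      have e1 : ∀ᶠ v in 𝓝 (V 0), v ∈ flowDomain g s ∧ geodesicFlow g s v ∈ U := by
        refine (hslice.continuousAt.eventually hsG.2).and ?_
        exact hφs.continuousAt.eventually_mem (by rw [hes]; exact hU.mem_nhds hs3)
      have e2 : ∀ᶠ p in 𝓝 (r, V 0), p.2 ∈ flowDomain g p.1 ∧
          geodesicFlow g p.1 p.2 = geodesicFlow g (p.1 - s) (geodesicFlow g s p.2) := by
        have e3 : ∀ᶠ q in 𝓝 r, |q - s| < δ := by
          filter_upwards [Ioo_mem_nhds (show s - δ < r by linarith [hs1.2])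
            (show r < s + δ by linarith [hs1.1])] with q hq
          rw [abs_lt]
          exact ⟨by linarith [hq.1], by linarith [hq.2]⟩
        have e4 : ∀ᶠ p in 𝓝 (r, V 0), |p.1 - s| < δ :=
          (continuous_fst.continuousAt (x := (r, V 0))).eventually e3
        have e5 : ∀ᶠ p in 𝓝 (r, V 0), p.2 ∈ flowDomain g s ∧ geodesicFlow g s p.2 ∈ U :=
          (continuous_snd.continuousAt (x := (r, V 0))).eventually e1
        filter_upwards [e4, e5] with p h4 h5
        have := geodesicFlow_add hg h5.1 (h (p.1 - s) h4 _ h5.2).1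
        simpa using this
      refine ⟨?_, e2.mono fun p hp => hp.1⟩
      have c1 : ContMDiffAt (𝓘(ℝ, ℝ).prod I.tangent) (𝓘(ℝ, ℝ).prod I.tangent) n
          (fun p : ℝ × TangentBundle I N => (p.1 - s, geodesicFlow g s p.2)) (r, V 0) := by
        refine ContMDiffAt.prodMk ?_ ?_
        · exact contMDiffAt_fst.sub contMDiffAt_const
        · exact ContMDiffAt.comp (r, V 0) (g := geodesicFlow g s) hφs contMDiffAt_snd
      have c2 := (h (r - s) (by rw [abs_lt]; exact ⟨by linarith [hs1.2], by linarith [hs1.1]⟩) _ hs3).2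
      rw [← hes] at c2
      refine (ContMDiffAt.comp (r, V 0) c2 c1).congr_of_eventuallyEq ?_
      exact e2.mono fun p hp => hp.2
  exact hsub ht

theorem mem_flowDomain_zero (v : TangentBundle I N) :
    v ∈ flowDomain g 0 ∧ geodesicFlow g 0 v = v := by
  obtain ⟨δ, hδ, U, hU, hvU, h⟩ := exists_local_geodesicFlow hg v one_ne_zero
  have h1 := (h 0 (by simpa using hδ) v hvU).1
  obtain ⟨w, hw⟩ := h1
  have h2 := hw
  obtain ⟨V, a, b, hV, h0, ht, rfl, rfl⟩ := (flowsTo_iff hg).1 hw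
  exact ⟨⟨_, hw⟩, hw.eq_geodesicFlow hg⟩

end GeodesicFlow

/-! ### Covariant derivatives and curvature of vector fields in coordinates -/

section CurvatureInCoordinates

variable {E : Type*} [NormedAddCommGroup E] [NormedSpace ℝ E]
  {H : Type*} [TopologicalSpace H] {I : ModelWithCorners ℝ E H}
  {N : Type*} [TopologicalSpace N] [ChartedSpace H N]

/-- The field `X` has coordinates `ξ` near the point with coordinates `y`. -/
def IsRep (P : E → N) (X : (p : N) → TangentSpace I p) (ξ : E → E) (y : E) : Prop :=
  ∀ᶠ z in 𝓝 y, X (P z) = (mD 𝓘(ℝ, E) I P z (ξ z) : E)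

variable [IsManifold I ∞ N] [IsManifold I 1 N]

omit [IsManifold I ∞ N] in
theorem IsParam.section_eventuallyEq {P : E → N} {Q : N → E} {Ω : Set E} (hP : IsParam I P Q Ω)
    {y : E} (hy : y ∈ Ω) {X : (p : N) → TangentSpace I p} {ξ : E → E} (hX : IsRep P X ξ y) :
    (fun q => (⟨q, X q⟩ : TangentBundle I N)) =ᶠ[𝓝 (P y)]
      fun q => tangentParam I P (Q q, ξ (Q q)) := by
  have h1 : ∀ᶠ q in 𝓝 (P y), X (P (Q q)) = (mD 𝓘(ℝ, E) I P (Q q) (ξ (Q q)) : E) := by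
    have hc := (hP.contMDiffAt_inv hy).continuousAt
    have hX' : ∀ᶠ z in 𝓝 (Q (P y)), X (P z) = (mD 𝓘(ℝ, E) I P z (ξ z) : E) := by
      rw [hP.left_inv y hy]
      exact hX
    exact hc.eventually hX'
  filter_upwards [h1, hP.image_mem_nhds hy] with q hq hq'
  obtain ⟨z, hz, rfl⟩ := hq'
  rw [hP.left_inv z hz] at hq ⊢
  exact congrArg (mkT I (P z)) hq

variable [I.Boundaryless] {g : (p : N) → TangentSpace I p → TangentSpace I p → ℝ}

namespace ChartData

variable {P : E → N} {Q : N → E} {Ω : Set E} {B : E → E →L[ℝ] E →L[ℝ] ℝ}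
  {Γ : E → E →L[ℝ] E →L[ℝ] E} (D : ChartData I g P Q Ω B Γ)
include D

omit [I.Boundaryless] in
theorem mdifferentiableAt_section {y : E} (hy : y ∈ Ω) {X : (p : N) → TangentSpace I p} {ξ : E → E}
    (hX : IsRep P X ξ y) (hξ : DifferentiableAt ℝ ξ y) :
    MDifferentiableAt I I.tangent (fun q => (⟨q, X q⟩ : TangentBundle I N)) (P y) := by
  have h1 := D.param.section_eventuallyEq hy hX
  refine MDifferentiableAt.congr_of_eventuallyEq ?_ h1
  have h2 : DifferentiableAt ℝ (fun z => (z, ξ z)) y := differentiableAt_id.prodMk hξ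
  have h3 : MDifferentiableAt 𝓘(ℝ, E) I.tangent (fun z => tangentParam I P (z, ξ z)) y :=
    MDifferentiableAt.comp y (D.param.tangent.mdifferentiableAt ⟨hy, mem_univ _⟩)
      h2.mdifferentiableAt
  have h4 : MDifferentiableAt 𝓘(ℝ, E) I.tangent (fun z => tangentParam I P (z, ξ z)) (Q (P y)) := by
    rw [D.param.left_inv y hy]
    exact h3
  exact MDifferentiableAt.comp (g := fun z => tangentParam I P (z, ξ z)) (f := Q) (P y) h4
    (D.param.mdifferentiableAt_inv hy)

theorem nabla_eq {X Y : (p : N) → TangentSpace I p} {η : E → E} {y : E} (hy : y ∈ Ω)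
    (hY : IsRep P Y η y) (hη : DifferentiableAt ℝ η y) {a : E}
    (hX : X (P y) = (mD 𝓘(ℝ, E) I P y a : E)) :
    nabla g X Y (P y) = (mD 𝓘(ℝ, E) I P y (fderiv ℝ η y a + Γ y a (η y)) : E) := by
  have hT := D.param.tangent
  have hS := D.mdifferentiableAt_section hy hY hη
  have h1 : mD I I.tangent (fun q => (⟨q, Y q⟩ : TangentBundle I N)) (P y)
      (mD 𝓘(ℝ, E) I P y a) =
      mD 𝓘(ℝ, E × E) I.tangent (tangentParam I P) (y, η y) (a, fderiv ℝ η y a) := by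
    rw [← mD_comp_apply hS (D.param.mdifferentiableAt hy)]
    have h2 : (fun z => (⟨P z, Y (P z)⟩ : TangentBundle I N)) =ᶠ[𝓝 y]
        fun z => tangentParam I P (z, η z) := by
      filter_upwards [hY] with z hz
      exact congrArg (mkT I (P z)) hz
    have hd : HasFDerivAt (fun z => (z, η z)) ((ContinuousLinearMap.id ℝ E).prod (fderiv ℝ η y)) y :=
      (hasFDerivAt_id y).prodMk hη.hasFDerivAt
    rw [mD_congr h2, mD_comp_apply (f := fun z => (z, η z)) (g := tangentParam I P)
      (hT.mdifferentiableAt ⟨hy, mem_univ _⟩) hd.differentiableAt.mdifferentiableAt, mD_eq_fderiv,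
      hd.fderiv]
    rfl
  have h3 : (⟨P y, Y (P y)⟩ : TangentBundle I N) = tangentParam I P (y, η y) :=
    congrArg (mkT I (P y)) hY.self_of_nhds
  have h4 : nabla g X Y (P y) = Sasaki.connector g (mkT I (P y) (Y (P y)))
      (mD I I.tangent (fun q => (⟨q, Y q⟩ : TangentBundle I N)) (P y) (X (P y))) := rfl
  rw [h4, hX, h1]
  have h5 := D.connector (z := (y, η y)) hy (a, fderiv ℝ η y a)
  rw [kap_apply] at h5
  rw [← h5, ← h3]
  rfl

theorem isRep_nabla {X Y : (p : N) → TangentSpace I p} {ξ η : E → E} {y : E} (hy : y ∈ Ω)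
    (hX : IsRep P X ξ y) (hY : IsRep P Y η y) (hη : ContDiffAt ℝ ∞ η y) :
    IsRep P (nabla g X Y) (fun z => fderiv ℝ η z (ξ z) + Γ z (ξ z) (η z)) y := by
  have h1 : ∀ᶠ z in 𝓝 y, DifferentiableAt ℝ η z :=
    ((hη.of_le (m := 1) (by norm_cast)).eventually (by simp)).mono fun z hz =>
      hz.differentiableAt (by simp)
  filter_upwards [D.param.mem_nhds hy, hX, hY.eventually_nhds, h1] with z hz h2 h3 h4
  exact D.nabla_eq hz h3 h4 h2

end ChartData

/-- The Lie bracket at `x` is defined through the preferred chart at `x`, so only there is it read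
off directly. Torsion-freeness, derived from this, carries the formula to arbitrary
parametrizations. -/
theorem mlieBracket_eq_of_isRep {x : N} {A B : (p : N) → TangentSpace I p} {α β : E → E}
    (hA : IsRep (extChartAt I x).symm A α (extChartAt I x x))
    (hB : IsRep (extChartAt I x).symm B β (extChartAt I x x)) :
    VectorField.mlieBracket I A B x = (fderiv ℝ β (extChartAt I x x) (α (extChartAt I x x))
      - fderiv ℝ α (extChartAt I x x) (β (extChartAt I x x)) : E) := by
  have hP := isParam_extChartAt (I := I) x
  have hy := mem_extChartAt_target (I := I) x
  have key : ∀ {A : (p : N) → TangentSpace I p} {α : E → E},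
      IsRep (extChartAt I x).symm A α (extChartAt I x x) →
      (fun z => (VectorField.mpullbackWithin 𝓘(ℝ, E) I (extChartAt I x).symm A (range I) z : E))
        =ᶠ[𝓝 (extChartAt I x x)] α := by
    intro A α hA
    filter_upwards [hA, hP.mem_nhds hy] with z hz hz'
    have h1 : (VectorField.mpullbackWithin 𝓘(ℝ, E) I (extChartAt I x).symm A (range I) z : E) =
        (mD 𝓘(ℝ, E) I (extChartAt I x).symm z).inverse (A ((extChartAt I x).symm z) : E) := by
      rw [VectorField.mpullbackWithin_apply, I.range_eq_univ, mfderivWithin_univ]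
      rfl
    have h2 : (mD 𝓘(ℝ, E) I (extChartAt I x).symm z).inverse =
        mD I 𝓘(ℝ, E) (extChartAt I x) ((extChartAt I x).symm z) := by
      refine ContinuousLinearMap.inverse_eq ?_ ?_
      · ext a; exact hP.mD_mD_inv hz' a
      · ext a; exact hP.mD_inv_mD hz' a
    rw [h1, h2, hz, hP.mD_inv_mD hz']
  have h1 := key hA
  have h2 := key hB
  have h3 : VectorField.mlieBracket I A B x =
      (mD I 𝓘(ℝ, E) (extChartAt I x) x).inverse (VectorField.lieBracketWithin ℝ
      (fun z => (VectorField.mpullbackWithin 𝓘(ℝ, E) I (extChartAt I x).symm A (range I) z : E))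
      (fun z => (VectorField.mpullbackWithin 𝓘(ℝ, E) I (extChartAt I x).symm B (range I) z : E))
      ((extChartAt I x).symm ⁻¹' univ ∩ range I) (extChartAt I x x)) := rfl
  have h4 : ((extChartAt I x).symm ⁻¹' univ ∩ range I : Set E) = univ := by
    rw [I.range_eq_univ, preimage_univ, univ_inter]
  have h5 : ∀ A' B' : E → E, A' =ᶠ[𝓝 (extChartAt I x x)] α → B' =ᶠ[𝓝 (extChartAt I x x)] β →
      (mD I 𝓘(ℝ, E) (extChartAt I x) x).inverse (VectorField.lieBracketWithin ℝ A' B'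
        ((extChartAt I x).symm ⁻¹' univ ∩ range I) (extChartAt I x x)) =
      fderiv ℝ β (extChartAt I x x) (α (extChartAt I x x))
        - fderiv ℝ α (extChartAt I x x) (β (extChartAt I x x)) := by
    intro A' B' h1 h2
    rw [h4, mD_extChartAt_self, VectorField.lieBracketWithin_univ, VectorField.lieBracket,
      h1.fderiv_eq, h2.fderiv_eq, h1.self_of_nhds, h2.self_of_nhds, ContinuousLinearMap.inverse_id]
    rfl
  exact h3.trans (h5 _ _ h1 h2)

variable (hg : IsRiemannian I g)
include hg

/-- The Levi-Civita connection is torsion-free. -/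
theorem mlieBracket_eq_nabla {x : N} {A B : (p : N) → TangentSpace I p}
    (hA : MDifferentiableAt I I.tangent (fun q => (⟨q, A q⟩ : TangentBundle I N)) x)
    (hB : MDifferentiableAt I I.tangent (fun q => (⟨q, B q⟩ : TangentBundle I N)) x) :
    VectorField.mlieBracket I A B x = (nabla g A B x - nabla g B A x : E) := by
  obtain ⟨B', Γ, D⟩ := hg x
  have hy := mem_extChartAt_target (I := I) x
  have hx : (extChartAt I x).symm (extChartAt I x x) = x := extChartAt_to_inv x
  have key : ∀ {A : (p : N) → TangentSpace I p},
      MDifferentiableAt I I.tangent (fun q => (⟨q, A q⟩ : TangentBundle I N)) x →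
      ∃ α : E → E, IsRep (extChartAt I x).symm A α (extChartAt I x x) ∧
        DifferentiableAt ℝ α (extChartAt I x x) := by
    intro A hA
    refine ⟨fun z => (tangentParamInv (extChartAt I x)
      (mkT I ((extChartAt I x).symm z) (A ((extChartAt I x).symm z)))).2, ?_, ?_⟩
    · filter_upwards [D.param.mem_nhds hy] with z hz
      exact (D.param.mD_mD_inv hz _).symm
    · refine DifferentiableAt.snd ?_
      rw [← mdifferentiableAt_iff_differentiableAt]
      obtain ⟨w, hw, e⟩ := D.param.exists_tangentParam (V := mkT I x (A x))
        ⟨_, hy, hx⟩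
      have h1 : MDifferentiableAt I.tangent 𝓘(ℝ, E × E) (tangentParamInv (extChartAt I x))
          (mkT I x (A x)) := by
        rw [← e]
        exact D.param.tangent.mdifferentiableAt_inv ⟨hw, mem_univ _⟩
      have h2 : MDifferentiableAt I 𝓘(ℝ, E × E)
          (fun q => tangentParamInv (extChartAt I x) (mkT I q (A q))) x :=
        MDifferentiableAt.comp x h1 hA
      refine MDifferentiableAt.comp (extChartAt I x x) (g := fun q =>
        tangentParamInv (extChartAt I x) (mkT I q (A q))) ?_ (D.param.mdifferentiableAt hy)
      rwa [hx]
  obtain ⟨α, hα, hα'⟩ := key hA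
  obtain ⟨β, hβ, hβ'⟩ := key hB
  have h1 := D.nabla_eq (X := A) hy hβ hβ' hα.self_of_nhds
  have h2 := D.nabla_eq (X := B) hy hα hα' hβ.self_of_nhds
  rw [mD_extChartAt_symm_self] at h1 h2
  have h3 : ∀ {A B : (p : N) → TangentSpace I p}, (nabla g A B
      ((extChartAt I x).symm (extChartAt I x x)) : E) = (nabla g A B x : E) := by
    intro A B
    rw [hx]
  rw [mlieBracket_eq_of_isRep hα hβ, ← h3 (A := A), ← h3 (A := B), h1, h2,
    D.lc.symm _ hy (β _)]
  simp only [ContinuousLinearMap.id_apply]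
  abel

namespace ChartData

variable {P : E → N} {Q : N → E} {Ω : Set E} {B : E → E →L[ℝ] E →L[ℝ] ℝ}
  {Γ : E → E →L[ℝ] E →L[ℝ] E} (D : ChartData I g P Q Ω B Γ)
include D

/-- All derivatives of the coefficient functions cancel, by the symmetry of the second derivative of
`ζ` and by the bracket term. This is the tensoriality of curvature: only the values at the point
enter. -/
theorem curvature_eq {X Y Z : (p : N) → TangentSpace I p} {ξ η ζ : E → E} {y : E} (hy : y ∈ Ω)
    (hX : IsRep P X ξ y) (hY : IsRep P Y η y) (hZ : IsRep P Z ζ y) (hξ : ContDiffAt ℝ ∞ ξ y)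
    (hη : ContDiffAt ℝ ∞ η y) (hζ : ContDiffAt ℝ ∞ ζ y) :
    curvature g X Y Z (P y) = (mD 𝓘(ℝ, E) I P y (curv Γ y (ξ y) (η y) (ζ y)) : E) := by
  have dΓ := D.lc.differentiableAt hy
  have d1 : ∀ {ζ : E → E}, ContDiffAt ℝ ∞ ζ y → DifferentiableAt ℝ ζ y := fun h =>
    h.differentiableAt (by simp)
  have d2 : DifferentiableAt ℝ (fderiv ℝ ζ) y :=
    (hζ.fderiv_right (m := 1) (by norm_cast)).differentiableAt (by simp)
  have hb : VectorField.mlieBracket I X Y (P y) =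
      (mD 𝓘(ℝ, E) I P y (fderiv ℝ η y (ξ y) - fderiv ℝ ξ y (η y)) : E) := by
    refine (mlieBracket_eq_nabla hg (D.mdifferentiableAt_section hy hX (d1 hξ))
      (D.mdifferentiableAt_section hy hY (d1 hη))).trans ((congrArg₂ (fun a b : E => a - b)
      (D.nabla_eq hy hY (d1 hη) hX.self_of_nhds)
      (D.nabla_eq hy hX (d1 hξ) hY.self_of_nhds)).trans ?_)
    refine (map_sub (mD 𝓘(ℝ, E) I P y) _ _).symm.trans (congrArg (mD 𝓘(ℝ, E) I P y) ?_)
    rw [D.lc.symm y hy (η y) (ξ y)]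
    abel
  have hd : ∀ {η : E → E}, ContDiffAt ℝ ∞ η y → ∀ a : E, DifferentiableAt ℝ
      (fun z => fderiv ℝ ζ z (η z) + Γ z (η z) (ζ z)) y ∧
      fderiv ℝ (fun z => fderiv ℝ ζ z (η z) + Γ z (η z) (ζ z)) y a =
      fderiv ℝ (fderiv ℝ ζ) y a (η y) + fderiv ℝ ζ y (fderiv ℝ η y a) + fderiv ℝ Γ y a (η y) (ζ y)
        + Γ y (fderiv ℝ η y a) (ζ y) + Γ y (η y) (fderiv ℝ ζ y a) := by
    intro η hη a
    have h1 := (d2.hasFDerivAt.clm_apply (d1 hη).hasFDerivAt).add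
      ((dΓ.hasFDerivAt.clm_apply (d1 hη).hasFDerivAt).clm_apply (d1 hζ).hasFDerivAt)
    refine ⟨h1.differentiableAt, (DFunLike.congr_fun h1.fderiv a).trans ?_⟩
    simp
    abel
  have e1 := D.nabla_eq hy (D.isRep_nabla hy hY hZ hζ) (hd hη 0).1 hX.self_of_nhds
  have e2 := D.nabla_eq hy (D.isRep_nabla hy hX hZ hζ) (hd hξ 0).1 hY.self_of_nhds
  have e3 := D.nabla_eq hy hZ (d1 hζ) hb
  have e4 : curvature g X Y Z (P y) = (nabla g X (nabla g Y Z) (P y) - nabla g Y (nabla g X Z) (P y)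
    - nabla g (VectorField.mlieBracket I X Y) Z (P y) : E) := rfl
  have e5 : ∀ a b c : E, (mD 𝓘(ℝ, E) I P y a - mD 𝓘(ℝ, E) I P y b - mD 𝓘(ℝ, E) I P y c : E) =
      mD 𝓘(ℝ, E) I P y (a - b - c) := fun a b c => by rw [map_sub, map_sub]
  have hs : fderiv ℝ (fderiv ℝ ζ) y (ξ y) (η y) = fderiv ℝ (fderiv ℝ ζ) y (η y) (ξ y) :=
    (hζ.isSymmSndFDerivAt (by simp; norm_cast)) (ξ y) (η y)
  refine e4.trans ((congrArg₂ (fun a b : E => a - b) (congrArg₂ (fun a b : E => a - b) e1 e2)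
    e3).trans ((e5 _ _ _).trans (congrArg (mD 𝓘(ℝ, E) I P y) ?_)))
  rw [(hd hη _).2, (hd hξ _).2, hs]
  simp only [curv, map_add, map_sub, sub_apply]
  abel

/-- The covariant derivative of the curvature tensor on fields with constant coefficients. -/
theorem nablaCurvature_eq {W X Y Z : (p : N) → TangentSpace I p} {w a b c : E} {y : E} (hy : y ∈ Ω)
    (hW : IsRep P W (fun _ => w) y) (hX : IsRep P X (fun _ => a) y)
    (hY : IsRep P Y (fun _ => b) y) (hZ : IsRep P Z (fun _ => c) y) :
    nablaCurvature g W X Y Z (P y) = (mD 𝓘(ℝ, E) I P y (dcurv Γ y w a b c) : E) := by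
  have hc : ∀ a : E, ContDiffAt ℝ ∞ (fun _ : E => a) y := fun a => contDiffAt_const
  have hR : IsRep P (curvature g X Y Z) (fun y => curv Γ y a b c) y := by
    have h0 : ∀ {X : (p : N) → TangentSpace I p} {a : E}, IsRep P X (fun _ => a) y →
        ∀ᶠ z in 𝓝 y, IsRep P X (fun _ => a) z := fun h => h.eventually_nhds
    have h1 : ∀ᶠ z in 𝓝 y, z ∈ Ω ∧ IsRep P X (fun _ => a) z ∧ IsRep P Y (fun _ => b) z ∧
        IsRep P Z (fun _ => c) z :=
      Filter.Eventually.and (D.param.mem_nhds hy) ((h0 hX).and ((h0 hY).and (h0 hZ)))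
    refine Filter.Eventually.mono h1 fun z h2 => ?_
    exact D.curvature_eq hg (ξ := fun _ => a) (η := fun _ => b) (ζ := fun _ => c) h2.1 h2.2.1
      h2.2.2.1 h2.2.2.2 contDiffAt_const contDiffAt_const contDiffAt_const
  have hΓ : ∀ a b : E, ContDiffAt ℝ ∞ (fun y => Γ y a b) y := fun a b =>
    ((D.lc.contDiffAt hy).clm_apply contDiffAt_const).clm_apply contDiffAt_const
  have hn : ∀ {X : (p : N) → TangentSpace I p} {a : E}, IsRep P X (fun _ => a) y →
      IsRep P (nabla g W X) (fun y => Γ y w a) y := by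
    intro X a hX
    have := D.isRep_nabla hy hW hX (hc a)
    simpa using this
  have hRd : DifferentiableAt ℝ (fun y => curv Γ y a b c) y := by
    have hd := D.lc.contDiffAt hy
    have hd' : ContDiffAt ℝ ∞ (fderiv ℝ Γ) y := hd.fderiv_right (by simp)
    have k1 : ∀ u v w : E, ContDiffAt ℝ ∞ (fun y => fderiv ℝ Γ y u v w) y := fun u v w =>
      ((hd'.clm_apply (hc u)).clm_apply (hc v)).clm_apply (hc w)
    have k2 : ∀ u v w : E, ContDiffAt ℝ ∞ (fun y => Γ y u (Γ y v w)) y := fun u v w =>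
      (hd.clm_apply (hc u)).clm_apply (hΓ v w)
    exact ((((k1 a b c).sub (k1 b a c)).add (k2 a b c)).sub (k2 b a c)).differentiableAt (by simp)
  have e1 := D.nabla_eq hy hR hRd hW.self_of_nhds
  have e2 := D.curvature_eq hg hy (hn hX) hY hZ (hΓ w a) (hc b) (hc c)
  have e3 := D.curvature_eq hg hy hX (hn hY) hZ (hc a) (hΓ w b) (hc c)
  have e4 := D.curvature_eq hg hy hX hY (hn hZ) (hc a) (hc b) (hΓ w c)
  have e5 : nablaCurvature g W X Y Z (P y) = (nabla g W (curvature g X Y Z) (P y)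
    - curvature g (nabla g W X) Y Z (P y) - curvature g X (nabla g W Y) Z (P y)
    - curvature g X Y (nabla g W Z) (P y) : E) := rfl
  have e6 : ∀ a b c d : E, (mD 𝓘(ℝ, E) I P y a - mD 𝓘(ℝ, E) I P y b - mD 𝓘(ℝ, E) I P y c
      - mD 𝓘(ℝ, E) I P y d : E) = mD 𝓘(ℝ, E) I P y (a - b - c - d) := fun a b c d => by
    rw [map_sub, map_sub, map_sub]
  exact e5.trans ((congrArg₂ (fun a b : E => a - b) (congrArg₂ (fun a b : E => a - b)
    (congrArg₂ (fun a b : E => a - b) e1 e2) e3) e4).trans (e6 _ _ _ _))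

end ChartData

end CurvatureInCoordinates

/-! ### From the curvature norms to bounds on the local curvature tensors -/

section CurvatureBounds

variable {m : ℕ} {M : Type*} [EMetricSpace M] [ChartedSpace (EuclideanSpace ℝ (Fin m)) M]
  [IsManifold (𝓡 m) ∞ M]

/-- A vector with coordinates `a` extends to a smooth field with locally constant coordinates. -/
theorem exists_smoothField [RiemannianBundle (fun x : M => TangentSpace (𝓡 m) x)] (p : M)
    (a : EuclideanSpace ℝ (Fin m)) :
    ∃ X : (q : M) → TangentSpace (𝓡 m) q, IsSmoothField X ∧
      IsRep (extChartAt (𝓡 m) p).symm X (fun _ => a) (extChartAt (𝓡 m) p p) := by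
  classical
  have hP := isParam_extChartAt (I := 𝓡 m) p
  let χ : SmoothBumpFunction (𝓡 m) p := Classical.arbitrary _
  let s : (q : M) → TangentSpace (𝓡 m) q := fun q =>
    mD 𝓘(ℝ, EuclideanSpace ℝ (Fin m)) (𝓡 m) (extChartAt (𝓡 m) p).symm (extChartAt (𝓡 m) p q) a
  have him : (extChartAt (𝓡 m) p).symm '' (extChartAt (𝓡 m) p).target =
    (chartAt (EuclideanSpace ℝ (Fin m)) p).source := by
    rw [(extChartAt (𝓡 m) p).symm_image_target_eq_source, extChartAt_source]
  have hs : ContMDiffOn (𝓡 m) (𝓡 m).tangent ∞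
      (fun q => (⟨q, s q⟩ : TangentBundle (𝓡 m) M))
      (chartAt (EuclideanSpace ℝ (Fin m)) p).source := by
    have h1 : ContMDiffOn (𝓡 m) 𝓘(ℝ, EuclideanSpace ℝ (Fin m) × EuclideanSpace ℝ (Fin m)) ∞
        (fun q => (extChartAt (𝓡 m) p q, a)) (chartAt (EuclideanSpace ℝ (Fin m)) p).source := by
      rw [← him]
      exact hP.smooth_inv.prodMk_space contMDiffOn_const
    have h2 := hP.tangent.smooth.comp h1 (fun q hq => ⟨by
      rw [← him] at hq
      exact hP.inv_mem hq, mem_univ _⟩)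
    refine h2.congr fun q hq => ?_
    have hq' : q ∈ (extChartAt (𝓡 m) p).source := by rwa [extChartAt_source]
    have e : (extChartAt (𝓡 m) p).symm (extChartAt (𝓡 m) p q) = q := (extChartAt (𝓡 m) p).left_inv hq'
    change mkT (𝓡 m) q (s q) = mkT (𝓡 m) ((extChartAt (𝓡 m) p).symm (extChartAt (𝓡 m) p q)) (s q)
    rw [e]
  refine ⟨fun q => χ q • s q, ?_, ?_⟩
  · exact ContMDiffOn.smul_section_of_tsupport (V := fun q : M => TangentSpace (𝓡 m) q)
      χ.contMDiff.contMDiffOn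
      (chartAt (EuclideanSpace ℝ (Fin m)) p).open_source χ.tsupport_subset_chartAt_source hs
  · have h1 : ∀ᶠ q in 𝓝 p, χ q = 1 := χ.eventuallyEq_one
    have hy := mem_extChartAt_target (I := 𝓡 m) p
    have hx : (extChartAt (𝓡 m) p).symm (extChartAt (𝓡 m) p p) = p := extChartAt_to_inv p
    have h2 : ∀ᶠ z in 𝓝 (extChartAt (𝓡 m) p p), χ ((extChartAt (𝓡 m) p).symm z) = 1 := by
      have h3 := (hP.contMDiffAt hy).continuousAt.tendsto
      rw [hx] at h3
      exact h3.eventually h1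
    filter_upwards [h2, hP.mem_nhds hy] with z hz hz'
    have h4 : s ((extChartAt (𝓡 m) p).symm z) = (mD 𝓘(ℝ, EuclideanSpace ℝ (Fin m)) (𝓡 m)
        (extChartAt (𝓡 m) p).symm z a : EuclideanSpace ℝ (Fin m)) := by
      change mD 𝓘(ℝ, EuclideanSpace ℝ (Fin m)) (𝓡 m) (extChartAt (𝓡 m) p).symm _ a = _
      rw [hP.left_inv z hz']
    rw [hz, one_smul, h4]

variable [RiemannianBundle (fun x : M => TangentSpace (𝓡 m) x)]

omit [IsManifold (𝓡 m) ∞ M] in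
theorem norm_eq_fnorm_metric (p : M) (u : TangentSpace (𝓡 m) p) :
    ‖u‖ = fnorm (fun a b : EuclideanSpace ℝ (Fin m) => metric p a b) u :=
  norm_eq_sqrt_real_inner u

variable [IsContMDiffRiemannianBundle (𝓡 m) ∞ (EuclideanSpace ℝ (Fin m))
      (fun x : M => TangentSpace (𝓡 m) x)]

/-- A multihomogeneous function is bounded by its values on unit vectors. -/
theorem le_of_homogeneous {V : Type*} [AddCommGroup V] [Module ℝ V] {b : V → V → ℝ}
    (hb : IsInner b) {n : ℕ} {f : (Fin n → V) → V} {C : ℝ} (hC : 0 ≤ C)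
    (hf : ∀ (r : Fin n → ℝ) (u : Fin n → V), f (fun i => r i • u i) = (∏ i, r i) • f u)
    (h0 : ∀ u : Fin n → V, (∃ i, fnorm b (u i) = 0) → fnorm b (f u) = 0)
    (h1 : ∀ u : Fin n → V, (∀ i, fnorm b (u i) = 1) → fnorm b (f u) ≤ C) (u : Fin n → V) :
    fnorm b (f u) ≤ C * ∏ i, fnorm b (u i) := by
  by_cases h : ∃ i, fnorm b (u i) = 0
  · rw [h0 u h]
    exact mul_nonneg hC (Finset.prod_nonneg fun i _ => fnorm_nonneg _)
  · push Not at h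
    have e : u = fun i => fnorm b (u i) • ((fnorm b (u i))⁻¹ • u i) := by
      funext i
      rw [smul_smul, mul_inv_cancel₀ (h i), one_smul]
    have hp : 0 ≤ ∏ i, fnorm b (u i) := Finset.prod_nonneg fun i _ => fnorm_nonneg _
    have h2 := h1 (fun i => (fnorm b (u i))⁻¹ • u i) fun i => by
      rw [hb.fnorm_smul, abs_of_nonneg (inv_nonneg.2 (fnorm_nonneg _)), inv_mul_cancel₀ (h i)]
    have h3 : f u = (∏ i, fnorm b (u i)) • f (fun i => (fnorm b (u i))⁻¹ • u i) := by
      rw [← hf, ← e]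
    rw [h3, hb.fnorm_smul, abs_of_nonneg hp, mul_comm]
    exact mul_le_mul_of_nonneg_right h2 hp

theorem dcurv_smul {E : Type*} [NormedAddCommGroup E] [NormedSpace ℝ E]
    {Γ : E → E →L[ℝ] E →L[ℝ] E} {y : E} (hΓ : ContDiffAt ℝ 2 Γ y) (r s t q : ℝ) (w a b c : E) :
    dcurv Γ y (r • w) (s • a) (t • b) (q • c) = (r * s * t * q) • dcurv Γ y w a b c := by
  have h1 : ∀ w : E, fderiv ℝ (fun y => curv Γ y (s • a) (t • b) (q • c)) y w =
      (s * t * q) • fderiv ℝ (fun y => curv Γ y a b c) y w := by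
    intro w
    simp only [fderiv_curv hΓ, map_smul, smul_apply]
    module
  rw [dcurv, dcurv, h1]
  simp only [curv_smul_left, curv_smul_mid, curv_smul_right, map_smul, smul_apply]
  module

/-- The norms are suprema over smooth fields with unit values at `p`. Fields with locally constant
coordinates realize every unit vector, and on them the curvature expressions are `curv` and `dcurv`;
homogeneity extends the bounds to all vectors. -/
theorem curvBound_of_curvatureNorm_le {p : M} {C₂ C₃ : ℝ} (h2 : 1 ≤ C₂) (h3 : 1 ≤ C₃)
    (hR : curvatureNorm m p ≤ ENNReal.ofReal C₂) (hdR : nablaCurvatureNorm m p ≤ ENNReal.ofReal C₃)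
    {B : EuclideanSpace ℝ (Fin m) → EuclideanSpace ℝ (Fin m) →L[ℝ] EuclideanSpace ℝ (Fin m) →L[ℝ] ℝ}
    {Γ : EuclideanSpace ℝ (Fin m) → EuclideanSpace ℝ (Fin m) →L[ℝ] EuclideanSpace ℝ (Fin m) →L[ℝ]
      EuclideanSpace ℝ (Fin m)}
    (D : ChartData (𝓡 m) (metric (M := M)) (extChartAt (𝓡 m) p).symm (extChartAt (𝓡 m) p)
      (extChartAt (𝓡 m) p).target B Γ) :
    CurvBound B Γ (extChartAt (𝓡 m) p p) C₂ C₃ := by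
  have hg := isRiemannian_metric (m := m) (M := M)
  have hy := mem_extChartAt_target (I := 𝓡 m) p
  have hx : (extChartAt (𝓡 m) p).symm (extChartAt (𝓡 m) p p) = p := extChartAt_to_inv p
  have hid := mD_extChartAt_symm_self (I := 𝓡 m) p
  set y := extChartAt (𝓡 m) p p with hyd
  have hb := D.lc.isInner hy
  have hn : ∀ u : EuclideanSpace ℝ (Fin m), fnorm (fun a b => B y a b) u =
      ‖(show TangentSpace (𝓡 m) p from u)‖ := by
    intro u
    have h1 := D.coeff y hy u u
    rw [hid, hx] at h1
    rw [norm_eq_fnorm_metric]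
    exact congrArg Real.sqrt h1.symm
  have hpos : ∀ u, fnorm (fun a b => B y a b) u = 0 → u = 0 := by
    intro u hu
    by_contra hne
    have := Real.sqrt_pos.2 (D.lc.pos y hy u hne)
    exact this.ne' hu
  have hz : fnorm (fun a b => B y a b) 0 = 0 := by simp [fnorm]
  have hΓ := D.lc.contDiffAt_two hy
  -- At the centre of the preferred chart coordinates and vectors coincide, so the field `F a` takes
  -- the value `a` at `p`.
  choose F hF hF' using exists_smoothField (m := m) (M := M) p
  have hFp : ∀ a, F a p = a := by
    intro a
    have h1 := (hF' a).self_of_nhds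
    rw [← hyd, hid, hx] at h1
    exact h1
  have hc3 : ∀ u : Fin 3 → EuclideanSpace ℝ (Fin m), (∀ i, fnorm (fun a b => B y a b) (u i) = 1) →
      fnorm (fun a b => B y a b) (curv Γ y (u 0) (u 1) (u 2)) ≤ C₂ := by
    intro u hu
    have h1 := (iSup₂_le_iff.1 hR) (fun i => F (u i)) fun i => ⟨hF _, by
      rw [hFp]; exact (hn _).symm.trans (hu i)⟩
    rw [ENNReal.ofReal_le_ofReal_iff (by linarith)] at h1
    have h4 := D.curvature_eq hg (ξ := fun _ => u 0) (η := fun _ => u 1) (ζ := fun _ => u 2) hy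
      (hF' (u 0)) (hF' (u 1)) (hF' (u 2)) contDiffAt_const contDiffAt_const contDiffAt_const
    rw [hid, hx] at h4
    rw [hn]
    refine le_trans (le_of_eq ?_) h1
    exact congrArg (fun v : TangentSpace (𝓡 m) p => ‖v‖) h4.symm
  have hc4 : ∀ u : Fin 4 → EuclideanSpace ℝ (Fin m), (∀ i, fnorm (fun a b => B y a b) (u i) = 1) →
      fnorm (fun a b => B y a b) (dcurv Γ y (u 0) (u 1) (u 2) (u 3)) ≤ C₃ := by
    intro u hu
    have h1 := (iSup₂_le_iff.1 hdR) (fun i => F (u i)) fun i => ⟨hF _, by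
      rw [hFp]; exact (hn _).symm.trans (hu i)⟩
    rw [ENNReal.ofReal_le_ofReal_iff (by linarith)] at h1
    have h4 := D.nablaCurvature_eq hg hy (hF' (u 0)) (hF' (u 1)) (hF' (u 2)) (hF' (u 3))
    rw [hid, hx] at h4
    rw [hn]
    refine le_trans (le_of_eq ?_) h1
    exact congrArg (fun v : TangentSpace (𝓡 m) p => ‖v‖) h4.symm
  refine ⟨h2, h3, fun a b c => ?_, fun w a b c => ?_⟩
  · have := le_of_homogeneous hb (n := 3) (f := fun u => curv Γ y (u 0) (u 1) (u 2)) (C := C₂)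
      (by linarith) (fun r u => by
        rw [curv_smul_left, curv_smul_mid, curv_smul_right, smul_smul, smul_smul,
          Fin.prod_univ_three]) (fun u ⟨i, hi⟩ => by
        have := hpos _ hi
        fin_cases i <;> simp only [Fin.zero_eta, Fin.mk_one, Fin.reduceFinMk] at this <;>
          simp [curv, this, fnorm]) hc3 ![a, b, c]
    simpa [Fin.prod_univ_three] using this
  · have := le_of_homogeneous hb (n := 4) (f := fun u => dcurv Γ y (u 0) (u 1) (u 2) (u 3)) (C := C₃)
      (by linarith) (fun r u => by
        rw [dcurv_smul hΓ, Fin.prod_univ_four]) (fun u ⟨i, hi⟩ => by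
        have := hpos _ hi
        fin_cases i <;> simp only [Fin.zero_eta, Fin.mk_one, Fin.reduceFinMk] at this <;>
          simp [dcurv, curv, this, fnorm]) hc4 ![w, a, b, c]
    simpa [Fin.prod_univ_four] using this

end CurvatureBounds

/-! ### The transport equation in coordinates -/

section LocalDuhamel

theorem hasFDerivAt_flow_time {V : Type*} [NormedAddCommGroup V] [NormedSpace ℝ V]
    {Φ : ℝ × V → V} {p : ℝ × V} (h : DifferentiableAt ℝ Φ p) (w : V) :
    DifferentiableAt ℝ (fun u => Φ (p.1, u)) p.2 ∧
      fderiv ℝ (fun u => Φ (p.1, u)) p.2 w = fderiv ℝ Φ p (0, w) := by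
  have h1 : HasFDerivAt (fun u : V => (p.1, u)) (ContinuousLinearMap.inr ℝ ℝ V) p.2 :=
    (hasFDerivAt_const p.1 p.2).prodMk (hasFDerivAt_id p.2)
  have h2 : HasFDerivAt (fun u => Φ (p.1, u)) _ p.2 :=
    HasFDerivAt.comp (g := Φ) (f := fun u : V => (p.1, u)) p.2 h.hasFDerivAt h1
  refine ⟨h2.differentiableAt, ?_⟩
  rw [h2.fderiv]
  rfl

theorem _root_.HasDerivAt.prod_fst {V W : Type*} [NormedAddCommGroup V] [NormedSpace ℝ V]
    [NormedAddCommGroup W] [NormedSpace ℝ W] {f : ℝ → V × W} {f' : V × W} {t : ℝ}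
    (h : HasDerivAt f f' t) : HasDerivAt (fun s => (f s).1) f'.1 t := h.fst

theorem _root_.HasDerivAt.prod_snd {V W : Type*} [NormedAddCommGroup V] [NormedSpace ℝ V]
    [NormedAddCommGroup W] [NormedSpace ℝ W] {f : ℝ → V × W} {f' : V × W} {t : ℝ}
    (h : HasDerivAt f f' t) : HasDerivAt (fun s => (f s).2) f'.2 t := h.snd

/-- The variational equation. -/
theorem hasDerivAt_fderiv_flow {V : Type*} [NormedAddCommGroup V] [NormedSpace ℝ V]
    {Φ : ℝ × V → V} {f : V → V} {z : V} (cΦ : ContDiffAt ℝ 2 Φ (0, z))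
    (hΦ : ∀ᶠ w in 𝓝 z, HasDerivAt (fun s => Φ (s, w)) (f w) 0) (hf : DifferentiableAt ℝ f z)
    (w : V) :
    HasDerivAt (fun τ => fderiv ℝ (fun u => Φ (τ, u)) z w) (fderiv ℝ f z w) 0 := by
  have hl : HasDerivAt (fun s : ℝ => z + s • w) w 0 := by
    simpa using ((hasDerivAt_id (0 : ℝ)).smul_const w).const_add z
  have hl0 : Filter.Tendsto (fun s : ℝ => z + s • w) (𝓝 0) (𝓝 z) := by
    simpa using hl.continuousAt.tendsto
  have hd : ∀ᶠ p in 𝓝 ((0 : ℝ), z), DifferentiableAt ℝ Φ p :=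
    (cΦ.eventually (by simp)).mono fun p hp => hp.differentiableAt (by simp)
  have hf' : HasDerivAt (fun s : ℝ => f (z + s • w)) (fderiv ℝ f z w) 0 := by
    refine HasFDerivAt.comp_hasDerivAt (f := fun s : ℝ => z + s • w) (l := f) 0 ?_ hl
    simpa using hf.hasFDerivAt
  have cf : ContDiffAt ℝ 2 (fun p : ℝ × ℝ => Φ (p.1, z + p.2 • w)) (0, 0) := by
    have c2 : ContDiffAt ℝ 2 (fun p : ℝ × ℝ => (p.1, z + p.2 • w)) (0, 0) := by fun_prop
    refine ContDiffAt.comp (g := Φ) (f := fun p : ℝ × ℝ => (p.1, z + p.2 • w)) (0, 0) ?_ c2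
    simpa using cΦ
  have h1 := hasDerivAt_deriv_swap cf (g := fun s => f (z + s • w)) (hl0.eventually hΦ) hf'
  refine h1.congr_of_eventuallyEq ?_
  have hτ : Filter.Tendsto (fun τ : ℝ => (τ, z)) (𝓝 0) (𝓝 (0, z)) :=
    (continuous_id.prodMk continuous_const).tendsto' _ _ rfl
  filter_upwards [hτ.eventually hd] with τ hτ
  have h2 := (hasFDerivAt_flow_time hτ w).1.hasFDerivAt
  have h3 : HasDerivAt (fun s : ℝ => Φ (τ, z + s • w)) (fderiv ℝ (fun u => Φ (τ, u)) z w) 0 := by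
    refine HasFDerivAt.comp_hasDerivAt (f := fun s : ℝ => z + s • w) (l := fun u => Φ (τ, u)) 0 ?_ hl
    simpa using h2
  exact h3.deriv.symm

/-- The Lie derivative of a vector field along an orbit. -/
theorem hasDerivAt_pullback_flow {V : Type*} [NormedAddCommGroup V] [NormedSpace ℝ V]
    {Φ : ℝ × V → V} {f : V → V} {z : V} (cΦ : ContDiffAt ℝ 2 Φ (0, z))
    (h0 : ∀ᶠ w in 𝓝 z, Φ (0, w) = w)
    (hΦ : ∀ᶠ w in 𝓝 z, HasDerivAt (fun s => Φ (s, w)) (f w) 0) (hf : DifferentiableAt ℝ f z)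
    {c X : ℝ → V} {c' X' : V} (hc : HasDerivAt c c' 0) (hc0 : c 0 = z) (hX : HasDerivAt X X' 0) :
    HasDerivAt (fun τ => fderiv ℝ (fun u => Φ (-τ, u)) (c τ) (X τ)) (X' - fderiv ℝ f z (X 0)) 0 := by
  subst hc0
  have hd : ∀ᶠ p in 𝓝 ((0 : ℝ), c 0), DifferentiableAt ℝ Φ p :=
    (cΦ.eventually (by simp)).mono fun p hp => hp.differentiableAt (by simp)
  have hL : HasFDerivAt (fderiv ℝ Φ) (fderiv ℝ (fderiv ℝ Φ) (0, c 0)) (0, c 0) :=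
    ((cΦ.fderiv_right (m := 1) (by norm_num)).differentiableAt (by simp)).hasFDerivAt
  set L := fderiv ℝ (fderiv ℝ Φ) (0, c 0) with hLdef
  have hcv : HasDerivAt (fun τ : ℝ => (-τ, c τ)) (-1, c') 0 := (hasDerivAt_neg 0).prodMk hc
  have h1 : HasDerivAt (fun τ : ℝ => fderiv ℝ Φ (-τ, c τ)) (L (-1, c')) 0 := by
    refine HasFDerivAt.comp_hasDerivAt (f := fun τ : ℝ => (-τ, c τ)) (l := fderiv ℝ Φ) 0 ?_ hcv
    simpa using hL
  have h2 := h1.clm_apply ((hasDerivAt_const (0 : ℝ) (0 : ℝ)).prodMk hX)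
  -- The mixed derivative of `Φ` in time and space is the derivative of `f`: this is the variational
  -- equation at time `0`.
  have e1 : ∀ w : V, L (1, 0) (0, w) = fderiv ℝ f (c 0) w := by
    intro w
    have h3 := hasDerivAt_fderiv_flow cΦ hΦ hf w
    have hτ : HasDerivAt (fun τ : ℝ => (τ, c 0)) (1, 0) 0 :=
      (hasDerivAt_id 0).prodMk (hasDerivAt_const 0 _)
    have h4 : HasDerivAt (fun τ : ℝ => fderiv ℝ Φ (τ, c 0) (0, w)) (L (1, 0) (0, w)) 0 := by
      have := (HasFDerivAt.comp_hasDerivAt (f := fun τ : ℝ => (τ, c 0)) (l := fderiv ℝ Φ) 0 hL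
        hτ).clm_apply (hasDerivAt_const 0 ((0 : ℝ), w))
      simpa using this
    refine h4.unique (h3.congr_of_eventuallyEq ?_)
    filter_upwards [hτ.continuousAt.tendsto.eventually hd] with τ hτ
    exact (hasFDerivAt_flow_time hτ w).2.symm
  have e0 : ∀ᶠ u in 𝓝 (c 0), ∀ w : V, fderiv ℝ Φ (0, u) (0, w) = w := by
    have hu : Filter.Tendsto (fun u : V => ((0 : ℝ), u)) (𝓝 (c 0)) (𝓝 (0, c 0)) :=
      (continuous_const.prodMk continuous_id).tendsto' _ _ rfl
    filter_upwards [hu.eventually hd, h0.eventually_nhds] with u hu h0 w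
    rw [← (hasFDerivAt_flow_time hu w).2]
    have : (fun u => Φ (0, u)) =ᶠ[𝓝 u] fun u => u := h0
    rw [this.fderiv_eq, fderiv_fun_id]
    rfl
  -- The flow at time `0` is the identity, so its second derivatives in space vanish. The movement
  -- of the base point `c τ` therefore contributes nothing.
  have e2 : ∀ a w : V, L (0, a) (0, w) = 0 := by
    intro a w
    have hτ : HasDerivAt (fun τ : ℝ => ((0 : ℝ), c 0 + τ • a)) (0, a) 0 := by
      simpa using (hasDerivAt_const (0 : ℝ) (0 : ℝ)).prodMk
        (((hasDerivAt_id (0 : ℝ)).smul_const a).const_add (c 0))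
    have h4 : HasDerivAt (fun τ : ℝ => fderiv ℝ Φ (0, c 0 + τ • a) (0, w)) (L (0, a) (0, w)) 0 := by
      have := (HasFDerivAt.comp_hasDerivAt (f := fun τ : ℝ => ((0 : ℝ), c 0 + τ • a))
        (l := fderiv ℝ Φ) 0 (by simpa using hL) hτ).clm_apply (hasDerivAt_const 0 ((0 : ℝ), w))
      simpa using this
    refine h4.unique ((hasDerivAt_const (0 : ℝ) w).congr_of_eventuallyEq ?_)
    have hl : Filter.Tendsto (fun τ : ℝ => c 0 + τ • a) (𝓝 0) (𝓝 (c 0)) :=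
      Continuous.tendsto' (by fun_prop) _ _ (by simp)
    filter_upwards [hl.eventually e0] with τ h using h w
  refine (h2.congr_of_eventuallyEq ?_).congr_deriv ?_
  · have := hcv.continuousAt.tendsto
    simp only [neg_zero] at this
    filter_upwards [this.eventually hd] with τ hτ
    exact (hasFDerivAt_flow_time hτ (X τ)).2
  · have h5 : ((-1 : ℝ), c') = (-1 : ℝ) • ((1 : ℝ), (0 : V)) + ((0 : ℝ), c') := by simp
    simp only [neg_zero]
    rw [h5, map_add, map_smul, add_apply, smul_apply, e1, e2, e0.self_of_nhds]
    module

variable {E : Type*} [NormedAddCommGroup E] [NormedSpace ℝ E]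
  {Ω : Set E} {B : E → E →L[ℝ] E →L[ℝ] ℝ} {Γ : E → E →L[ℝ] E →L[ℝ] E}

theorem IsLeviCivita.differentiableAt_sprayF (hL : IsLeviCivita Ω B Γ) {z : E × E} (hz : z.1 ∈ Ω) :
    DifferentiableAt ℝ (sprayF Γ) z :=
  (hasFDerivAt_sprayF (hL.differentiableAt hz) (hL.symm _ hz) 0).1

/-- Solutions of the variational equation of the spray are Jacobi fields. -/
theorem hasCov_of_variational (hL : IsLeviCivita Ω B Γ) {z ξ : ℝ → E × E} {z₀ ξ₀ : E × E}
    (hΩ : z₀.1 ∈ Ω) (hz₀ : z 0 = z₀) (hξ₀ : ξ 0 = ξ₀) (hz : HasDerivAt z (sprayF Γ z₀) 0)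
    (hξ : HasDerivAt ξ (fderiv ℝ (sprayF Γ) z₀ ξ₀) 0) :
    HasDerivAt (fun τ => (z τ).1) z₀.2 0 ∧ HasCov Γ z₀.1 z₀.2 (fun τ => (z τ).2) 0 0 ∧
    HasCov Γ z₀.1 z₀.2 (fun τ => (ξ τ).1) (kap Γ z₀ ξ₀) 0 ∧
    HasCov Γ z₀.1 z₀.2 (fun τ => kap Γ (z τ) (ξ τ)) (- curv Γ z₀.1 ξ₀.1 z₀.2 z₀.2) 0 := by
  subst hz₀ hξ₀
  have hd := hL.differentiableAt hΩ
  have hs := hL.symm _ hΩ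
  rw [(hasFDerivAt_sprayF hd hs _).2] at hξ
  have hz1 : HasDerivAt (fun τ => (z τ).1) (z 0).2 0 := hz.prod_fst
  have hz2 : HasDerivAt (fun τ => (z τ).2) (- Γ (z 0).1 (z 0).2 (z 0).2) 0 := hz.prod_snd
  have hξ1 : HasDerivAt (fun τ => (ξ τ).1) (ξ 0).2 0 := hξ.prod_fst
  have hξ2 := hξ.prod_snd
  refine ⟨hz1, ?_, ?_, ?_⟩
  · simpa [HasCov] using hz2
  · refine hξ1.congr_deriv ?_
    rw [kap_apply, hs (z 0).2 (ξ 0).1, add_sub_cancel_right]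
  · have h1 := hξ2.add (hasDerivAt_bilin hd hz1 hξ1 hz2)
    simp only [kap_apply]
    refine h1.congr_deriv ?_
    simp only [curv, map_neg, map_add, two_smul]
    rw [hs (z 0).2 (ξ 0).2, hs (z 0).2 (Γ (z 0).1 (ξ 0).1 (z 0).2)]
    abel

/-- Transport by the flow of the tangential Sasaki covariant derivative, in coordinates. -/
theorem hasDerivAt_transport (hL : IsLeviCivita Ω B Γ) {Φ : ℝ × E × E → E × E} {z : E × E}
    (hz : z.1 ∈ Ω) (cΦ : ContDiffAt ℝ 4 Φ (0, z)) (h0 : ∀ᶠ w in 𝓝 z, Φ (0, w) = w)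
    (hΦ : ∀ᶠ w in 𝓝 z, HasDerivAt (fun s => Φ (s, w)) (sprayF Γ w) 0) {C₂ C₃ : ℝ}
    (hC : CurvBound B Γ z.1 C₂ C₃) {ξ η ζ : E × E} (hT : B z.1 z.2 z.2 = 1)
    (hN : B z.1 (kap Γ z (ζ + sasΓ Γ z η ξ)) z.2 + B z.1 (kap Γ z ξ) (kap Γ z η) = 0)
    {c : ℝ → ℝ → E × E} (ec : c = fun τ s => Φ (τ, z + s • η)) {Ξ : ℝ → ℝ → E × E}
    (eΞ : Ξ = fun τ s => fderiv ℝ (fun u => Φ (τ, u)) (z + s • η) (ξ + s • ζ))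
    {X : ℝ → E × E} (eX : X = fun τ => deriv (Ξ τ) 0 + sasΓ Γ (c τ 0) (deriv (c τ) 0) (Ξ τ 0)) :
    ∃ S : E × E, HasDerivAt (fun τ => fderiv ℝ (fun u => Φ (-τ, u)) (c τ 0)
        (X τ - (0, B (c τ 0).1 (kap Γ (c τ 0) (X τ)) (c τ 0).2 • (c τ 0).2))) S 0 ∧
      B z.1 (kap Γ z S) z.2 = 0 ∧
      √(sasB B Γ z S S) ≤ 5 * (C₂ ^ 2 * C₃) * (√(sasB B Γ z ξ ξ) * √(sasB B Γ z η η)) := by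
  have hl : HasDerivAt (fun s : ℝ => z + s • η) η 0 := by
    simpa using ((hasDerivAt_id (0 : ℝ)).smul_const η).const_add z
  have hl0 : Filter.Tendsto (fun s : ℝ => z + s • η) (𝓝 0) (𝓝 z) := by
    simpa using hl.continuousAt.tendsto
  have hline : ∀ n : WithTop ℕ∞, ContDiffAt ℝ n (fun p : ℝ × ℝ => (p.1, z + p.2 • η)) (0, 0) := by
    intro n; fun_prop
  have hline0 : Filter.Tendsto (fun p : ℝ × ℝ => (p.1, z + p.2 • η)) (𝓝 (0, 0)) (𝓝 (0, z)) := by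
    simpa using (hline 0).continuousAt.tendsto
  have hd : ∀ᶠ p in 𝓝 ((0 : ℝ), z), DifferentiableAt ℝ Φ p :=
    (cΦ.eventually (by simp)).mono fun p hp => hp.differentiableAt (by simp)
  have cc : ContDiffAt ℝ 2 (fun p : ℝ × ℝ => c p.1 p.2) (0, 0) := by
    rw [ec]
    refine ContDiffAt.comp (g := Φ) (f := fun p : ℝ × ℝ => (p.1, z + p.2 • η)) (0, 0) ?_ (hline 2)
    simpa using cΦ.of_le (by norm_cast)
  have cΞ : ContDiffAt ℝ 2 (fun p : ℝ × ℝ => Ξ p.1 p.2) (0, 0) := by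
    have h1 : ContDiffAt ℝ 2 (fun p : ℝ × ℝ => fderiv ℝ Φ (p.1, z + p.2 • η)) (0, 0) := by
      refine ContDiffAt.comp (g := fderiv ℝ Φ) (f := fun p : ℝ × ℝ => (p.1, z + p.2 • η)) (0, 0) ?_
        (hline 2)
      simpa using cΦ.fderiv_right (m := 2) (by norm_cast)
    have h2 : ContDiffAt ℝ 2 (fun p : ℝ × ℝ => ((0 : ℝ), ξ + p.2 • ζ)) (0, 0) := by fun_prop
    refine (h1.clm_apply h2).congr_of_eventuallyEq ?_
    filter_upwards [hline0.eventually hd] with p hp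
    rw [eΞ]
    exact (hasFDerivAt_flow_time hp _).2
  have hc0 : ∀ᶠ s in 𝓝 (0 : ℝ), c 0 s = z + s • η := by
    rw [ec]; exact hl0.eventually h0
  have hΞ0 : ∀ᶠ s in 𝓝 (0 : ℝ), Ξ 0 s = ξ + s • ζ := by
    rw [eΞ]
    filter_upwards [hl0.eventually h0.eventually_nhds] with s hs
    have : (fun u => Φ (0, u)) =ᶠ[𝓝 (z + s • η)] fun u => u := hs
    rw [this.fderiv_eq, fderiv_fun_id]
    rfl
  have hΩ : ∀ᶠ s in 𝓝 (0 : ℝ), (c 0 s).1 ∈ Ω := by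
    have h1 : ∀ᶠ w in 𝓝 z, (w : E × E).1 ∈ Ω := continuousAt_fst.eventually (hL.isOpen.mem_nhds hz)
    filter_upwards [hc0, hl0.eventually h1] with s hs h
    rwa [hs]
  have ev : ∀ᶠ s in 𝓝 (0 : ℝ), HasDerivAt (fun τ => c τ s) (sprayF Γ (c 0 s)) 0 ∧
      HasDerivAt (fun τ => Ξ τ s) (fderiv ℝ (sprayF Γ) (c 0 s) (Ξ 0 s)) 0 := by
    have c2 : ∀ᶠ w in 𝓝 z, ContDiffAt ℝ 2 Φ (0, w) := by
      have hu : Filter.Tendsto (fun u : E × E => ((0 : ℝ), u)) (𝓝 z) (𝓝 (0, z)) :=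
        (continuous_const.prodMk continuous_id).tendsto' _ _ rfl
      exact hu.eventually ((cΦ.of_le (m := 2) (by norm_cast)).eventually (by simp))
    filter_upwards [hc0, hΞ0, hΩ, hl0.eventually c2, hl0.eventually hΦ,
      hl0.eventually hΦ.eventually_nhds] with s h1 h2 h3 h4 h5 h6
    have h7 := hL.differentiableAt_sprayF h3
    rw [h1] at h7 ⊢
    rw [h2, ec, eΞ]
    exact ⟨h5, hasDerivAt_fderiv_flow h4 h6 h7 _⟩
  have ev2 : ∀ᶠ s in 𝓝 (0 : ℝ), HasDerivAt (fun τ => (c τ s).1) (c 0 s).2 0 ∧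
      HasCov Γ (c 0 s).1 (c 0 s).2 (fun τ => (c τ s).2) 0 0 ∧
      HasCov Γ (c 0 s).1 (c 0 s).2 (fun τ => (Ξ τ s).1) (kap Γ (c 0 s) (Ξ 0 s)) 0 ∧
      HasCov Γ (c 0 s).1 (c 0 s).2 (fun τ => kap Γ (c τ s) (Ξ τ s))
        (- curv Γ (c 0 s).1 (Ξ 0 s).1 (c 0 s).2 (c 0 s).2) 0 := by
    filter_upwards [ev, hΩ] with s h h'
    exact hasCov_of_variational hL h' rfl rfl h.1 h.2
  have c00 : c 0 0 = z := by simpa using hc0.self_of_nhds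
  have Ξ00 : Ξ 0 0 = ξ := by simpa using hΞ0.self_of_nhds
  have ck : ContDiffAt ℝ 2 (fun p : ℝ × ℝ => kap Γ (c p.1 p.2) (Ξ p.1 p.2)) (0, 0) := by
    have h1 : ContDiffAt ℝ ∞ (kap Γ) (c 0 0) := hL.contDiffOn_kap.contDiffAt
      ((hL.isOpen.prod isOpen_univ).mem_nhds ⟨by rwa [c00], mem_univ _⟩)
    have h2 : ContDiffAt ℝ 2 (fun p : ℝ × ℝ => kap Γ (c p.1 p.2)) (0, 0) :=
      ContDiffAt.comp (g := kap Γ) (f := fun p : ℝ × ℝ => c p.1 p.2) (0, 0)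
        (h1.of_le (by norm_cast)) cc
    exact h2.clm_apply cΞ
  obtain ⟨I, eI⟩ : ∃ I : ℝ → E, I = fun τ => deriv (fun s => (c τ s).1) 0 := ⟨_, rfl⟩
  obtain ⟨I₂, eI₂⟩ : ∃ I₂ : ℝ → E, I₂ = fun τ => deriv (fun s => (c τ s).2) 0 +
    Γ (c τ 0).1 (I τ) (c τ 0).2 := ⟨_, rfl⟩
  obtain ⟨W, eW⟩ : ∃ W : ℝ → E, W = fun τ => deriv (fun s => (Ξ τ s).1) 0 +
    Γ (c τ 0).1 (I τ) (Ξ τ 0).1 := ⟨_, rfl⟩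
  obtain ⟨U, eU⟩ : ∃ U : ℝ → E, U = fun τ => deriv (fun s => kap Γ (c τ s) (Ξ τ s)) 0 +
    Γ (c τ 0).1 (I τ) (kap Γ (c τ 0) (Ξ τ 0)) := ⟨_, rfl⟩
  obtain ⟨k1, k2, k3, k4⟩ := jacobi_evolution hL (x := fun p => (c p.1 p.2).1)
    (T := fun p => (c p.1 p.2).2) (J := fun p => (Ξ p.1 p.2).1)
    (K := fun p => kap Γ (c p.1 p.2) (Ξ p.1 p.2)) hΩ.self_of_nhds cc.fst cc.snd cΞ.fst ck
    (ev2.mono fun s h => h.1) (ev2.mono fun s h => h.2.1) (ev2.mono fun s h => h.2.2.1)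
    (ev2.mono fun s h => h.2.2.2) eI eI₂ eW eU
  have hs : ∀ τ : ℝ, HasDerivAt (fun s : ℝ => (τ, s)) (0, 1) 0 := fun τ =>
    (hasDerivAt_const 0 τ).prodMk (hasDerivAt_id 0)
  have hτ0 : Filter.Tendsto (fun τ : ℝ => (τ, (0 : ℝ))) (𝓝 0) (𝓝 (0, 0)) :=
    (continuous_id.prodMk continuous_const).tendsto' _ _ rfl
  have dS : ∀ {Y : ℝ × ℝ → E × E}, ContDiffAt ℝ 2 Y (0, 0) →
      ∀ᶠ τ in 𝓝 (0 : ℝ), HasDerivAt (fun s => Y (τ, s)) (deriv (fun s => Y (τ, s)) 0) 0 := by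
    intro Y cY
    have h1 : ∀ᶠ p in 𝓝 ((0 : ℝ), (0 : ℝ)), DifferentiableAt ℝ Y p :=
      (cY.eventually (by simp)).mono fun p hp => hp.differentiableAt (by simp)
    filter_upwards [hτ0.eventually h1] with τ h
    exact (h.hasFDerivAt.comp_hasDerivAt 0 (hs τ)).differentiableAt.hasDerivAt
  have hΩτ : ∀ᶠ τ in 𝓝 (0 : ℝ), (c τ 0).1 ∈ Ω := by
    have h1 : Filter.Tendsto (fun τ : ℝ => (c τ 0).1) (𝓝 0) (𝓝 (c 0 0).1) :=
      cc.fst.continuousAt.tendsto.comp hτ0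
    exact h1.eventually (hL.isOpen.mem_nhds hΩ.self_of_nhds)
  -- the Sasaki connector in terms of the covariant derivatives
  obtain ⟨Pf, eP⟩ : ∃ Pf : ℝ → E, Pf = fun τ => W τ + (1 / 2 : ℝ) • curv Γ (c τ 0).1 (c τ 0).2
    (kap Γ (c τ 0) (Ξ τ 0)) (I τ) + (1 / 2 : ℝ) • curv Γ (c τ 0).1 (c τ 0).2 (I₂ τ) (Ξ τ 0).1 :=
    ⟨_, rfl⟩
  obtain ⟨Qf, eQ⟩ : ∃ Qf : ℝ → E, Qf = fun τ => U τ - (1 / 2 : ℝ) • curv Γ (c τ 0).1 (I τ)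
    (Ξ τ 0).1 (c τ 0).2 := ⟨_, rfl⟩
  obtain ⟨Nf, eN⟩ : ∃ Nf : ℝ → E, Nf = fun τ => Qf τ - B (c τ 0).1 (Qf τ) (c τ 0).2 • (c τ 0).2 :=
    ⟨_, rfl⟩
  -- This identifies the Sasaki connector `X`, computed with `sasΓ`, with the pair of fields built
  -- from `W`, `U` and curvature, to which the evolution equations apply.
  have eXPQ : ∀ᶠ τ in 𝓝 (0 : ℝ), X τ = (Pf τ, Qf τ - Γ (c τ 0).1 (Pf τ) (c τ 0).2) ∧
      deriv (c τ) 0 = (I τ, deriv (fun s => (c τ s).2) 0) := by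
    filter_upwards [dS cc, dS cΞ, hΩτ] with τ hc hΞ hτΩ
    have dc : HasDerivAt (c τ) (deriv (c τ) 0) 0 := hc
    have dΞ : HasDerivAt (Ξ τ) (deriv (Ξ τ) 0) 0 := hΞ
    have hI : I τ = (deriv (c τ) 0).1 := by rw [eI]; exact dc.prod_fst.deriv
    have hi2 : deriv (fun s => (c τ s).2) 0 = (deriv (c τ) 0).2 := dc.prod_snd.deriv
    have hI2 : I₂ τ = kap Γ (c τ 0) (deriv (c τ) 0) := by
      rw [eI₂, kap_apply]
      simp only
      rw [hi2, hI]
    have hW : W τ = (deriv (Ξ τ) 0).1 + Γ (c τ 0).1 (I τ) (Ξ τ 0).1 := by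
      rw [eW]
      exact congrArg (· + _) dΞ.prod_fst.deriv
    have hU : U τ = (deriv (Ξ τ) 0).2 + (fderiv ℝ Γ (c τ 0).1 (I τ) (Ξ τ 0).1 (c τ 0).2
        + Γ (c τ 0).1 (deriv (Ξ τ) 0).1 (c τ 0).2 + Γ (c τ 0).1 (Ξ τ 0).1 (deriv (c τ) 0).2)
        + Γ (c τ 0).1 (I τ) (kap Γ (c τ 0) (Ξ τ 0)) := by
      have h1 := dΞ.prod_snd.add (hasDerivAt_bilin (hL.differentiableAt hτΩ) dc.prod_fst dΞ.prod_fst dc.prod_snd)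
      rw [eU]
      simp only [kap_apply] at h1 ⊢
      rw [hI]
      exact congrArg (· + _) h1.deriv
    refine ⟨?_, Prod.ext hI.symm hi2.symm⟩
    have eP' : Pf τ = (deriv (Ξ τ) 0).1 + sasH Γ (c τ 0) (deriv (c τ) 0) (Ξ τ 0) := by
      rw [eP]
      simp only [sasH, hW, hI2, ← hI, smul_add]
      abel
    rw [eX]
    refine Prod.ext eP'.symm ?_
    rw [eP', eQ]
    simp only [sasΓ, Prod.snd_add, sasV, hU, ← hI, map_add, add_apply]
    abel
  have eXk : ∀ᶠ τ in 𝓝 (0 : ℝ), kap Γ (c τ 0) (X τ) = Qf τ ∧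
      X τ - (0, B (c τ 0).1 (kap Γ (c τ 0) (X τ)) (c τ 0).2 • (c τ 0).2) =
        (Pf τ, Nf τ - Γ (c τ 0).1 (Pf τ) (c τ 0).2) := by
    filter_upwards [eXPQ] with τ h
    have h1 : kap Γ (c τ 0) (X τ) = Qf τ := by
      rw [h.1, kap_apply]
      exact sub_add_cancel _ _
    refine ⟨h1, ?_⟩
    rw [h1, h.1, eN]
    refine Prod.ext (sub_zero _) ?_
    simp only [Prod.snd_sub]
    abel
  have hI0 : I 0 = η.1 ∧ I₂ 0 = kap Γ z η := by
    have h1 : HasDerivAt (c 0) η 0 := hl.congr_of_eventuallyEq hc0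
    have h2 := eXPQ.self_of_nhds.2
    rw [h1.deriv] at h2
    have h3 : I 0 = η.1 := (congrArg Prod.fst h2).symm
    refine ⟨h3, ?_⟩
    rw [eI₂, kap_apply]
    simp only
    have h4 : deriv (fun s => (c 0 s).2) 0 = η.2 := (congrArg Prod.snd h2).symm
    rw [c00, h3, h4]
  have hX0 : X 0 = ζ + sasΓ Γ z η ξ := by
    have h1 : HasDerivAt (c 0) η 0 := hl.congr_of_eventuallyEq hc0
    have h2 : HasDerivAt (Ξ 0) ζ 0 := by
      have : HasDerivAt (fun s : ℝ => ξ + s • ζ) ζ 0 := by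
        simpa using ((hasDerivAt_id (0 : ℝ)).smul_const ζ).const_add ξ
      exact this.congr_of_eventuallyEq hΞ0
    rw [eX]
    simp only
    rw [h1.deriv, h2.deriv, c00, Ξ00]
  -- The constraint `hN` concerns `Q = U - R(I, J)T / 2`. The curvature term is orthogonal to `T`,
  -- so the constraint holds for `U` as well.
  have hQ0 : B z.1 (U 0) z.2 + B z.1 (kap Γ z ξ) (I₂ 0) = 0 := by
    have h1 := eXk.self_of_nhds.1
    rw [hX0, c00] at h1
    rw [h1, eQ] at hN
    simp only [c00, Ξ00, map_sub, map_smul, sub_apply, smul_apply, smul_eq_mul] at hN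
    have e1 := hL.metric_curv hz (I 0) ξ.1 z.2 z.2
    have e2 := hL.metric_symm _ hz (curv Γ z.1 (I 0) ξ.1 z.2) z.2
    rw [hI0.2]
    linarith
  have hcz := ev.self_of_nhds.1
  obtain ⟨Sh, Sv, hS, hS1, hS2⟩ := hasDerivAt_sasaki_cov hL hz hC (x := fun τ => (c τ 0).1)
    (T := fun τ => (c τ 0).2) (J := fun τ => (Ξ τ 0).1) (K := fun τ => kap Γ (c τ 0) (Ξ τ 0))
    (I := I) (I₂ := I₂) (W := W) (U := U) (P := Pf) (Q := Qf) (N := Nf)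
    (by simp only [c00]) ev2.self_of_nhds.1 (by simpa only [c00] using ev2.self_of_nhds.2.1)
    (by simpa only [c00] using ev2.self_of_nhds.2.2.1)
    (by simpa only [c00] using ev2.self_of_nhds.2.2.2)
    (by simpa only [c00] using k1) (by simpa only [c00] using k2) (by simpa only [c00] using k3)
    (by simpa only [c00] using k4) (by simpa only [c00] using hT)
    (by simpa only [c00, Ξ00] using hQ0) eP eQ eN
  simp only [c00, Ξ00] at hS hS1 hS2
  rw [hI0.1, hI0.2] at hS2
  refine ⟨(Sh, Sv - Γ z.1 Sh z.2), ?_, ?_, ?_⟩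
  -- Pulling back subtracts the linearized spray from the derivative, which is the first term of
  -- `hS`; exactly the error `(Sh, Sv - Γ Sh T)` is left.
  · have h1 := hasDerivAt_pullback_flow (cΦ.of_le (by norm_cast)) h0 hΦ (hL.differentiableAt_sprayF hz)
      hcz c00 hS
    simp only [c00, Prod.mk.eta, add_sub_cancel_left] at h1
    refine h1.congr_of_eventuallyEq ?_
    filter_upwards [eXk] with τ h
    rw [h.2]
  · rw [kap_apply]
    simpa using hS1
  · have e : kap Γ z (Sh, Sv - Γ z.1 Sh z.2) = Sv := by simp [kap_apply]
    rw [sasB_apply, sasB_apply, sasB_apply, e]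
    exact hS2

end LocalDuhamel

/-! ### The transport equation on the manifold -/

section FlowTransport

variable {E : Type*} [NormedAddCommGroup E] [NormedSpace ℝ E]
  {H : Type*} [TopologicalSpace H] {I : ModelWithCorners ℝ E H}
  {N : Type*} [TopologicalSpace N] [ChartedSpace H N] [IsManifold I ∞ N] [IsManifold I 1 N]
  [I.Boundaryless] [FiniteDimensional ℝ E] [T2Space N]
  {g : (p : N) → TangentSpace I p → TangentSpace I p → ℝ} (hg : IsRiemannian I g)

include hg

theorem contMDiffAt_flow {t : ℝ} {v : TangentBundle I N} (hv : v ∈ flowDomain g t) {n : ℕ}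
    (hn : n ≠ 0) : ContMDiffAt I.tangent I.tangent n (geodesicFlow g t) v ∧
      ∀ᶠ w in 𝓝 v, w ∈ flowDomain g t := by
  have h := contMDiffAt_geodesicFlow hg hv hn
  have hc : Continuous fun w : TangentBundle I N => (t, w) := by fun_prop
  exact ⟨ContMDiffAt.comp v (f := fun w : TangentBundle I N => (t, w)) h.1
    (contMDiffAt_const.prodMk contMDiffAt_id), hc.continuousAt.eventually h.2⟩

theorem mdifferentiableAt_flow {t : ℝ} {v : TangentBundle I N} (hv : v ∈ flowDomain g t) :
    MDifferentiableAt I.tangent I.tangent (geodesicFlow g t) v :=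
  (contMDiffAt_flow hg hv one_ne_zero).1.mdifferentiableAt (by simp)

theorem isOpen_flowDomain (t : ℝ) : IsOpen (flowDomain g t) :=
  isOpen_iff_mem_nhds.2 fun _ hv => (contMDiffAt_flow hg hv one_ne_zero).2

theorem contMDiffOn_tangentMap_flow (t : ℝ) (n : ℕ) :
    ContMDiffOn I.tangent.tangent I.tangent.tangent n
      (tangentMap I.tangent I.tangent (geodesicFlow g t)) (TotalSpace.proj ⁻¹' flowDomain g t) := by
  have h1 : ContMDiffOn I.tangent I.tangent (n + 1 : ℕ) (geodesicFlow g t) (flowDomain g t) :=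
    fun v hv => (contMDiffAt_flow hg hv (Nat.succ_ne_zero n)).1.contMDiffWithinAt
  exact ContMDiffOn.tangentMap_of_isOpen (isOpen_flowDomain hg t) h1 (by push_cast; exact le_rfl)
    (by exact_mod_cast le_top)

theorem contMDiffAt_tangentMap_flow {t : ℝ} {ξ : TangentBundle I.tangent (TangentBundle I N)}
    (hξ : ξ.proj ∈ flowDomain g t) (n : ℕ) :
    ContMDiffAt I.tangent.tangent I.tangent.tangent n
      (tangentMap I.tangent I.tangent (geodesicFlow g t)) ξ :=
  (contMDiffOn_tangentMap_flow hg t n).contMDiffAt (((isOpen_flowDomain hg t).preimage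
    (FiberBundle.continuous_proj (E × E) (TangentSpace I.tangent))).mem_nhds hξ)

theorem mdifferentiableAt_tangentMap_flow {t : ℝ}
    {ξ : TangentBundle I.tangent (TangentBundle I N)} (hξ : ξ.proj ∈ flowDomain g t) :
    MDifferentiableAt I.tangent.tangent I.tangent.tangent
      (tangentMap I.tangent I.tangent (geodesicFlow g t)) ξ :=
  (contMDiffAt_tangentMap_flow hg hξ 1).mdifferentiableAt (by simp)

omit [FiniteDimensional ℝ E] in
theorem hasVel_geodesicFlow {t : ℝ} {v : TangentBundle I N} (hv : v ∈ flowDomain g t) :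
    HasVel I.tangent (fun s => geodesicFlow g s v) (spray g (geodesicFlow g t v)) t := by
  obtain ⟨V, a, b, hV, h0, ht, rfl, e⟩ := (flowsTo_iff hg).1 (flowsTo_geodesicFlow hg hv)
  rw [← e]
  refine (hV t ht).congr_of_eventuallyEq ?_
  filter_upwards [isOpen_Ioo.mem_nhds ht] with s hs
  exact (hV.geodesicFlow_eq hg h0 hs).2

theorem eventually_flow_add {t s : ℝ} {v : TangentBundle I N} (hv : v ∈ flowDomain g t)
    (hv' : geodesicFlow g t v ∈ flowDomain g s) :
    (geodesicFlow g (t + s)) =ᶠ[𝓝 v] fun w => geodesicFlow g s (geodesicFlow g t w) := by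
  have h := contMDiffAt_flow hg hv one_ne_zero
  filter_upwards [h.2, h.1.continuousAt.eventually_mem ((isOpen_flowDomain hg s).mem_nhds hv')] with
    w h1 h2
  exact (geodesicFlow_add hg h1 h2).2

theorem mD_flow_add {t s : ℝ} {v : TangentBundle I N} (hv : v ∈ flowDomain g t)
    (hv' : geodesicFlow g t v ∈ flowDomain g s) (a : E × E) :
    mD I.tangent I.tangent (geodesicFlow g (t + s)) v a =
      mD I.tangent I.tangent (geodesicFlow g s) (geodesicFlow g t v)
        (mD I.tangent I.tangent (geodesicFlow g t) v a) := by
  rw [mD_congr (eventually_flow_add hg hv hv'),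
    mD_comp_apply (mdifferentiableAt_flow hg hv') (mdifferentiableAt_flow hg hv)]

theorem mD_flow_neg {t : ℝ} {v : TangentBundle I N} (hv : v ∈ flowDomain g t) (a : E × E) :
    mD I.tangent I.tangent (geodesicFlow g (-t)) (geodesicFlow g t v)
      (mD I.tangent I.tangent (geodesicFlow g t) v a) = a := by
  have h1 : geodesicFlow g 0 =ᶠ[𝓝 v] fun w => w :=
    Filter.Eventually.of_forall fun w => (mem_flowDomain_zero hg w).2
  rw [← mD_flow_add hg hv (geodesicFlow_neg hg hv).1, add_neg_cancel, mD_congr h1, mD_id]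
  rfl

theorem tangentMap_flow_add {t s : ℝ} {ξ : TangentBundle I.tangent (TangentBundle I N)}
    (hv : ξ.proj ∈ flowDomain g t) (hv' : geodesicFlow g t ξ.proj ∈ flowDomain g s) :
    tangentMap I.tangent I.tangent (geodesicFlow g (t + s)) ξ =
      tangentMap I.tangent I.tangent (geodesicFlow g s)
        (tangentMap I.tangent I.tangent (geodesicFlow g t) ξ) :=
  congrArg₂ (mkT I.tangent) (geodesicFlow_add hg hv hv').2 (mD_flow_add hg hv hv' (vec ξ))

/-- The group law for the second derivative of the flow. It reduces the transport equation at an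
arbitrary time to time `0`, where the coordinates are available. -/
theorem mD_tangentMap_flow_add {t s : ℝ} {ξ : TangentBundle I.tangent (TangentBundle I N)}
    (hv : ξ.proj ∈ flowDomain g t) (hv' : geodesicFlow g t ξ.proj ∈ flowDomain g s)
    (Z : (E × E) × (E × E)) :
    mD I.tangent.tangent I.tangent.tangent
        (tangentMap I.tangent I.tangent (geodesicFlow g (t + s))) ξ Z =
      mD I.tangent.tangent I.tangent.tangent (tangentMap I.tangent I.tangent (geodesicFlow g s))
        (tangentMap I.tangent I.tangent (geodesicFlow g t) ξ)
        (mD I.tangent.tangent I.tangent.tangent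
          (tangentMap I.tangent I.tangent (geodesicFlow g t)) ξ Z) := by
  have h := contMDiffAt_flow hg hv one_ne_zero
  have hp : ContinuousAt (TotalSpace.proj : TangentBundle I.tangent (TangentBundle I N) → _) ξ :=
    (FiberBundle.continuous_proj (E × E) (TangentSpace I.tangent)).continuousAt
  have h1 : tangentMap I.tangent I.tangent (geodesicFlow g (t + s)) =ᶠ[𝓝 ξ] fun ξ =>
      tangentMap I.tangent I.tangent (geodesicFlow g s)
        (tangentMap I.tangent I.tangent (geodesicFlow g t) ξ) := by
    filter_upwards [hp.eventually h.2, hp.eventually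
      (h.1.continuousAt.eventually_mem ((isOpen_flowDomain hg s).mem_nhds hv'))] with ξ' h1 h2
    exact tangentMap_flow_add hg h1 h2
  rw [mD_congr h1]
  exact mD_comp_apply (f := tangentMap I.tangent I.tangent (geodesicFlow g t))
    (g := tangentMap I.tangent I.tangent (geodesicFlow g s))
    (mdifferentiableAt_tangentMap_flow hg hv') (mdifferentiableAt_tangentMap_flow hg hv) Z

omit [FiniteDimensional ℝ E] [T2Space N] in
-- The Christoffel vector of `0` is itself a choice; that it vanishes follows from the homogeneity
-- of the connector.
theorem connector_vertical (V : TangentBundle I N) (w : E) : connector g V ((0, w) : E × E) = w := by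
  have h0 : connector g V ((0, 0) : E × E) = (0 : E) := by
    have := hg.connector_smul V 0 (0, 0)
    rw [zero_smul, zero_smul] at this
    exact this
  have h1 : ∀ w : E, (connector g V ((0, w) : E × E) : E) = w + christoffel g V.proj (0 : E) V.snd := by
    intro w
    have e : horiz V ((0, w) : E × E) = (0 : E) := horiz_eq V (0, w)
    have e2 : (connector g V ((0, w) : E × E) : E) = w + christoffel g V.proj
      (horiz V ((0, w) : E × E)) V.snd := rfl
    rw [e2, e]
  have h2 := (h1 0).symm.trans h0
  rw [zero_add] at h2
  refine (h1 w).trans ?_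
  rw [h2, add_zero]

omit [FiniteDimensional ℝ E] [T2Space N] hg in
theorem ext_horiz_connector {V : TangentBundle I N} {ξ η : E × E} (h1 : (horiz V ξ : E) = horiz V η)
    (h2 : (connector g V ξ : E) = connector g V η) : ξ = η := by
  have e : ∀ ξ : E × E, (connector g V ξ : E) = ξ.2 + christoffel g V.proj (horiz V ξ) V.snd :=
    fun _ => rfl
  have h3 : ξ.2 + christoffel g V.proj (horiz V ξ) V.snd =
    η.2 + christoffel g V.proj (horiz V η) V.snd := h2
  rw [h1] at h3
  exact Prod.ext ((horiz_eq V ξ).symm.trans (h1.trans (horiz_eq V η))) (add_right_cancel h3)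

omit hg in
/-- The Sasaki connector. -/
def sasCov (g : (p : N) → TangentSpace I p → TangentSpace I p → ℝ)
    (ξ : TangentBundle I.tangent (TangentBundle I N)) (Z : (E × E) × (E × E)) : E × E :=
  connector (sasakiMetric g) ξ Z

omit hg in
/-- The component tangent to the unit tangent bundle of the Sasaki connector of `Z`. -/
def tanPart (g : (p : N) → TangentSpace I p → TangentSpace I p → ℝ)
    (ξ : TangentBundle I.tangent (TangentBundle I N)) (Z : (E × E) × (E × E)) : E × E :=
  sasCov g ξ Z -
    (0, g ξ.proj.proj (connector g ξ.proj (sasCov g ξ Z)) ξ.proj.snd • vec ξ.proj)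

namespace ChartData

variable {P : E → N} {Q : N → E} {Ω : Set E} {B : E → E →L[ℝ] E →L[ℝ] ℝ}
  {Γ : E → E →L[ℝ] E →L[ℝ] E} (D : ChartData I g P Q Ω B Γ)
include D

omit [FiniteDimensional ℝ E] [T2Space N] in
theorem mD_tangentParam_vertical {z : E × E} (hz : z.1 ∈ Ω) (w : E) :
    mD 𝓘(ℝ, E × E) I.tangent (tangentParam I P) z (0, w) = (0, mD 𝓘(ℝ, E) I P z.1 w) := by
  refine ext_horiz_connector (g := g) (V := tangentParam I P z) ?_ ?_
  · rw [D.horiz hz, map_zero]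
    exact (horiz_eq (tangentParam I P z) (0, mD 𝓘(ℝ, E) I P z.1 w)).symm
  · rw [D.connector hz, connector_vertical hg, kap_apply, map_zero, zero_apply, add_zero]

omit [FiniteDimensional ℝ E] [T2Space N] in
theorem tanPart_eq {w : (E × E) × (E × E)} (hw : w.1.1 ∈ Ω) (ζ : (E × E) × (E × E)) :
    tanPart g (tangentParam I.tangent (tangentParam I P) w)
      (mD 𝓘(ℝ, (E × E) × (E × E)) I.tangent.tangent
        (tangentParam I.tangent (tangentParam I P)) w ζ) =
      mD 𝓘(ℝ, E × E) I.tangent (tangentParam I P) w.1 (ζ.2 + sasΓ Γ w.1 ζ.1 w.2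
        - (0, B w.1.1 (kap Γ w.1 (ζ.2 + sasΓ Γ w.1 ζ.1 w.2)) w.1.2 • w.1.2)) := by
  have h1 := D.connector_sasaki hg hw w.2 ζ.1 ζ.2
  have h2 : tanPart g (tangentParam I.tangent (tangentParam I P) w)
      (mD 𝓘(ℝ, (E × E) × (E × E)) I.tangent.tangent
        (tangentParam I.tangent (tangentParam I P)) w ζ) =
      mD 𝓘(ℝ, E × E) I.tangent (tangentParam I P) w.1 (ζ.2 + sasΓ Γ w.1 ζ.1 w.2) -
      (0, g (P w.1.1) (Sasaki.connector g (tangentParam I P w.1)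
        (mD 𝓘(ℝ, E × E) I.tangent (tangentParam I P) w.1 (ζ.2 + sasΓ Γ w.1 ζ.1 w.2)))
        (mD 𝓘(ℝ, E) I P w.1.1 w.1.2) • mD 𝓘(ℝ, E) I P w.1.1 w.1.2) := by
    rw [← h1]
    rfl
  rw [h2, D.connector hw, D.coeff _ hw, map_sub, D.mD_tangentParam_vertical hg hw, map_smul]

omit [FiniteDimensional ℝ E] [T2Space N] [I.Boundaryless] hg in
theorem tangentMap_eq {τ : ℝ} {Φ : E × E → E × E} {z : E × E} (hz : z.1 ∈ Ω)
    (hΦz : (Φ z).1 ∈ Ω) (hΦ : DifferentiableAt ℝ Φ z)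
    (hf : MDifferentiableAt I.tangent I.tangent (geodesicFlow g τ) (tangentParam I P z))
    (h : ∀ᶠ u in 𝓝 z, geodesicFlow g τ (tangentParam I P u) = tangentParam I P (Φ u)) (w : E × E) :
    mD I.tangent I.tangent (geodesicFlow g τ) (tangentParam I P z)
      (mD 𝓘(ℝ, E × E) I.tangent (tangentParam I P) z w) =
      mD 𝓘(ℝ, E × E) I.tangent (tangentParam I P) (Φ z) (fderiv ℝ Φ z w) := by
  have hT := D.param.tangent
  rw [← mD_comp_apply hf (hT.mdifferentiableAt ⟨hz, mem_univ _⟩), mD_congr h,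
    mD_comp_apply (f := Φ) (g := tangentParam I P) (hT.mdifferentiableAt ⟨hΦz, mem_univ _⟩)
      hΦ.mdifferentiableAt, mD_eq_fderiv]

/-- The geodesic flow in coordinates. -/
theorem flow_coordinates {z : E × E} (hz : z.1 ∈ Ω) {Φ : ℝ × E × E → E × E}
    (eΦ : Φ = fun p => tangentParamInv Q (geodesicFlow g p.1 (tangentParam I P p.2))) {n : ℕ}
    (hn : n ≠ 0) : ContDiffAt ℝ n Φ (0, z) ∧ (∀ᶠ w in 𝓝 z, Φ (0, w) = w) ∧
      (∀ᶠ w in 𝓝 z, HasDerivAt (fun s => Φ (s, w)) (sprayF Γ w) 0) ∧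
      ∀ᶠ p in 𝓝 ((0 : ℝ), z), p.2.1 ∈ Ω ∧ (Φ p).1 ∈ Ω ∧ tangentParam I P p.2 ∈ flowDomain g p.1 ∧
        geodesicFlow g p.1 (tangentParam I P p.2) = tangentParam I P (Φ p) := by
  have hT := D.param.tangent
  have hzz : z ∈ Ω ×ˢ (univ : Set E) := ⟨hz, mem_univ _⟩
  have hle : (n : WithTop ℕ∞) ≤ (∞ : WithTop ℕ∞) := by exact_mod_cast le_top
  have hfl := contMDiffAt_geodesicFlow hg (mem_flowDomain_zero hg (tangentParam I P z)).1 hn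
  have c0 : ContMDiffAt 𝓘(ℝ, ℝ × E × E) (𝓘(ℝ, ℝ).prod I.tangent) n
      (fun p : ℝ × E × E => (p.1, tangentParam I P p.2)) (0, z) := by
    refine contDiff_fst.contMDiff.contMDiffAt.prodMk ?_
    exact ContMDiffAt.comp (g := tangentParam I P) (f := fun p : ℝ × E × E => p.2) (0, z)
      ((hT.contMDiffAt hzz).of_le hle) contDiff_snd.contMDiff.contMDiffAt
  have c1 : ContMDiffAt 𝓘(ℝ, ℝ × E × E) I.tangent n
      (fun p : ℝ × E × E => geodesicFlow g p.1 (tangentParam I P p.2)) (0, z) :=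
    ContMDiffAt.comp (0, z) (f := fun p : ℝ × E × E => (p.1, tangentParam I P p.2)) hfl.1 c0
  have e0 : geodesicFlow g 0 (tangentParam I P z) = tangentParam I P z :=
    (mem_flowDomain_zero hg _).2
  refine ⟨?_, ?_, ?_, ?_⟩
  · rw [eΦ, ← contMDiffAt_iff_contDiffAt]
    refine ContMDiffAt.comp (0, z) (g := tangentParamInv Q)
      (f := fun p : ℝ × E × E => geodesicFlow g p.1 (tangentParam I P p.2)) ?_ c1
    simp only [e0]
    exact (hT.contMDiffAt_inv hzz).of_le hle
  · filter_upwards [hT.mem_nhds hzz] with w hw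
    rw [eΦ]
    simp only [(mem_flowDomain_zero hg _).2, hT.left_inv w hw]
  · filter_upwards [hT.mem_nhds hzz] with w hw
    rw [eΦ]
    have h0 := mem_flowDomain_zero hg (tangentParam I P w)
    have h1 := hasVel_geodesicFlow hg h0.1
    have h2 := hT.hasDerivAt (by rw [h0.2]; exact mem_image_of_mem _ hw) h1
    rw [h0.2, ← D.spray_eq hw.1, hT.mD_inv_mD hw] at h2
    exact h2
  · have h1 : ∀ᶠ p in 𝓝 ((0 : ℝ), z), geodesicFlow g p.1 (tangentParam I P p.2) ∈
        tangentParam I P '' (Ω ×ˢ univ) := by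
      refine c1.continuousAt.eventually_mem ?_
      simp only [e0]
      exact hT.image_mem_nhds hzz
    have h2 : ∀ᶠ p in 𝓝 ((0 : ℝ), z), p.2 ∈ Ω ×ˢ (univ : Set E) :=
      continuousAt_snd.eventually_mem (hT.mem_nhds hzz)
    have h3 : ∀ᶠ p in 𝓝 ((0 : ℝ), z), tangentParam I P p.2 ∈ flowDomain g p.1 :=
      c0.continuousAt.eventually hfl.2
    filter_upwards [h1, h2, h3] with p h1 h2 h3
    rw [eΦ]
    exact ⟨h2.1, (hT.inv_mem h1).1, h3, (hT.right_inv h1).symm⟩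

/-- Transport by the flow of the tangential Sasaki covariant derivative. -/
theorem exists_hasDerivAt_transport {C₂ C₃ : ℝ} {w ζ : (E × E) × (E × E)} (hw : w.1.1 ∈ Ω)
    (hC : CurvBound B Γ w.1.1 C₂ C₃) (hT : B w.1.1 w.1.2 w.1.2 = 1)
    (hN : B w.1.1 (kap Γ w.1 (ζ.2 + sasΓ Γ w.1 ζ.1 w.2)) w.1.2
      + B w.1.1 (kap Γ w.1 w.2) (kap Γ w.1 ζ.1) = 0)
    {ξ : TangentBundle I.tangent (TangentBundle I N)} {Z : (E × E) × (E × E)}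
    (eξ : ξ = tangentParam I.tangent (tangentParam I P) w)
    (eZ : Z = mD 𝓘(ℝ, (E × E) × (E × E)) I.tangent.tangent
      (tangentParam I.tangent (tangentParam I P)) w ζ) :
    ∃ S : E × E, HasDerivAt (fun τ => mD I.tangent I.tangent (geodesicFlow g (-τ))
        (geodesicFlow g τ ξ.proj) (tanPart g (tangentMap I.tangent I.tangent (geodesicFlow g τ) ξ)
          (mD I.tangent.tangent I.tangent.tangent
            (tangentMap I.tangent I.tangent (geodesicFlow g τ)) ξ Z)))
        (mD 𝓘(ℝ, E × E) I.tangent (tangentParam I P) w.1 S) 0 ∧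
      B w.1.1 (kap Γ w.1 S) w.1.2 = 0 ∧
      √(sasB B Γ w.1 S S) ≤
        5 * (C₂ ^ 2 * C₃) * (√(sasB B Γ w.1 w.2 w.2) * √(sasB B Γ w.1 ζ.1 ζ.1)) := by
  obtain ⟨Φ, eΦ⟩ : ∃ Φ : ℝ × E × E → E × E,
    Φ = fun p => tangentParamInv Q (geodesicFlow g p.1 (tangentParam I P p.2)) := ⟨_, rfl⟩
  obtain ⟨cΦ, h0, hΦ, hev⟩ := D.flow_coordinates hg hw eΦ (n := 4) (by norm_num)
  obtain ⟨c, ec⟩ : ∃ c : ℝ → ℝ → E × E, c = fun τ s => Φ (τ, w.1 + s • ζ.1) := ⟨_, rfl⟩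
  obtain ⟨Ξ, eΞ⟩ : ∃ Ξ : ℝ → ℝ → E × E,
    Ξ = fun τ s => fderiv ℝ (fun u => Φ (τ, u)) (w.1 + s • ζ.1) (w.2 + s • ζ.2) := ⟨_, rfl⟩
  obtain ⟨X, eX⟩ : ∃ X : ℝ → E × E,
    X = fun τ => deriv (Ξ τ) 0 + sasΓ Γ (c τ 0) (deriv (c τ) 0) (Ξ τ 0) := ⟨_, rfl⟩
  obtain ⟨S, hS, hS1, hS2⟩ := hasDerivAt_transport D.lc hw cΦ h0 hΦ hC hT hN ec eΞ eX
  refine ⟨S, ?_, hS1, hS2⟩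
  have hTP := D.param.tangent
  have hd : ∀ᶠ p in 𝓝 ((0 : ℝ), w.1), DifferentiableAt ℝ (fun u => Φ (p.1, u)) p.2 :=
    (cΦ.eventually (by simp)).mono fun p hp =>
      (hasFDerivAt_flow_time (hp.differentiableAt (by simp)) 0).1
  have hsl : ∀ (q : ℝ × E × E → Prop) (p : ℝ × E × E), (∀ᶠ p' in 𝓝 p, q p') →
      ∀ᶠ u in 𝓝 p.2, q (p.1, u) := fun q p h =>
    (Continuous.continuousAt (f := fun u : E × E => (p.1, u)) (by fun_prop)).eventually h
  -- the derivative of the flow in coordinates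
  have hgood : ∀ᶠ p in 𝓝 ((0 : ℝ), w.1), p.2.1 ∈ Ω ∧ (Φ p).1 ∈ Ω ∧
      tangentParam I P p.2 ∈ flowDomain g p.1 ∧
      geodesicFlow g p.1 (tangentParam I P p.2) = tangentParam I P (Φ p) ∧
      ∀ a : E × E, mD I.tangent I.tangent (geodesicFlow g p.1) (tangentParam I P p.2)
        (mD 𝓘(ℝ, E × E) I.tangent (tangentParam I P) p.2 a) =
        mD 𝓘(ℝ, E × E) I.tangent (tangentParam I P) (Φ p)
          (fderiv ℝ (fun u => Φ (p.1, u)) p.2 a) := by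
    filter_upwards [hev.eventually_nhds, hd] with p hp hpd
    have hp0 := hp.self_of_nhds
    refine ⟨hp0.1, hp0.2.1, hp0.2.2.1, hp0.2.2.2, fun a => ?_⟩
    exact D.tangentMap_eq (Φ := fun u => Φ (p.1, u)) hp0.1 hp0.2.1 hpd
      (mdifferentiableAt_flow hg hp0.2.2.1) ((hsl _ p hp).mono fun u hu => hu.2.2.2) a
  have hτ0 : Filter.Tendsto (fun τ : ℝ => (τ, w.1)) (𝓝 0) (𝓝 (0, w.1)) :=
    (continuous_id.prodMk continuous_const).tendsto' _ _ rfl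
  have hc00 : ∀ τ, c τ 0 = Φ (τ, w.1) := by intro τ; rw [ec]; simp
  have hΞ00 : ∀ τ, Ξ τ 0 = fderiv ℝ (fun u => Φ (τ, u)) w.1 w.2 := by intro τ; rw [eΞ]; simp
  have hTTP := hTP.tangent
  -- the second derivative of the flow in coordinates
  have hX : ∀ᶠ τ in 𝓝 (0 : ℝ), tanPart g (tangentMap I.tangent I.tangent (geodesicFlow g τ) ξ)
      (mD I.tangent.tangent I.tangent.tangent
        (tangentMap I.tangent I.tangent (geodesicFlow g τ)) ξ Z) =
      mD 𝓘(ℝ, E × E) I.tangent (tangentParam I P) (c τ 0)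
        (X τ - (0, B (c τ 0).1 (kap Γ (c τ 0) (X τ)) (c τ 0).2 • (c τ 0).2)) := by
    filter_upwards [hτ0.eventually hgood.eventually_nhds] with τ hτ
    have hτg := hτ.self_of_nhds
    have hl : Filter.Tendsto (fun s : ℝ => (τ, w.1 + s • ζ.1)) (𝓝 0) (𝓝 (τ, w.1)) :=
      Continuous.tendsto' (by fun_prop) _ _ (by simp)
    -- Only the velocity `Z` matters, so it is represented by a straight line in the coordinates of
    -- `TTN`; its image under the flow is the family `(c τ s, Ξ τ s)`.
    have hline : HasDerivAt (fun s : ℝ => w + s • ζ) ζ 0 := by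
      simpa using ((hasDerivAt_id (0 : ℝ)).smul_const ζ).const_add w
    have h1 : HasVel I.tangent.tangent
        (fun s : ℝ => tangentParam I.tangent (tangentParam I P) (w + s • ζ)) Z 0 := by
      have := hTTP.hasVel (z := fun s : ℝ => w + s • ζ) (t := 0) (by
        rw [zero_smul, add_zero]; exact ⟨⟨hw, mem_univ _⟩, mem_univ _⟩) hline
      simpa [eZ] using this
    have h2 : HasVel I.tangent.tangent (fun s : ℝ => tangentMap I.tangent I.tangent (geodesicFlow g τ)
        (tangentParam I.tangent (tangentParam I P) (w + s • ζ)))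
        (mD I.tangent.tangent I.tangent.tangent
        (tangentMap I.tangent I.tangent (geodesicFlow g τ)) ξ Z) 0 := by
      have e1 : tangentParam I.tangent (tangentParam I P) (w + (0 : ℝ) • ζ) = ξ := by simp [eξ]
      have h3 := h1.comp (f := tangentMap I.tangent I.tangent (geodesicFlow g τ))
        (I' := I.tangent.tangent) (by
          rw [e1]
          refine mdifferentiableAt_tangentMap_flow hg ?_
          rw [eξ]
          exact hτg.2.2.1)
      rwa [e1] at h3
    have h3 : (fun s : ℝ => tangentMap I.tangent I.tangent (geodesicFlow g τ)
        (tangentParam I.tangent (tangentParam I P) (w + s • ζ))) =ᶠ[𝓝 0]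
        fun s => tangentParam I.tangent (tangentParam I P) (c τ s, Ξ τ s) := by
      filter_upwards [hl.eventually hτ] with s hs
      rw [ec, eΞ]
      exact congrArg₂ (mkT I.tangent) hs.2.2.2.1 (hs.2.2.2.2 (w.2 + s • ζ.2))
    have h4 := h2.congr_of_eventuallyEq h3.symm
    have hcΩ : (c τ 0).1 ∈ Ω := by rw [hc00]; exact hτg.2.1
    have hmem : (c τ 0, Ξ τ 0) ∈ (Ω ×ˢ (univ : Set E)) ×ˢ (univ : Set (E × E)) :=
      ⟨⟨hcΩ, mem_univ _⟩, mem_univ _⟩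
    have h5 := hTTP.hasDerivAt (mem_image_of_mem _ hmem) h4
    have h6' : (fun s => (c τ s, Ξ τ s)) =ᶠ[𝓝 0] fun s => tangentParamInv (tangentParamInv Q)
        (tangentParam I.tangent (tangentParam I P) (c τ s, Ξ τ s)) := by
      have h7 : ∀ᶠ s in 𝓝 (0 : ℝ), (c τ s).1 ∈ Ω := by
        filter_upwards [hl.eventually hτ] with s hs
        rw [ec]
        exact hs.2.1
      filter_upwards [h7] with s hs
      exact (hTTP.left_inv (c τ s, Ξ τ s) ⟨⟨hs, mem_univ _⟩, mem_univ _⟩).symm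
    have h6 := h5.congr_of_eventuallyEq h6'
    have h8 := hTTP.mD_mD_inv hmem (mD I.tangent.tangent I.tangent.tangent
        (tangentMap I.tangent I.tangent (geodesicFlow g τ)) ξ Z)
    have h9 : mD I.tangent.tangent 𝓘(ℝ, (E × E) × (E × E)) (tangentParamInv (tangentParamInv Q))
        (tangentParam I.tangent (tangentParam I P) (c τ 0, Ξ τ 0))
        (mD I.tangent.tangent I.tangent.tangent
        (tangentMap I.tangent I.tangent (geodesicFlow g τ)) ξ Z) =
        (deriv (c τ) 0, deriv (Ξ τ) 0) :=
      Prod.ext h6.prod_fst.deriv.symm h6.prod_snd.deriv.symm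
    rw [h9] at h8
    have h10 : tangentMap I.tangent I.tangent (geodesicFlow g τ) ξ =
        tangentParam I.tangent (tangentParam I P) (c τ 0, Ξ τ 0) := by
      have := h3.self_of_nhds
      simpa [eξ] using this
    rw [h10, ← h8, D.tanPart_eq hg (w := (c τ 0, Ξ τ 0)) hcΩ, eX]
  have hneg : ∀ᶠ τ in 𝓝 (0 : ℝ), ∀ a : E × E,
      mD I.tangent I.tangent (geodesicFlow g (-τ)) (geodesicFlow g τ ξ.proj)
        (mD 𝓘(ℝ, E × E) I.tangent (tangentParam I P) (c τ 0) a) =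
      mD 𝓘(ℝ, E × E) I.tangent (tangentParam I P) w.1
        (fderiv ℝ (fun u => Φ (-τ, u)) (c τ 0) a) := by
    have hcc : Filter.Tendsto (fun τ : ℝ => (-τ, c τ 0)) (𝓝 0) (𝓝 (0, w.1)) := by
      have h1 : Filter.Tendsto (fun τ : ℝ => Φ (τ, w.1)) (𝓝 0) (𝓝 (Φ (0, w.1))) :=
        cΦ.continuousAt.tendsto.comp hτ0
      rw [h0.self_of_nhds] at h1
      simp only [hc00]
      exact (continuous_neg.tendsto' 0 0 (by simp)).prodMk_nhds h1
    filter_upwards [hτ0.eventually hgood, hcc.eventually hgood] with τ h1 h2 a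
    have e1 : geodesicFlow g τ ξ.proj = tangentParam I P (c τ 0) := by
      rw [eξ, hc00]
      exact h1.2.2.2.1
    have e2 : Φ (-τ, c τ 0) = w.1 := by
      have h3 := h2.2.2.2.1
      rw [← e1, eξ] at h3
      have h4 := (geodesicFlow_neg hg h1.2.2.1).2
      have h5 : tangentParam I P w.1 = tangentParam I P (Φ (-τ, c τ 0)) := h4.symm.trans h3
      have h6 := congrArg (tangentParamInv Q) h5
      rw [hTP.left_inv _ ⟨hw, mem_univ _⟩, hTP.left_inv _ ⟨h2.2.1, mem_univ _⟩] at h6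
      exact h6.symm
    rw [e1, h2.2.2.2.2 a, e2]
  have hlin : HasDerivAt (fun τ => mD 𝓘(ℝ, E × E) I.tangent (tangentParam I P) w.1
      (fderiv ℝ (fun u => Φ (-τ, u)) (c τ 0)
        (X τ - (0, B (c τ 0).1 (kap Γ (c τ 0) (X τ)) (c τ 0).2 • (c τ 0).2))))
      (mD 𝓘(ℝ, E × E) I.tangent (tangentParam I P) w.1 S) 0 :=
    (mD 𝓘(ℝ, E × E) I.tangent (tangentParam I P) w.1).hasFDerivAt.comp_hasDerivAt 0 hS
  refine hlin.congr_of_eventuallyEq ?_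
  filter_upwards [hX, hneg] with τ h1 h2
  rw [h1, h2]

end ChartData

end FlowTransport

/-! ### Conserved quantities and constraints along the flow -/

section Invariants

variable {E : Type*} [NormedAddCommGroup E] [NormedSpace ℝ E]
  {H : Type*} [TopologicalSpace H] {I : ModelWithCorners ℝ E H}
  {N : Type*} [TopologicalSpace N] [ChartedSpace H N] [IsManifold I ∞ N] [IsManifold I 1 N]
  [I.Boundaryless]
  {g : (p : N) → TangentSpace I p → TangentSpace I p → ℝ} (hg : IsRiemannian I g)

omit [IsManifold I ∞ N] [IsManifold I 1 N] [I.Boundaryless] in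
theorem IsParam.exists_curve {P : E → N} {Q : N → E} {Ω : Set E} (hP : IsParam I P Q Ω) {c : ℝ → N}
    {ξ : E} {t : ℝ} (hc : c t ∈ P '' Ω) (h : HasVel I c ξ t) :
    ∃ (z : ℝ → E) (a : E), z t ∈ Ω ∧ HasDerivAt z a t ∧ (∀ᶠ s in 𝓝 t, z s ∈ Ω ∧ c s = P (z s)) ∧
      ξ = mD 𝓘(ℝ, E) I P (z t) a := by
  have h1 := h.continuousAt.eventually_mem (hP.isOpen_image.mem_nhds hc)
  refine ⟨fun s => Q (c s), _, hP.inv_mem hc, hP.hasDerivAt hc h, ?_, ?_⟩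
  · filter_upwards [h1] with s hs using ⟨hP.inv_mem hs, (hP.right_inv hs).symm⟩
  · obtain ⟨y, hy, e⟩ := hc
    change ξ = mD 𝓘(ℝ, E) I P (Q (c t)) (mD I 𝓘(ℝ, E) Q (c t) ξ)
    rw [← e, hP.left_inv y hy, hP.mD_mD_inv hy]

theorem exists_hasVel (V : TangentBundle I N) (a : E × E) :
    ∃ c : ℝ → TangentBundle I N, c 0 = V ∧ HasVel I.tangent c a 0 := by
  have hP := isParam_extChartAt (I := I) V.proj
  have hT := hP.tangent
  obtain ⟨z, hz, e⟩ := hP.exists_tangentParam (V := V)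
    ⟨_, mem_extChartAt_target V.proj, extChartAt_to_inv V.proj⟩
  have hzz : z ∈ (extChartAt I V.proj).target ×ˢ (univ : Set E) := ⟨hz, mem_univ _⟩
  set b := mD I.tangent 𝓘(ℝ, E × E) (tangentParamInv (extChartAt I V.proj))
    (tangentParam I (extChartAt I V.proj).symm z) a with hb
  have hline : HasDerivAt (fun s : ℝ => z + s • b) b 0 := by
    simpa using ((hasDerivAt_id (0 : ℝ)).smul_const b).const_add z
  refine ⟨fun s => tangentParam I (extChartAt I V.proj).symm (z + s • b), ?_, ?_⟩
  · simpa using e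
  · have h1 := hT.hasVel (z := fun s : ℝ => z + s • b) (t := 0)
      (by rw [zero_smul, add_zero]; exact hzz) hline
    refine h1.congr_vel ?_
    rw [zero_smul, add_zero, hb, hT.mD_mD_inv hzz]

include hg

/-- The squared length of `V` changes by `2 ⟨κ ξ, V⟩`; thus a velocity `ξ` is tangent to the sphere
bundle exactly if its connector is orthogonal to `V`. -/
theorem hasDerivAt_metric_self {V : ℝ → TangentBundle I N} {ξ : E × E} {t : ℝ}
    (h : HasVel I.tangent V ξ t) :
    HasDerivAt (fun s => g (V s).proj (V s).snd (V s).snd)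
      (2 * g (V t).proj (connector g (V t) ξ) (V t).snd) t := by
  obtain ⟨P, Q, Ω, B, Γ, w, D, hw, e, -⟩ := hg.exists_chart (V t)
  obtain ⟨z, a, hz, ha, hev, rfl⟩ := D.param.tangent.exists_curve
    ⟨w, ⟨hw, mem_univ _⟩, e⟩ h
  have hd := HasCov.metric D.lc hz.1 rfl ha.prod_fst (HasCov.of_hasDerivAt (Γ := Γ) (y := (z t).1)
    (v := a.1) ha.prod_snd) (HasCov.of_hasDerivAt ha.prod_snd)
  refine (hd.congr_of_eventuallyEq ?_).congr_deriv ?_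
  · filter_upwards [hev] with s hs
    rw [hs.2]
    exact D.coeff _ hs.1.1 _ _
  · rw [hev.self_of_nhds.2, D.connector hz.1, kap_apply]
    have h1 := D.coeff _ hz.1 (a.2 + Γ (z t).1 a.1 (z t).2) (z t).2
    rw [D.lc.metric_symm _ hz.1 (z t).2, ← two_mul]
    exact congrArg (2 * ·) h1.symm

omit [I.Boundaryless] in
theorem exists_curve_tangent {Ξ : ℝ → TangentBundle I.tangent (TangentBundle I N)}
    {Z : (E × E) × (E × E)} {t : ℝ} (h : HasVel I.tangent.tangent Ξ Z t) :
    ∃ (P : E → N) (Q : N → E) (Ω : Set E) (B : E → E →L[ℝ] E →L[ℝ] ℝ) (Γ : E → E →L[ℝ] E →L[ℝ] E)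
      (w : ℝ → (E × E) × (E × E)) (ζ : (E × E) × (E × E)), ChartData I g P Q Ω B Γ ∧
      (w t).1.1 ∈ Ω ∧ HasDerivAt w ζ t ∧ (∀ᶠ s in 𝓝 t, (w s).1.1 ∈ Ω ∧
        Ξ s = tangentParam I.tangent (tangentParam I P) (w s)) ∧
      Z = mD 𝓘(ℝ, (E × E) × (E × E)) I.tangent.tangent
        (tangentParam I.tangent (tangentParam I P)) (w t) ζ := by
  obtain ⟨B, Γ, D⟩ := hg (Ξ t).proj.proj
  obtain ⟨w, hw, e⟩ := D.param.exists_tangentParam (V := (Ξ t).proj)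
    ⟨_, mem_extChartAt_target (Ξ t).proj.proj, extChartAt_to_inv (Ξ t).proj.proj⟩
  obtain ⟨w', hw', e'⟩ := D.param.tangent.exists_tangentParam (V := Ξ t) ⟨w, ⟨hw, mem_univ _⟩, e⟩
  obtain ⟨z, a, hz, ha, hev, hZ⟩ := D.param.tangent.tangent.exists_curve
    ⟨w', ⟨hw', mem_univ _⟩, e'⟩ h
  exact ⟨_, _, _, B, Γ, z, a, D, hz.1.1, ha, hev.mono fun s hs => ⟨hs.1.1.1, hs.2⟩, hZ⟩

/-- Differentiation of the equation of the tangent bundle of the unit tangent bundle. -/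
theorem hasDerivAt_constraint {Ξ : ℝ → TangentBundle I.tangent (TangentBundle I N)}
    {Z : (E × E) × (E × E)} {t : ℝ} (h : HasVel I.tangent.tangent Ξ Z t) :
    HasDerivAt (fun s => g (Ξ s).proj.proj (connector g (Ξ s).proj (Ξ s).snd) (Ξ s).proj.snd)
      (g (Ξ t).proj.proj (connector g (Ξ t).proj (sasCov g (Ξ t) Z)) (Ξ t).proj.snd
        + g (Ξ t).proj.proj (connector g (Ξ t).proj (Ξ t).snd)
          (connector g (Ξ t).proj (horiz (Ξ t) Z))) t := by
  obtain ⟨P, Q, Ω, B, Γ, w, ζ, D, hw, hd, hev, rfl⟩ := exists_curve_tangent hg h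
  have hz := hd.prod_fst
  have hξ := hd.prod_snd
  have hΓ := D.lc.differentiableAt hw
  have hk : HasDerivAt (fun s => kap Γ (w s).1 (w s).2) (ζ.2.2 + (fderiv ℝ Γ (w t).1.1 ζ.1.1
      (w t).2.1 (w t).1.2 + Γ (w t).1.1 ζ.2.1 (w t).1.2 + Γ (w t).1.1 (w t).2.1 ζ.1.2)) t := by
    simp only [kap_apply]
    exact hξ.prod_snd.add (hasDerivAt_bilin hΓ hz.prod_fst hξ.prod_fst hz.prod_snd)
  have h1 := HasCov.metric D.lc hw rfl hz.prod_fst (HasCov.of_hasDerivAt (Γ := Γ) (y := (w t).1.1)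
    (v := ζ.1.1) hk) (HasCov.of_hasDerivAt hz.prod_snd)
  refine (h1.congr_of_eventuallyEq ?_).congr_deriv ?_
  · filter_upwards [hev] with s hs
    rw [hs.2]
    have h2 := D.connector (z := (w s).1) hs.1 (w s).2
    refine Eq.trans ?_ (D.coeff _ hs.1 (kap Γ (w s).1 (w s).2) (w s).1.2)
    exact congrArg (fun u : E => g (P (w s).1.1) u (mD 𝓘(ℝ, E) I P (w s).1.1 (w s).1.2)) h2
  · have e0 := hev.self_of_nhds.2
    have h2 := D.connector (z := (w t).1) hw (w t).2
    have h3 := D.connector_sasaki hg hw (w t).2 ζ.1 ζ.2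
    have h4 := D.horiz_sasaki hw (w t).2 ζ.1 ζ.2
    have h5 := D.connector (z := (w t).1) hw ζ.1
    have h6 := D.connector (z := (w t).1) hw (ζ.2 + sasΓ Γ (w t).1 ζ.1 (w t).2)
    rw [e0]
    have h7 : g (P (w t).1.1) (mD 𝓘(ℝ, E) I P (w t).1.1
          (kap Γ (w t).1 (ζ.2 + sasΓ Γ (w t).1 ζ.1 (w t).2)))
        (mD 𝓘(ℝ, E) I P (w t).1.1 (w t).1.2) +
        g (P (w t).1.1) (mD 𝓘(ℝ, E) I P (w t).1.1 (kap Γ (w t).1 (w t).2))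
        (mD 𝓘(ℝ, E) I P (w t).1.1 (kap Γ (w t).1 ζ.1)) =
        B (w t).1.1 (ζ.2.2 + (fderiv ℝ Γ (w t).1.1 ζ.1.1
          (w t).2.1 (w t).1.2 + Γ (w t).1.1 ζ.2.1 (w t).1.2 + Γ (w t).1.1 (w t).2.1 ζ.1.2)
          + Γ (w t).1.1 ζ.1.1 (kap Γ (w t).1 (w t).2)) (w t).1.2 +
        B (w t).1.1 (kap Γ (w t).1 (w t).2) (ζ.1.2 + Γ (w t).1.1 ζ.1.1 (w t).1.2) := by
      rw [D.coeff _ hw, D.coeff _ hw, kap_apply Γ (w t).1 ζ.1, map_add (kap Γ (w t).1), kap_sasΓ,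
        kap_apply Γ (w t).1 ζ.2]
      have e1 := D.lc.metric_curv hw ζ.1.1 (w t).2.1 (w t).1.2 (w t).1.2
      have e2 := D.lc.metric_symm _ hw (curv Γ (w t).1.1 ζ.1.1 (w t).2.1 (w t).1.2) (w t).1.2
      simp only [sasV, map_add, map_sub, add_apply, sub_apply, map_smul, smul_apply, smul_eq_mul]
      linarith
    rw [← h7, ← h2, ← h5, ← h6, ← h3, ← h4]
    rfl

/-- Compatibility of the Sasaki connection with the Sasaki metric, along a curve in `TTN`. -/
theorem hasDerivAt_sasaki_self {Ξ : ℝ → TangentBundle I.tangent (TangentBundle I N)}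
    {Z : (E × E) × (E × E)} {t : ℝ} (h : HasVel I.tangent.tangent Ξ Z t) :
    HasDerivAt (fun s => sasakiMetric g (Ξ s).proj (Ξ s).snd (Ξ s).snd)
      (2 * sasakiMetric g (Ξ t).proj (sasCov g (Ξ t) Z) (Ξ t).snd) t := by
  obtain ⟨P, Q, Ω, B, Γ, w, ζ, D, hw, hd, hev, rfl⟩ := exists_curve_tangent hg h
  have hz := hd.prod_fst
  have hξ := hd.prod_snd
  have hB : DifferentiableAt ℝ (sasB B Γ) (w t).1 := (D.isCoeff_sasaki hw).differentiableAt
  have h1 := hasDerivAt_bilin hB hz hξ hξ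
  refine (h1.congr_of_eventuallyEq ?_).congr_deriv ?_
  · filter_upwards [hev] with s hs
    rw [hs.2]
    exact D.sasaki hs.1 (w s).2 (w s).2
  · have e0 := hev.self_of_nhds.2
    have h3 := D.connector_sasaki hg hw (w t).2 ζ.1 ζ.2
    have h4 := D.sasaki hw (ζ.2 + sasΓ Γ (w t).1 ζ.1 (w t).2) (w t).2
    rw [e0]
    have h5 : fderiv ℝ (sasB B Γ) (w t).1 ζ.1 (w t).2 (w t).2 + sasB B Γ (w t).1 ζ.2 (w t).2
        + sasB B Γ (w t).1 (w t).2 ζ.2 =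
        2 * sasB B Γ (w t).1 (ζ.2 + sasΓ Γ (w t).1 ζ.1 (w t).2) (w t).2 := by
      rw [D.lc.sasB_compat hw, D.lc.sasB_symm hw (w t).2 ζ.2,
        D.lc.sasB_symm hw (w t).2 (sasΓ Γ (w t).1 ζ.1 (w t).2), map_add, add_apply]
      ring
    rw [h5, ← h4, ← h3]
    rfl

variable [T2Space N]

/-- The geodesic flow preserves the length of vectors. -/
theorem metric_geodesicFlow {t : ℝ} {v : TangentBundle I N} (hv : v ∈ flowDomain g t) :
    g (geodesicFlow g t v).proj (geodesicFlow g t v).snd (geodesicFlow g t v).snd =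
      g v.proj v.snd v.snd := by
  obtain ⟨V, a, b, hV, h0, ht, rfl, e⟩ := (flowsTo_iff hg).1 (flowsTo_geodesicFlow hg hv)
  rw [← e]
  have hd : ∀ s ∈ Ioo a b, HasDerivAt (fun s => g (V s).proj (V s).snd (V s).snd) 0 s := by
    intro s hs
    refine (hasDerivAt_metric_self hg (hV s hs)).congr_deriv ?_
    have h1 : g (V s).proj (connector g (V s) (spray g (V s))) (V s).snd =
      g (V s).proj (0 : E) (V s).snd := congrArg (fun u : E => g (V s).proj u (V s).snd)
        (connector_spray (V s))
    have h2 := hg.metricTensor.smul (V s).proj 0 0 (V s).snd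
    rw [zero_smul, zero_mul] at h2
    have h3 : g (V s).proj (0 : E) (V s).snd = 0 := h2
    rw [h1, h3, mul_zero]
  exact isOpen_Ioo.is_const_of_deriv_eq_zero isPreconnected_Ioo
    (fun s hs => (hd s hs).differentiableAt.differentiableWithinAt) (fun s hs => (hd s hs).deriv) ht h0

variable [FiniteDimensional ℝ E]

/-- Differentiate the conservation of length along a curve with velocity `a`. In particular `Dφ_t`
maps vectors tangent to `T¹N` to vectors tangent to `T¹N`. -/
theorem metric_connector_mD_flow {t : ℝ} {v : TangentBundle I N} (hv : v ∈ flowDomain g t)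
    (a : E × E) : g (geodesicFlow g t v).proj (connector g (geodesicFlow g t v)
      (mD I.tangent I.tangent (geodesicFlow g t) v a)) (geodesicFlow g t v).snd =
      g v.proj (connector g v a) v.snd := by
  obtain ⟨c, rfl, hc⟩ := exists_hasVel (I := I) v a
  have h1 := hasDerivAt_metric_self hg hc
  have h2 := hasDerivAt_metric_self hg (hc.comp (mdifferentiableAt_flow hg hv))
  have h3 : (fun s => g (geodesicFlow g t (c s)).proj (geodesicFlow g t (c s)).snd
      (geodesicFlow g t (c s)).snd) =ᶠ[𝓝 0] fun s => g (c s).proj (c s).snd (c s).snd := by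
    filter_upwards [hc.continuousAt.eventually_mem ((isOpen_flowDomain hg t).mem_nhds hv)] with s hs
    exact metric_geodesicFlow hg hs
  have h4 := h2.unique (h1.congr_of_eventuallyEq h3)
  linarith

/-- Transport by the flow of the tangential Sasaki covariant derivative. -/
theorem exists_hasDerivAt_transport {C₂ C₃ : ℝ}
    {ξ : TangentBundle I.tangent (TangentBundle I N)} {Z : (E × E) × (E × E)}
    {P : E → N} {Q : N → E} {Ω : Set E} {B : E → E →L[ℝ] E →L[ℝ] ℝ} {Γ : E → E →L[ℝ] E →L[ℝ] E}
    (D : ChartData I g P Q Ω B Γ) (hp : ξ.proj.proj ∈ P '' Ω)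
    (hC : CurvBound B Γ (Q ξ.proj.proj) C₂ C₃) (hT : g ξ.proj.proj ξ.proj.snd ξ.proj.snd = 1)
    (hN : g ξ.proj.proj (connector g ξ.proj (sasCov g ξ Z)) ξ.proj.snd
      + g ξ.proj.proj (connector g ξ.proj ξ.snd) (connector g ξ.proj (horiz ξ Z)) = 0) :
    ∃ S : E × E, HasDerivAt (fun τ => mD I.tangent I.tangent (geodesicFlow g (-τ))
        (geodesicFlow g τ ξ.proj) (tanPart g (tangentMap I.tangent I.tangent (geodesicFlow g τ) ξ)
          (mD I.tangent.tangent I.tangent.tangent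
            (tangentMap I.tangent I.tangent (geodesicFlow g τ)) ξ Z))) S 0 ∧
      g ξ.proj.proj (connector g ξ.proj S) ξ.proj.snd = 0 ∧
      √(sasakiMetric g ξ.proj S S) ≤ 5 * (C₂ ^ 2 * C₃) * (√(sasakiMetric g ξ.proj ξ.snd ξ.snd) *
        √(sasakiMetric g ξ.proj (horiz ξ Z) (horiz ξ Z))) := by
  obtain ⟨z, hz, e⟩ := D.param.exists_tangentParam (V := ξ.proj) hp
  obtain ⟨w, hw, rfl⟩ := D.param.tangent.exists_tangentParam (V := ξ) ⟨z, ⟨hz, mem_univ _⟩, e⟩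
  have hw := hw.1
  obtain ⟨ζ, rfl⟩ : ∃ ζ, mD 𝓘(ℝ, (E × E) × (E × E)) I.tangent.tangent
      (tangentParam I.tangent (tangentParam I P)) w ζ = Z :=
    ⟨_, D.param.tangent.tangent.mD_mD_inv ⟨⟨hw, mem_univ _⟩, mem_univ _⟩ Z⟩
  have hC' : CurvBound B Γ w.1.1 C₂ C₃ := by
    have h1 : Q (P w.1.1) = w.1.1 := D.param.left_inv _ hw
    rw [← h1]
    exact hC
  have h2 := D.connector (z := w.1) hw w.2
  have h3 := D.connector_sasaki hg hw w.2 ζ.1 ζ.2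
  have h4 := D.horiz_sasaki hw w.2 ζ.1 ζ.2
  have h5 := D.connector (z := w.1) hw ζ.1
  have h6 := D.connector (z := w.1) hw (ζ.2 + sasΓ Γ w.1 ζ.1 w.2)
  have hT' : B w.1.1 w.1.2 w.1.2 = 1 := (D.coeff _ hw _ _).symm.trans hT
  have hN' : B w.1.1 (kap Γ w.1 (ζ.2 + sasΓ Γ w.1 ζ.1 w.2)) w.1.2
      + B w.1.1 (kap Γ w.1 w.2) (kap Γ w.1 ζ.1) = 0 := by
    rw [← D.coeff _ hw, ← D.coeff _ hw, ← h2, ← h5, ← h6, ← h3, ← h4]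
    exact hN
  obtain ⟨S, hS, hS1, hS2⟩ := D.exists_hasDerivAt_transport hg hw hC' hT' hN' rfl rfl
  refine ⟨_, hS, ?_, ?_⟩
  · have h7 := D.connector (z := w.1) hw S
    rw [← D.coeff _ hw, ← h7] at hS1
    exact hS1
  · rw [← D.sasaki hw, ← D.sasaki hw, ← D.sasaki hw, ← h4] at hS2
    exact hS2

/-- The pull-back of the tangential Sasaki covariant derivative to the initial vector. -/
theorem hasDerivAt_pullback {t : ℝ} {ξ : TangentBundle I.tangent (TangentBundle I N)}
    {Z : (E × E) × (E × E)} (hξ : ξ.proj ∈ flowDomain g t) {S : E × E}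
    (h : HasDerivAt (fun τ => mD I.tangent I.tangent (geodesicFlow g (-τ))
        (geodesicFlow g τ (tangentMap I.tangent I.tangent (geodesicFlow g t) ξ).proj)
        (tanPart g (tangentMap I.tangent I.tangent (geodesicFlow g τ)
          (tangentMap I.tangent I.tangent (geodesicFlow g t) ξ))
          (mD I.tangent.tangent I.tangent.tangent
            (tangentMap I.tangent I.tangent (geodesicFlow g τ))
            (tangentMap I.tangent I.tangent (geodesicFlow g t) ξ)
            (mD I.tangent.tangent I.tangent.tangent
              (tangentMap I.tangent I.tangent (geodesicFlow g t)) ξ Z)))) S 0) :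
    HasDerivAt (fun τ => mD I.tangent I.tangent (geodesicFlow g (-τ))
        (geodesicFlow g τ ξ.proj) (tanPart g (tangentMap I.tangent I.tangent (geodesicFlow g τ) ξ)
          (mD I.tangent.tangent I.tangent.tangent
            (tangentMap I.tangent I.tangent (geodesicFlow g τ)) ξ Z)))
      (mD I.tangent I.tangent (geodesicFlow g (-t)) (geodesicFlow g t ξ.proj) S) t := by
  have h1 := (mD I.tangent I.tangent (geodesicFlow g (-t))
    (geodesicFlow g t ξ.proj)).hasFDerivAt.comp_hasDerivAt 0 h
  have h2 := HasDerivAt.comp_sub_const t t (by rw [sub_self]; exact h1)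
  -- By the group law, pulling back from time `s` to `0` is pulling back from `s` to `t`, followed
  -- by the linear map `Dφ_{-t}`, which does not depend on `s`.
  refine h2.congr_of_eventuallyEq ?_
  have hfl := (contMDiffAt_geodesicFlow hg (mem_flowDomain_zero hg (geodesicFlow g t ξ.proj)).1
    one_ne_zero).2
  have hcont : Filter.Tendsto (fun s : ℝ => (s - t, geodesicFlow g t ξ.proj)) (𝓝 t)
      (𝓝 (0, geodesicFlow g t ξ.proj)) :=
    Continuous.tendsto' (by fun_prop) _ _ (by simp)
  filter_upwards [hcont.eventually hfl] with s hs
  have e1 : geodesicFlow g s ξ.proj = geodesicFlow g (s - t) (geodesicFlow g t ξ.proj) := by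
    have := (geodesicFlow_add hg hξ hs).2
    rwa [add_sub_cancel] at this
  have e2 := tangentMap_flow_add hg hξ hs
  have e3 := mD_tangentMap_flow_add hg hξ hs Z
  rw [add_sub_cancel] at e2 e3
  have h3 := geodesicFlow_neg hg hs
  have e4 : ∀ a, mD I.tangent I.tangent (geodesicFlow g (-s))
      (geodesicFlow g (s - t) (geodesicFlow g t ξ.proj)) a =
      mD I.tangent I.tangent (geodesicFlow g (-t)) (geodesicFlow g t ξ.proj)
        (mD I.tangent I.tangent (geodesicFlow g (-(s - t)))
          (geodesicFlow g (s - t) (geodesicFlow g t ξ.proj)) a) := by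
    intro a
    have h4 := mD_flow_add hg (t := -(s - t)) (s := -t) h3.1 (by
      rw [h3.2]; exact (geodesicFlow_neg hg hξ).1) a
    rw [h3.2] at h4
    rw [← h4]
    congr 3
    ring
  rw [e1, e2, e3, e4]
  rfl

end Invariants

/-! ### Growth of the tangential connector: Duhamel's formula -/

section Duhamel

variable {E : Type*} [NormedAddCommGroup E] [NormedSpace ℝ E]
  {H : Type*} [TopologicalSpace H] {I : ModelWithCorners ℝ E H}
  {N : Type*} [TopologicalSpace N] [ChartedSpace H N] [IsManifold I ∞ N] [IsManifold I 1 N]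
  [I.Boundaryless]
  {g : (p : N) → TangentSpace I p → TangentSpace I p → ℝ} (hg : IsRiemannian I g)

/-- The norm of the Sasaki metric. -/
def sasN (g : (p : N) → TangentSpace I p → TangentSpace I p → ℝ) (V : TangentBundle I N)
    (a : E × E) : ℝ :=
  √(sasakiMetric g V a a)

/-- The component of `a` normal to the sphere bundle, up to scaling. -/
def nrm (g : (p : N) → TangentSpace I p → TangentSpace I p → ℝ) (V : TangentBundle I N)
    (a : E × E) : ℝ :=
  g V.proj (connector g V a) V.snd

omit [IsManifold I ∞ N] [I.Boundaryless] in
theorem sasN_nonneg (V : TangentBundle I N) (a : E × E) : 0 ≤ sasN g V a := Real.sqrt_nonneg _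

omit [I.Boundaryless] in
-- Differentiate `π ∘ Tf = f ∘ π`.
theorem horiz_tangentMap {f : TangentBundle I N → TangentBundle I N}
    {ξ : TangentBundle I.tangent (TangentBundle I N)}
    (hf : MDifferentiableAt I.tangent I.tangent f ξ.proj)
    (hf' : MDifferentiableAt I.tangent.tangent I.tangent.tangent (tangentMap I.tangent I.tangent f) ξ)
    (Z : (E × E) × (E × E)) :
    horiz (tangentMap I.tangent I.tangent f ξ)
      (mD I.tangent.tangent I.tangent.tangent (tangentMap I.tangent I.tangent f) ξ Z) =
      mD I.tangent I.tangent f ξ.proj (horiz ξ Z) := by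
  have h1 := mD_comp_apply (I := I.tangent.tangent) (I' := I.tangent.tangent) (I'' := I.tangent)
    (f := tangentMap I.tangent I.tangent f)
    (g := (TotalSpace.proj : TangentBundle I.tangent (TangentBundle I N) → TangentBundle I N))
    (x := ξ) (mdifferentiable_proj _) hf' Z
  have h2 := mD_comp_apply (I := I.tangent.tangent) (I' := I.tangent) (I'' := I.tangent)
    (f := (TotalSpace.proj : TangentBundle I.tangent (TangentBundle I N) → TangentBundle I N))
    (g := f) (x := ξ) hf (mdifferentiable_proj _) Z
  exact h1.symm.trans h2

include hg

theorem sasN_sq (V : TangentBundle I N) (a : E × E) : sasN g V a ^ 2 = sasakiMetric g V a a :=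
  Real.sq_sqrt ((hg.metricTensor_sasaki.isInner V).nonneg a)

theorem sasakiMetric_vertical (V : TangentBundle I N) (a : E × E) (w : E) :
    sasakiMetric g V a ((0, w) : E × E) = g V.proj (connector g V a) w := by
  refine (sasakiMetric_eq g V a (0, w)).trans ?_
  have h1 : horiz V ((0, w) : E × E) = (0 : E) := horiz_eq V (0, w)
  have h2 := connector_vertical hg V w
  have h3 := (hg.metricTensor.isInner V.proj).smul_left 0 0 (horiz V a)
  rw [zero_smul, zero_mul] at h3
  have h4 : g V.proj (horiz V a) (0 : E) = 0 :=
    ((hg.metricTensor.isInner V.proj).symm (horiz V a) 0).trans h3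
  rw [h1, h2, h4, zero_add]

theorem nrm_sub_smul (V : TangentBundle I N) (a b : E × E) (r : ℝ) :
    nrm g V (a - r • b) = nrm g V a - r * nrm g V b := by
  have hi := hg.metricTensor.isInner V.proj
  have h1 : (connector g V (a - r • b : E × E) : E) = connector g V a + (-r) • (connector g V b : E) := by
    have := hg.connector_add V a ((-r) • b)
    rw [hg.connector_smul, neg_smul, ← sub_eq_add_neg] at this
    exact this
  have h2 : nrm g V (a - r • b) = g V.proj ((connector g V a : E) + (-r) • (connector g V b : E)) V.snd :=
    congrArg (fun u : E => g V.proj u V.snd) h1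
  rw [h2]
  refine (hi.add_left _ _ _).trans ?_
  have h3 : g V.proj ((-r) • (connector g V b : E)) V.snd = (-r) * nrm g V b := hi.smul_left _ _ _
  rw [h3]
  simp only [nrm]
  ring

/-- The vertical vector with connector `v` is a unit vector, and pairing with it is `nrm`; `tanPart`
removes this component, so the squares of the norms obey Pythagoras. This identifies the norm of
`tanPart` with `tangentialNorm`. -/
theorem tanPart_spec (ξ : TangentBundle I.tangent (TangentBundle I N)) (Z : (E × E) × (E × E))
    (h1 : g ξ.proj.proj ξ.proj.snd ξ.proj.snd = 1) :
    nrm g ξ.proj (tanPart g ξ Z) = 0 ∧ sasakiMetric g ξ.proj (tanPart g ξ Z) (tanPart g ξ Z) =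
      sasakiMetric g ξ.proj (sasCov g ξ Z) (sasCov g ξ Z) - nrm g ξ.proj (sasCov g ξ Z) ^ 2 := by
  set X := sasCov g ξ Z with hX
  set V := ξ.proj with hV
  have e : tanPart g ξ Z = X - nrm g V X • ((0, vec V) : E × E) := by
    rw [Prod.smul_mk, smul_zero]; rfl
  have hi := hg.metricTensor_sasaki.isInner V
  have h2 : nrm g V (0, vec V) = 1 := by
    have := connector_vertical hg V (vec V)
    exact (congrArg (fun u : E => g V.proj u V.snd) this).trans h1
  have h3 : ∀ a : E × E, sasakiMetric g V a ((0, vec V) : E × E) = nrm g V a := fun a =>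
    sasakiMetric_vertical hg V a (vec V)
  rw [e]
  refine ⟨by rw [nrm_sub_smul hg, h2]; ring, ?_⟩
  have h4 := hi.sub_left X (nrm g V X • ((0, vec V) : E × E)) (X - nrm g V X • ((0, vec V) : E × E))
  have h5 := hi.sub_right X X (nrm g V X • ((0, vec V) : E × E))
  have h6 := hi.sub_right (nrm g V X • ((0, vec V) : E × E)) X (nrm g V X • ((0, vec V) : E × E))
  have h7 := hi.smul_right (nrm g V X) X ((0, vec V) : E × E)
  have h8 := hi.smul_left (nrm g V X) ((0, vec V) : E × E) X
  have h9 := hi.smul_left (nrm g V X) ((0, vec V) : E × E) (nrm g V X • ((0, vec V) : E × E))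
  have h10 := hi.smul_right (nrm g V X) ((0, vec V) : E × E) ((0, vec V) : E × E)
  have h11 := hi.symm ((0, vec V) : E × E) X
  rw [h3] at h7 h10 h11
  rw [h2] at h10
  rw [h11] at h8
  rw [h10] at h9
  refine h4.trans ?_
  rw [h5, h6, h7, h8, h9]
  ring

/-- The mean value inequality for the Sasaki norm of a curve of vectors at one point. -/
theorem sasN_sub_le [FiniteDimensional ℝ E] (V : TangentBundle I N) {Y Y' : ℝ → E × E} {t K : ℝ}
    (hY : ∀ s ∈ uIcc 0 t, HasDerivAt Y (Y' s) s) (hK : ∀ s ∈ uIcc 0 t, sasN g V (Y' s) ≤ K) :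
    sasN g V (Y t) ≤ sasN g V (Y 0) + K * |t| := by
  have hi := hg.metricTensor_sasaki.isInner V
  set w := Y t - Y 0 with hw
  -- The Sasaki norm at `V` is not the norm of the model space. Pairing with the increment `w`
  -- reduces the claim to the mean value inequality for real functions: `|w|² ≤ K |t| |w|`.
  let L : E × E →ₗ[ℝ] ℝ :=
    { toFun := fun a => sasakiMetric g V a w
      map_add' := fun a b => hi.add_left a b w
      map_smul' := fun r a => hi.smul_left r a w }
  have h1 : ∀ s ∈ uIcc 0 t, HasDerivWithinAt (fun s => L (Y s)) (L (Y' s)) (uIcc 0 t) s := fun s hs =>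
    ((LinearMap.toContinuousLinearMap L).hasFDerivAt.comp_hasDerivAt s (hY s hs)).hasDerivWithinAt
  have h2 : ∀ s ∈ uIcc 0 t, ‖L (Y' s)‖ ≤ K * sasN g V w := by
    intro s hs
    refine (hi.abs_le (Y' s) w).trans ?_
    exact mul_le_mul_of_nonneg_right (hK s hs) (sasN_nonneg _ _)
  have h3 := (convex_uIcc 0 t).norm_image_sub_le_of_norm_hasDerivWithin_le h1 h2 left_mem_uIcc
    right_mem_uIcc
  have h4 : L (Y t) - L (Y 0) = sasN g V w ^ 2 := by
    rw [sasN_sq hg, ← map_sub]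
    rfl
  rw [h4, sub_zero, Real.norm_eq_abs, Real.norm_eq_abs, abs_of_nonneg (sq_nonneg _)] at h3
  have hKt : 0 ≤ K * |t| := mul_nonneg
    ((sasN_nonneg (g := g) V (Y' 0)).trans (hK 0 left_mem_uIcc)) (abs_nonneg t)
  have h5 : sasN g V w ≤ K * |t| := by
    rcases (sasN_nonneg (g := g) V w).eq_or_lt with h0 | h0
    · rw [← h0]; exact hKt
    · refine le_of_mul_le_mul_right ?_ h0
      nlinarith
  have h6 : sasN g V (Y 0 + w) ≤ sasN g V (Y 0) + sasN g V w := hi.fnorm_add (Y 0) w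
  rw [hw, add_sub_cancel] at h6
  linarith

variable [FiniteDimensional ℝ E] [T2Space N]

/-- Growth of the tangential Sasaki covariant derivative under the geodesic flow. -/
theorem sasN_flow_le {t : ℝ} {v : TangentBundle I N}
    {σ : ℝ → TangentBundle I.tangent (TangentBundle I N)}
    {Z : (E × E) × (E × E)} {s₀ : ℝ} (hv : (σ s₀).proj = v) (hσ : HasVel I.tangent.tangent σ Z s₀)
    (h1 : ∀ᶠ s in 𝓝 s₀, g (σ s).proj.proj (σ s).proj.snd (σ s).proj.snd = 1 ∧
      nrm g (σ s).proj (σ s).snd = 0)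
    (hD : ∀ s ∈ uIcc 0 t, v ∈ flowDomain g s) {A C₂ C₃ : ℝ} (hA : 0 ≤ A) (hC₃ : 0 ≤ C₃)
    (hA₁ : ∀ s ∈ uIcc 0 t, ∀ a : E × E, nrm g v a = 0 →
      sasN g (geodesicFlow g s v) (mD I.tangent I.tangent (geodesicFlow g s) v a) ≤ A * sasN g v a)
    (hA₂ : ∀ s ∈ uIcc 0 t, ∀ a : E × E, nrm g (geodesicFlow g s v) a = 0 →
      sasN g v (mD I.tangent I.tangent (geodesicFlow g (-s)) (geodesicFlow g s v) a) ≤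
        A * sasN g (geodesicFlow g s v) a)
    (hK : ∀ s ∈ uIcc 0 t, ∃ (P : E → N) (Q : N → E) (Ω : Set E) (B : E → E →L[ℝ] E →L[ℝ] ℝ)
      (Γ : E → E →L[ℝ] E →L[ℝ] E), ChartData I g P Q Ω B Γ ∧ (geodesicFlow g s v).proj ∈ P '' Ω ∧
        CurvBound B Γ (Q (geodesicFlow g s v).proj) C₂ C₃) :
    sasN g (geodesicFlow g t v) (horiz (tangentMap I.tangent I.tangent (geodesicFlow g t) (σ s₀))
      (mD I.tangent.tangent I.tangent.tangent (tangentMap I.tangent I.tangent (geodesicFlow g t))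
        (σ s₀) Z)) ≤ A * sasN g v (horiz (σ s₀) Z) ∧
    sasN g (geodesicFlow g t v) (tanPart g (tangentMap I.tangent I.tangent (geodesicFlow g t) (σ s₀))
      (mD I.tangent.tangent I.tangent.tangent (tangentMap I.tangent I.tangent (geodesicFlow g t))
        (σ s₀) Z)) ≤ A * (sasN g v (tanPart g (σ s₀) Z) +
          A * (5 * (C₂ ^ 2 * C₃) * ((A * sasN g v (vec (σ s₀))) * (A * sasN g v (horiz (σ s₀) Z)))) * |t|) := by
  subst hv
  set ξ := σ s₀ with hξ
  set v := ξ.proj with hv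
  -- the horizontal part is tangent to the unit tangent bundle
  have hη : nrm g v (horiz ξ Z) = 0 := by
    have h2 := hσ.comp (I' := I.tangent) (f := (TotalSpace.proj : TangentBundle I.tangent
      (TangentBundle I N) → TangentBundle I N)) (mdifferentiable_proj _)
    have h3 := hasDerivAt_metric_self hg h2
    have h4 : (fun s => g (σ s).proj.proj (σ s).proj.snd (σ s).proj.snd) =ᶠ[𝓝 s₀] fun _ => 1 :=
      h1.mono fun s hs => hs.1
    have h5 : 2 * nrm g v (horiz ξ Z) = 0 := h3.unique ((hasDerivAt_const s₀ (1 : ℝ)).congr_of_eventuallyEq h4)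
    linarith
  have hηt : ∀ s ∈ uIcc 0 t, horiz (tangentMap I.tangent I.tangent (geodesicFlow g s) ξ)
      (mD I.tangent.tangent I.tangent.tangent (tangentMap I.tangent I.tangent (geodesicFlow g s))
        ξ Z) = mD I.tangent I.tangent (geodesicFlow g s) v (horiz ξ Z) := fun s hs =>
    horiz_tangentMap (mdifferentiableAt_flow hg (hD s hs))
      (mdifferentiableAt_tangentMap_flow hg (hD s hs)) Z
  have h10 := h1.self_of_nhds
  -- the constraints along the flow
  have hunit : ∀ s ∈ uIcc 0 t, g (geodesicFlow g s v).proj (geodesicFlow g s v).snd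
      (geodesicFlow g s v).snd = 1 := fun s hs => (metric_geodesicFlow hg (hD s hs)).trans h10.1
  have hcon : ∀ s ∈ uIcc 0 t, g (geodesicFlow g s v).proj (connector g (geodesicFlow g s v)
      (sasCov g (tangentMap I.tangent I.tangent (geodesicFlow g s) ξ)
      (mD I.tangent.tangent I.tangent.tangent (tangentMap I.tangent I.tangent (geodesicFlow g s))
        ξ Z))) (geodesicFlow g s v).snd
      + g (geodesicFlow g s v).proj (connector g (geodesicFlow g s v)
        (mD I.tangent I.tangent (geodesicFlow g s) v (vec ξ))) (connector g (geodesicFlow g s v)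
        (horiz (tangentMap I.tangent I.tangent (geodesicFlow g s) ξ)
        (mD I.tangent.tangent I.tangent.tangent (tangentMap I.tangent I.tangent (geodesicFlow g s))
        ξ Z))) = 0 := by
    intro s hs
    have h2 := hσ.comp (mdifferentiableAt_tangentMap_flow hg (hD s hs))
    have h3 := hasDerivAt_constraint hg h2
    -- The connector of `Dφ_s ξ` stays orthogonal to the base vector along the whole curve, by
    -- conservation, so the derivative of this constraint vanishes.
    refine h3.unique ((hasDerivAt_const s₀ (0 : ℝ)).congr_of_eventuallyEq ?_)
    have hc : ContinuousAt (fun r => (σ r).proj) s₀ :=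
      ContinuousAt.comp (g := (TotalSpace.proj : TangentBundle I.tangent (TangentBundle I N) → _))
        (FiberBundle.continuous_proj (E × E) (TangentSpace I.tangent)).continuousAt hσ.continuousAt
    filter_upwards [hc.eventually_mem ((isOpen_flowDomain hg s).mem_nhds (hD s hs)), h1] with r hr hr'
    exact (metric_connector_mD_flow hg hr (vec (σ r))).trans hr'.2
  have hC : 0 ≤ 5 * (C₂ ^ 2 * C₃) := by positivity
  -- the derivative of the pull-back
  have hder : ∀ s ∈ uIcc 0 t, ∃ S : E × E, HasDerivAt (fun τ => mD I.tangent I.tangent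
      (geodesicFlow g (-τ)) (geodesicFlow g τ v) (tanPart g (tangentMap I.tangent I.tangent
        (geodesicFlow g τ) ξ) (mD I.tangent.tangent I.tangent.tangent
            (tangentMap I.tangent I.tangent (geodesicFlow g τ)) ξ Z))) S s ∧
      sasN g v S ≤ A * (5 * (C₂ ^ 2 * C₃) * ((A * sasN g v (vec ξ)) * (A * sasN g v (horiz ξ Z)))) := by
    intro s hs
    obtain ⟨P, Q, Ω, B, Γ, D, hp, hCB⟩ := hK s hs
    obtain ⟨S, hS, hS1, hS2⟩ := exists_hasDerivAt_transport hg D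
      (ξ := tangentMap I.tangent I.tangent (geodesicFlow g s) ξ)
      (Z := mD I.tangent.tangent I.tangent.tangent (tangentMap I.tangent I.tangent
        (geodesicFlow g s)) ξ Z) hp hCB (hunit s hs) (hcon s hs)
    refine ⟨_, hasDerivAt_pullback hg (hD s hs) hS, (hA₂ s hs S hS1).trans
      (mul_le_mul_of_nonneg_left ?_ hA)⟩
    refine hS2.trans (mul_le_mul_of_nonneg_left ?_ hC)
    have h3 := hA₁ s hs (vec ξ) h10.2
    have h4 := hA₁ s hs (horiz ξ Z) hη
    rw [← hηt s hs] at h4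
    exact mul_le_mul h3 h4 (Real.sqrt_nonneg _) (mul_nonneg hA (sasN_nonneg _ _))
  refine ⟨?_, ?_⟩
  · rw [hηt t right_mem_uIcc]
    exact hA₁ t right_mem_uIcc _ hη
  choose! Y' hY' hY'K using hder
  have h2 := sasN_sub_le hg v hY' hY'K
  have hDt := hD t right_mem_uIcc
  have hneg := geodesicFlow_neg hg hDt
  have e0 : geodesicFlow g 0 v = v := (mem_flowDomain_zero hg v).2
  have hid : geodesicFlow g 0 = fun w : TangentBundle I N => w :=
    funext fun w => (mem_flowDomain_zero hg w).2
  have hid2 : tangentMap I.tangent I.tangent (geodesicFlow g 0) =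
      fun w : TangentBundle I.tangent (TangentBundle I N) => w := by
    rw [hid]; exact tangentMap_id
  have e1 : mD I.tangent I.tangent (geodesicFlow g (-0)) (geodesicFlow g 0 v) (tanPart g
      (tangentMap I.tangent I.tangent (geodesicFlow g 0) ξ) (mD I.tangent.tangent I.tangent.tangent
        (tangentMap I.tangent I.tangent (geodesicFlow g 0)) ξ Z)) = tanPart g ξ Z := by
    rw [hid2, neg_zero, mD_id, hid, mD_id]
    rfl
  rw [e1] at h2
  set Xt := tanPart g (tangentMap I.tangent I.tangent (geodesicFlow g t) ξ)
    (mD I.tangent.tangent I.tangent.tangent (tangentMap I.tangent I.tangent (geodesicFlow g t)) ξ Z)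
    with hXt
  have hX0 : nrm g (geodesicFlow g t v) Xt = 0 :=
    (tanPart_spec hg (tangentMap I.tangent I.tangent (geodesicFlow g t) ξ) _
      (hunit t right_mem_uIcc)).1
  -- The pulled-back vector is tangent to `T¹N`, so the growth bound for `Dφ_t` applies to it and
  -- returns an estimate for `Xt` itself.
  have h3 : nrm g v (mD I.tangent I.tangent (geodesicFlow g (-t)) (geodesicFlow g t v) Xt) = 0 := by
    have := metric_connector_mD_flow hg hneg.1 Xt
    rw [hneg.2] at this
    exact this.trans hX0
  have h4 := hA₁ t right_mem_uIcc _ h3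
  have h5 := mD_flow_neg hg hneg.1 Xt
  rw [neg_neg, hneg.2] at h5
  rw [h5] at h4
  exact h4.trans (mul_le_mul_of_nonneg_left h2 hA)

end Duhamel

/-! ### The growth of the speed of a curve in `TT¹M` -/

section Pointwise

variable {m : ℕ} {M : Type*} [EMetricSpace M] [ChartedSpace (EuclideanSpace ℝ (Fin m)) M]
  [IsManifold (𝓡 m) ∞ M] [RiemannianBundle (fun x : M => TangentSpace (𝓡 m) x)]

local notation "𝔼" => EuclideanSpace ℝ (Fin m)

theorem mem_unitTangent_iff (v : TangentBundle (𝓡 m) M) :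
    v ∈ unitTangent m M ↔ metric v.proj v.snd v.snd = 1 := by
  have h1 : metric v.proj v.snd v.snd = ‖v.snd‖ ^ 2 := real_inner_self_eq_norm_sq v.snd
  rw [h1, pow_eq_one_iff_of_nonneg (norm_nonneg _) two_ne_zero]
  rfl

theorem mem_tangentUnitTangent_iff (ξ : TangentBundle (𝓡 m).tangent (TangentBundle (𝓡 m) M)) :
    ξ ∈ tangentUnitTangent m M ↔
      metric ξ.proj.proj ξ.proj.snd ξ.proj.snd = 1 ∧ nrm metric ξ.proj ξ.snd = 0 := by
  rw [← mem_unitTangent_iff]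
  rfl

variable [IsContMDiffRiemannianBundle (𝓡 m) ∞ (EuclideanSpace ℝ (Fin m))
      (fun x : M => TangentSpace (𝓡 m) x)]

theorem nrm_smul_eq_zero {v : TangentBundle (𝓡 m) M} {a : 𝔼 × 𝔼} (h : nrm metric v a = 0) (r : ℝ) :
    nrm metric v (r • a) = 0 := by
  have h1 := nrm_sub_smul (isRiemannian_metric (m := m) (M := M)) v a a (1 - r)
  rw [h, mul_zero, sub_zero] at h1
  rw [← h1, sub_smul, one_smul, sub_sub_cancel]

/-- The operator norm of `D_v φ_t` bounds the growth of all vectors tangent to `T¹M`. -/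
theorem sasN_mD_flow_le {t C : ℝ} (hC : 0 ≤ C) {v : TangentBundle (𝓡 m) M}
    (hv : v ∈ unitTangent m M) (h : flowDerivNorm t v ≤ ENNReal.ofReal C) {a : 𝔼 × 𝔼}
    (ha : nrm metric v a = 0) :
    sasN metric (geodesicFlow metric t v)
      (mD (𝓡 m).tangent (𝓡 m).tangent (geodesicFlow metric t) v a) ≤ C * sasN metric v a := by
  have hg := isRiemannian_metric (m := m) (M := M)
  have hs : ∀ (w : TangentBundle (𝓡 m) M) (r : ℝ) (b : 𝔼 × 𝔼),
      sasN metric w (r • b) = |r| * sasN metric w b := fun w r b =>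
    (hg.metricTensor_sasaki.isInner w).fnorm_smul r b
  rcases (sasN_nonneg (g := metric) v a).eq_or_lt with h0 | h0
  · have ha0 : a = 0 := by
      by_contra hne
      have := hg.metricTensor_sasaki.pos v a hne
      rw [← sasN_sq hg, ← h0] at this
      simp at this
    rw [ha0, map_zero]
    have e1 := hs (geodesicFlow metric t v) 0 0
    have e2 := hs v 0 0
    rw [zero_smul, abs_zero, zero_mul] at e1 e2
    rw [e1, e2, mul_zero]
  · set b := (sasN metric v a)⁻¹ • a with hb
    have hbn : sasN metric v b = 1 := by
      rw [hs, abs_of_pos (inv_pos.2 h0), inv_mul_cancel₀ h0.ne']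
    have hmem : mkT (𝓡 m).tangent v b ∈ unitTangentUnitTangent m M := by
      refine ⟨⟨hv, ?_⟩, hbn⟩
      exact nrm_smul_eq_zero ha _
    have h1 : ENNReal.ofReal (sasN metric (geodesicFlow metric t v)
        (mD (𝓡 m).tangent (𝓡 m).tangent (geodesicFlow metric t) v b)) ≤ ENNReal.ofReal C :=
      (le_iSup₂ (f := fun (ξ : TangentBundle (𝓡 m).tangent (TangentBundle (𝓡 m) M))
        (_ : ξ ∈ unitTangentUnitTangent m M ∧ ξ.proj = v) =>
        ENNReal.ofReal (sasakiNorm (flowDeriv t ξ).proj (flowDeriv t ξ).snd))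
        (mkT (𝓡 m).tangent v b) ⟨hmem, rfl⟩).trans h
    have h2 := (ENNReal.ofReal_le_ofReal_iff hC).1 h1
    rw [hb, map_smul, hs, abs_of_pos (inv_pos.2 h0), inv_mul_le_iff₀ h0, mul_comm] at h2
    exact h2

theorem sasakiNorm₂_eq {ξ : TangentBundle (𝓡 m).tangent (TangentBundle (𝓡 m) M)}
    (h : metric ξ.proj.proj ξ.proj.snd ξ.proj.snd = 1) (Z : (𝔼 × 𝔼) × (𝔼 × 𝔼)) :
    sasakiNorm₂ ξ Z = √(sasN metric ξ.proj (horiz ξ Z) ^ 2 +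
      sasN metric ξ.proj (tanPart metric ξ Z) ^ 2) := by
  have h1 : tangentialNorm ξ.proj (connector (sasakiMetric metric) ξ Z) =
      sasN metric ξ.proj (tanPart metric ξ Z) :=
    congrArg Real.sqrt (tanPart_spec isRiemannian_metric ξ Z h).2.symm
  change √(sasN metric ξ.proj (horiz ξ Z) ^ 2 + tangentialNorm ξ.proj
    (connector (sasakiMetric metric) ξ Z) ^ 2) = _
  rw [h1]

/-- The constant works because `64 (n² + k²) - n² - (k + 7 n)² = 14 (n - k/2)² + (119/2) k²`. -/
theorem sqrt_growth_le {q n k n' k' : ℝ} (hq : 0 ≤ q) (hn' : 0 ≤ n')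
    (hk' : 0 ≤ k') (h1 : n' ≤ q * n) (h2 : k' ≤ q * (k + 7 * n)) :
    √(n' ^ 2 + k' ^ 2) ≤ 8 * q * √(n ^ 2 + k ^ 2) := by
  refine Real.sqrt_le_iff.2 ⟨by positivity, ?_⟩
  rw [mul_pow, Real.sq_sqrt (by positivity)]
  have h3 : n' ^ 2 ≤ (q * n) ^ 2 := pow_le_pow_left₀ hn' h1 2
  have h4 : k' ^ 2 ≤ (q * (k + 7 * n)) ^ 2 := pow_le_pow_left₀ hk' h2 2
  nlinarith [mul_nonneg (sq_nonneg q) (add_nonneg (sq_nonneg (n - k / 2)) (sq_nonneg k)),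
    mul_nonneg (sq_nonneg q) (sq_nonneg k), mul_nonneg (sq_nonneg q) (sq_nonneg (n - k / 2))]

theorem flowDeriv_mem_tangentUnitTangent {t : ℝ}
    {ξ : TangentBundle (𝓡 m).tangent (TangentBundle (𝓡 m) M)} (hξ : ξ ∈ tangentUnitTangent m M)
    (h : ξ.proj ∈ flowDomain metric t) : flowDeriv t ξ ∈ tangentUnitTangent m M := by
  have hg := isRiemannian_metric (m := m) (M := M)
  rw [mem_tangentUnitTangent_iff] at hξ ⊢
  exact ⟨(metric_geodesicFlow hg h).trans hξ.1, (metric_connector_mD_flow hg h (vec ξ)).trans hξ.2⟩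

/-- The derivative of the flow on `TT¹M` is bounded by the derivative bound and the curvature
bounds along the orbit. -/
theorem sasakiNorm₂_flow_le {t : ℝ} (ht : |t| ≤ 1)
    {σ : ℝ → TangentBundle (𝓡 m).tangent (TangentBundle (𝓡 m) M)} {Z : (𝔼 × 𝔼) × (𝔼 × 𝔼)} {s₀ : ℝ}
    (hσ : HasVel (𝓡 m).tangent.tangent σ Z s₀) (h1 : ∀ᶠ s in 𝓝 s₀, σ s ∈ tangentUnitTangent m M)
    (hD : ∀ s ∈ uIcc 0 t, (σ s₀).proj ∈ flowDomain metric s) {A C₂ C₃ : ℝ} (hA : 1 ≤ A)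
    (hC₂ : 1 ≤ C₂) (hC₃ : 1 ≤ C₃)
    (hA' : ∀ s ∈ uIcc 0 t, flowDerivNorm s (σ s₀).proj ≤ ENNReal.ofReal A ∧
      flowDerivNorm (-s) (geodesicFlow metric s (σ s₀).proj) ≤ ENNReal.ofReal A)
    (hR : ∀ s ∈ uIcc 0 t, curvatureNorm m (geodesicFlow metric s (σ s₀).proj).proj ≤
      ENNReal.ofReal C₂ ∧ nablaCurvatureNorm m (geodesicFlow metric s (σ s₀).proj).proj ≤
      ENNReal.ofReal C₃) (hξ : sasN metric (σ s₀).proj (vec (σ s₀)) ≤ 7 / 5) :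
    sasakiNorm₂ (flowDeriv t (σ s₀))
      (mD (𝓡 m).tangent.tangent (𝓡 m).tangent.tangent (flowDeriv t) (σ s₀) Z) ≤
      8 * (A ^ 4 * (C₂ ^ 2 * C₃)) * sasakiNorm₂ (σ s₀) Z := by
  have hg := isRiemannian_metric (m := m) (M := M)
  have hm := h1.self_of_nhds
  have hm' := (mem_tangentUnitTangent_iff _).1 hm
  have hA0 : 0 ≤ A := by linarith
  have key := sasN_flow_le hg (t := t) rfl hσ
    (h1.mono fun s hs => (mem_tangentUnitTangent_iff _).1 hs) hD hA0 (C₂ := C₂) (C₃ := C₃)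
    (by linarith)
    (fun s hs a ha => sasN_mD_flow_le hA0 hm.1 (hA' s hs).1 ha)
    (fun s hs a ha => by
      have hu : geodesicFlow metric s (σ s₀).proj ∈ unitTangent m M :=
        (mem_unitTangent_iff _).2 ((metric_geodesicFlow hg (hD s hs)).trans hm'.1)
      have h2 := sasN_mD_flow_le hA0 hu (hA' s hs).2 ha
      rwa [(geodesicFlow_neg hg (hD s hs)).2] at h2)
    (fun s hs => by
      obtain ⟨B, Γ, D⟩ := hg (geodesicFlow metric s (σ s₀).proj).proj
      exact ⟨_, _, _, B, Γ, D, ⟨_, mem_extChartAt_target _, extChartAt_to_inv _⟩,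
        curvBound_of_curvatureNorm_le hC₂ hC₃ (hR s hs).1 (hR s hs).2 D⟩)
  have hflow := flowDeriv_mem_tangentUnitTangent hm (hD t right_mem_uIcc)
  rw [sasakiNorm₂_eq ((mem_tangentUnitTangent_iff _).1 hflow).1, sasakiNorm₂_eq hm'.1]
  set n := sasN metric (σ s₀).proj (horiz (σ s₀) Z) with hn
  set k := sasN metric (σ s₀).proj (tanPart metric (σ s₀) Z) with hk
  have hn0 : 0 ≤ n := sasN_nonneg _ _
  have hk0 : 0 ≤ k := sasN_nonneg _ _
  have hc : 1 ≤ C₂ ^ 2 * C₃ := one_le_mul_of_one_le_of_one_le (one_le_pow₀ hC₂) hC₃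
  set c := C₂ ^ 2 * C₃ with hc'
  have hA3 : 1 ≤ A ^ 3 := one_le_pow₀ hA
  have hq : A ≤ A ^ 4 * c := by
    have : A * 1 ≤ A * (A ^ 3 * c) :=
      mul_le_mul_of_nonneg_left (one_le_mul_of_one_le_of_one_le hA3 hc) hA0
    calc A = A * 1 := (mul_one A).symm
      _ ≤ _ := this
      _ = A ^ 4 * c := by ring
  refine sqrt_growth_le (by positivity) (sasN_nonneg _ _) (sasN_nonneg _ _)
    (key.1.trans (mul_le_mul_of_nonneg_right hq hn0)) (key.2.trans ?_)
  set x := sasN metric (σ s₀).proj (vec (σ s₀)) with hx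
  have hx0 : 0 ≤ x := sasN_nonneg _ _
  -- The `7` is `5 · 7/5`: the constant of the error term times the bound on the length of `ξ`.
  -- Together with `|t| ≤ 1` this absorbs the whole integral.
  have e1 : A * (5 * c * (A * x * (A * n))) * |t| ≤ 7 * (A ^ 3 * c) * n := by
    have e2 : A * (5 * c * (A * x * (A * n))) * |t| ≤ A * (5 * c * (A * x * (A * n))) * 1 :=
      mul_le_mul_of_nonneg_left ht (by positivity)
    have e3 : A ^ 3 * c * n * x ≤ A ^ 3 * c * n * (7 / 5) :=
      mul_le_mul_of_nonneg_left hξ (by positivity)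
    linarith
  calc A * (k + A * (5 * c * (A * x * (A * n))) * |t|) ≤ A * (k + 7 * (A ^ 3 * c) * n) :=
        mul_le_mul_of_nonneg_left (by linarith) hA0
    _ = A * k + A ^ 4 * c * (7 * n) := by ring
    _ ≤ A ^ 4 * c * k + A ^ 4 * c * (7 * n) := by
        have := mul_le_mul_of_nonneg_right hq hk0
        linarith
    _ = A ^ 4 * c * (k + 7 * n) := by ring

end Pointwise

/-! ### Comparison of the Sasaki norm with charts, and cut-off functions -/

section Comparison

variable {E : Type*} [NormedAddCommGroup E] [NormedSpace ℝ E]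
  {H : Type*} [TopologicalSpace H] {I : ModelWithCorners ℝ E H}
  {N : Type*} [TopologicalSpace N] [ChartedSpace H N] [IsManifold I ∞ N] [IsManifold I 1 N]
  [I.Boundaryless]
  {g : (p : N) → TangentSpace I p → TangentSpace I p → ℝ} (hg : IsRiemannian I g)

/-- A continuous family of positive definite forms is locally bounded below. -/
theorem exists_lower_bound {X V : Type*} [TopologicalSpace X] [NormedAddCommGroup V]
    [NormedSpace ℝ V] [FiniteDimensional ℝ V] {S : X → V →L[ℝ] V →L[ℝ] ℝ} {x₀ : X}
    (hS : ContinuousAt S x₀) (hp : ∀ a, a ≠ 0 → 0 < S x₀ a a) :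
    ∃ κ > 0, ∀ᶠ x in 𝓝 x₀, ∀ a, κ * ‖a‖ ^ 2 ≤ S x a a := by
  have hK : IsCompact (Metric.sphere (0 : V) 1) := isCompact_sphere 0 1
  have hne : ∀ e ∈ Metric.sphere (0 : V) 1, e ≠ 0 := fun e he h => by
    rw [h, mem_sphere_zero_iff_norm, norm_zero] at he
    exact zero_ne_one he
  obtain ⟨κ, hκ, hmin⟩ : ∃ κ > 0, ∀ e ∈ Metric.sphere (0 : V) 1, κ < S x₀ e e := by
    rcases (Metric.sphere (0 : V) 1).eq_empty_or_nonempty with h | h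
    · exact ⟨1, one_pos, fun e he => by simp [h] at he⟩
    · have hc : Continuous fun e : V => S x₀ e e := by fun_prop
      obtain ⟨e₀, he₀, hm⟩ := hK.exists_isMinOn h hc.continuousOn
      have h0 := hp e₀ (hne e₀ he₀)
      exact ⟨S x₀ e₀ e₀ / 2, by linarith, fun e he => by
        have : S x₀ e₀ e₀ ≤ S x₀ e e := hm he
        linarith⟩
  refine ⟨κ, hκ, ?_⟩
  -- The strict inequality is an open condition in `(x, e)`, and the unit sphere is compact, so one
  -- neighbourhood of `x₀` works for all `e`; homogeneity does the rest.
  have h1 : ∀ᶠ x in 𝓝 x₀, ∀ e ∈ Metric.sphere (0 : V) 1, κ < S x e e := by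
    refine hK.eventually_forall_of_forall_eventually fun e he => ?_
    have h2 : ContinuousAt (fun z : X × V => S z.1 z.2 z.2) (x₀, e) := by
      have h3 : ContinuousAt (fun z : X × V => S z.1) (x₀, e) :=
        ContinuousAt.comp (g := S) (f := Prod.fst) hS continuousAt_fst
      exact (h3.clm_apply continuousAt_snd).clm_apply continuousAt_snd
    exact h2.eventually (lt_mem_nhds (hmin e he))
  filter_upwards [h1] with x hx a
  rcases eq_or_ne a 0 with rfl | ha
  · simp
  have hn : 0 < ‖a‖ := norm_pos_iff.2 ha
  have h2 := (hx (‖a‖⁻¹ • a) (by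
    rw [mem_sphere_zero_iff_norm, norm_smul, norm_inv, norm_norm, inv_mul_cancel₀ hn.ne'])).le
  rw [map_smul, map_smul, smul_apply, smul_eq_mul, smul_eq_mul, ← mul_assoc,
    ← mul_inv, le_inv_mul_iff₀ (by positivity)] at h2
  linarith [h2, (by ring : ‖a‖ * ‖a‖ * κ = κ * ‖a‖ ^ 2)]

omit [I.Boundaryless] [IsManifold I ∞ N] in
theorem extChartAt_tangent_eventuallyEq (V V₀ : TangentBundle I N)
    (h : V.proj ∈ (extChartAt I V₀.proj).source) :
    extChartAt I.tangent V₀ =ᶠ[𝓝 V] tangentParamInv (extChartAt I V₀.proj) := by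
  have hc : ContinuousAt (TotalSpace.proj : TangentBundle I N → N) V :=
    (FiberBundle.continuous_proj E (TangentSpace I)).continuousAt
  filter_upwards [hc.eventually_mem ((isOpen_extChartAt_source V₀.proj).mem_nhds h)] with W hW
  exact extChartAt_tangent V₀ W hW

include hg

/-- Near a point the Sasaki norm is bounded below by the norm in a chart. -/
theorem exists_norm_extChartAt_le_sasN [FiniteDimensional ℝ E] (V₀ : TangentBundle I N) :
    ∃ C > 0, ∀ᶠ V in 𝓝 V₀, ∀ a : E × E,
      ‖mD I.tangent 𝓘(ℝ, E × E) (extChartAt I.tangent V₀) V a‖ ≤ C * sasN g V a := by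
  obtain ⟨B, Γ, D⟩ := hg V₀.proj
  set P := (extChartAt I V₀.proj).symm with hP
  set Q := extChartAt I V₀.proj with hQ
  set Ω := (extChartAt I V₀.proj).target with hΩ
  have hV₀ : V₀.proj ∈ P '' Ω := ⟨_, mem_extChartAt_target _, extChartAt_to_inv _⟩
  have hV₀' : V₀ ∈ tangentParam I P '' (Ω ×ˢ univ) := by
    obtain ⟨z, hz, h⟩ := D.param.exists_tangentParam hV₀
    exact ⟨z, ⟨hz, mem_univ _⟩, h⟩
  have hTP := D.param.tangent
  set z₀ := tangentParamInv Q V₀ with hz₀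
  have hz₀Ω : z₀ ∈ Ω ×ˢ univ := hTP.inv_mem hV₀'
  have hS : ContinuousAt (sasB B Γ) z₀ :=
    D.lc.contDiffOn_sasB.continuousOn.continuousAt (hTP.mem_nhds hz₀Ω)
  have hpos : ∀ a, a ≠ 0 → 0 < sasB B Γ z₀ a a := by
    intro a ha
    rw [← D.sasaki hz₀Ω.1 a a]
    refine hg.metricTensor_sasaki.pos _ _ fun h0 => ha ?_
    have := hTP.mD_inv_mD hz₀Ω a
    rw [h0, map_zero] at this
    exact this.symm
  obtain ⟨κ, hκ, hev⟩ := exists_lower_bound hS hpos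
  have hQc : ContinuousAt (tangentParamInv Q) V₀ := by
    have := (hTP.contMDiffAt_inv hz₀Ω).continuousAt
    rwa [hTP.right_inv hV₀'] at this
  refine ⟨(√κ)⁻¹, by positivity, ?_⟩
  filter_upwards [hQc.eventually hev, hTP.isOpen_image.mem_nhds hV₀'] with V hV hVmem a
  have hz := hTP.inv_mem hVmem
  have hVz := hTP.right_inv hVmem
  set z := tangentParamInv Q V with hz'
  have hsrc : V.proj ∈ (extChartAt I V₀.proj).source := by
    have h1 : (tangentParam I P z).proj = P z.1 := rfl
    rw [← hVz, h1]
    exact (extChartAt I V₀.proj).map_target hz.1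
  rw [mD_congr (extChartAt_tangent_eventuallyEq V V₀ hsrc)]
  set ζ := mD I.tangent 𝓘(ℝ, E × E) (tangentParamInv Q) V a with hζ
  have ha : mD 𝓘(ℝ, E × E) I.tangent (tangentParam I P) z ζ = a := by
    have := hTP.mD_mD_inv hz a
    rwa [hVz] at this
  have h2 : sasN g V a = √(sasB B Γ z ζ ζ) := by
    have := D.sasaki hz.1 ζ ζ
    rw [ha, hVz] at this
    exact congrArg Real.sqrt this
  rw [h2, le_inv_mul_iff₀ (by positivity)]
  refine Real.le_sqrt_of_sq_le ?_
  rw [mul_pow, Real.sq_sqrt hκ.le]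
  exact hV ζ

/-- Cut-off functions on `TN` with bounded derivative. -/
theorem exists_cutoff [FiniteDimensional ℝ E] [T2Space N] {V₀ : TangentBundle I N}
    {U : Set (TangentBundle I N)} (hU : U ∈ 𝓝 V₀) :
    ∃ (χ : TangentBundle I N → ℝ) (C : ℝ), 0 < C ∧ ContMDiff I.tangent 𝓘(ℝ, ℝ) ∞ χ ∧ χ V₀ = 1 ∧
      (∀ V, χ V ≠ 0 → V ∈ U) ∧
      ∀ V (a : E × E), |mD I.tangent 𝓘(ℝ, ℝ) χ V a| ≤ C * sasN g V a := by
  obtain ⟨C, hC, hev⟩ := exists_norm_extChartAt_le_sasN hg V₀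
  -- The support of the bump function lies where the chart norm is controlled by the Sasaki norm, so
  -- its bounded derivative in the chart is bounded in the Sasaki norm; outside the support the
  -- derivative vanishes.
  obtain ⟨χ, -, hχ⟩ := (SmoothBumpFunction.nhds_basis_tsupport (I := I.tangent) V₀).mem_iff.1
    (Filter.inter_mem hU hev)
  have hb : ContDiff ℝ 1 (χ.toContDiffBump : E × E → ℝ) := χ.toContDiffBump.contDiff
  obtain ⟨L, hL⟩ := (χ.toContDiffBump.hasCompactSupport.fderiv (𝕜 := ℝ)).exists_bound_of_continuous
    (hb.continuous_fderiv one_ne_zero)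
  have hL0 : 0 ≤ L := (norm_nonneg _).trans (hL 0)
  refine ⟨χ, (L + 1) * C, by positivity, χ.contMDiff, χ.eq_one, fun V hV =>
    (hχ (subset_closure hV)).1, fun V a => ?_⟩
  by_cases hV : V ∈ tsupport χ
  · have hsrc := χ.tsupport_subset_extChartAt_source hV
    have h1 : χ =ᶠ[𝓝 V] fun W => χ.toContDiffBump (extChartAt I.tangent V₀ W) :=
      χ.eventuallyEq_of_mem_source (χ.tsupport_subset_chartAt_source hV)
    have h2 : mD I.tangent 𝓘(ℝ, ℝ) χ V a = fderiv ℝ (χ.toContDiffBump : E × E → ℝ)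
        (extChartAt I.tangent V₀ V) (mD I.tangent 𝓘(ℝ, E × E) (extChartAt I.tangent V₀) V a) := by
      rw [mD_congr h1, ← mD_eq_fderiv]
      exact mD_comp_apply (I := I.tangent) (I' := 𝓘(ℝ, E × E)) (I'' := 𝓘(ℝ, ℝ))
        (g := (χ.toContDiffBump : E × E → ℝ)) (f := extChartAt I.tangent V₀)
        (hb.differentiable one_ne_zero).mdifferentiable.mdifferentiableAt
        (mdifferentiableAt_extChartAt (by rwa [extChartAt_source] at hsrc)) a
    rw [h2, ← Real.norm_eq_abs]
    refine (ContinuousLinearMap.le_opNorm _ _).trans ?_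
    calc _ ≤ L * (C * sasN g V a) := mul_le_mul (hL _) ((hχ hV).2 a) (norm_nonneg _) hL0
      _ ≤ (L + 1) * C * sasN g V a := by
        have := mul_nonneg hC.le (sasN_nonneg (g := g) V a)
        nlinarith
  · have h1 : (χ : TangentBundle I N → ℝ) =ᶠ[𝓝 V] fun _ => (0 : ℝ) :=
      notMem_tsupport_iff_eventuallyEq.1 hV
    have h2 : mD I.tangent 𝓘(ℝ, ℝ) (fun _ : TangentBundle I N => (0 : ℝ)) V a = 0 :=
      congrArg (fun l : E × E →L[ℝ] ℝ => l a) (mfderiv_const (I := I.tangent) (I' := 𝓘(ℝ, ℝ)))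
    rw [mD_congr h1, h2, abs_zero]
    exact mul_nonneg (by positivity) (sasN_nonneg _ _)

/-- The square of the Sasaki norm is a smooth function on `TTN`. -/
theorem contMDiff_sasaki_self : ContMDiff I.tangent.tangent 𝓘(ℝ, ℝ) ∞
    (fun ξ : TangentBundle I.tangent (TangentBundle I N) =>
      sasakiMetric g ξ.proj ξ.snd ξ.snd) := by
  intro ξ
  obtain ⟨B, Γ, D⟩ := hg ξ.proj.proj
  set P := (extChartAt I ξ.proj.proj).symm with hP
  set Q := extChartAt I ξ.proj.proj with hQ
  set Ω := (extChartAt I ξ.proj.proj).target with hΩ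
  have hξ : ξ.proj.proj ∈ P '' Ω := ⟨_, mem_extChartAt_target _, extChartAt_to_inv _⟩
  have hTP := D.param.tangent
  have hTTP := hTP.tangent
  have hmem : ξ ∈ tangentParam I.tangent (tangentParam I P) '' ((Ω ×ˢ univ) ×ˢ univ) := by
    obtain ⟨z, hz, h⟩ := D.param.exists_tangentParam hξ
    obtain ⟨w, hw, h'⟩ := hTP.exists_tangentParam (V := ξ) ⟨z, ⟨hz, mem_univ _⟩, h⟩
    exact ⟨w, ⟨hw, mem_univ _⟩, h'⟩
  have hw := hTTP.inv_mem hmem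
  have e := hTTP.right_inv hmem
  set w := tangentParamInv (tangentParamInv Q) ξ with hw'
  have h1 : ContDiffAt ℝ ∞ (fun u : (E × E) × (E × E) => sasB B Γ u.1 u.2 u.2) w := by
    have h2 : ContDiffAt ℝ ∞ (fun u : (E × E) × (E × E) => sasB B Γ u.1) w :=
      ContDiffAt.comp (g := sasB B Γ) (f := Prod.fst) w
        (D.lc.contDiffOn_sasB.contDiffAt (hTP.mem_nhds hw.1)) contDiffAt_fst
    exact (h2.clm_apply contDiffAt_snd).clm_apply contDiffAt_snd
  have h2 : ContMDiffAt I.tangent.tangent 𝓘(ℝ, (E × E) × (E × E)) ∞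
      (tangentParamInv (tangentParamInv Q)) ξ := by
    have := hTTP.contMDiffAt_inv hw
    rwa [e] at this
  have h3 : ContMDiffAt I.tangent.tangent 𝓘(ℝ, ℝ) ∞ (fun η => (fun u : (E × E) × (E × E) =>
      sasB B Γ u.1 u.2 u.2) (tangentParamInv (tangentParamInv Q) η)) ξ :=
    ContMDiffAt.comp (I' := 𝓘(ℝ, (E × E) × (E × E)))
      (g := fun u : (E × E) × (E × E) => sasB B Γ u.1 u.2 u.2)
      (f := tangentParamInv (tangentParamInv Q)) ξ h1.contMDiffAt h2
  refine h3.congr_of_eventuallyEq ?_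
  filter_upwards [hTTP.isOpen_image.mem_nhds hmem] with η hη
  have hu := hTTP.inv_mem hη
  have e' := hTTP.right_inv hη
  set u := tangentParamInv (tangentParamInv Q) η with hu'
  rw [← e']
  exact D.sasaki hu.1.1 u.2 u.2

end Comparison

/-! ### Variation of functions along a curve in terms of its length -/

section CurveLength

variable {E : Type*} [NormedAddCommGroup E] [NormedSpace ℝ E]
  {H : Type*} [TopologicalSpace H] {I : ModelWithCorners ℝ E H}
  {N : Type*} [TopologicalSpace N] [ChartedSpace H N]

theorem hasVel_of_contMDiffOn_Icc {σ : ℝ → N} (hσ : ContMDiffOn 𝓘(ℝ, ℝ) I 1 σ (Icc 0 1)) {s : ℝ}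
    (hs : s ∈ Ioo (0 : ℝ) 1) : HasVel I σ (mD 𝓘(ℝ, ℝ) I σ s 1) s :=
  hasVel_of_mdifferentiableAt
    ((hσ.contMDiffAt (Icc_mem_nhds hs.1 hs.2)).mdifferentiableAt one_ne_zero)

/-- In the length of a curve the derivative at the end points does not matter. -/
theorem lintegral_mfderivWithin_eq (σ : ℝ → N) (F : N → E → ℝ) :
    ∫⁻ s in Icc (0 : ℝ) 1, ENNReal.ofReal
      (F (σ s) (mfderivWithin 𝓘(ℝ, ℝ) I σ (Icc 0 1) s (1 : ℝ))) =
    ∫⁻ s in Ioo (0 : ℝ) 1, ENNReal.ofReal (F (σ s) (mD 𝓘(ℝ, ℝ) I σ s 1)) := by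
  rw [← setLIntegral_congr Ioo_ae_eq_Icc]
  refine setLIntegral_congr_fun measurableSet_Ioo fun s hs => ?_
  have h1 : mfderivWithin 𝓘(ℝ, ℝ) I σ (Icc 0 1) s = mfderiv 𝓘(ℝ, ℝ) I σ s :=
    mfderivWithin_of_mem_nhds (Icc_mem_nhds hs.1 hs.2)
  exact congrArg (fun l : ℝ →L[ℝ] E => ENNReal.ofReal (F (σ s) (l 1))) h1

/-- A function with derivative dominated by the speed of a curve varies by at most the length. -/
theorem abs_sub_le_of_deriv_le {f : ℝ → ℝ} (hf : ContDiffOn ℝ 1 f (Icc 0 1)) {F : ℝ → ℝ} {C : ℝ}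
    (hC : 0 ≤ C) (hF : ∀ s ∈ Ioo (0 : ℝ) 1, |deriv f s| ≤ C * F s) {L : ℝ}
    (hL : ∫⁻ s in Ioo (0 : ℝ) 1, ENNReal.ofReal (F s) ≤ ENNReal.ofReal L) (hL0 : 0 ≤ L)
    {s : ℝ} (hs : s ∈ Icc (0 : ℝ) 1) : |f s - f 0| ≤ C * L := by
  have h1 := enorm_sub_le_lintegral_deriv_of_contDiffOn_Icc
    (hf.mono (Icc_subset_Icc le_rfl hs.2)) hs.1
  have h2 : ∫⁻ x in Icc (0 : ℝ) s, ‖deriv f x‖ₑ ≤ ENNReal.ofReal C * ENNReal.ofReal L := by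
    rw [← setLIntegral_congr Ioo_ae_eq_Icc]
    calc ∫⁻ x in Ioo (0 : ℝ) s, ‖deriv f x‖ₑ ≤ ∫⁻ x in Ioo (0 : ℝ) 1, ‖deriv f x‖ₑ :=
          lintegral_mono_set (Ioo_subset_Ioo le_rfl hs.2)
      _ ≤ ∫⁻ x in Ioo (0 : ℝ) 1, ENNReal.ofReal C * ENNReal.ofReal (F x) := by
          refine setLIntegral_mono' measurableSet_Ioo fun x hx => ?_
          rw [← ENNReal.ofReal_mul hC, ← ofReal_norm]
          exact ENNReal.ofReal_le_ofReal (hF x hx)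
      _ = ENNReal.ofReal C * ∫⁻ x in Ioo (0 : ℝ) 1, ENNReal.ofReal (F x) :=
          lintegral_const_mul' _ _ ENNReal.ofReal_ne_top
      _ ≤ _ := mul_le_mul_right hL _
  have h3 := h1.trans h2
  rw [← ENNReal.ofReal_mul hC, ← ofReal_norm, ENNReal.ofReal_le_ofReal_iff (by positivity)] at h3
  exact h3

end CurveLength

/-! ### Short curves of unit vectors -/

section ShortCurves

variable {E : Type*} [NormedAddCommGroup E] [NormedSpace ℝ E]
  {H : Type*} [TopologicalSpace H] {I : ModelWithCorners ℝ E H}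
  {N : Type*} [TopologicalSpace N] [ChartedSpace H N] [IsManifold I ∞ N] [IsManifold I 1 N]
  [I.Boundaryless]
  {g : (p : N) → TangentSpace I p → TangentSpace I p → ℝ} (hg : IsRiemannian I g)
include hg

/-- Nearby unit vectors are joined by curves of unit vectors of small Sasaki speed. -/
theorem exists_short_curve {V₀ : TangentBundle I N} (h₀ : g V₀.proj V₀.snd V₀.snd = 1) {ε : ℝ}
    (hε : 0 < ε) : ∀ᶠ V in 𝓝 V₀, g V.proj V.snd V.snd = 1 → ∃ c : ℝ → TangentBundle I N,
      ContMDiffOn 𝓘(ℝ, ℝ) I.tangent 1 c (Icc 0 1) ∧ c 0 = V ∧ c 1 = V₀ ∧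
      ∀ s ∈ Icc (0 : ℝ) 1, g (c s).proj (c s).snd (c s).snd = 1 ∧
        sasN g (c s) (mD 𝓘(ℝ, ℝ) I.tangent c s 1) ≤ ε := by
  obtain ⟨B, Γ, D⟩ := hg V₀.proj
  set P := (extChartAt I V₀.proj).symm with hP
  set Q := extChartAt I V₀.proj with hQ
  set Ω := (extChartAt I V₀.proj).target with hΩ
  have hV₀ : V₀.proj ∈ P '' Ω := ⟨_, mem_extChartAt_target _, extChartAt_to_inv _⟩
  have hmem₀ : V₀ ∈ tangentParam I P '' (Ω ×ˢ univ) := by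
    obtain ⟨z, hz, h⟩ := D.param.exists_tangentParam hV₀
    exact ⟨z, ⟨hz, mem_univ _⟩, h⟩
  have hTP := D.param.tangent
  have hco : ∀ V ∈ tangentParam I P '' (Ω ×ˢ univ), B (tangentParamInv Q V).1
      (tangentParamInv Q V).2 (tangentParamInv Q V).2 = g V.proj V.snd V.snd := by
    intro V hV
    have h1 := D.coeff _ (hTP.inv_mem hV).1 (tangentParamInv Q V).2 (tangentParamInv Q V).2
    rw [← h1]
    exact congrArg (fun W : TangentBundle I N => g W.proj W.snd W.snd) (hTP.right_inv hV)
  set z₀ := tangentParamInv Q V₀ with hz₀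
  have hz₀Ω : z₀ ∈ Ω ×ˢ univ := hTP.inv_mem hmem₀
  -- normalisation in coordinates
  set b : E × E → ℝ := fun w => B w.1 w.2 w.2 with hb
  set ν : E × E → E × E := fun w => (w.1, (√(b w))⁻¹ • w.2) with hν
  have hbS : ∀ w, w.1 ∈ Ω → ContDiffAt ℝ ∞ b w := by
    intro w hw
    have h1 : ContDiffAt ℝ ∞ (fun w : E × E => B w.1) w :=
      ContDiffAt.comp (g := B) (f := Prod.fst) w
        (D.lc.contDiffOn_metric.contDiffAt (D.param.mem_nhds hw)) contDiffAt_fst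
    exact (h1.clm_apply contDiffAt_snd).clm_apply contDiffAt_snd
  have hνS : ∀ w, w.1 ∈ Ω → 0 < b w → ContDiffAt ℝ ∞ ν w := fun w hw hw' =>
    contDiffAt_fst.prodMk ((((hbS w hw).sqrt hw'.ne').inv (Real.sqrt_pos.2 hw').ne').smul
      contDiffAt_snd)
  have hνfix : ∀ w, b w = 1 → ν w = w := by
    intro w hw
    simp only [hν]
    rw [hw, Real.sqrt_one, inv_one, one_smul]
  have hνb : ∀ w, 0 < b w → b (ν w) = 1 := by
    intro w hw
    have h1 : b (ν w) = (√(b w))⁻¹ * ((√(b w))⁻¹ * b w) := by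
      simp only [hν, hb, map_smul, smul_apply, smul_eq_mul]
    rw [h1, ← mul_assoc, ← mul_inv, Real.mul_self_sqrt hw.le, inv_mul_cancel₀ hw.ne']
  have hb₀ : b z₀ = 1 := (hco V₀ hmem₀).trans h₀
  have hνz₀ := hνfix z₀ hb₀
  -- For the base point `z₀` and the velocity `0` the speed is `0`; by continuity it stays below `ε`
  -- for base points near `z₀` and small velocities.
  have hev : ∀ᶠ p in 𝓝 ((z₀, 0) : (E × E) × (E × E)), p.1.1 ∈ Ω ∧ 0 < b p.1 ∧
      sasB B Γ (ν p.1) (fderiv ℝ ν p.1 p.2) (fderiv ℝ ν p.1 p.2) < ε ^ 2 := by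
    have hν₀ := hνS z₀ hz₀Ω.1 (by rw [hb₀]; exact one_pos)
    have h1 : ContinuousAt (fun p : (E × E) × (E × E) => fderiv ℝ ν p.1 p.2) (z₀, 0) := by
      have h2 : ContinuousAt (fderiv ℝ ν) z₀ := (hν₀.fderiv_right (m := 0) (by simp)).continuousAt
      exact (ContinuousAt.comp (g := fderiv ℝ ν) (f := Prod.fst) (x := (z₀, (0 : E × E))) h2
        continuousAt_fst).clm_apply continuousAt_snd
    have h3 : ContinuousAt (fun p : (E × E) × (E × E) => sasB B Γ (ν p.1)) (z₀, 0) := by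
      have h4 : ContinuousAt (sasB B Γ) (ν z₀) := by
        rw [hνz₀]
        exact D.lc.contDiffOn_sasB.continuousOn.continuousAt (hTP.mem_nhds hz₀Ω)
      have h5 : ContinuousAt (fun p : (E × E) × (E × E) => ν p.1) (z₀, 0) :=
        ContinuousAt.comp (g := ν) (f := Prod.fst) (x := (z₀, (0 : E × E))) hν₀.continuousAt
          continuousAt_fst
      exact ContinuousAt.comp (g := sasB B Γ) (f := fun p : (E × E) × (E × E) => ν p.1)
        (x := (z₀, (0 : E × E))) h4 h5
    have h6 := (h3.clm_apply h1).clm_apply h1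
    have h7 : ContinuousAt (fun p : (E × E) × (E × E) => b p.1) (z₀, 0) :=
      ContinuousAt.comp (g := b) (f := Prod.fst) (x := (z₀, (0 : E × E)))
        (hbS z₀ hz₀Ω.1).continuousAt continuousAt_fst
    have h8 : ContinuousAt (fun p : (E × E) × (E × E) => p.1.1) (z₀, 0) :=
      (continuous_fst.comp continuous_fst).continuousAt
    refine (h8.eventually_mem (D.param.mem_nhds hz₀Ω.1)).and
      ((h7.eventually (lt_mem_nhds ?_)).and (h6.eventually (gt_mem_nhds ?_)))
    · change 0 < b z₀
      rw [hb₀]; exact one_pos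
    · simp only [map_zero]
      positivity
  obtain ⟨ρ, hρ, hball⟩ := Metric.eventually_nhds_iff.1 hev
  have hQc : ContinuousAt (tangentParamInv Q) V₀ := by
    have := (hTP.contMDiffAt_inv hz₀Ω).continuousAt
    rwa [hTP.right_inv hmem₀] at this
  filter_upwards [hQc.eventually_mem (Metric.ball_mem_nhds z₀ hρ),
    hTP.isOpen_image.mem_nhds hmem₀] with V hV hVmem hV1
  set z := tangentParamInv Q V with hz
  have hbz : b z = 1 := (hco V hVmem).trans hV1
  -- The curve is the straight segment in coordinates, normalised to unit length; its end points are
  -- unit vectors already, so `ν` fixes them.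
  set w : ℝ → E × E := fun s => z + s • (z₀ - z) with hw
  have hwd : ∀ s, HasDerivAt w (z₀ - z) s := fun s => by
    have h1 := ((hasDerivAt_id s).smul_const (z₀ - z)).const_add z
    rw [one_smul] at h1
    exact h1
  have hws : ∀ s ∈ Icc (0 : ℝ) 1, (w s).1 ∈ Ω ∧ 0 < b (w s) ∧ sasB B Γ (ν (w s))
      (fderiv ℝ ν (w s) (z₀ - z)) (fderiv ℝ ν (w s) (z₀ - z)) < ε ^ 2 := by
    intro s hs
    refine hball (y := (w s, z₀ - z)) ?_
    rw [Prod.dist_eq, max_lt_iff]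
    rw [Metric.mem_ball, dist_eq_norm] at hV
    refine ⟨?_, ?_⟩
    · have e : w s - z₀ = (1 - s) • (z - z₀) := by
        simp only [hw]
        module
      change dist (w s) z₀ < ρ
      rw [dist_eq_norm, e, norm_smul, Real.norm_eq_abs, abs_of_nonneg (by linarith [hs.2])]
      have := norm_nonneg (z - z₀)
      nlinarith [hs.1]
    · change dist (z₀ - z) 0 < ρ
      rwa [dist_zero_right, norm_sub_rev]
  have hνd : ∀ s ∈ Icc (0 : ℝ) 1, HasDerivAt (fun r => ν (w r)) (fderiv ℝ ν (w s) (z₀ - z)) s :=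
    fun s hs => HasFDerivAt.comp_hasDerivAt (l := ν) s ((hνS _ (hws s hs).1
      (hws s hs).2.1).differentiableAt (by simp)).hasFDerivAt (hwd s)
  have hνm : ∀ s ∈ Icc (0 : ℝ) 1, ν (w s) ∈ Ω ×ˢ (univ : Set E) := fun s hs =>
    ⟨(hws s hs).1, mem_univ _⟩
  refine ⟨fun s => tangentParam I P (ν (w s)), ?_, ?_, ?_, ?_⟩
  · intro s hs
    have hwc : ContDiffAt ℝ ∞ w s := by
      have : ContDiff ℝ ∞ w := by fun_prop
      exact this.contDiffAt
    have h1 : ContDiffAt ℝ ∞ (fun r => ν (w r)) s :=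
      ContDiffAt.comp (g := ν) s (hνS _ (hws s hs).1 (hws s hs).2.1) hwc
    have h2 : ContMDiffAt 𝓘(ℝ, ℝ) I.tangent ∞ (fun r => tangentParam I P (ν (w r))) s :=
      ContMDiffAt.comp (I' := 𝓘(ℝ, E × E)) (g := tangentParam I P) (f := fun r => ν (w r)) s
        (hTP.contMDiffAt (hνm s hs)) h1.contMDiffAt
    exact (h2.of_le (by exact_mod_cast le_top)).contMDiffWithinAt
  · change tangentParam I P (ν (w 0)) = V
    have e : w 0 = z := by simp [hw]
    rw [e, hνfix z hbz]
    exact hTP.right_inv hVmem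
  · change tangentParam I P (ν (w 1)) = V₀
    have e : w 1 = z₀ := by simp [hw]
    rw [e, hνz₀]
    exact hTP.right_inv hmem₀
  · intro s hs
    refine ⟨(D.coeff _ (hνm s hs).1 (ν (w s)).2 (ν (w s)).2).trans (hνb _ (hws s hs).2.1), ?_⟩
    have h1 := (hTP.hasVel (z := fun r => ν (w r)) (hνm s hs) (hνd s hs)).mD_eq
    rw [h1]
    have h2 : sasN g (tangentParam I P (ν (w s))) (mD 𝓘(ℝ, E × E) I.tangent (tangentParam I P)
        (ν (w s)) (fderiv ℝ ν (w s) (z₀ - z))) = √(sasB B Γ (ν (w s))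
        (fderiv ℝ ν (w s) (z₀ - z)) (fderiv ℝ ν (w s) (z₀ - z))) :=
      congrArg Real.sqrt (D.sasaki (hνm s hs).1 _ _)
    rw [h2]
    exact Real.sqrt_le_iff.2 ⟨hε.le, (hws s hs).2.2.le⟩

/-- The Sasaki norm of a tangent vector of `T¹N` changes at most at the rate of the tangential
part of the covariant derivative. -/
theorem abs_sasakiMetric_sasCov_le {ξ : TangentBundle I.tangent (TangentBundle I N)}
    {a : E × E} (h : nrm g ξ.proj a = 0) (Z : (E × E) × (E × E)) :
    |sasakiMetric g ξ.proj (sasCov g ξ Z) a| ≤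
      sasN g ξ.proj (tanPart g ξ Z) * sasN g ξ.proj a := by
  have hi := hg.metricTensor_sasaki.isInner ξ.proj
  set r := nrm g ξ.proj (sasCov g ξ Z) with hr
  have h1 : tanPart g ξ Z = sasCov g ξ Z - ((0, r • vec ξ.proj) : E × E) := rfl
  have h2 : sasakiMetric g ξ.proj ((0, r • vec ξ.proj) : E × E) a = 0 := by
    refine (hi.symm _ _).trans ?_
    rw [sasakiMetric_vertical hg]
    have hj := hg.metricTensor.isInner ξ.proj.proj
    refine (hj.smul_right r _ (vec ξ.proj)).trans ?_
    have h3 : g ξ.proj.proj (connector g ξ.proj a) ξ.proj.snd = 0 := h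
    exact (congrArg (r * ·) h3).trans (mul_zero r)
  have h4 : sasakiMetric g ξ.proj (tanPart g ξ Z) a =
      sasakiMetric g ξ.proj (sasCov g ξ Z) a := by
    rw [h1]
    refine (hi.sub_left _ _ _).trans ?_
    rw [h2, sub_zero]
  rw [← h4]
  exact hi.abs_le _ _

end ShortCurves

/-! ### Short curves stay in the region where the hypotheses hold -/

section CurveControl

variable {m : ℕ} {M : Type*} [EMetricSpace M] [ChartedSpace (EuclideanSpace ℝ (Fin m)) M]
  [IsManifold (𝓡 m) ∞ M] [RiemannianBundle (fun x : M => TangentSpace (𝓡 m) x)]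
  [IsContMDiffRiemannianBundle (𝓡 m) ∞ (EuclideanSpace ℝ (Fin m))
      (fun x : M => TangentSpace (𝓡 m) x)]

local notation "𝔼" => EuclideanSpace ℝ (Fin m)

theorem sasN_horiz_le {ξ : TangentBundle (𝓡 m).tangent (TangentBundle (𝓡 m) M)}
    (h : ξ ∈ tangentUnitTangent m M) (Z : (𝔼 × 𝔼) × (𝔼 × 𝔼)) :
    sasN metric ξ.proj (horiz ξ Z) ≤ sasakiNorm₂ ξ Z := by
  rw [sasakiNorm₂_eq ((mem_tangentUnitTangent_iff _).1 h).1]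
  exact Real.le_sqrt_of_sq_le (by nlinarith [sq_nonneg (sasN metric ξ.proj (tanPart metric ξ Z))])

theorem sasN_tanPart_le {ξ : TangentBundle (𝓡 m).tangent (TangentBundle (𝓡 m) M)}
    (h : ξ ∈ tangentUnitTangent m M) (Z : (𝔼 × 𝔼) × (𝔼 × 𝔼)) :
    sasN metric ξ.proj (tanPart metric ξ Z) ≤ sasakiNorm₂ ξ Z := by
  rw [sasakiNorm₂_eq ((mem_tangentUnitTangent_iff _).1 h).1]
  exact Real.le_sqrt_of_sq_le (by nlinarith [sq_nonneg (sasN metric ξ.proj (horiz ξ Z))])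

omit [IsContMDiffRiemannianBundle (𝓡 m) ∞ (EuclideanSpace ℝ (Fin m))
      (fun x : M => TangentSpace (𝓡 m) x)] in
/-- A cut-off function varies little between points of small Sasaki distance. -/
theorem abs_cutoff_sub_le {χ : TangentBundle (𝓡 m) M → ℝ} {C : ℝ} (hC : 0 ≤ C)
    (hχ : ContMDiff (𝓡 m).tangent 𝓘(ℝ, ℝ) ∞ χ) (hχ' : ∀ V (a : 𝔼 × 𝔼),
      |mD (𝓡 m).tangent 𝓘(ℝ, ℝ) χ V a| ≤ C * sasN metric V a) {v w : TangentBundle (𝓡 m) M} {L : ℝ}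
    (hL : 0 ≤ L) (h : sasakiEDist v w < ENNReal.ofReal L) : |χ w - χ v| ≤ C * L := by
  obtain ⟨σ, h⟩ := iInf_lt_iff.1 h
  obtain ⟨⟨hσ, h0, h1, -⟩, h⟩ := iInf_lt_iff.1 h
  have e := lintegral_mfderivWithin_eq (I := (𝓡 m).tangent) σ (fun V (a : 𝔼 × 𝔼) => sasN metric V a)
  have hL' : ∫⁻ s in Ioo (0 : ℝ) 1, ENNReal.ofReal
      (sasN metric (σ s) (mD 𝓘(ℝ, ℝ) (𝓡 m).tangent σ s 1)) ≤ ENNReal.ofReal L := e ▸ h.le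
  have hf : ContDiffOn ℝ 1 (fun s => χ (σ s)) (Icc 0 1) :=
    contMDiffOn_iff_contDiffOn.1 ((hχ.of_le (by exact_mod_cast le_top)).comp_contMDiffOn hσ)
  have h3 := abs_sub_le_of_deriv_le hf hC (F := fun s => sasN metric (σ s)
    (mD 𝓘(ℝ, ℝ) (𝓡 m).tangent σ s 1)) (fun s hs => by
      have h2 := (hasVel_of_contMDiffOn_Icc hσ hs).comp (f := χ)
        ((hχ.mdifferentiable (by simp)).mdifferentiableAt)
      rw [(hasVel_iff_hasDerivAt.1 h2).deriv]
      exact hχ' _ _) hL' hL (right_mem_Icc.2 zero_le_one)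
  rwa [h0, h1] at h3

/-- The projection from `TT¹M` to `T¹M` does not increase length, so a cut-off function on `TM` also
controls curves in `TT¹M`. -/
theorem abs_cutoff_proj_sub_le {χ : TangentBundle (𝓡 m) M → ℝ} {C : ℝ} (hC : 0 ≤ C)
    (hχ : ContMDiff (𝓡 m).tangent 𝓘(ℝ, ℝ) ∞ χ) (hχ' : ∀ V (a : 𝔼 × 𝔼),
      |mD (𝓡 m).tangent 𝓘(ℝ, ℝ) χ V a| ≤ C * sasN metric V a)
    {σ : ℝ → TangentBundle (𝓡 m).tangent (TangentBundle (𝓡 m) M)}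
    (hσ : ContMDiffOn 𝓘(ℝ, ℝ) (𝓡 m).tangent.tangent 1 σ (Icc 0 1))
    (hmem : ∀ s ∈ Icc (0 : ℝ) 1, σ s ∈ tangentUnitTangent m M) {L : ℝ} (hL : 0 ≤ L)
    (h : ∫⁻ s in Ioo (0 : ℝ) 1, ENNReal.ofReal (sasakiNorm₂ (σ s)
      (mD 𝓘(ℝ, ℝ) (𝓡 m).tangent.tangent σ s 1)) ≤ ENNReal.ofReal L)
    {s : ℝ} (hs : s ∈ Icc (0 : ℝ) 1) : |χ (σ s).proj - χ (σ 0).proj| ≤ C * L := by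
  have hp : ContMDiff (𝓡 m).tangent.tangent 𝓘(ℝ, ℝ) ∞
      (fun ξ : TangentBundle (𝓡 m).tangent (TangentBundle (𝓡 m) M) => χ ξ.proj) :=
    hχ.comp (Bundle.contMDiff_proj (TangentSpace (𝓡 m).tangent))
  have hf : ContDiffOn ℝ 1 (fun s => χ (σ s).proj) (Icc 0 1) :=
    contMDiffOn_iff_contDiffOn.1 ((hp.of_le (by exact_mod_cast le_top)).comp_contMDiffOn hσ)
  refine abs_sub_le_of_deriv_le hf hC (fun s hs => ?_) h hL hs
  have h1 := hasVel_of_contMDiffOn_Icc hσ hs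
  have h2 := h1.comp (I' := (𝓡 m).tangent) (f := (TotalSpace.proj : TangentBundle (𝓡 m).tangent
    (TangentBundle (𝓡 m) M) → TangentBundle (𝓡 m) M)) (mdifferentiable_proj _)
  have h3 := h2.comp (f := χ) ((hχ.mdifferentiable (by simp)).mdifferentiableAt)
  rw [(hasVel_iff_hasDerivAt.1 h3).deriv]
  exact (hχ' _ _).trans (mul_le_mul_of_nonneg_left
    (sasN_horiz_le (hmem s ⟨hs.1.le, hs.2.le⟩) _) hC)

/-- Along a short curve in `TT¹M` from a unit vector, all vectors have length at most `7 / 5`. -/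
theorem sasN_vec_le {σ : ℝ → TangentBundle (𝓡 m).tangent (TangentBundle (𝓡 m) M)}
    (hσ : ContMDiffOn 𝓘(ℝ, ℝ) (𝓡 m).tangent.tangent 1 σ (Icc 0 1))
    (hmem : ∀ s ∈ Icc (0 : ℝ) 1, σ s ∈ tangentUnitTangent m M)
    (h0 : σ 0 ∈ unitTangentUnitTangent m M) {L : ℝ} (hL : 0 ≤ L) (hL' : L ≤ 1 / 5)
    (h : ∫⁻ s in Ioo (0 : ℝ) 1, ENNReal.ofReal (sasakiNorm₂ (σ s)
      (mD 𝓘(ℝ, ℝ) (𝓡 m).tangent.tangent σ s 1)) ≤ ENNReal.ofReal L)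
    {s : ℝ} (hs : s ∈ Icc (0 : ℝ) 1) : sasN metric (σ s).proj (vec (σ s)) ≤ 7 / 5 := by
  have hg := isRiemannian_metric (m := m) (M := M)
  set q : TangentBundle (𝓡 m).tangent (TangentBundle (𝓡 m) M) → ℝ := fun ξ =>
    sasakiMetric metric ξ.proj ξ.snd ξ.snd with hq
  have hqs : ∀ ξ, q ξ = sasN metric ξ.proj (vec ξ) ^ 2 := fun ξ => (sasN_sq hg ξ.proj (vec ξ)).symm
  have hq0 : ∀ ξ, 0 ≤ q ξ := fun ξ => by rw [hqs]; positivity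
  have hqσ : ContDiffOn ℝ 1 (fun s => q (σ s)) (Icc 0 1) :=
    contMDiffOn_iff_contDiffOn.1
      (((contMDiff_sasaki_self hg).of_le (by exact_mod_cast le_top)).comp_contMDiffOn hσ)
  -- With `x = |ξ|` and `X` the tangential part of the connector, the derivative of `log (1 + x²)`
  -- is at most `2 |X| x / (1 + x²) ≤ |X|`. The norm itself need not be differentiable where `ξ =
  -- 0`.
  have hf : ContDiffOn ℝ 1 (fun s => Real.log (1 + q (σ s))) (Icc 0 1) :=
    (contDiffOn_const.add hqσ).log fun s _ => by have := hq0 (σ s); positivity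
  have h1 := abs_sub_le_of_deriv_le hf zero_le_one (F := fun s => sasakiNorm₂ (σ s)
    (mD 𝓘(ℝ, ℝ) (𝓡 m).tangent.tangent σ s 1)) (fun r hr => by
      have hr' := hmem r ⟨hr.1.le, hr.2.le⟩
      set Z := mD 𝓘(ℝ, ℝ) (𝓡 m).tangent.tangent σ r 1 with hZ
      have h2 := hasDerivAt_sasaki_self hg (hasVel_of_contMDiffOn_Icc hσ hr)
      have h3 : HasDerivAt (fun s => Real.log (1 + q (σ s))) _ r :=
        (h2.const_add 1).log (by have := hq0 (σ r); positivity)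
      rw [h3.deriv]
      have h4 := abs_sasakiMetric_sasCov_le hg (a := vec (σ r))
        ((mem_tangentUnitTangent_iff _).1 hr').2 Z
      have h5 := sasN_tanPart_le hr' Z
      have h6 : 1 + sasakiMetric metric (σ r).proj (σ r).snd (σ r).snd =
        1 + sasN metric (σ r).proj (vec (σ r)) ^ 2 := congrArg (1 + ·) (hqs (σ r))
      rw [h6, one_mul, abs_div, abs_mul, abs_two,
        abs_of_pos (by positivity : (0 : ℝ) < 1 + sasN metric (σ r).proj (vec (σ r)) ^ 2),
        div_le_iff₀ (by positivity)]
      set x := sasN metric (σ r).proj (vec (σ r)) with hx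
      have hx0 : 0 ≤ x := sasN_nonneg _ _
      have h7 : 0 ≤ sasN metric (σ r).proj (tanPart metric (σ r) Z) := sasN_nonneg _ _
      have h8 : |sasakiMetric metric (σ r).proj (sasCov metric (σ r) Z) (σ r).snd| ≤
        sasakiNorm₂ (σ r) Z * x := h4.trans (mul_le_mul_of_nonneg_right h5 hx0)
      nlinarith [mul_nonneg (h7.trans h5) (sq_nonneg (x - 1))]) h hL hs
  have e0 : q (σ 0) = 1 := by
    rw [hqs]
    have : sasN metric (σ 0).proj (vec (σ 0)) = 1 := h0.2
    rw [this, one_pow]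
  have h2 : Real.log (1 + q (σ s)) - Real.log (1 + q (σ 0)) ≤ 1 / 5 :=
    (le_abs_self _).trans (h1.trans (by linarith))
  have hq1 := hq0 (σ s)
  rw [e0, ← Real.log_div (by positivity) (by norm_num)] at h2
  have h3 : (1 + q (σ s)) / (1 + 1) ≤ Real.exp (1 / 5) :=
    (Real.log_le_iff_le_exp (by positivity)).1 h2
  -- This follows from `exp (-1/5) ≥ 4/5`. Since `x = 1` at the start, `1 + x² ≤ 2 · 5/4`, so that
  -- `x² ≤ 3/2 < (7/5)²`.
  have h4 : Real.exp (1 / 5) ≤ 5 / 4 := by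
    have h5 := Real.add_one_le_exp (-(1 / 5) : ℝ)
    rw [Real.exp_neg] at h5
    have h6 := Real.exp_pos (1 / 5)
    rw [le_inv_comm₀ (by norm_num) h6] at h5
    exact h5.trans (by norm_num)
  refine abs_le_of_sq_le_sq' ?_ (by norm_num) |>.2
  rw [← hqs]
  linarith

/-- The hypothesis on the flow is stated with the Sasaki distance, while cut-off functions live on
topological neighbourhoods; this passes from the latter to the former. -/
theorem eventually_sasakiEDist_lt {v₀ : TangentBundle (𝓡 m) M} (h₀ : v₀ ∈ unitTangent m M) {ε : ℝ}
    (hε : 0 < ε) : ∀ᶠ v in 𝓝 v₀, v ∈ unitTangent m M → sasakiEDist v v₀ < ENNReal.ofReal ε := by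
  filter_upwards [exists_short_curve isRiemannian_metric ((mem_unitTangent_iff v₀).1 h₀)
    (half_pos hε)] with v hv hv'
  obtain ⟨c, hc, h0, h1, hs⟩ := hv ((mem_unitTangent_iff v).1 hv')
  refine lt_of_le_of_lt (iInf₂_le c ⟨hc, h0, h1, fun s hs' =>
    (mem_unitTangent_iff _).2 (hs s hs').1⟩) ?_
  have e := lintegral_mfderivWithin_eq (I := (𝓡 m).tangent) c (fun V (a : 𝔼 × 𝔼) => sasN metric V a)
  refine lt_of_le_of_lt e.le ?_
  refine lt_of_le_of_lt (setLIntegral_mono' measurableSet_Ioo (g := fun _ =>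
    ENNReal.ofReal (ε / 2)) fun s hs' => ENNReal.ofReal_le_ofReal
      (hs s ⟨hs'.1.le, hs'.2.le⟩).2) ?_
  rw [setLIntegral_const, Real.volume_Ioo, sub_zero, ENNReal.ofReal_one, mul_one]
  exact (ENNReal.ofReal_lt_ofReal_iff hε).2 (by linarith)

/-- At each time the assertion is open in `(t, v)`, because the flow has an open domain and is
continuous; compactness of the time interval gives one neighbourhood of `γ̇(0)` for all times. -/
theorem eventually_flow_near {γ : ℝ → M} {a b α β : ℝ} (hγ : IsGeodesicOn (I := 𝓡 m) metric γ a b)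
    (h0 : (0 : ℝ) ∈ Ioo a b) (hsub : Icc α β ⊆ Ioo a b) {ε : ℝ≥0∞} (hε : 0 < ε) :
    ∀ᶠ v in 𝓝 (velocity (𝓡 m) γ 0), ∀ t ∈ Icc α β, v ∈ flowDomain metric t ∧
      edist (geodesicFlow metric t v).proj (γ t) < ε := by
  have hg := isRiemannian_metric (m := m) (M := M)
  have hV : IsSprayCurve metric (velocity (𝓡 m) γ) a b := hasVel_velocity hγ
  have hcp : Continuous (TotalSpace.proj : TangentBundle (𝓡 m) M → M) :=
    FiberBundle.continuous_proj 𝔼 (TangentSpace (𝓡 m))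
  refine isCompact_Icc.eventually_forall_of_forall_eventually fun t ht => ?_
  obtain ⟨h1, h2⟩ := hV.geodesicFlow_eq hg h0 (hsub ht)
  obtain ⟨h3, h4⟩ := contMDiffAt_geodesicFlow hg h1 one_ne_zero
  have h5 : ContinuousAt (fun p : ℝ × TangentBundle (𝓡 m) M =>
      (geodesicFlow metric p.1 p.2).proj) (t, velocity (𝓡 m) γ 0) :=
    ContinuousAt.comp (g := (TotalSpace.proj : TangentBundle (𝓡 m) M → M)) hcp.continuousAt
      h3.continuousAt
  have h6 : ContinuousAt γ t :=
    ContinuousAt.comp (g := (TotalSpace.proj : TangentBundle (𝓡 m) M → M)) hcp.continuousAt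
      (hV t (hsub ht)).continuousAt
  have h7 : ContinuousAt (fun p : ℝ × TangentBundle (𝓡 m) M => γ p.1)
      (t, velocity (𝓡 m) γ 0) := ContinuousAt.comp (g := γ) (f := Prod.fst)
        (x := (t, velocity (𝓡 m) γ 0)) h6 continuousAt_fst
  have h8 : ∀ᶠ p in 𝓝 (t, velocity (𝓡 m) γ 0),
      edist (geodesicFlow metric p.1 p.2).proj (γ p.1) < ε := by
    refine (Filter.Tendsto.edist h5 h7).eventually (gt_mem_nhds ?_)
    have h9 : (geodesicFlow metric t (velocity (𝓡 m) γ 0)).proj = γ t := by rw [h2]; rfl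
    change edist (geodesicFlow metric t (velocity (𝓡 m) γ 0)).proj (γ t) < ε
    rwa [h9, edist_self]
  exact (continuous_swap.tendsto (velocity (𝓡 m) γ 0, t)).eventually (h4.and h8)

end CurveControl

/-! ### From the growth of the speed to the Lipschitz estimate -/

section MainEstimate

variable {m : ℕ} {M : Type*} [EMetricSpace M] [ChartedSpace (EuclideanSpace ℝ (Fin m)) M]
  [IsManifold (𝓡 m) ∞ M] [RiemannianBundle (fun x : M => TangentSpace (𝓡 m) x)]
  [IsContMDiffRiemannianBundle (𝓡 m) ∞ (EuclideanSpace ℝ (Fin m))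
      (fun x : M => TangentSpace (𝓡 m) x)]

omit [IsContMDiffRiemannianBundle (𝓡 m) ∞ (EuclideanSpace ℝ (Fin m))
      (fun x : M => TangentSpace (𝓡 m) x)] in
-- A tangent space of dimension `0` has no unit vectors; this is what lets the factor `m` be
-- inserted in the final constant.
theorem one_le_of_mem_unitTangent {v : TangentBundle (𝓡 m) M} (hv : v ∈ unitTangent m M) :
    1 ≤ m := by
  rcases Nat.eq_zero_or_pos m with rfl | h
  · exfalso
    rw [mem_unitTangent_iff] at hv
    have h1 : ∀ a : EuclideanSpace ℝ (Fin 0), metric (m := 0) v.proj a a = 0 := fun a => by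
      have h2 : metric (m := 0) v.proj ((0 : ℝ) • a) a = 0 * metric (m := 0) v.proj a a :=
        (isMetricTensor_metric.isInner v.proj).smul_left 0 a a
      rw [zero_mul] at h2
      rwa [Subsingleton.elim ((0 : ℝ) • a) a] at h2
    exact zero_ne_one ((h1 v.snd).symm.trans hv)
  · exact h

/-- If the growth of `D²φ_t` is bounded along all short curves in `TT¹M` from `ξ₀`, then `Dφ_t` is
Lipschitz at `ξ₀`. -/
theorem sasakiEDist₂_flowDeriv_le {t K ε : ℝ} (hK : 0 < K)
    {ξ₀ ξ₁ : TangentBundle (𝓡 m).tangent (TangentBundle (𝓡 m) M)}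
    (hlt : sasakiEDist₂ ξ₀ ξ₁ < ENNReal.ofReal ε)
    (h : ∀ σ : ℝ → TangentBundle (𝓡 m).tangent (TangentBundle (𝓡 m) M),
      ContMDiffOn 𝓘(ℝ, ℝ) (𝓡 m).tangent.tangent 1 σ (Icc 0 1) → σ 0 = ξ₀ →
      (∀ s ∈ Icc (0 : ℝ) 1, σ s ∈ tangentUnitTangent m M) →
      ∫⁻ s in Ioo (0 : ℝ) 1, ENNReal.ofReal (sasakiNorm₂ (σ s)
        (mD 𝓘(ℝ, ℝ) (𝓡 m).tangent.tangent σ s 1)) ≤ ENNReal.ofReal ε →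
      (∀ s ∈ Icc (0 : ℝ) 1, (σ s).proj ∈ flowDomain metric t) ∧
      ∀ s ∈ Ioo (0 : ℝ) 1, sasakiNorm₂ (flowDeriv t (σ s))
        (mD (𝓡 m).tangent.tangent (𝓡 m).tangent.tangent (flowDeriv t) (σ s)
          (mD 𝓘(ℝ, ℝ) (𝓡 m).tangent.tangent σ s 1)) ≤
        K * sasakiNorm₂ (σ s) (mD 𝓘(ℝ, ℝ) (𝓡 m).tangent.tangent σ s 1)) :
    sasakiEDist₂ (flowDeriv t ξ₀) (flowDeriv t ξ₁) ≤ ENNReal.ofReal K * sasakiEDist₂ ξ₀ ξ₁ := by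
  have hg := isRiemannian_metric (m := m) (M := M)
  -- the length of the image of a short curve
  have key : ∀ σ : ℝ → TangentBundle (𝓡 m).tangent (TangentBundle (𝓡 m) M),
      (ContMDiffOn 𝓘(ℝ, ℝ) (𝓡 m).tangent.tangent 1 σ (Icc 0 1) ∧ σ 0 = ξ₀ ∧ σ 1 = ξ₁ ∧
        ∀ s ∈ Icc (0 : ℝ) 1, σ s ∈ tangentUnitTangent m M) →
      ∫⁻ s in Icc (0 : ℝ) 1, ENNReal.ofReal (sasakiNorm₂ (σ s)
        (mfderivWithin 𝓘(ℝ, ℝ) (𝓡 m).tangent.tangent σ (Icc 0 1) s (1 : ℝ))) ≤ ENNReal.ofReal ε →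
      sasakiEDist₂ (flowDeriv t ξ₀) (flowDeriv t ξ₁) ≤ ENNReal.ofReal K *
        ∫⁻ s in Icc (0 : ℝ) 1, ENNReal.ofReal (sasakiNorm₂ (σ s)
        (mfderivWithin 𝓘(ℝ, ℝ) (𝓡 m).tangent.tangent σ (Icc 0 1) s (1 : ℝ))) := by
    rintro σ ⟨hσ, h0, h1, hmem⟩ hlen
    have e := lintegral_mfderivWithin_eq (I := (𝓡 m).tangent.tangent) σ
      (fun ξ Z => sasakiNorm₂ ξ Z)
    obtain ⟨hD, hle⟩ := h σ hσ h0 hmem (e ▸ hlen)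
    have hsm : ContMDiffOn 𝓘(ℝ, ℝ) (𝓡 m).tangent.tangent 1 (fun s => flowDeriv t (σ s))
        (Icc 0 1) := fun s hs =>
      ContMDiffAt.comp_contMDiffWithinAt (I' := (𝓡 m).tangent.tangent)
        (g := tangentMap (𝓡 m).tangent (𝓡 m).tangent (geodesicFlow metric t)) s
        (by exact_mod_cast contMDiffAt_tangentMap_flow hg (hD s hs) 1) (hσ s hs)
    refine (iInf₂_le (fun s => flowDeriv t (σ s)) ⟨hsm, congrArg (flowDeriv t) h0,
      congrArg (flowDeriv t) h1, fun s hs =>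
      flowDeriv_mem_tangentUnitTangent (hmem s hs) (hD s hs)⟩).trans ?_
    have e' := lintegral_mfderivWithin_eq (I := (𝓡 m).tangent.tangent) (fun s => flowDeriv t (σ s))
      (fun ξ Z => sasakiNorm₂ ξ Z)
    refine e'.le.trans ?_
    rw [e, ← lintegral_const_mul' _ _ ENNReal.ofReal_ne_top]
    refine setLIntegral_mono' measurableSet_Ioo fun s hs => ?_
    rw [← ENNReal.ofReal_mul hK.le]
    refine ENNReal.ofReal_le_ofReal ?_
    have h2 := (hasVel_of_contMDiffOn_Icc hσ hs).comp (f := flowDeriv t)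
      (mdifferentiableAt_tangentMap_flow hg (hD s ⟨hs.1.le, hs.2.le⟩))
    rw [h2.mD_eq]
    exact hle s hs
  obtain ⟨σ₁, h1⟩ := iInf_lt_iff.1 hlt
  obtain ⟨hσ₁, h1⟩ := iInf_lt_iff.1 h1
  rw [sasakiEDist₂, sasakiEDist₂, ENNReal.mul_iInf_of_ne
    (by simpa using hK) ENNReal.ofReal_ne_top]
  refine le_iInf fun σ => ?_
  rw [ENNReal.mul_iInf_of_ne (by simpa using hK) ENNReal.ofReal_ne_top]
  refine le_iInf fun hσ => ?_
  -- The growth of speed is known only along curves of length at most `ε`. A longer competitor is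
  -- compared with the image of the fixed short curve `σ₁`, which is no longer than it.
  rcases le_total (∫⁻ s in Icc (0 : ℝ) 1, ENNReal.ofReal (sasakiNorm₂ (σ s)
    (mfderivWithin 𝓘(ℝ, ℝ) (𝓡 m).tangent.tangent σ (Icc 0 1) s (1 : ℝ)))) (ENNReal.ofReal ε)
    with hl | hl
  · exact key σ hσ hl
  · exact (key σ₁ hσ₁ h1.le).trans (mul_le_mul_right (h1.le.trans hl) _)

end MainEstimate

end Sasaki

end

/-! ### The proposition -/

theorem proposition7p2 (m : ℕ) {M : Type*} [EMetricSpace M]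
    [ChartedSpace (EuclideanSpace ℝ (Fin m)) M] [IsManifold (𝓡 m) ∞ M]
    [RiemannianBundle (fun x : M => TangentSpace (𝓡 m) x)]
    [IsContMDiffRiemannianBundle (𝓡 m) ∞ (EuclideanSpace ℝ (Fin m))
      (fun x : M => TangentSpace (𝓡 m) x)]
    [IsRiemannianManifold (𝓡 m) M]
    (t₀ : ℝ) (ht₀ : 0 < t₀) (ht₀' : t₀ ≤ 1)
    -- a unit-speed geodesic segment on the closed interval `[-t₀, t₀]`
    (γ : ℝ → M)
    (hγ : ∃ δ > 0, Sasaki.IsGeodesicOn (I := 𝓡 m) Sasaki.metric γ (-t₀ - δ) (t₀ + δ))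
    (hγ' : ∀ t ∈ Set.Icc (-t₀) t₀, Sasaki.velocity (𝓡 m) γ t ∈ Sasaki.unitTangent m M)
    (C₁ C₂ C₃ ε₀ : ℝ) (hC₁ : 1 < C₁) (hC₂ : 1 < C₂) (hC₃ : 1 < C₃) (hε₀ : 0 < ε₀)
    -- bound on the first derivative of the flow, wherever the flow is defined
    (hflow : ∀ t ∈ Set.Ioo (-t₀) t₀, ∀ v ∈ Sasaki.unitTangent m M,
      Sasaki.sasakiEDist v (Sasaki.velocity (𝓡 m) γ 0) < ENNReal.ofReal ε₀ →
      v ∈ Sasaki.flowDomain Sasaki.metric t →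
      max (Sasaki.flowDerivNorm t v)
        (Sasaki.flowDerivNorm (-t) (Sasaki.geodesicFlow Sasaki.metric t v)) ≤ ENNReal.ofReal C₁)
    (hcurv : ∀ t ∈ Set.Ioo (-t₀) t₀, ∀ p : M, edist p (γ t) < ENNReal.ofReal ε₀ →
      Sasaki.curvatureNorm m p ≤ ENNReal.ofReal C₂ ∧
      Sasaki.nablaCurvatureNorm m p ≤ ENNReal.ofReal C₃) :
    ∃ ε₁ : ℝ, 0 < ε₁ ∧ ∀ t ∈ Set.Ioo (-t₀) t₀,
      -- near `γ̇(0)` the flow is defined and differentiable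
      (∀ v ∈ Sasaki.unitTangent m M,
        Sasaki.sasakiEDist v (Sasaki.velocity (𝓡 m) γ 0) < ENNReal.ofReal ε₁ →
        v ∈ Sasaki.flowDomain Sasaki.metric t ∧
        MDifferentiableAt (𝓡 m).tangent (𝓡 m).tangent
          (Sasaki.geodesicFlow (I := 𝓡 m) (N := M) Sasaki.metric t) v) ∧
      ∀ ξ₀ ∈ Sasaki.unitTangentUnitTangent m M, ∀ ξ₁ ∈ Sasaki.unitTangentUnitTangent m M,
        Sasaki.sasakiEDist ξ₀.proj (Sasaki.velocity (𝓡 m) γ 0) < ENNReal.ofReal ε₁ →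
        Sasaki.sasakiEDist ξ₁.proj (Sasaki.velocity (𝓡 m) γ 0) < ENNReal.ofReal ε₁ →
        Sasaki.sasakiEDist₂ ξ₀ ξ₁ < ENNReal.ofReal ε₁ →
        Sasaki.sasakiEDist₂ (Sasaki.flowDeriv t ξ₀) (Sasaki.flowDeriv t ξ₁) ≤
          ENNReal.ofReal (8 * m * C₁ ^ 4 * C₂ ^ 2 * C₃) * Sasaki.sasakiEDist₂ ξ₀ ξ₁ := by
  have hg := Sasaki.isRiemannian_metric (m := m) (M := M)
  obtain ⟨δ, hδ, hgeo⟩ := hγ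
  set v₀ := Sasaki.velocity (𝓡 m) γ 0 with hv₀
  have hv₀u : v₀ ∈ Sasaki.unitTangent m M := hγ' 0 ⟨by linarith, ht₀.le⟩
  have hm : (1 : ℝ) ≤ m := by exact_mod_cast Sasaki.one_le_of_mem_unitTangent hv₀u
  -- a neighbourhood of `γ̇(0)` where the hypotheses apply
  obtain ⟨χ, C, hC, hχ, hχ0, hχU, hχ'⟩ := Sasaki.exists_cutoff hg
    (Filter.inter_mem (Sasaki.eventually_flow_near hgeo (α := -t₀) (β := t₀)
      ⟨by linarith, by linarith⟩ (Icc_subset_Ioo (by linarith) (by linarith))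
      (ENNReal.ofReal_pos.2 hε₀)) (Sasaki.eventually_sasakiEDist_lt hv₀u hε₀))
  -- The bound `1/5` is the length for which vectors along the curve stay of norm at most `7/5`. The
  -- bound `1/(4 C)` lets `χ` drop by at most `1/4` from `γ̇(0)` to the foot point of `ξ₀` and by at
  -- most `1/4` again along the curve; so `χ ≥ 1/2` throughout, and all foot points lie in the
  -- chosen neighbourhood.
  set ε₁ : ℝ := min (1 / 5) (1 / (4 * C)) with hε₁
  have hε₁0 : 0 < ε₁ := by positivity
  have hCε : C * ε₁ ≤ 1 / 4 := by
    calc C * ε₁ ≤ C * (1 / (4 * C)) := mul_le_mul_of_nonneg_left (min_le_right _ _) hC.le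
      _ = 1 / 4 := by field_simp
  have hnear : ∀ v : TangentBundle (𝓡 m) M,
      Sasaki.sasakiEDist v v₀ < ENNReal.ofReal ε₁ → 3 / 4 ≤ χ v := by
    intro v hv
    have h1 := (abs_le.1 (Sasaki.abs_cutoff_sub_le hC.le hχ hχ' hε₁0.le hv)).2
    rw [hχ0] at h1
    linarith
  refine ⟨ε₁, hε₁0, fun t ht => ⟨fun v _ hv => ?_, ?_⟩⟩
  · have hD := ((hχU v (by linarith [hnear v hv])).1 t ⟨ht.1.le, ht.2.le⟩).1
    exact ⟨hD, Sasaki.mdifferentiableAt_flow hg hD⟩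
  intro ξ₀ hξ₀ ξ₁ _ hd₀ _ hd
  have hK : (0 : ℝ) < 8 * (C₁ ^ 4 * (C₂ ^ 2 * C₃)) := by positivity
  -- Duhamel's formula uses the flow and curvature bounds at all times between `0` and `t`, which
  -- may be negative.
  have hsub : ∀ s ∈ uIcc 0 t, s ∈ Ioo (-t₀) t₀ := fun s hs =>
    (ordConnected_Ioo.uIcc_subset ⟨by linarith, ht₀⟩ ht) hs
  refine (Sasaki.sasakiEDist₂_flowDeriv_le hK hd fun σ hσ h0 hmem hlen => ?_).trans
    (mul_le_mul_left (ENNReal.ofReal_le_ofReal ?_) _)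
  · have hU : ∀ s ∈ Icc (0 : ℝ) 1, _ := fun s hs => hχU (σ s).proj (by
      have h1 := (abs_le.1 (Sasaki.abs_cutoff_proj_sub_le hC.le hχ hχ' hσ hmem hε₁0.le hlen hs)).1
      have h2 := hnear ξ₀.proj hd₀
      rw [h0] at h1
      linarith)
    refine ⟨fun s hs => ((hU s hs).1 t ⟨ht.1.le, ht.2.le⟩).1, fun s hs => ?_⟩
    have hs' : s ∈ Icc (0 : ℝ) 1 := ⟨hs.1.le, hs.2.le⟩
    have hDom := fun r hr => (hU s hs').1 r ⟨(hsub r hr).1.le, (hsub r hr).2.le⟩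
    refine Sasaki.sasakiNorm₂_flow_le (abs_le.2 ⟨by linarith [ht.1], by linarith [ht.2]⟩)
      (Sasaki.hasVel_of_contMDiffOn_Icc hσ hs) ?_ (fun r hr => (hDom r hr).1) hC₁.le hC₂.le hC₃.le
      (fun r hr => ?_) (fun r hr => hcurv r (hsub r hr) _ (hDom r hr).2)
      (Sasaki.sasN_vec_le hσ hmem (by rwa [h0]) hε₁0.le (min_le_left _ _) hlen hs')
    · filter_upwards [Ioo_mem_nhds hs.1 hs.2] with r hr
      exact hmem r ⟨hr.1.le, hr.2.le⟩
    · have hu := (hmem s hs').1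
      exact max_le_iff.1 (hflow r (hsub r hr) _ hu ((hU s hs').2 hu) (hDom r hr).1)
  -- The estimate holds without the factor `m`; it is inserted using `1 ≤ m`.
  · calc 8 * (C₁ ^ 4 * (C₂ ^ 2 * C₃)) = 1 * (8 * (C₁ ^ 4 * (C₂ ^ 2 * C₃))) := (one_mul _).symm
      _ ≤ m * (8 * (C₁ ^ 4 * (C₂ ^ 2 * C₃))) := mul_le_mul_of_nonneg_right hm hK.le
      _ = 8 * m * C₁ ^ 4 * C₂ ^ 2 * C₃ := by ring
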